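/- **Setting.** Let $n\ge 3$, let $N$ be a compact $(n-1)$-dimensional manifold without boundary with a smooth Riemannian metric $\mathring h$ satisfying $\mathrm{Ric}[\mathring h]=(n-2)k\,\mathring h$, $k\in\{0,1,-1\}$, and put $$\mathring g=x^{-2}\Big(dx^2+\big(1-\tfrac k4x^2\big)^2\,\mathring h\Big)\quad\text{on }(0,\infty)\times N .$$ A metric is said to have *the asymptotic form with coefficient $\mu$* if for small $x>0$, uniformly over $N$, $$g=x^{-2}\Big(dx^2+\big(1-\tfrac k4x^2\big)^2\,\mathring h+x^n\mu\Big)+o(x^{n-2})\,dx^i\,dx^j ,\qquad(\ast)$$ where $\mu$ is a $C^2$ symmetric 2-tensor field on $N$; the function $\Theta=\mathring h^{AB}\mu_{AB}$ on $N$ is its *mass aspect function*. Let $M$ be an $n$-dimensional smooth manifold with a positive smooth function $x$ such that, for some $0<x_0<1$, the region $\{x<x_0\}$ is diffeomorphic to $(0,x_0)\times N$ with $x$ as first coordinate, and let $g$ be a $C^2$ Riemannian metric on $M$ which on $\{x<x_0\}$ has the form $(\ast)$ with mass aspect function $\Theta$. Write $\lambda=g-\mathring g$ there. Assume that $$x^{-1}\big(R[g]-R[\mathring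 g]\big)\in L^1(\{x<x_0\},d\mu_g)$$ and that for some constant $C_1$ $$\sum_{0\le l\le 2}\Big(|\mathring\nabla^l\lambda|_{\mathring g}+x^{-1}|\mathring\nabla^l\mathring{\mathcal D}\lambda|_{\mathring g}\Big)\le C_1x^n\quad\text{on }\{0<x<x_0\},$$ where $R$ is the scalar curvature, $\mathring\nabla$ is the Levi-Civita connection of $\mathring g$, and $\mathring{\mathcal D}$ is that of $\mathring h$ acting along the slices $\{x\}\times N$ (with $\mathring{\mathcal D}\lambda$ of class $C^2$). **Theorem.** Let $\eta:N\to[0,\infty)$ be smooth. There is $\epsilon_0\in(0,x_0/4)$ such that for every $0<\epsilon<\epsilon_0$ there are a $C^2$ Riemannian metric $g_\epsilon$ on $M$ and a constant $c_\epsilon\ge 0$, with $c_\epsilon\to0$ as $\epsilon\to0$, such that 1. $0\le R[g_\epsilon]-R[g]\le C_\epsilon\,x^{n+2}$ on $M$, for a constant $C_\epsilon$ which may depend on $\epsilon$; 2. $g_\epsilon=g$ on $\{x>4\epsilon\}$; 3. after a change of the coordinates $(x,x^A)$ near $\{x=0\}$ which is smooth up to $\{0\}\times N$ and fixes $\{0\}\times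 N$ pointwise, $g_\epsilon$ has the asymptotic form $(\ast)$, with the same $\mathring h$ and $k$, and its mass aspect function is $\Theta+\eta+c_\epsilon$. -/

import Mathlib

open Set Filter Topology MeasureTheory
open scoped Manifold ContDiff

set_option maxSynthPendingDepth 3

noncomputable section

namespace MassAspect

/-! ### Covariant tensors on an open subset of a vector space

`V` is the coordinate space.  A metric in coordinates is a map `G : V → V →L[ℝ] V →L[ℝ] ℝ`. -/

section Coordinates

variable {V : Type*} [NormedAddCommGroup V] [NormedSpace ℝ V]

/-- The Christoffel symbols of `G`, as a bilinear map `Γ(u)(v, w)`, characterised by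
`G(Γ(v, w), z) = ½ (∂_v G(w, z) + ∂_w G(v, z) - ∂_z G(v, w))`. -/
def christoffel (G : V → V →L[ℝ] V →L[ℝ] ℝ) (u : V) : V →L[ℝ] V →L[ℝ] V :=
  let D : V →L[ℝ] V →L[ℝ] V →L[ℝ] ℝ := fderiv ℝ G u
  let flip : (V →L[ℝ] V →L[ℝ] ℝ) →L[ℝ] V →L[ℝ] V →L[ℝ] ℝ :=
    (ContinuousLinearMap.flipₗᵢ ℝ V V ℝ).toContinuousLinearEquiv
  let K : V →L[ℝ] V →L[ℝ] V →L[ℝ] ℝ := D + D.flip - flip.comp D.flip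
  (2⁻¹ : ℝ) • (ContinuousLinearMap.compL ℝ V (V →L[ℝ] ℝ) V (G u).inverse).comp K

/-- The curvature endomorphism `v ↦ R(v, w) z = ∇_v ∇_w z - ∇_w ∇_v z` of a connection with
Christoffel symbols `Γ`, that is
`∂_v Γ(w, z) - ∂_w Γ(v, z) + Γ(v, Γ(w, z)) - Γ(w, Γ(v, z))`. -/
def curvatureEnd (Γ : V → V →L[ℝ] V →L[ℝ] V) (u w z : V) : V →L[ℝ] V :=
  let D : V →L[ℝ] V →L[ℝ] V →L[ℝ] V := fderiv ℝ Γ u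
  (D.flip w).flip z - (D w).flip z + (Γ u).flip (Γ u w z) - (Γ u w).comp ((Γ u).flip z)

/-- The Ricci tensor `Ric(w, z) = tr (v ↦ R(v, w) z)` of `G`. -/
def ricci (G : V → V →L[ℝ] V →L[ℝ] ℝ) (u : V) : V →ₗ[ℝ] V →ₗ[ℝ] ℝ :=
  LinearMap.mk₂ ℝ
    (fun w z => LinearMap.trace ℝ V (curvatureEnd (christoffel G) u w z : V →ₗ[ℝ] V))
    (fun w w' z => by
      rw [← map_add]; congr 1; ext v; simp [curvatureEnd]; abel)
    (fun c w z => by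
      rw [← map_smul]; congr 1; ext v; simp [curvatureEnd, smul_add, smul_sub])
    (fun w z z' => by
      rw [← map_add]; congr 1; ext v; simp [curvatureEnd]; abel)
    (fun c w z => by
      rw [← map_smul]; congr 1; ext v; simp [curvatureEnd, smul_add, smul_sub])

/-- The trace `B^{ij} T_{ij}` of a bilinear form `T` with respect to a nondegenerate bilinear
form `B`. -/
def traceWith (B T : V →L[ℝ] V →L[ℝ] ℝ) : ℝ :=
  LinearMap.trace ℝ V ((B.inverse.comp T : V →L[ℝ] V) : V →ₗ[ℝ] V)

/-- The scalar curvature `G^{ij} Ric_{ij}` of `G`. -/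
def scalarCoord [FiniteDimensional ℝ V] (G : V → V →L[ℝ] V →L[ℝ] ℝ) (u : V) : ℝ :=
  traceWith (G u)
    (LinearMap.toContinuousLinearMap
      ((LinearMap.toContinuousLinearMap : (V →ₗ[ℝ] ℝ) ≃ₗ[ℝ] (V →L[ℝ] ℝ)).toLinearMap.comp
        (ricci G u)))

/-- The covariant derivative of a covariant `k`-tensor field; the differentiation slot comes
first. -/
def covDeriv (Γ : V → V →L[ℝ] V →L[ℝ] V) {k : ℕ} (T : V → (Fin k → V) → ℝ) (u : V)
    (v : Fin (k + 1) → V) : ℝ :=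
  fderiv ℝ (fun u' => T u' (Fin.tail v)) u (v 0) -
    ∑ i : Fin k, T u (Function.update (Fin.tail v) i (Γ u (v 0) (Fin.tail v i)))

/-- The iterated covariant derivative `∇^l T`. -/
def iterCovDeriv (Γ : V → V →L[ℝ] V →L[ℝ] V) {k : ℕ} (T : V → (Fin k → V) → ℝ) :
    (l : ℕ) → V → (Fin (k + l) → V) → ℝ
  | 0 => T
  | l + 1 => covDeriv Γ (iterCovDeriv Γ T l)

/-- `|T|_B ≤ c` for the operator norm of the covariant `k`-tensor `T` defined by the scalar
product `B` (in a fixed dimension this norm is equivalent to every other tensor norm, with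
universal constants). -/
def TensorNormLE (B : V →L[ℝ] V →L[ℝ] ℝ) {k : ℕ} (T : (Fin k → V) → ℝ) (c : ℝ) : Prop :=
  ∀ v : Fin k → V, |T v| ≤ c * ∏ i, Real.sqrt (B (v i) (v i))

/-- A bilinear form as a covariant `2`-tensor. -/
def toTwoTensor (L : V → V →L[ℝ] V →L[ℝ] ℝ) (u : V) (v : Fin 2 → V) : ℝ := L u (v 0) (v 1)

/-- The density `√|det B(b_i, b_j)|` of the Riemannian measure in the linear coordinates given by
the basis `b`. -/
def volumeDensity {ι : Type*} [Fintype ι] [DecidableEq ι] (b : Module.Basis ι ℝ V)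
    (B : V →L[ℝ] V →L[ℝ] ℝ) : ℝ :=
  Real.sqrt |(Matrix.of fun i j => B (b i) (b j)).det|

end Coordinates

/-! ### Covariant 2-tensor fields on manifolds

A covariant 2-tensor field on a manifold modelled on `V` is a map `T : M → V →L[ℝ] V →L[ℝ] ℝ`,
where `T p` is a bilinear form on `TangentSpace I p` (which is `V` by definition). -/

section Manifolds

variable {V : Type*} [NormedAddCommGroup V] [NormedSpace ℝ V]
  {H : Type*} [TopologicalSpace H] (I : ModelWithCorners ℝ V H)
  {M : Type*} [TopologicalSpace M] [ChartedSpace H M]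
  {V₂ : Type*} [NormedAddCommGroup V₂] [NormedSpace ℝ V₂]
  {H₂ : Type*} [TopologicalSpace H₂] (I₂ : ModelWithCorners ℝ V₂ H₂)
  {M₂ : Type*} [TopologicalSpace M₂] [ChartedSpace H₂ M₂]

/-- The pull-back `f^* T`. -/
def pullback (f : M → M₂) (T : M₂ → V₂ →L[ℝ] V₂ →L[ℝ] ℝ) (z : M) : V →L[ℝ] V →L[ℝ] ℝ :=
  let A : V →L[ℝ] V₂ := mfderiv I I₂ f z
  (T (f z)).bilinearComp A A

/-- The components of `T` in the preferred chart around `p`. -/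
def chartRep (T : M → V →L[ℝ] V →L[ℝ] ℝ) (p : M) : V → V →L[ℝ] V →L[ℝ] ℝ :=
  pullback 𝓘(ℝ, V) I (extChartAt I p).symm T

/-- The scalar curvature of the metric `T` at `p`, computed in the preferred chart around `p`. -/
def scalarCurvature [FiniteDimensional ℝ V] (T : M → V →L[ℝ] V →L[ℝ] ℝ) (p : M) : ℝ :=
  scalarCoord (chartRep I T p) (extChartAt I p p)

/-- `Ric[T] = c T`. -/
def IsEinstein (T : M → V →L[ℝ] V →L[ℝ] ℝ) (c : ℝ) : Prop :=
  ∀ (p : M) (v w : V), ricci (chartRep I T p) (extChartAt I p p) v w =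
    c * chartRep I T p (extChartAt I p p) v w

/-- Symmetric 2-tensor fields of class `C²`. -/
structure IsSymmC2 (T : M → V →L[ℝ] V →L[ℝ] ℝ) : Prop where
  symm : ∀ (p : M) (v w : V), T p v w = T p w v
  contDiffOn : ∀ p : M, ContDiffOn ℝ 2 (chartRep I T p) (extChartAt I p).target

end Manifolds

/-! ### Asymptotically locally hyperbolic metrics -/

/-- The coordinate space of an `n`-dimensional manifold. -/
abbrev E (n : ℕ) : Type := EuclideanSpace ℝ (Fin n)

/-- The coordinate space of `ℝ × N`, where `dim N = n - 1`. -/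
abbrev F (n : ℕ) : Type := ℝ × E (n - 1)

/-- The model of the product manifold `ℝ × N`, where `dim N = n - 1`. -/
abbrev IC (n : ℕ) : ModelWithCorners ℝ (F n) (ModelProd ℝ (E (n - 1))) :=
  𝓘(ℝ, ℝ).prod (𝓡 (n - 1))

/-- Riemannian metrics of class `C^r` on an `n`-dimensional manifold `M`. -/
abbrev RiemMetric (n : ℕ) (r : ℕ∞ω) (M : Type*) [TopologicalSpace M] [ChartedSpace (E n) M]
    [IsManifold (𝓡 n) ∞ M] : Type _ :=
  Bundle.ContMDiffRiemannianMetric (𝓡 n) r (E n) (fun q : M => TangentSpace (𝓡 n) q)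

/-- The 2-tensor field underlying a Riemannian metric. -/
def RiemMetric.toTensor {n : ℕ} {r : ℕ∞ω} {M : Type*} [TopologicalSpace M] [ChartedSpace (E n) M]
    [IsManifold (𝓡 n) ∞ M] (g : RiemMetric n r M) : M → E n →L[ℝ] E n →L[ℝ] ℝ :=
  fun q => g.inner q

section Collar

variable {n : ℕ} {N : Type*} [TopologicalSpace N] [ChartedSpace (E (n - 1)) N]

/-- The pull-back to `ℝ × N` of a bilinear form on `N`, at a point. -/
def liftN (B : E (n - 1) →L[ℝ] E (n - 1) →L[ℝ] ℝ) : F n →L[ℝ] F n →L[ℝ] ℝ :=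
  B.bilinearComp (ContinuousLinearMap.snd ℝ ℝ (E (n - 1)))
    (ContinuousLinearMap.snd ℝ ℝ (E (n - 1)))

/-- The tensor `dx²` on `ℝ × N`. -/
def dxSq : F n →L[ℝ] F n →L[ℝ] ℝ :=
  (ContinuousLinearMap.mul ℝ ℝ).bilinearComp (ContinuousLinearMap.fst ℝ ℝ (E (n - 1)))
    (ContinuousLinearMap.fst ℝ ℝ (E (n - 1)))

/-- The product metric `dx² + h` on `ℝ × N`. -/
def productMetric (h : N → E (n - 1) →L[ℝ] E (n - 1) →L[ℝ] ℝ) (z : ℝ × N) :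
    F n →L[ℝ] F n →L[ℝ] ℝ :=
  dxSq + liftN (h z.2)

/-- The reference metric `x⁻² (dx² + (1 - (k/4) x²)² h)`. -/
def referenceMetric (h : N → E (n - 1) →L[ℝ] E (n - 1) →L[ℝ] ℝ) (k : ℝ) (z : ℝ × N) :
    F n →L[ℝ] F n →L[ℝ] ℝ :=
  (z.1 ^ 2)⁻¹ • (dxSq + (1 - k / 4 * z.1 ^ 2) ^ 2 • liftN (h z.2))

/-- The tensor field `T` on (a neighbourhood of `{0} × N` in) `(0, ∞) × N` has the form
`x⁻² (dx² + (1 - (k/4) x²)² h + x^n μ) + o(x^{n-2}) dx^i dx^j`, where `μ` is a symmetric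
2-tensor field of class `C²` on `N`.  The components of the error term are measured by `dx² + h`,
uniformly over `N`. -/
structure HasAsymptoticForm (h : N → E (n - 1) →L[ℝ] E (n - 1) →L[ℝ] ℝ) (k : ℝ)
    (T : ℝ × N → F n →L[ℝ] F n →L[ℝ] ℝ) (μ : N → E (n - 1) →L[ℝ] E (n - 1) →L[ℝ] ℝ) : Prop where
  regular : IsSymmC2 (𝓡 (n - 1)) μ
  expansion : ∀ δ > 0, ∃ r > 0, ∀ z : ℝ × N, 0 < z.1 → z.1 < r → ∀ v w : F n,
    |T z v w - referenceMetric h k z v w - z.1 ^ (n - 2) * liftN (μ z.2) v w| ≤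
      δ * z.1 ^ (n - 2) *
        (Real.sqrt (productMetric h z v v) * Real.sqrt (productMetric h z w w))

/-- The components, in the preferred chart around `z`, of the 3-tensor field `𝒟 λ`, where `𝒟` is
the covariant derivative of `h` acting in the `N` directions: it is the covariant derivative of
`λ` for the Levi-Civita connection of `dx² + h`, with the differentiation slot projected to the
tangent spaces of the slices `{x} × N`. -/
def horizontalDeriv (h : N → E (n - 1) →L[ℝ] E (n - 1) →L[ℝ] ℝ)
    (lam : ℝ × N → F n →L[ℝ] F n →L[ℝ] ℝ) (z : ℝ × N) (u : F n) (v : Fin 3 → F n) : ℝ :=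
  covDeriv (christoffel (chartRep (IC n) (productMetric h) z))
    (toTwoTensor (chartRep (IC n) lam z)) u (Fin.cons (0, (v 0).2) (Fin.tail v))

/-- The weighted estimate
`∑_{0 ≤ l ≤ 2} (|∇^l λ| + x⁻¹ |∇^l 𝒟 λ|) ≤ C₁ x^n` on `(0, x₀) × N`, where `∇` and the norms are
those of the reference metric (and `𝒟 λ` is of class `C²`). -/
def HasWeightedDecay (h : N → E (n - 1) →L[ℝ] E (n - 1) →L[ℝ] ℝ) (k x₀ : ℝ)
    (lam : ℝ × N → F n →L[ℝ] F n →L[ℝ] ℝ) : Prop :=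
  ∃ C₁ : ℝ, ∀ z : ℝ × N, 0 < z.1 → z.1 < x₀ →
    let u := extChartAt (IC n) z z
    let G := chartRep (IC n) (referenceMetric h k) z
    (∀ v, ContDiffAt ℝ 2 (fun u' => horizontalDeriv h lam z u' v) u) ∧
    ∀ l ≤ 2,
      TensorNormLE (G u)
        (iterCovDeriv (christoffel G) (toTwoTensor (chartRep (IC n) lam z)) l u)
        (C₁ * z.1 ^ n) ∧
      TensorNormLE (G u)
        (iterCovDeriv (christoffel G) (horizontalDeriv h lam z) l u)
        (C₁ * z.1 ^ n * z.1)

/-- The function `f` on `(0, x₀) × N` belongs to `L¹` for the Riemannian measure of the metric `T`.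
(For compact `N`, this can be checked near each point of `N`.) -/
def IntegrableOnCollar (T : ℝ × N → F n →L[ℝ] F n →L[ℝ] ℝ) (x₀ : ℝ) (f : ℝ × N → ℝ) : Prop :=
  ∀ p : N, ∃ s ∈ 𝓝 (extChartAt (𝓡 (n - 1)) p p),
    IntegrableOn
      (fun u : F n => f (u.1, (extChartAt (𝓡 (n - 1)) p).symm u.2) *
        volumeDensity
          ((Module.Basis.singleton Unit ℝ).prod (EuclideanSpace.basisFun (Fin (n - 1)) ℝ).toBasis)
          (chartRep (IC n) T (0, p) u))
      (Ioo 0 x₀ ×ˢ s)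

/-- A change of coordinates near the boundary `{0} × N` of `[0, ∞) × N` which is smooth up to the
boundary and fixes every point of the boundary. -/
structure IsBoundaryCoordChange (n : ℕ) {N : Type*} [TopologicalSpace N]
    [ChartedSpace (E (n - 1)) N] (Ψ : OpenPartialHomeomorph (ℝ × N) (ℝ × N)) : Prop where
  contMDiffOn : ContMDiffOn (IC n) (IC n) ∞ Ψ Ψ.source
  contMDiffOn_symm : ContMDiffOn (IC n) (IC n) ∞ Ψ.symm Ψ.target
  boundary_mem : ∀ p : N, ((0 : ℝ), p) ∈ Ψ.source
  boundary_fixed : ∀ p : N, Ψ (0, p) = (0, p)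
  pos_iff : ∀ z ∈ Ψ.source, 0 < (Ψ z).1 ↔ 0 < z.1

/-- `x` is a positive smooth function on `M`, and `Φ` is a diffeomorphism from `(0, x₀) × N` onto
the region `{x < x₀}` under which `x` becomes the first coordinate. -/
structure IsCollar (n : ℕ) {N : Type*} [TopologicalSpace N] [ChartedSpace (E (n - 1)) N]
    {M : Type*} [TopologicalSpace M] [ChartedSpace (E n) M]
    (x : M → ℝ) (x₀ : ℝ) (Φ : OpenPartialHomeomorph (ℝ × N) M) : Prop where
  smooth : ContMDiff (𝓡 n) 𝓘(ℝ, ℝ) ∞ x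
  pos : ∀ q, 0 < x q
  source_eq : Φ.source = Ioo 0 x₀ ×ˢ univ
  target_eq : Φ.target = {q | x q < x₀}
  contMDiffOn : ContMDiffOn (IC n) (𝓡 n) ∞ Φ Φ.source
  contMDiffOn_symm : ContMDiffOn (𝓡 n) (IC n) ∞ Φ.symm Φ.target
  fst_eq : ∀ z ∈ Φ.source, x (Φ z) = z.1

end Collar

end MassAspect

end

open MassAspect

noncomputable section

namespace MassAspect

/-! ### Christoffel symbols, curvature and scalar curvature under changes of coordinates. -/

section CoordinateInvariance

variable {V : Type*} [NormedAddCommGroup V] [NormedSpace ℝ V]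
  {W : Type*} [NormedAddCommGroup W] [NormedSpace ℝ W]

/-! Only the `dx²` component of `g` is changed: with `t = log x`, the new metric is `g + δ dt²`.
Such a change affects the scalar curvature through `δ`, its first derivative across the level sets
of `t`, and its derivatives along them; no second transversal derivative occurs. Near infinity `t`
has almost unit gradient and its Hessian is almost `-1` on the level sets, so to leading order the
change of `R` is `-(n - 1) (∂_t δ - n δ)`. Every derivative of `δ` along `N` gains a factor `x`,
because slice vectors of unit length have size comparable to `x`. The kernel of `∂_t - n` is spanned
by `x^n`, and `x^n` is the order at which the mass aspect function appears. Hence mass can be added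
at almost no cost in scalar curvature.

The choice is `δ = (n / (n - 1)) x^n χ (η + K (16 ε² - x²))`, where `χ` is a nonincreasing cutoff,
equal to `1` for `x ≤ 3ε` and to `0` for `x ≥ 4ε`. With `P = (n / (n - 1)) x^n χ`, the remainder in
the change of `R` is at most `K P x²`. The derivative of `χ` contributes with the favourable sign,
since `η + K (16 ε² - x²) ≥ 0` on the support of `χ`. The term `-K x²` contributes at least `2 K P
x²`, which dominates the remainder. The constant `K` does not depend on `ε`, as long as `16 K ε² ≤
1`.

The exact formula for the change of `R` is `IsPerturbationAt.scalarCoord_addSq`. The Ricci tensor of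
`g` drops out of it, because the rank-one change of the inverse metric produces `Ric(∇t, ∇t)`, which
a Bochner identity expresses by `∇ Hess t`. The formula is then a function of finitely many tensors
at a point (a `LapseJet`), and `IsModelJet.exists_variation_bound` expands it around hyperbolic
space. In an affine chart which moves `(x, y₀)` to `(1, 0)` and normalises the reference metric, the
jet of `g` is `O(x²)`-close to the model: the curvature of the reference metric costs `x²`, and the
decay of `λ` costs `x^n ≤ x²`. This gives `exists_coordinate_bound`, which `scalar_change_bounds`
turns into the sign and the upper bound of the theorem.

For the mass, put `m = (n / (n - 1)) (η + 16 K ε²)`. Near `x = 0` the radial part is `X⁻² (1 + m X^n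
+ O(X^(n+2))) dX²`. The substitution `X = x (1 + m x^n / 2)^(-1/n)` restores `x⁻² dx²` up to
negligible terms and multiplies the slice metric by `1 + (m / n) x^n`. So `μ` becomes `μ + (m / n)
h`, whose trace exceeds that of `μ` by `(n - 1) m / n = η + 16 K ε²`; hence `c_ε = 16 K ε²`
(`hasAsymptoticForm_addDiffSq`). -/

lemma fderiv_apply_apply {X : Type*} [NormedAddCommGroup X] [NormedSpace ℝ X]
    {Y : Type*} [NormedAddCommGroup Y] [NormedSpace ℝ Y]
    {G : V → W →L[ℝ] X →L[ℝ] Y} {u : V} (hG : DifferentiableAt ℝ G u) (v : V) (w : W) (z : X) :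
    fderiv ℝ G u v w z = fderiv ℝ (fun u' => G u' w z) u v := by
  have h := ((hG.hasFDerivAt.clm_apply (hasFDerivAt_const w u)).clm_apply
    (hasFDerivAt_const z u)).fderiv
  rw [h]; simp

/-- The Koszul formula. -/
lemma christoffel_koszul {G : V → V →L[ℝ] V →L[ℝ] ℝ} {u : V} (hG : (G u).IsInvertible)
    (v w z : V) :
    G u (christoffel G u v w) z =
      2⁻¹ * (fderiv ℝ G u v w z + fderiv ℝ G u w v z - fderiv ℝ G u z v w) := by
  simp only [christoffel, smul_apply, ContinuousLinearMap.comp_apply,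
    ContinuousLinearMap.compL_apply, map_smul, hG.self_apply_inverse, smul_eq_mul]
  simp

lemma christoffel_symm {G : V → V →L[ℝ] V →L[ℝ] ℝ} {u : V} (hG : (G u).IsInvertible)
    (hd : DifferentiableAt ℝ G u) (hs : ∀ᶠ u' in 𝓝 u, ∀ v w, G u' v w = G u' w v) (v w : V) :
    christoffel G u v w = christoffel G u w v := by
  apply hG.injective
  ext z
  rw [christoffel_koszul hG, christoffel_koszul hG, fderiv_apply_apply hd z v w,
    fderiv_apply_apply hd z w v]
  have : (fun u' => G u' v w) =ᶠ[𝓝 u] fun u' => G u' w v := hs.mono fun u' h => h v w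
  rw [this.fderiv_eq]; ring

lemma ContinuousLinearMap.IsInvertible.eventually [CompleteSpace V] {X : Type*}
    [TopologicalSpace X] {A : X → V →L[ℝ] W} {x : X} (hA : ContinuousAt A x)
    (hx : (A x).IsInvertible) : ∀ᶠ y in 𝓝 x, (A y).IsInvertible := by
  have : range (fun e : V ≃L[ℝ] W => (e : V →L[ℝ] W)) ∈ 𝓝 (A x) :=
    ContinuousLinearEquiv.isOpen.mem_nhds hx
  exact hA.eventually this

lemma contDiffAt_christoffel [CompleteSpace V] {G : V → V →L[ℝ] V →L[ℝ] ℝ} {u : V} {m n : ℕ∞ω}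
    (hG : ContDiffAt ℝ n G u) (hmn : m + 1 ≤ n) (hi : (G u).IsInvertible) :
    ContDiffAt ℝ m (christoffel G) u := by
  have hD : ContDiffAt ℝ m (fderiv ℝ G) u := hG.fderiv_right hmn
  have hI : ContDiffAt ℝ m (fun u => (G u).inverse) u :=
    hi.contDiffAt_map_inverse.comp u (hG.of_le (le_trans (by simp) hmn))
  unfold christoffel
  refine ContDiffAt.const_smul _ (ContDiffAt.clm_comp ?_ ?_)
  · exact (ContinuousLinearMap.contDiff _).contDiffAt.comp u hI
  · have hf : ContDiffAt ℝ m (fun u => (fderiv ℝ G u).flip) u :=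
      (ContinuousLinearMap.flipₗᵢ ℝ V V (V →L[ℝ] ℝ)).toContinuousLinearEquiv.contDiff.contDiffAt.comp
        u hD
    exact (hD.add hf).sub (contDiffAt_const.clm_comp hf)

lemma contDiffAt_bilinearComp {X : Type*} [NormedAddCommGroup X] [NormedSpace ℝ X]
    {B : X → W →L[ℝ] W →L[ℝ] ℝ} {A A' : X → V →L[ℝ] W} {x : X} {n : ℕ∞ω}
    (hB : ContDiffAt ℝ n B x) (hA : ContDiffAt ℝ n A x) (hA' : ContDiffAt ℝ n A' x) :
    ContDiffAt ℝ n (fun x => (B x).bilinearComp (A x) (A' x)) x := by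
  unfold ContinuousLinearMap.bilinearComp
  have h1 : ContDiffAt ℝ n (fun x => ((B x).comp (A x)).flip) x :=
    (ContinuousLinearMap.flipₗᵢ ℝ V W ℝ).toContinuousLinearEquiv.contDiff.contDiffAt.comp
        x (hB.clm_comp hA)
  exact (ContinuousLinearMap.flipₗᵢ ℝ V V ℝ).toContinuousLinearEquiv.contDiff.contDiffAt.comp
        x (h1.clm_comp hA')

lemma isInvertible_bilinearComp {B : W →L[ℝ] W →L[ℝ] ℝ} {A : V →L[ℝ] W} (hB : B.IsInvertible)
    (hA : A.IsInvertible) : (B.bilinearComp A A).IsInvertible := by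
  obtain ⟨b, rfl⟩ := hB
  obtain ⟨a, rfl⟩ := hA
  refine ⟨(a.trans b).trans (a.symm.arrowCongr (ContinuousLinearEquiv.refl ℝ ℝ)), ?_⟩
  ext v w
  simp

/-- `G' = φ^* G` near `u`, for a local diffeomorphism `φ` of class `C³` and a metric `G` of class
`C²`. -/
structure IsLocalPullback (φ : V → W) (G : W → W →L[ℝ] W →L[ℝ] ℝ) (G' : V → V →L[ℝ] V →L[ℝ] ℝ)
    (u : V) : Prop where
  contDiffAt : ContDiffAt ℝ 3 φ u
  invertible : (fderiv ℝ φ u).IsInvertible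
  metric_contDiffAt : ContDiffAt ℝ 2 G (φ u)
  metric_invertible : (G (φ u)).IsInvertible
  eventually_eq : ∀ᶠ u' in 𝓝 u, G' u' = (G (φ u')).bilinearComp (fderiv ℝ φ u') (fderiv ℝ φ u')

namespace IsLocalPullback

variable {φ : V → W} {G : W → W →L[ℝ] W →L[ℝ] ℝ} {G' : V → V →L[ℝ] V →L[ℝ] ℝ} {u : V}

lemma contDiffAt_pullback (h : IsLocalPullback φ G G' u) : ContDiffAt ℝ 2 G' u := by
  have h1 : ContDiffAt ℝ 2 (fderiv ℝ φ) u := h.contDiffAt.fderiv_right (by norm_num)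
  exact (contDiffAt_bilinearComp (h.metric_contDiffAt.comp u (h.contDiffAt.of_le (by norm_num)))
    h1 h1).congr_of_eventuallyEq h.eventually_eq

lemma invertible_pullback (h : IsLocalPullback φ G G' u) : (G' u).IsInvertible := by
  rw [h.eventually_eq.self_of_nhds]
  exact isInvertible_bilinearComp h.metric_invertible h.invertible

protected lemma eventually [CompleteSpace V] [CompleteSpace W] (h : IsLocalPullback φ G G' u) :
    ∀ᶠ u' in 𝓝 u, IsLocalPullback φ G G' u' := by
  have h1 : ContDiffAt ℝ 2 (fderiv ℝ φ) u := h.contDiffAt.fderiv_right (by norm_num)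
  have hc : ContinuousAt φ u := h.contDiffAt.continuousAt
  filter_upwards [h.contDiffAt.eventually (by simp),
    ContinuousLinearMap.IsInvertible.eventually h1.continuousAt h.invertible,
    hc.eventually (h.metric_contDiffAt.eventually (by simp)),
    hc.eventually (ContinuousLinearMap.IsInvertible.eventually
      h.metric_contDiffAt.continuousAt h.metric_invertible),
    h.eventually_eq.eventually_nhds] with u' a1 a2 a3 a4 a5
  exact ⟨a1, a2, a3, a4, a5⟩

/-- The transformation law of the Christoffel symbols. -/
lemma christoffel_eq (h : IsLocalPullback φ G G' u)
    (hs : ∀ᶠ y in 𝓝 (φ u), ∀ v w, G y v w = G y w v) (v w : V) :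
    fderiv ℝ φ u (christoffel G' u v w) = fderiv ℝ (fderiv ℝ φ) u v w +
      christoffel G (φ u) (fderiv ℝ φ u v) (fderiv ℝ φ u w) := by
  have h1 : HasFDerivAt (fderiv ℝ φ) (fderiv ℝ (fderiv ℝ φ) u) u :=
    ((h.contDiffAt.fderiv_right (m := 2) (by norm_num)).differentiableAt (by norm_num)).hasFDerivAt
  have h0 : HasFDerivAt φ (fderiv ℝ φ u) u :=
    (h.contDiffAt.differentiableAt (by norm_num)).hasFDerivAt
  have hG : HasFDerivAt G (fderiv ℝ G (φ u)) (φ u) :=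
    (h.metric_contDiffAt.differentiableAt (by norm_num)).hasFDerivAt
  have hG' : DifferentiableAt ℝ G' u := h.contDiffAt_pullback.differentiableAt (by norm_num)
  have hsymm : ∀ a b, fderiv ℝ (fderiv ℝ φ) u a b = fderiv ℝ (fderiv ℝ φ) u b a := fun a b =>
    (h.contDiffAt.isSymmSndFDerivAt (by simp; norm_num)).eq a b
  set A := fderiv ℝ φ u with hA
  -- Leibniz rule for `φ^* G`. In the Koszul combination the second derivatives of `φ` cancel in
  -- pairs, except for one term in which `D²φ(v, w)` is paired with the image of `z`.
  have key : ∀ a b c : V, fderiv ℝ G' u a b c = fderiv ℝ G (φ u) (A a) (A b) (A c) +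
      G (φ u) (fderiv ℝ (fderiv ℝ φ) u a b) (A c) +
      G (φ u) (A b) (fderiv ℝ (fderiv ℝ φ) u a c) := by
    intro a b c
    rw [fderiv_apply_apply hG']
    have e : (fun u' => G' u' b c) =ᶠ[𝓝 u] fun u' => G (φ u') (fderiv ℝ φ u' b) (fderiv ℝ φ u' c) :=
      h.eventually_eq.mono fun u' hu' => by simp [hu']
    rw [e.fderiv_eq]
    have hb := h1.clm_apply (hasFDerivAt_const b u)
    have hc := h1.clm_apply (hasFDerivAt_const c u)
    have hGφ : HasFDerivAt (fun y => G (φ y)) _ u := hG.comp u h0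
    rw [((hGφ.clm_apply hb).clm_apply hc).fderiv]
    simp [hA]; ring
  have hs' : ∀ a b, G (φ u) a b = G (φ u) b a := hs.self_of_nhds
  apply h.metric_invertible.injective
  obtain ⟨e, he⟩ := h.invertible
  ext z'
  obtain ⟨z, rfl⟩ : ∃ z, A z = z' := ⟨e.symm z', by rw [hA, ← he]; simp⟩
  have hk := christoffel_koszul h.invertible_pullback v w z
  rw [h.eventually_eq.self_of_nhds] at hk
  simp only [ContinuousLinearMap.bilinearComp_apply] at hk
  rw [← hA] at hk
  rw [hk, map_add, add_apply, christoffel_koszul h.metric_invertible,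
    key, key, key, hsymm w v, hsymm z v, hsymm z w, hs' (A w) (fderiv ℝ (fderiv ℝ φ) u v z)]
  ring

/-- The curvature is a tensor. -/
lemma curvatureEnd_eq [CompleteSpace V] [CompleteSpace W] (h : IsLocalPullback φ G G' u)
    (hs : ∀ᶠ y in 𝓝 (φ u), ∀ v w, G y v w = G y w v) (v w z : V) :
    fderiv ℝ φ u (curvatureEnd (christoffel G') u w z v) =
      curvatureEnd (christoffel G) (φ u) (fderiv ℝ φ u w) (fderiv ℝ φ u z) (fderiv ℝ φ u v) := by
  have c2 : ContDiffAt ℝ 2 (fderiv ℝ φ) u := h.contDiffAt.fderiv_right (by norm_num)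
  have h1 : HasFDerivAt (fderiv ℝ φ) (fderiv ℝ (fderiv ℝ φ) u) u :=
    (c2.differentiableAt (by norm_num)).hasFDerivAt
  have h2 : HasFDerivAt (fderiv ℝ (fderiv ℝ φ)) (fderiv ℝ (fderiv ℝ (fderiv ℝ φ)) u) u :=
    ((c2.fderiv_right (m := 1) (by norm_num)).differentiableAt (by norm_num)).hasFDerivAt
  have h0 : HasFDerivAt φ (fderiv ℝ φ u) u :=
    (h.contDiffAt.differentiableAt (by norm_num)).hasFDerivAt
  have hΓ : HasFDerivAt (christoffel G) (fderiv ℝ (christoffel G) (φ u)) (φ u) :=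
    ((contDiffAt_christoffel h.metric_contDiffAt (m := 1) (by norm_num)
      h.metric_invertible).differentiableAt (by norm_num)).hasFDerivAt
  have hΓ' : HasFDerivAt (christoffel G') (fderiv ℝ (christoffel G') u) u :=
    ((contDiffAt_christoffel h.contDiffAt_pullback (m := 1) (by norm_num)
      h.invertible_pullback).differentiableAt (by norm_num)).hasFDerivAt
  have hsymm2 : ∀ a b, fderiv ℝ (fderiv ℝ φ) u a b = fderiv ℝ (fderiv ℝ φ) u b a := fun a b =>
    (h.contDiffAt.isSymmSndFDerivAt (by simp; norm_num)).eq a b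
  have hsymm3 : ∀ a b, fderiv ℝ (fderiv ℝ (fderiv ℝ φ)) u a b =
      fderiv ℝ (fderiv ℝ (fderiv ℝ φ)) u b a := fun a b =>
    (c2.isSymmSndFDerivAt (by simp)).eq a b
  -- The transformation law is needed in a neighbourhood because it is differentiated once more. The
  -- third derivatives of `φ` are symmetric in the first two slots and disappear from the
  -- antisymmetrised combination.
  have hev : ∀ᶠ u' in 𝓝 u, ∀ v w, fderiv ℝ φ u' (christoffel G' u' v w) =
      fderiv ℝ (fderiv ℝ φ) u' v w +
      christoffel G (φ u') (fderiv ℝ φ u' v) (fderiv ℝ φ u' w) := by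
    filter_upwards [h.eventually, h.contDiffAt.continuousAt.eventually hs.eventually_nhds]
      with u' a1 a2 v w
    exact a1.christoffel_eq a2 v w
  have key : ∀ a b c : V, fderiv ℝ (fderiv ℝ φ) u a (christoffel G' u b c) +
      fderiv ℝ φ u (fderiv ℝ (christoffel G') u a b c) =
      fderiv ℝ (fderiv ℝ (fderiv ℝ φ)) u a b c +
      (fderiv ℝ (christoffel G) (φ u) (fderiv ℝ φ u a) (fderiv ℝ φ u b) (fderiv ℝ φ u c) +
      christoffel G (φ u) (fderiv ℝ (fderiv ℝ φ) u a b) (fderiv ℝ φ u c) +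
      christoffel G (φ u) (fderiv ℝ φ u b) (fderiv ℝ (fderiv ℝ φ) u a c)) := by
    intro a b c
    have hb := h1.clm_apply (hasFDerivAt_const b u)
    have hc := h1.clm_apply (hasFDerivAt_const c u)
    have l := h1.clm_apply ((hΓ'.clm_apply (hasFDerivAt_const b u)).clm_apply
      (hasFDerivAt_const c u))
    have r := ((h2.clm_apply (hasFDerivAt_const b u)).clm_apply (hasFDerivAt_const c u)).add
      (((hΓ.comp u h0).clm_apply hb).clm_apply hc)
    have e := l.unique (r.congr_of_eventuallyEq (hev.mono fun u' hu' => hu' b c))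
    have := congrArg (fun L => L a) e
    simp at this
    rw [add_comm]
    rw [this]
    abel
  have hev0 := hev.self_of_nhds
  have k1 := key v w z
  have k2 := key w v z
  rw [← eq_sub_iff_add_eq'] at k1 k2
  simp only [curvatureEnd, add_apply, sub_apply,
    ContinuousLinearMap.flip_apply, ContinuousLinearMap.comp_apply, map_add, map_sub, hev0, k1, k2]
  rw [hsymm3 w v, hsymm2 w v]
  abel

/-- The curvature endomorphisms in the two coordinate systems are conjugate by `dφ`, and traces are
invariant under conjugation. -/
lemma ricci_eq [CompleteSpace V] [CompleteSpace W] (h : IsLocalPullback φ G G' u)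
    (hs : ∀ᶠ y in 𝓝 (φ u), ∀ v w, G y v w = G y w v) (w z : V) :
    ricci G' u w z = ricci G (φ u) (fderiv ℝ φ u w) (fderiv ℝ φ u z) := by
  obtain ⟨e, he⟩ := h.invertible
  simp only [ricci, LinearMap.mk₂_apply]
  rw [← LinearMap.trace_conj' _ e.toLinearEquiv]
  congr 1
  ext y
  have := h.curvatureEnd_eq hs (e.symm y) w z
  rw [← he] at this ⊢
  simpa [LinearEquiv.conj_apply] using this

end IsLocalPullback

/-- The endomorphism `B⁻¹ T` is conjugated by `A`; this is verified after lowering an index, which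
avoids a formula for the inverse of the pulled-back form. -/
lemma traceWith_bilinearComp {B T : W →L[ℝ] W →L[ℝ] ℝ} {A : V →L[ℝ] W} (hB : B.IsInvertible)
    (hA : A.IsInvertible) :
    traceWith (B.bilinearComp A A) (T.bilinearComp A A) = traceWith B T := by
  obtain ⟨a, rfl⟩ := hA
  unfold traceWith
  rw [← LinearMap.trace_conj' _ a.toLinearEquiv]
  congr 1
  ext y
  have hi := isInvertible_bilinearComp hB (A := (a : V →L[ℝ] W)) ContinuousLinearMap.isInvertible_equiv
  simp only [LinearEquiv.conj_apply, LinearMap.comp_apply]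
  apply hB.injective
  ext z
  simp only [ContinuousLinearMap.coe_coe, ContinuousLinearMap.comp_apply, hB.self_apply_inverse,
    LinearEquiv.coe_coe]
  have := congrArg (fun L => L (a.symm z)) (hi.self_apply_inverse
    ((T.bilinearComp (a : V →L[ℝ] W) (a : V →L[ℝ] W)) (a.symm y)))
  simpa using this

/-- The scalar curvature is invariant under changes of coordinates. -/
lemma IsLocalPullback.scalarCoord_eq [FiniteDimensional ℝ V] [FiniteDimensional ℝ W]
    {φ : V → W} {G : W → W →L[ℝ] W →L[ℝ] ℝ} {G' : V → V →L[ℝ] V →L[ℝ] ℝ} {u : V}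
    (h : IsLocalPullback φ G G' u) (hs : ∀ᶠ y in 𝓝 (φ u), ∀ v w, G y v w = G y w v) :
    scalarCoord G' u = scalarCoord G (φ u) := by
  have := FiniteDimensional.complete ℝ V
  have := FiniteDimensional.complete ℝ W
  unfold scalarCoord
  rw [← traceWith_bilinearComp h.metric_invertible h.invertible, ← h.eventually_eq.self_of_nhds]
  congr 1
  ext w z
  simpa using h.ricci_eq hs w z

lemma scalarCoord_congr [FiniteDimensional ℝ V] {G G' : V → V →L[ℝ] V →L[ℝ] ℝ} {u : V}
    (h : G =ᶠ[𝓝 u] G') : scalarCoord G u = scalarCoord G' u := by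
  have h1 : christoffel G =ᶠ[𝓝 u] christoffel G' := by
    filter_upwards [h.eventuallyEq_nhds] with u' hu'
    unfold christoffel
    rw [hu'.fderiv_eq, hu'.eq_of_nhds]
  have h2 : ricci G u = ricci G' u := by
    unfold ricci curvatureEnd
    simp only [h1.fderiv_eq, h1.eq_of_nhds]
  unfold scalarCoord
  rw [h2, h.eq_of_nhds]

end CoordinateInvariance

/-! ### Covariant derivatives in coordinates and the Ricci identity. -/

section CovariantCalculus

variable {V : Type*} [NormedAddCommGroup V] [NormedSpace ℝ V]

/-- The covariant derivative of a covector field. -/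
def nablaCovector (Γ : V → V →L[ℝ] V →L[ℝ] V) (α : V → V →L[ℝ] ℝ) (u : V) :
    V →L[ℝ] V →L[ℝ] ℝ :=
  fderiv ℝ α u - (ContinuousLinearMap.compL ℝ V V ℝ (α u)).comp (Γ u)

/-- The covariant derivative of a vector field. -/
def nablaVector (Γ : V → V →L[ℝ] V →L[ℝ] V) (X : V → V) (u : V) : V →L[ℝ] V :=
  fderiv ℝ X u + (Γ u).flip (X u)

/-- The covariant derivative of a field of bilinear forms; the differentiation slot comes first. -/
def nablaBilin (Γ : V → V →L[ℝ] V →L[ℝ] V) (B : V → V →L[ℝ] V →L[ℝ] ℝ) (u : V) :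
    V →L[ℝ] V →L[ℝ] V →L[ℝ] ℝ :=
  fderiv ℝ B u - (ContinuousLinearMap.compL ℝ V V (V →L[ℝ] ℝ) (B u)).comp (Γ u) -
    ((ContinuousLinearMap.flipₗᵢ ℝ V V ℝ).toContinuousLinearEquiv :
      (V →L[ℝ] V →L[ℝ] ℝ) →L[ℝ] V →L[ℝ] V →L[ℝ] ℝ).comp
      ((ContinuousLinearMap.compL ℝ V V (V →L[ℝ] ℝ) (B u).flip).comp (Γ u))

/-- The covariant derivative of a field of endomorphisms; the differentiation slot comes first. -/
def nablaEnd (Γ : V → V →L[ℝ] V →L[ℝ] V) (S : V → V →L[ℝ] V) (u : V) :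
    V →L[ℝ] V →L[ℝ] V :=
  fderiv ℝ S u + (ContinuousLinearMap.compL ℝ V V V).flip (S u) ∘L (Γ u) -
    (ContinuousLinearMap.compL ℝ V V V (S u)).comp (Γ u)

variable {Γ : V → V →L[ℝ] V →L[ℝ] V} {u : V}

lemma nablaCovector_apply (α : V → V →L[ℝ] ℝ) (v w : V) :
    nablaCovector Γ α u v w = fderiv ℝ α u v w - α u (Γ u v w) := by
  simp [nablaCovector]

lemma nablaVector_apply (X : V → V) (v : V) :
    nablaVector Γ X u v = fderiv ℝ X u v + Γ u v (X u) := by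
  simp [nablaVector]

lemma nablaBilin_apply (B : V → V →L[ℝ] V →L[ℝ] ℝ) (v w z : V) :
    nablaBilin Γ B u v w z = fderiv ℝ B u v w z - B u (Γ u v w) z - B u w (Γ u v z) := by
  simp [nablaBilin]

lemma nablaEnd_apply (S : V → V →L[ℝ] V) (v w : V) :
    nablaEnd Γ S u v w = fderiv ℝ S u v w + Γ u v (S u w) - S u (Γ u v w) := by
  simp [nablaEnd]
  

/-- The field of vectors metrically equivalent to a field of covectors. -/
def sharp (G : V → V →L[ℝ] V →L[ℝ] ℝ) (α : V → V →L[ℝ] ℝ) (u : V) : V := (G u).inverse (α u)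

lemma contDiffAt_sharp [CompleteSpace V] {G : V → V →L[ℝ] V →L[ℝ] ℝ} {α : V → V →L[ℝ] ℝ}
    {n : ℕ∞ω} (hG : ContDiffAt ℝ n G u) (hi : (G u).IsInvertible) (hα : ContDiffAt ℝ n α u) :
    ContDiffAt ℝ n (sharp G α) u :=
  ContDiffAt.clm_apply (hi.contDiffAt_map_inverse.comp u hG) hα

variable {G : V → V →L[ℝ] V →L[ℝ] ℝ}

/-- A metric of class `C²` in coordinates around `u`. -/
structure IsMetricAt (G : V → V →L[ℝ] V →L[ℝ] ℝ) (u : V) : Prop where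
  contDiffAt : ContDiffAt ℝ 2 G u
  invertible : (G u).IsInvertible
  eventually_symm : ∀ᶠ y in 𝓝 u, ∀ v w, G y v w = G y w v

namespace IsMetricAt

lemma symm (h : IsMetricAt G u) (v w : V) : G u v w = G u w v := h.eventually_symm.self_of_nhds v w

lemma differentiableAt (h : IsMetricAt G u) : DifferentiableAt ℝ G u :=
  h.contDiffAt.differentiableAt (by norm_num)

protected lemma eventually [CompleteSpace V] (h : IsMetricAt G u) :
    ∀ᶠ y in 𝓝 u, IsMetricAt G y := by
  filter_upwards [h.contDiffAt.eventually (by simp),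
    ContinuousLinearMap.IsInvertible.eventually h.contDiffAt.continuousAt h.invertible,
    h.eventually_symm.eventually_nhds] with y a b c
  exact ⟨a, b, c⟩

lemma christoffel_symm (h : IsMetricAt G u) (v w : V) :
    christoffel G u v w = christoffel G u w v :=
  MassAspect.christoffel_symm h.invertible h.differentiableAt h.eventually_symm v w

lemma apply_sharp (h : IsMetricAt G u) (α : V → V →L[ℝ] ℝ) (v : V) :
    G u (sharp G α u) v = α u v := by
  simp [sharp, h.invertible.self_apply_inverse]

lemma fderiv_symm (h : IsMetricAt G u) (v w z : V) : fderiv ℝ G u v w z = fderiv ℝ G u v z w := by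
  rw [fderiv_apply_apply h.differentiableAt, fderiv_apply_apply h.differentiableAt]
  have : (fun u' => G u' w z) =ᶠ[𝓝 u] fun u' => G u' z w :=
    h.eventually_symm.mono fun y hy => hy w z
  rw [this.fderiv_eq]

/-- Metric compatibility `∇G = 0`, written out in coordinates. -/
lemma fderiv_eq (h : IsMetricAt G u) (v w z : V) :
    fderiv ℝ G u v w z = G u (christoffel G u v w) z + G u w (christoffel G u v z) := by
  rw [h.symm w, christoffel_koszul h.invertible, christoffel_koszul h.invertible,
    h.fderiv_symm v z w, h.fderiv_symm w v z, h.fderiv_symm z v w]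
  ring

/-- Raising an index commutes with covariant differentiation. -/
lemma apply_nablaVector_sharp [CompleteSpace V] (h : IsMetricAt G u) {α : V → V →L[ℝ] ℝ}
    (hα : DifferentiableAt ℝ α u) (v w : V) :
    G u (nablaVector (christoffel G) (sharp G α) u v) w =
      nablaCovector (christoffel G) α u v w := by
  have hsh : HasFDerivAt (sharp G α) (fderiv ℝ (sharp G α) u) u :=
    (((h.invertible.contDiffAt_map_inverse (n := 1)).differentiableAt (by norm_num)).comp u
      h.differentiableAt |>.clm_apply hα).hasFDerivAt
  have e : (fun y => G y (sharp G α y) w) =ᶠ[𝓝 u] fun y => α y w := by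
    filter_upwards [h.eventually] with y hy using hy.apply_sharp α w
  have l := (h.differentiableAt.hasFDerivAt.clm_apply hsh).clm_apply (hasFDerivAt_const w u)
  have r := hα.hasFDerivAt.clm_apply (hasFDerivAt_const w u)
  have := congrArg (fun L => L v) (l.unique (r.congr_of_eventuallyEq e))
  simp [h.fderiv_eq] at this
  rw [nablaCovector_apply, nablaVector_apply, ← this, ← h.apply_sharp α]
  simp
  ring

/-- A closed covector field has a symmetric covariant derivative because the connection is torsion
free; this is what makes Hessians symmetric. -/
lemma nablaCovector_symm (h : IsMetricAt G u) {α : V → V →L[ℝ] ℝ}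
    (hα : ∀ v w, fderiv ℝ α u v w = fderiv ℝ α u w v) (v w : V) :
    nablaCovector (christoffel G) α u v w = nablaCovector (christoffel G) α u w v := by
  rw [nablaCovector_apply, nablaCovector_apply, hα, h.christoffel_symm]

/-- Since `∇G = 0`, lowering an index commutes with covariant differentiation. -/
lemma apply_nablaEnd (h : IsMetricAt G u) {S : V → V →L[ℝ] V} {B : V → V →L[ℝ] V →L[ℝ] ℝ}
    (hS : DifferentiableAt ℝ S u) (hB : DifferentiableAt ℝ B u)
    (e : ∀ᶠ y in 𝓝 u, ∀ v w, G y (S y v) w = B y v w) (v w z : V) :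
    G u (nablaEnd (christoffel G) S u v w) z = nablaBilin (christoffel G) B u v w z := by
  have l := (h.differentiableAt.hasFDerivAt.clm_apply (hS.hasFDerivAt.clm_apply
    (hasFDerivAt_const w u))).clm_apply (hasFDerivAt_const z u)
  have r := (hB.hasFDerivAt.clm_apply (hasFDerivAt_const w u)).clm_apply (hasFDerivAt_const z u)
  have := congrArg (fun L => L v) (l.unique (r.congr_of_eventuallyEq (e.mono fun y hy => hy w z)))
  simp [h.fderiv_eq] at this
  rw [nablaBilin_apply, nablaEnd_apply, ← this, ← e.self_of_nhds, ← e.self_of_nhds]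
  simp
  ring

/-- `R(v, w) X = (∇_v ∇X) w - (∇_w ∇X) v`. -/
lemma curvatureEnd_apply_field [CompleteSpace V] (h : IsMetricAt G u) {X : V → V}
    (hX : ContDiffAt ℝ 2 X u)
    (v w : V) :
    curvatureEnd (christoffel G) u w (X u) v =
      nablaEnd (christoffel G) (nablaVector (christoffel G) X) u v w -
      nablaEnd (christoffel G) (nablaVector (christoffel G) X) u w v := by
  have h1 : HasFDerivAt X (fderiv ℝ X u) u := (hX.differentiableAt (by norm_num)).hasFDerivAt
  have h2 : HasFDerivAt (fderiv ℝ X) (fderiv ℝ (fderiv ℝ X) u) u :=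
    ((hX.fderiv_right (m := 1) (by norm_num)).differentiableAt (by norm_num)).hasFDerivAt
  have hs : ∀ a b, fderiv ℝ (fderiv ℝ X) u a b = fderiv ℝ (fderiv ℝ X) u b a := fun a b =>
    (hX.isSymmSndFDerivAt (by simp)).eq a b
  have hΓ : HasFDerivAt (christoffel G) (fderiv ℝ (christoffel G) u) u :=
    ((contDiffAt_christoffel h.contDiffAt (m := 1) (by norm_num)
      h.invertible).differentiableAt (by norm_num)).hasFDerivAt
  have hΓf : HasFDerivAt (fun y => (christoffel G y).flip) _ u :=
    (ContinuousLinearMap.flipₗᵢ ℝ V V V).toContinuousLinearEquiv.hasFDerivAt.comp u hΓ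
  have hN : HasFDerivAt (nablaVector (christoffel G) X) _ u := h2.add (hΓf.clm_apply h1)
  rw [nablaEnd_apply, nablaEnd_apply, hN.fderiv]
  simp [nablaVector_apply, curvatureEnd, hs w v, h.christoffel_symm w v]
  abel

end IsMetricAt

end CovariantCalculus

/-! ### Rank-one changes of a metric and the pointwise algebra of the curvature variation. -/

section TraceAlgebra

variable {V : Type*} [NormedAddCommGroup V] [NormedSpace ℝ V]

lemma traceWith_add (B S T : V →L[ℝ] V →L[ℝ] ℝ) :
    traceWith B (S + T) = traceWith B S + traceWith B T := by
  simp [traceWith, ContinuousLinearMap.comp_add]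

lemma traceWith_sub (B S T : V →L[ℝ] V →L[ℝ] ℝ) :
    traceWith B (S - T) = traceWith B S - traceWith B T := by
  simp [traceWith, ContinuousLinearMap.comp_sub]

lemma traceWith_smul (B T : V →L[ℝ] V →L[ℝ] ℝ) (c : ℝ) :
    traceWith B (c • T) = c * traceWith B T := by
  simp [traceWith]

variable [FiniteDimensional ℝ V]

lemma traceWith_smulRight (B : V →L[ℝ] V →L[ℝ] ℝ) (α β : V →L[ℝ] ℝ) :
    traceWith B (α.smulRight β) = α (B.inverse β) := by
  unfold traceWith
  have := LinearMap.trace_smulRight (α : V →ₗ[ℝ] ℝ) (B.inverse β)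
  rw [ContinuousLinearMap.coe_coe] at this
  rw [← this]
  congr 1
  ext v
  simp

/-- The inverse of a rank-one perturbation. -/
lemma rankOne_perturbation {G : V →L[ℝ] V →L[ℝ] ℝ} (hG : G.IsInvertible)
    (hs : ∀ v w, G v w = G w v) (θ : V →L[ℝ] ℝ) {δ : ℝ}
    (h : 1 + δ * θ (G.inverse θ) ≠ 0) :
    (G + δ • θ.smulRight θ).IsInvertible ∧ ∀ α, (G + δ • θ.smulRight θ).inverse α =
      G.inverse α - (δ / (1 + δ * θ (G.inverse θ)) * α (G.inverse θ)) • G.inverse θ := by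
  have e : ∀ α : V →L[ℝ] ℝ, θ (G.inverse α) = α (G.inverse θ) := fun α => by
    have h1 := hs (G.inverse θ) (G.inverse α)
    rwa [hG.self_apply_inverse, hG.self_apply_inverse] at h1
  have hi : (G + δ • θ.smulRight θ).IsInvertible := by
    -- A kernel vector is a multiple of `G⁻¹ θ`; evaluating `θ` on it shows that the multiple is
    -- killed by `1 + δ θ(G⁻¹ θ)`. In finite dimension injectivity suffices.
    have hinj : Function.Injective (G + δ • θ.smulRight θ) := by
      rw [injective_iff_map_eq_zero]
      intro v hv
      have h1 : G v = -(δ * θ v) • θ := by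
        ext w
        have := congrArg (fun L => L w) hv
        simp at this ⊢
        linarith
      have h2 : v = -(δ * θ v) • G.inverse θ := by
        have := (hG.inverse_apply_self v).symm
        rwa [h1, map_smul] at this
      have h3 := congrArg θ h2
      simp only [map_smul, smul_eq_mul] at h3
      have h4 : θ v = 0 := by
        have : (1 + δ * θ (G.inverse θ)) * θ v = 0 := by linarith
        exact (mul_eq_zero.1 this).resolve_left h
      rw [h2, h4]; simp
    obtain ⟨g, hg⟩ := hG
    have hd : Module.finrank ℝ V = Module.finrank ℝ (V →L[ℝ] ℝ) := g.toLinearEquiv.finrank_eq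
    have : FiniteDimensional ℝ (V →L[ℝ] ℝ) := g.toLinearEquiv.finiteDimensional
    exact ⟨(LinearEquiv.ofInjectiveOfFinrankEq
      ((G + δ • θ.smulRight θ : V →L[ℝ] V →L[ℝ] ℝ) : V →ₗ[ℝ] V →L[ℝ] ℝ) hinj hd
        ).toContinuousLinearEquiv, by ext; rfl⟩
  refine ⟨hi, fun α => ?_⟩
  rw [hi.inverse_apply_eq]
  ext w
  simp only [add_apply, smul_apply, ContinuousLinearMap.smulRight_apply, map_sub, map_smul,
    sub_apply, hG.self_apply_inverse, smul_eq_mul, e]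
  field_simp
  ring

/-- The trace with respect to a rank-one perturbation. -/
lemma traceWith_rankOne {G : V →L[ℝ] V →L[ℝ] ℝ} (hG : G.IsInvertible)
    (hs : ∀ v w, G v w = G w v) (θ : V →L[ℝ] ℝ) {δ : ℝ}
    (h : 1 + δ * θ (G.inverse θ) ≠ 0) (T : V →L[ℝ] V →L[ℝ] ℝ) :
    traceWith (G + δ • θ.smulRight θ) T = traceWith G T -
      δ / (1 + δ * θ (G.inverse θ)) * T (G.inverse θ) (G.inverse θ) := by
  obtain ⟨hi, hinv⟩ := rankOne_perturbation hG hs θ h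
  unfold traceWith
  set c := δ / (1 + δ * θ (G.inverse θ))
  have : (((G + δ • θ.smulRight θ).inverse.comp T : V →L[ℝ] V) : V →ₗ[ℝ] V) =
      ((G.inverse.comp T : V →L[ℝ] V) : V →ₗ[ℝ] V) -
        c • ((T.flip (G.inverse θ) : V →L[ℝ] ℝ) : V →ₗ[ℝ] ℝ).smulRight (G.inverse θ) := by
    ext v
    simp [hinv, smul_smul]
  rw [this, map_sub, map_smul, LinearMap.trace_smulRight]
  simp

/-- The scalar invariants, at a point, of the gradient `θ♯`, the Hessian `H` and the covariant
derivative `∇H` of the Hessian of a function, which enter the variation of the scalar curvature. -/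
structure LapseScalars where
  u : ℝ
  h : ℝ
  a1 : ℝ
  a2 : ℝ
  a3 : ℝ
  a4 : ℝ
  a5 : ℝ
  a6 : ℝ

/-- The invariants of `LapseScalars` for given tensors. -/
def lapseScalars (G : V →L[ℝ] V →L[ℝ] ℝ) (θ : V →L[ℝ] ℝ) (H : V →L[ℝ] V →L[ℝ] ℝ)
    (DH : V →L[ℝ] V →L[ℝ] V →L[ℝ] ℝ) : LapseScalars where
  u := θ (G.inverse θ)
  h := traceWith G H
  a1 := H (G.inverse θ) (G.inverse θ)
  a2 := H (G.inverse θ) (G.inverse (H (G.inverse θ)))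
  a3 := traceWith G (H.comp (G.inverse.comp H))
  a4 := traceWith G (DH (G.inverse θ))
  a5 := DH (G.inverse θ) (G.inverse θ) (G.inverse θ)
  a6 := traceWith G (DH.flip (G.inverse θ))

namespace LapseScalars

/-- The mean curvature (up to normalisation) of the level sets. -/
def tau (s : LapseScalars) : ℝ := s.h - s.a1 / s.u

/-- The zeroth order coefficient in the variation of the scalar curvature. -/
def zeroth (s : LapseScalars) : ℝ :=
  (s.a3 - 2 * s.a2 / s.u + s.a1 ^ 2 / s.u ^ 2 + s.tau ^ 2 +
    2 * (s.a4 - (s.a5 + 2 * s.a2) / s.u + 2 * s.a1 ^ 2 / s.u ^ 2) - 2 * s.tau * s.a1 / s.u) / s.u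

/-- The Laplacian of `|θ|²` along the level sets. -/
def lapU (s : LapseScalars) : ℝ :=
  2 * s.a6 + 2 * s.a3 - (2 * s.a5 + 2 * s.a2) / s.u - 2 * s.a1 / s.u * s.tau

/-- The square of the tangential part of the differential of `|θ|²`. -/
def gradU (s : LapseScalars) : ℝ := 4 * s.a2 - 4 * s.a1 ^ 2 / s.u

/-- The variation of the scalar curvature in terms of `δ`, `e = dδ(ξ)`, `p = |dδ|²`,
`r = H(ξ, dδ♯)`, `a7 = Δδ` and `a8 = Hess δ(ξ, ξ)`. -/
def variation (s : LapseScalars) (δ e p r a7 a8 : ℝ) : ℝ :=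
  δ * s.u / (1 + δ * s.u) * s.zeroth + s.tau / s.u * (2 * δ * s.a1 + s.u * e) / (1 + δ * s.u) ^ 2 -
    (s.u * (a7 - a8 / s.u - e / s.u * s.tau) + 2 * (2 * r - 2 * s.a1 * e / s.u) + δ * s.lapU) /
      (1 + δ * s.u) +
    (δ ^ 2 * s.gradU + 2 * δ * s.u * (2 * r - 2 * s.a1 * e / s.u) + s.u ^ 2 * (p - e ^ 2 / s.u)) /
      (2 * (1 + δ * s.u) ^ 2) +
    (δ * s.gradU / s.u + (2 * r - 2 * s.a1 * e / s.u)) / (1 + δ * s.u)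

end LapseScalars

/-- The trace of the change of the Ricci tensor. -/
lemma traceWith_ricci_change {G : V →L[ℝ] V →L[ℝ] ℝ} (hG : G.IsInvertible)
    (hs : ∀ v w, G v w = G w v) {θ d : V →L[ℝ] ℝ} {H D : V →L[ℝ] V →L[ℝ] ℝ}
    (hH : ∀ v w, H v w = H w v) (hD : ∀ v w, D v w = D w v)
    (DH : V →L[ℝ] V →L[ℝ] V →L[ℝ] ℝ) {δ : ℝ} {ξ η : V} (hξ : ξ = G.inverse θ)
    (hη : η = G.inverse d) (hu : θ ξ ≠ 0) (hδ : 1 + δ * θ ξ ≠ 0)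
    {N A : V → V → ℝ} {N' A' : V → V → V → ℝ} {σ e h a7 : ℝ} {σ' e' : V → ℝ}
    (hσ : σ = 1 / (1 + δ * θ ξ)) (he : e = d ξ) (hh : h = traceWith G H)
    (ha7 : a7 = traceWith G D)
    (hN : ∀ w z, N w z = 2⁻¹ * (d w * θ z + θ w * d z) + δ * H w z + 2⁻¹ * δ * e * θ w * θ z)
    (hA : ∀ w z, A w z = σ * N w z)
    (hσ' : ∀ v, σ' v = - σ ^ 2 * (θ ξ * d v + 2 * δ * H v ξ))
    (he' : ∀ v, e' v = D v ξ + H v η)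
    (hN' : ∀ v w z, N' v w z = 2⁻¹ * (D v w * θ z + d w * H v z + H v w * d z + θ w * D v z) +
      d v * H w z + δ * DH v w z + 2⁻¹ * (d v * e + δ * e' v) * θ w * θ z +
      2⁻¹ * δ * e * (H v w * θ z + θ w * H v z))
    (hA' : ∀ v w z, A' v w z = σ' v * N w z + σ * N' v w z)
    (T : V →L[ℝ] V →L[ℝ] ℝ)
    (hT : ∀ w z, T w z = A' ξ w z - A' w ξ z + (A w z * A ξ ξ - 2⁻¹ * θ w * θ z * A ξ η) -
      A w ξ * A ξ z + 2⁻¹ * θ z * θ ξ * A w η + A w z * h - 2⁻¹ * θ w * θ z * a7 -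
      2⁻¹ * θ w * H η z + 2⁻¹ * H w z * e - 2⁻¹ * (A w z * θ ξ - 2⁻¹ * θ w * θ z * e) * e +
      2⁻¹ * θ w * (θ ξ * A η z - 2⁻¹ * θ z * e ^ 2) - A (G.inverse (H w)) z +
      2⁻¹ * θ z * D w ξ) :
    traceWith (G + δ • θ.smulRight θ) T - δ * σ * (traceWith G (DH.flip ξ) - traceWith G (DH ξ)) =
      (lapseScalars G θ H DH).variation δ e (d η) (H ξ η) a7 (D ξ ξ) := by
  have i1 : ∀ α β : V →L[ℝ] ℝ, α (G.inverse β) = β (G.inverse α) := fun α β => by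
    have h1 := hs (G.inverse α) (G.inverse β)
    rwa [hG.self_apply_inverse, hG.self_apply_inverse] at h1
  have iθ : ∀ β : V →L[ℝ] ℝ, θ (G.inverse β) = β ξ := fun β => by rw [i1, hξ]
  have iη : ∀ β : V →L[ℝ] ℝ, d (G.inverse β) = β η := fun β => by rw [i1, hη]
  have hdξ : d ξ = e := he.symm
  have hθη : θ η = e := by rw [hη, iθ, he]
  set Hx : V →L[ℝ] ℝ := H ξ with hHx
  set Hy : V →L[ℝ] ℝ := H η with hHy
  set Dx : V →L[ℝ] ℝ := D ξ with hDx
  have kx : ∀ w, H w ξ = Hx w := fun w => hH w ξ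
  have ky : ∀ w, H w η = Hy w := fun w => hH w η
  have kd : ∀ w, D w ξ = Dx w := fun w => hD w ξ
  have kyx : Hy ξ = Hx η := hH η ξ
  set K : V →L[ℝ] V →L[ℝ] ℝ := H.comp (G.inverse.comp H) with hK
  set S' : V →L[ℝ] ℝ := (-σ ^ 2) • (θ ξ • d + (2 * δ) • Hx) with hS'
  set E' : V →L[ℝ] ℝ := Dx + Hy with hE'
  set NN : V →L[ℝ] V →L[ℝ] ℝ := (2⁻¹ : ℝ) • (d.smulRight θ + θ.smulRight d) + δ • H +
    (2⁻¹ * δ * e) • θ.smulRight θ with hNN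
  set Nx : V →L[ℝ] ℝ := (2⁻¹ : ℝ) • (e • θ + θ ξ • d) + δ • Hx + (2⁻¹ * δ * e * θ ξ) • θ with hNx
  set Ny : V →L[ℝ] ℝ := (2⁻¹ : ℝ) • (d η • θ + e • d) + δ • Hy + (2⁻¹ * δ * e * e) • θ with hNy
  -- `T` is rewritten as a combination of rank-one tensors and of `H`, `D`, `H G⁻¹ H` and
  -- contractions of `∇H`, so that its trace can be read off term by term.
  have hTT : T = (S' ξ) • NN + σ • ((2⁻¹ : ℝ) • (Dx.smulRight θ + d.smulRight Hx + Hx.smulRight d +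
      θ.smulRight Dx) + e • H + δ • DH ξ + (2⁻¹ * (e * e + δ * E' ξ)) • θ.smulRight θ +
      (2⁻¹ * δ * e) • (Hx.smulRight θ + θ.smulRight Hx)) - S'.smulRight Nx -
      σ • ((2⁻¹ : ℝ) • (Dx.smulRight θ + e • H + Hx.smulRight d + θ ξ • D) + d.smulRight Hx +
        δ • DH.flip ξ + (2⁻¹ * θ ξ) • (e • d + δ • E').smulRight θ +
        (2⁻¹ * δ * e) • (Hx.smulRight θ + θ ξ • H)) +
      (σ * (σ * Nx ξ)) • NN - (2⁻¹ * (σ * Nx η)) • θ.smulRight θ -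
      (σ * σ) • Nx.smulRight Nx + (2⁻¹ * θ ξ * σ) • Ny.smulRight θ + (h * σ) • NN -
      (2⁻¹ * a7) • θ.smulRight θ - (2⁻¹ : ℝ) • θ.smulRight Hy + (2⁻¹ * e) • H -
      (2⁻¹ * e) • ((σ * θ ξ) • NN - (2⁻¹ * e) • θ.smulRight θ) +
      (2⁻¹ : ℝ) • θ.smulRight ((θ ξ * σ) • Ny - (2⁻¹ * e ^ 2) • θ) -
      σ • ((2⁻¹ : ℝ) • (Hy.smulRight θ + Hx.smulRight d) + δ • K + (2⁻¹ * δ * e) • Hx.smulRight θ) +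
      (2⁻¹ : ℝ) • Dx.smulRight θ := by
    ext w z
    simp only [hT, hA, hA', hN, hN', hσ', he', add_apply, sub_apply, smul_apply, smul_eq_mul,
      ContinuousLinearMap.smulRight_apply, hNN, hNx, hNy, hS', hE', kx, ky, kd, hdξ, hθη, iθ, iη,
      hK, ContinuousLinearMap.comp_apply, ContinuousLinearMap.flip_apply, ← hHx, ← hHy, ← hDx, kyx]
    ring
  have jx : Hx (G.inverse Hx) = (lapseScalars G θ H DH).a2 := by
    simp [lapseScalars, ← hξ, hHx]
  -- The trace for the perturbed metric is the trace for `G` minus a multiple of `T(ξ, ξ)`.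
  rw [traceWith_rankOne hG hs θ (by rwa [← hξ]), ← hξ]
  rw [hTT]
  simp only [traceWith_add, traceWith_sub, traceWith_smul, traceWith_smulRight, map_add, map_smul,
    map_sub, iθ, iη, ← hξ, ← hη, hNN, hNx, hNy, hS', hE', add_apply, sub_apply, smul_apply,
    smul_eq_mul, hdξ, hθη, kyx, ContinuousLinearMap.smulRight_apply, jx, ← hHx, ← hDx,
    ← hh, ← ha7]
  have hK0 : K ξ ξ = (lapseScalars G θ H DH).a2 := by
    simp [lapseScalars, ← hξ, hHx, hK, kx]
  have hf : (DH.flip ξ) ξ ξ = DH ξ ξ ξ := rfl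
  have e1 : (lapseScalars G θ H DH).u = θ ξ := by rw [hξ]; rfl
  have e2 : (lapseScalars G θ H DH).h = h := hh.symm
  have e3 : (lapseScalars G θ H DH).a1 = Hx ξ := by rw [hHx, hξ]; rfl
  have e4 : (lapseScalars G θ H DH).a3 = traceWith G K := rfl
  have e5 : (lapseScalars G θ H DH).a4 = traceWith G (DH ξ) := by rw [hξ]; rfl
  have e6 : (lapseScalars G θ H DH).a5 = DH ξ ξ ξ := by rw [hξ]; rfl
  have e7 : (lapseScalars G θ H DH).a6 = traceWith G (DH.flip ξ) := by rw [hξ]; rfl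
  rw [hK0, hf]
  simp only [LapseScalars.variation, LapseScalars.zeroth, LapseScalars.lapU, LapseScalars.gradU,
    LapseScalars.tau, e1, e2, e3, e4, e5, e6, e7]
  rw [hσ]
  clear_value Hx Hy Dx K S' E' NN Nx Ny
  -- What is left is an identity of rational functions of independent scalars, with denominators `u`
  -- and `1 + δ u`.
  generalize (lapseScalars G θ H DH).a2 = a2
  generalize traceWith G (DH.flip ξ) = a6
  generalize traceWith G (DH ξ) = a4
  generalize DH ξ ξ ξ = a5
  generalize traceWith G K = a3
  generalize Hx ξ = a1 at *
  generalize Hx η = r at *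
  generalize Dx ξ = a8 at *
  generalize θ ξ = u at *
  generalize d η = p at *
  clear * - hu hδ
  field_simp
  ring

end TraceAlgebra

set_option linter.unusedSectionVars false

lemma _root_.HasFDerivAt.apply_const {X Y Z : Type*} [NormedAddCommGroup X] [NormedSpace ℝ X]
    [NormedAddCommGroup Y] [NormedSpace ℝ Y] [NormedAddCommGroup Z] [NormedSpace ℝ Z]
    {f : X → Y →L[ℝ] Z} {f' : X →L[ℝ] Y →L[ℝ] Z} {x : X} (hf : HasFDerivAt f f' x) (y : Y) :
    HasFDerivAt (fun x => f x y) (f'.flip y) x := by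
  simpa using hf.clm_apply (hasFDerivAt_const y x)

/-! ### The Christoffel symbols of `G + δ dt²`. -/

section Perturbation

variable {V : Type*} [NormedAddCommGroup V] [NormedSpace ℝ V] [FiniteDimensional ℝ V]
  {G : V → V →L[ℝ] V →L[ℝ] ℝ} {t δ : V → ℝ} {u : V}

/-- The metric `G + δ dt²`. -/
def addSq (G : V → V →L[ℝ] V →L[ℝ] ℝ) (t δ : V → ℝ) (y : V) : V →L[ℝ] V →L[ℝ] ℝ :=
  G y + δ y • (fderiv ℝ t y).smulRight (fderiv ℝ t y)

/-- The Hessian of `t` with respect to `G`. -/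
def hess (G : V → V →L[ℝ] V →L[ℝ] ℝ) (t : V → ℝ) : V → V →L[ℝ] V →L[ℝ] ℝ :=
  nablaCovector (christoffel G) (fderiv ℝ t)

/-- The gradient of `t` with respect to `G`. -/
def grad (G : V → V →L[ℝ] V →L[ℝ] ℝ) (t : V → ℝ) : V → V := sharp G (fderiv ℝ t)

/-- `t` is a function of class `C³` and `δ` a function of class `C²` for which `G + δ dt²` is again
a nondegenerate metric. -/
structure IsPerturbationAt (G : V → V →L[ℝ] V →L[ℝ] ℝ) (t δ : V → ℝ) (u : V) : Prop where
  metric : IsMetricAt G u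
  contDiffAt_fun : ContDiffAt ℝ 3 t u
  contDiffAt_coeff : ContDiffAt ℝ 2 δ u
  nondegenerate : 1 + δ u * fderiv ℝ t u (grad G t u) ≠ 0

lemma IsMetricAt.contDiffAt_hess (h : IsMetricAt G u) {m n : ℕ∞ω} (ht : ContDiffAt ℝ n t u)
    (hm : m ≤ 1) (hmn : m + 2 ≤ n) : ContDiffAt ℝ m (hess G t) u := by
  have := FiniteDimensional.complete ℝ V
  have h2 : ContDiffAt ℝ (m + 1) (fderiv ℝ t) u :=
    ht.fderiv_right (by rw [add_assoc, one_add_one_eq_two]; exact hmn)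
  have h3 : ContDiffAt ℝ m (christoffel G) u :=
    contDiffAt_christoffel h.contDiffAt (by rw [← one_add_one_eq_two]; gcongr) h.invertible
  refine (h2.fderiv_right le_rfl).sub (ContDiffAt.clm_comp ?_ h3)
  exact (ContinuousLinearMap.contDiff _).contDiffAt.comp u (h2.of_le (by simp))

lemma hess_symm (h : IsMetricAt G u) (ht : ContDiffAt ℝ 2 t u) (v w : V) :
    hess G t u v w = hess G t u w v :=
  h.nablaCovector_symm (fun v w => (ht.isSymmSndFDerivAt (by simp)).eq v w) v w

lemma hess_apply (v w : V) :
    hess G t u v w = fderiv ℝ (fderiv ℝ t) u v w - fderiv ℝ t u (christoffel G u v w) :=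
  nablaCovector_apply _ _ _

lemma IsMetricAt.contDiffAt_grad (h : IsMetricAt G u) (ht : ContDiffAt ℝ 3 t u) :
    ContDiffAt ℝ 2 (grad G t) u := by
  have := FiniteDimensional.complete ℝ V
  exact contDiffAt_sharp h.contDiffAt h.invertible (ht.fderiv_right (by norm_num))

lemma IsMetricAt.apply_nablaVector_grad (h : IsMetricAt G u) (ht : ContDiffAt ℝ 2 t u) (v w : V) :
    G u (nablaVector (christoffel G) (grad G t) u v) w = hess G t u v w := by
  have := FiniteDimensional.complete ℝ V
  exact h.apply_nablaVector_sharp ((ht.fderiv_right (m := 1) (by norm_num)).differentiableAt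
    (by norm_num)) v w

lemma IsMetricAt.nablaVector_grad (h : IsMetricAt G u) (ht : ContDiffAt ℝ 2 t u) :
    nablaVector (christoffel G) (grad G t) u = (G u).inverse.comp (hess G t u) := by
  ext v
  apply h.invertible.injective
  ext w
  rw [h.apply_nablaVector_grad ht]
  simp [h.invertible.self_apply_inverse]

/-- The Ricci curvature in the direction of a gradient. -/
lemma IsMetricAt.ricci_grad (h : IsMetricAt G u) (ht : ContDiffAt ℝ 3 t u) :
    ricci G u (grad G t u) (grad G t u) =
      traceWith (G u) ((nablaBilin (christoffel G) (hess G t) u).flip (grad G t u)) -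
      traceWith (G u) (nablaBilin (christoffel G) (hess G t) u (grad G t u)) := by
  have := FiniteDimensional.complete ℝ V
  have hS : ContDiffAt ℝ 1 (nablaVector (christoffel G) (grad G t)) u := by
    have h3 : ContDiffAt ℝ 1 (christoffel G) u :=
      contDiffAt_christoffel h.contDiffAt (by norm_num) h.invertible
    have h4 := h.contDiffAt_grad ht
    refine (h4.fderiv_right (by norm_num)).add (ContDiffAt.clm_apply ?_ (h4.of_le (by norm_num)))
    exact (ContinuousLinearMap.flipₗᵢ ℝ V V V).toContinuousLinearEquiv.contDiff.contDiffAt.comp u h3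
  have hB := (h.contDiffAt_hess (m := 1) ht le_rfl (by norm_num)).differentiableAt (by norm_num)
  have key := h.apply_nablaEnd (hS.differentiableAt (by norm_num)) hB (by
    filter_upwards [h.eventually, ht.eventually (by simp)] with y a b v w
    exact a.apply_nablaVector_grad (b.of_le (by norm_num)) v w)
  have e : ∀ v w, nablaEnd (christoffel G) (nablaVector (christoffel G) (grad G t)) u v w =
      (G u).inverse (nablaBilin (christoffel G) (hess G t) u v w) := by
    intro v w
    apply h.invertible.injective
    ext z
    rw [key, h.invertible.self_apply_inverse]
  unfold traceWith
  rw [← map_sub]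
  simp only [ricci, LinearMap.mk₂_apply]
  congr 1
  ext v
  -- The Ricci identity for the gradient field, contracted over `v`: the two orders of
  -- differentiation give the two traces of `∇ Hess t`.
  have := h.curvatureEnd_apply_field (h.contDiffAt_grad ht) v (grad G t u)
  simp [this, e]

namespace IsPerturbationAt

protected lemma eventually (h : IsPerturbationAt G t δ u) :
    ∀ᶠ y in 𝓝 u, IsPerturbationAt G t δ y := by
  have := FiniteDimensional.complete ℝ V
  have hc : ContinuousAt (fun y => 1 + δ y * fderiv ℝ t y (grad G t y)) u := by
    have a := h.contDiffAt_coeff.continuousAt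
    have b := (h.contDiffAt_fun.fderiv_right (m := 2) (by norm_num)).continuousAt
    have c := (h.metric.contDiffAt_grad h.contDiffAt_fun).continuousAt
    exact continuousAt_const.add (a.mul (b.clm_apply c))
  filter_upwards [h.metric.eventually, h.contDiffAt_fun.eventually (by simp),
    h.contDiffAt_coeff.eventually (by simp), hc.eventually_ne h.nondegenerate] with y a b c d
  exact ⟨a, b, c, d⟩

lemma isMetricAt (h : IsPerturbationAt G t δ u) : IsMetricAt (addSq G t δ) u := by
  have := FiniteDimensional.complete ℝ V
  have h2 : ContDiffAt ℝ 2 (fderiv ℝ t) u := h.contDiffAt_fun.fderiv_right (by norm_num)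
  refine ⟨h.metric.contDiffAt.add (h.contDiffAt_coeff.smul (h2.smulRight h2)),
    (rankOne_perturbation h.metric.invertible h.metric.symm _ h.nondegenerate).1, ?_⟩
  filter_upwards [h.metric.eventually_symm] with y hy v w
  simp [addSq, hy v w, mul_comm]

/-- The bilinear form describing the `ξ`-component of the change of the Christoffel symbols. -/
def changeForm (G : V → V →L[ℝ] V →L[ℝ] ℝ) (t δ : V → ℝ) (y : V) : V →L[ℝ] V →L[ℝ] ℝ :=
  (1 + δ y * fderiv ℝ t y (grad G t y))⁻¹ •
    ((2⁻¹ : ℝ) • ((fderiv ℝ δ y).smulRight (fderiv ℝ t y) +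
      (fderiv ℝ t y).smulRight (fderiv ℝ δ y)) + δ y • hess G t y +
      (2⁻¹ * δ y * fderiv ℝ δ y (grad G t y)) • (fderiv ℝ t y).smulRight (fderiv ℝ t y))

/-- The change of the Christoffel symbols. -/
lemma christoffel_addSq (h : IsPerturbationAt G t δ u) (v w : V) :
    christoffel (addSq G t δ) u v w = christoffel G u v w + changeForm G t δ u v w • grad G t u -
      (2⁻¹ * fderiv ℝ t u v * fderiv ℝ t u w) • grad G δ u := by
  have := FiniteDimensional.complete ℝ V
  have h2 : ContDiffAt ℝ 2 (fderiv ℝ t) u := h.contDiffAt_fun.fderiv_right (by norm_num)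
  have h1 : HasFDerivAt (fderiv ℝ t) (fderiv ℝ (fderiv ℝ t) u) u :=
    (h2.differentiableAt (by norm_num)).hasFDerivAt
  have hd : HasFDerivAt δ (fderiv ℝ δ u) u :=
    (h.contDiffAt_coeff.differentiableAt (by norm_num)).hasFDerivAt
  have hs : ∀ a b, fderiv ℝ (fderiv ℝ t) u a b = fderiv ℝ (fderiv ℝ t) u b a := fun a b =>
    (h.contDiffAt_fun.isSymmSndFDerivAt (by simp; norm_num)).eq a b
  have key : ∀ a b c, fderiv ℝ (addSq G t δ) u a b c = fderiv ℝ G u a b c +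
      fderiv ℝ δ u a * fderiv ℝ t u b * fderiv ℝ t u c +
      δ u * (fderiv ℝ (fderiv ℝ t) u a b * fderiv ℝ t u c +
        fderiv ℝ t u b * fderiv ℝ (fderiv ℝ t) u a c) := by
    intro a b c
    have hG := (h.metric.differentiableAt.hasFDerivAt.clm_apply (hasFDerivAt_const b u)).clm_apply
      (hasFDerivAt_const c u)
    have := hG.add (hd.mul ((h1.clm_apply (hasFDerivAt_const b u)).mul
      (h1.clm_apply (hasFDerivAt_const c u))))
    rw [fderiv_apply_apply h.isMetricAt.differentiableAt]
    have e : (fun y => addSq G t δ y b c) = fun y => G y b c +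
        δ y * (fderiv ℝ t y b * fderiv ℝ t y c) := by
      ext y; simp [addSq]
    rw [e]
    refine (congrArg (fun L => L a) this.fderiv).trans ?_
    simp
    ring
  -- The claimed vector is tested after lowering its index with the new metric. The factor `1 / (1 +
  -- δ u)` in `changeForm` compensates `δ dt²` applied to `grad t`, and the summand `½ δ dδ(ξ) dt²`
  -- compensates `δ dt²` applied to `grad δ`.
  apply h.isMetricAt.invertible.injective
  ext z
  rw [christoffel_koszul h.isMetricAt.invertible, key, key, key, hs w v, hs z v, hs z w]
  have hne := h.nondegenerate
  have k := christoffel_koszul h.metric.invertible v w z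
  have hx : ∀ z, G u (grad G t u) z = fderiv ℝ t u z := h.metric.apply_sharp _
  have hy : ∀ z, G u (grad G δ u) z = fderiv ℝ δ u z := h.metric.apply_sharp _
  have hxy : fderiv ℝ t u (grad G δ u) = fderiv ℝ δ u (grad G t u) := by
    rw [← hx, ← hy, h.metric.symm]
  simp only [addSq, map_add, map_sub, add_apply, sub_apply, map_smul, smul_apply, k, hx, hy,
    ContinuousLinearMap.smulRight_apply, smul_eq_mul, changeForm, hess_apply, hxy]
  field_simp
  ring

lemma contDiffAt_changeForm (h : IsPerturbationAt G t δ u) :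
    ContDiffAt ℝ 1 (changeForm G t δ) u := by
  have h2 : ContDiffAt ℝ 1 (fderiv ℝ t) u := h.contDiffAt_fun.fderiv_right (by norm_num)
  have hd : ContDiffAt ℝ 1 (fderiv ℝ δ) u := h.contDiffAt_coeff.fderiv_right (by norm_num)
  have h0 : ContDiffAt ℝ 1 δ u := h.contDiffAt_coeff.of_le (by norm_num)
  have hH := h.metric.contDiffAt_hess (m := 1) h.contDiffAt_fun le_rfl (by norm_num)
  have hg : ContDiffAt ℝ 1 (grad G t) u :=
    (h.metric.contDiffAt_grad h.contDiffAt_fun).of_le (by norm_num)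
  have k1 : ContDiffAt ℝ 1 (fun y => (1 + δ y * fderiv ℝ t y (grad G t y))⁻¹) u :=
    (contDiffAt_const.add (h0.mul (h2.clm_apply hg))).inv h.nondegenerate
  have k2 : ContDiffAt ℝ 1 (fun y => (2⁻¹ : ℝ) • ((fderiv ℝ δ y).smulRight (fderiv ℝ t y) +
      (fderiv ℝ t y).smulRight (fderiv ℝ δ y))) u :=
    ((hd.smulRight h2).add (h2.smulRight hd)).const_smul _
  have k3 : ContDiffAt ℝ 1 (fun y => δ y • hess G t y) u := h0.smul hH
  have k4 : ContDiffAt ℝ 1 (fun y => 2⁻¹ * δ y * fderiv ℝ δ y (grad G t y)) u :=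
    (contDiffAt_const.mul h0).mul (hd.clm_apply hg)
  have k5 : ContDiffAt ℝ 1 (fun y => (fderiv ℝ t y).smulRight (fderiv ℝ t y)) u := h2.smulRight h2
  exact k1.smul ((k2.add k3).add (k4.smul k5))

/-- The covariant derivative of `changeForm`. -/
lemma nablaBilin_changeForm (h : IsPerturbationAt G t δ u) {σ : ℝ}
    (hσ : σ = 1 / (1 + δ u * fderiv ℝ t u (grad G t u))) (v w z : V) :
    nablaBilin (christoffel G) (changeForm G t δ) u v w z =
      (-σ ^ 2 * (fderiv ℝ t u (grad G t u) * fderiv ℝ δ u v +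
        2 * δ u * hess G t u v (grad G t u))) *
      (2⁻¹ * (fderiv ℝ δ u w * fderiv ℝ t u z + fderiv ℝ t u w * fderiv ℝ δ u z) +
        δ u * hess G t u w z +
        2⁻¹ * δ u * fderiv ℝ δ u (grad G t u) * fderiv ℝ t u w * fderiv ℝ t u z) +
      σ * (2⁻¹ * (hess G δ u v w * fderiv ℝ t u z + fderiv ℝ δ u w * hess G t u v z +
          hess G t u v w * fderiv ℝ δ u z + fderiv ℝ t u w * hess G δ u v z) +
        fderiv ℝ δ u v * hess G t u w z +
        δ u * nablaBilin (christoffel G) (hess G t) u v w z +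
        2⁻¹ * (fderiv ℝ δ u v * fderiv ℝ δ u (grad G t u) +
          δ u * (hess G δ u v (grad G t u) + hess G t u v (grad G δ u))) *
          fderiv ℝ t u w * fderiv ℝ t u z +
        2⁻¹ * δ u * fderiv ℝ δ u (grad G t u) *
          (hess G t u v w * fderiv ℝ t u z + fderiv ℝ t u w * hess G t u v z)) := by
  have h1 : HasFDerivAt (fderiv ℝ t) (fderiv ℝ (fderiv ℝ t) u) u :=
    ((h.contDiffAt_fun.fderiv_right (m := 2) (by norm_num)).differentiableAt
      (by norm_num)).hasFDerivAt
  have hd : HasFDerivAt (fderiv ℝ δ) (fderiv ℝ (fderiv ℝ δ) u) u :=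
    ((h.contDiffAt_coeff.fderiv_right (m := 1) (by norm_num)).differentiableAt
      (by norm_num)).hasFDerivAt
  have h0 : HasFDerivAt δ (fderiv ℝ δ u) u :=
    (h.contDiffAt_coeff.differentiableAt (by norm_num)).hasFDerivAt
  have hH : HasFDerivAt (hess G t) (fderiv ℝ (hess G t) u) u :=
    ((h.metric.contDiffAt_hess (m := 1) h.contDiffAt_fun le_rfl
      (by norm_num)).differentiableAt (by norm_num)).hasFDerivAt
  have hg : HasFDerivAt (grad G t) (fderiv ℝ (grad G t) u) u :=
    ((h.metric.contDiffAt_grad h.contDiffAt_fun).differentiableAt (by norm_num)).hasFDerivAt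
  have hdiff := h.contDiffAt_changeForm.differentiableAt (by norm_num)
  have hu := h1.clm_apply hg
  have he := hd.clm_apply hg
  have hσ' := (hasDerivAt_inv h.nondegenerate).comp_hasFDerivAt u ((h0.mul hu).const_add 1)
  have hN := ((((hd.apply_const w).mul (h1.apply_const z)).add ((h1.apply_const w).mul (hd.apply_const z))).const_mul (2⁻¹ : ℝ)).add
    (h0.mul ((hH.apply_const w).apply_const z)) |>.add
    (((((h0.const_mul (2⁻¹ : ℝ)).mul he)).mul (h1.apply_const w)).mul (h1.apply_const z))
  have hA := hσ'.mul hN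
  have hA' := hA.congr_of_eventuallyEq (f₁ := fun y => changeForm G t δ y w z)
    (Eventually.of_forall fun y => by simp [changeForm]; ring)
  have hx : ∀ z, G u (grad G t u) z = fderiv ℝ t u z := h.metric.apply_sharp _
  have hy : ∀ z, G u (grad G δ u) z = fderiv ℝ δ u z := h.metric.apply_sharp _
  -- Coordinate derivatives are traded for covariant ones; the Christoffel terms then cancel, as
  -- both sides are tensors.
  have hgv : fderiv ℝ (grad G t) u v = nablaVector (christoffel G) (grad G t) u v -
      christoffel G u v (grad G t u) := by rw [nablaVector_apply]; abel
  have ht2 : ContDiffAt ℝ 2 t u := h.contDiffAt_fun.of_le (by norm_num)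
  have n1 : fderiv ℝ t u (nablaVector (christoffel G) (grad G t) u v) =
      hess G t u v (grad G t u) := by
    rw [← hx, h.metric.symm, h.metric.apply_nablaVector_grad ht2]
  have n2 : fderiv ℝ δ u (nablaVector (christoffel G) (grad G t) u v) =
      hess G t u v (grad G δ u) := by
    rw [← hy, h.metric.symm, h.metric.apply_nablaVector_grad ht2]
  have m1 : ∀ a b, fderiv ℝ (fderiv ℝ t) u a b = hess G t u a b +
    fderiv ℝ t u (christoffel G u a b) := fun a b => by rw [hess_apply]; ring
  have m2 : ∀ a b, fderiv ℝ (fderiv ℝ δ) u a b = hess G δ u a b +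
    fderiv ℝ δ u (christoffel G u a b) := fun a b => by rw [hess_apply]; ring
  have m3 : ∀ a b c, fderiv ℝ (hess G t) u a b c = nablaBilin (christoffel G) (hess G t) u a b c +
    hess G t u (christoffel G u a b) c + hess G t u b (christoffel G u a c) := fun a b c => by
      rw [nablaBilin_apply]; ring
  have hσi : (1 + δ u * fderiv ℝ t u (grad G t u))⁻¹ = σ := by rw [hσ, one_div]
  have hσ2 : ((1 + δ u * fderiv ℝ t u (grad G t u)) ^ 2)⁻¹ = σ ^ 2 := by rw [← hσi, inv_pow]
  rw [nablaBilin_apply, fderiv_apply_apply hdiff, hA'.fderiv]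
  simp only [changeForm, add_apply, smul_apply, ContinuousLinearMap.comp_apply,
    Pi.mul_apply, Pi.add_apply, Function.comp_apply,
    ContinuousLinearMap.flip_apply, ContinuousLinearMap.smulRight_apply, smul_eq_mul, map_sub,
    hgv, n1, n2, m1, m2, m3, hσi, hσ2]
  ring

end IsPerturbationAt

end Perturbation

set_option linter.unusedSectionVars false

/-! ### The curvature of `G + δ dt²` and the exact formula for its scalar curvature. -/

section Perturbation

variable {V : Type*} [NormedAddCommGroup V] [NormedSpace ℝ V] [FiniteDimensional ℝ V]
  {G : V → V →L[ℝ] V →L[ℝ] ℝ} {t δ : V → ℝ} {u : V}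

namespace IsPerturbationAt

/-- The change of the curvature. -/
lemma curvatureEnd_addSq (h : IsPerturbationAt G t δ u) (w z : V) :
    curvatureEnd (christoffel (addSq G t δ)) u w z = curvatureEnd (christoffel G) u w z +
      ((((nablaBilin (christoffel G) (changeForm G t δ) u).flip w).flip z -
        (nablaBilin (christoffel G) (changeForm G t δ) u w).flip z +
        (changeForm G t δ u w z • (changeForm G t δ u).flip (grad G t u) -
          (2⁻¹ * fderiv ℝ t u w * fderiv ℝ t u z) • (changeForm G t δ u).flip (grad G δ u)) -
        changeForm G t δ u w (grad G t u) • (changeForm G t δ u).flip z +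
        (2⁻¹ * fderiv ℝ t u z * changeForm G t δ u w (grad G δ u)) • fderiv ℝ t u).smulRight
          (grad G t u) +
      changeForm G t δ u w z • nablaVector (christoffel G) (grad G t) u -
      (2⁻¹ * fderiv ℝ t u w * fderiv ℝ t u z) • nablaVector (christoffel G) (grad G δ) u +
      (-(2⁻¹ * fderiv ℝ t u w) • (hess G t u).flip z + (2⁻¹ * hess G t u w z) • fderiv ℝ t u -
        (2⁻¹ * (changeForm G t δ u w z * fderiv ℝ t u (grad G t u) -
          2⁻¹ * fderiv ℝ t u w * fderiv ℝ t u z * fderiv ℝ δ u (grad G t u))) • fderiv ℝ t u +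
        (2⁻¹ * fderiv ℝ t u w) • (fderiv ℝ t u (grad G t u) • (changeForm G t δ u).flip z -
          (2⁻¹ * fderiv ℝ t u z * fderiv ℝ δ u (grad G t u)) • fderiv ℝ t u)).smulRight
          (grad G δ u) -
      ((changeForm G t δ u).flip z).smulRight
        (nablaVector (christoffel G) (grad G t) u w) +
      ((2⁻¹ * fderiv ℝ t u z) • fderiv ℝ t u).smulRight
        (nablaVector (christoffel G) (grad G δ) u w)) := by
  have := FiniteDimensional.complete ℝ V
  have h1 : HasFDerivAt (fderiv ℝ t) (fderiv ℝ (fderiv ℝ t) u) u :=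
    ((h.contDiffAt_fun.fderiv_right (m := 2) (by norm_num)).differentiableAt
      (by norm_num)).hasFDerivAt
  have hA : HasFDerivAt (changeForm G t δ) (fderiv ℝ (changeForm G t δ) u) u :=
    (h.contDiffAt_changeForm.differentiableAt (by norm_num)).hasFDerivAt
  have hξ : HasFDerivAt (grad G t) (fderiv ℝ (grad G t) u) u :=
    ((h.metric.contDiffAt_grad h.contDiffAt_fun).differentiableAt (by norm_num)).hasFDerivAt
  have hη : HasFDerivAt (grad G δ) (fderiv ℝ (grad G δ) u) u :=
    ((contDiffAt_sharp (n := 1) (h.metric.contDiffAt.of_le (by norm_num)) h.metric.invertible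
      (h.contDiffAt_coeff.fderiv_right (by norm_num))).differentiableAt (by norm_num)).hasFDerivAt
  have hΓ : HasFDerivAt (christoffel G) (fderiv ℝ (christoffel G) u) u :=
    ((contDiffAt_christoffel h.metric.contDiffAt (m := 1) (by norm_num)
      h.metric.invertible).differentiableAt (by norm_num)).hasFDerivAt
  have hΓ' : HasFDerivAt (christoffel (addSq G t δ)) (fderiv ℝ (christoffel (addSq G t δ)) u) u :=
    ((contDiffAt_christoffel h.isMetricAt.contDiffAt (m := 1) (by norm_num)
      h.isMetricAt.invertible).differentiableAt (by norm_num)).hasFDerivAt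
  have ev := h.eventually
  -- The formula for the new Christoffel symbols holds in a neighbourhood and may be differentiated.
  have key : ∀ a b c, fderiv ℝ (christoffel (addSq G t δ)) u a b c =
      fderiv ℝ (christoffel G) u a b c + (fderiv ℝ (changeForm G t δ) u a b c • grad G t u +
        changeForm G t δ u b c • fderiv ℝ (grad G t) u a) -
      ((2⁻¹ * (fderiv ℝ (fderiv ℝ t) u a b * fderiv ℝ t u c +
        fderiv ℝ t u b * fderiv ℝ (fderiv ℝ t) u a c)) • grad G δ u +
        (2⁻¹ * fderiv ℝ t u b * fderiv ℝ t u c) • fderiv ℝ (grad G δ) u a) := by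
    intro a b c
    have l := (hΓ'.apply_const b).apply_const c
    have r := (((hΓ.apply_const b).apply_const c).add
      (((hA.apply_const b).apply_const c).smul hξ)).sub
      ((((h1.apply_const b).const_mul (2⁻¹ : ℝ)).mul (h1.apply_const c)).smul hη)
    have e := l.unique (r.congr_of_eventuallyEq (ev.mono fun y hy => by
      simpa using hy.christoffel_addSq b c))
    have := congrArg (fun L => L a) e
    simp only [ContinuousLinearMap.flip_apply, add_apply, sub_apply, smul_apply,
      ContinuousLinearMap.smulRight_apply, smul_eq_mul] at this
    rw [this]
    simp only [Pi.mul_apply]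
    module
  have hx : ∀ z, G u (grad G t u) z = fderiv ℝ t u z := h.metric.apply_sharp _
  have hy : ∀ z, G u (grad G δ u) z = fderiv ℝ δ u z := h.metric.apply_sharp _
  have hxy : fderiv ℝ t u (grad G δ u) = fderiv ℝ δ u (grad G t u) := by
    rw [← hx, ← hy, h.metric.symm]
  have hs := hess_symm h.metric (h.contDiffAt_fun.of_le (by norm_num) : ContDiffAt ℝ 2 t u)
  have m1 : ∀ a b, fderiv ℝ (fderiv ℝ t) u a b = hess G t u a b +
    fderiv ℝ t u (christoffel G u a b) := fun a b => by rw [hess_apply]; ring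
  ext v
  simp only [curvatureEnd, add_apply, sub_apply, ContinuousLinearMap.flip_apply,
    ContinuousLinearMap.comp_apply, key, h.christoffel_addSq, smul_apply,
    ContinuousLinearMap.smulRight_apply, smul_eq_mul, nablaBilin_apply, nablaVector_apply,
    map_add, map_sub, map_smul, hxy, m1, hs w v, h.metric.christoffel_symm w v]
  module

/-- The change of the Ricci curvature. -/
lemma ricci_addSq (h : IsPerturbationAt G t δ u) (w z : V) :
    ricci (addSq G t δ) u w z = ricci G u w z +
      (nablaBilin (christoffel G) (changeForm G t δ) u (grad G t u) w z -
      nablaBilin (christoffel G) (changeForm G t δ) u w (grad G t u) z +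
      (changeForm G t δ u w z * changeForm G t δ u (grad G t u) (grad G t u) -
        2⁻¹ * fderiv ℝ t u w * fderiv ℝ t u z * changeForm G t δ u (grad G t u) (grad G δ u)) -
      changeForm G t δ u w (grad G t u) * changeForm G t δ u (grad G t u) z +
      2⁻¹ * fderiv ℝ t u z * fderiv ℝ t u (grad G t u) * changeForm G t δ u w (grad G δ u) +
      changeForm G t δ u w z * traceWith (G u) (hess G t u) -
      2⁻¹ * fderiv ℝ t u w * fderiv ℝ t u z * traceWith (G u) (hess G δ u) -
      2⁻¹ * fderiv ℝ t u w * hess G t u (grad G δ u) z +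
      2⁻¹ * hess G t u w z * fderiv ℝ δ u (grad G t u) -
      2⁻¹ * (changeForm G t δ u w z * fderiv ℝ t u (grad G t u) -
          2⁻¹ * fderiv ℝ t u w * fderiv ℝ t u z * fderiv ℝ δ u (grad G t u)) *
            fderiv ℝ δ u (grad G t u) +
      2⁻¹ * fderiv ℝ t u w * (fderiv ℝ t u (grad G t u) * changeForm G t δ u (grad G δ u) z -
          2⁻¹ * fderiv ℝ t u z * fderiv ℝ δ u (grad G t u) ^ 2) -
      changeForm G t δ u ((G u).inverse (hess G t u w)) z +
      2⁻¹ * fderiv ℝ t u z * hess G δ u w (grad G t u)) := by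
  have := FiniteDimensional.complete ℝ V
  have ht2 : ContDiffAt ℝ 2 t u := h.contDiffAt_fun.of_le (by norm_num)
  have hx : ∀ z, G u (grad G t u) z = fderiv ℝ t u z := h.metric.apply_sharp _
  have hy : ∀ z, G u (grad G δ u) z = fderiv ℝ δ u z := h.metric.apply_sharp _
  have hxy : fderiv ℝ t u (grad G δ u) = fderiv ℝ δ u (grad G t u) := by
    rw [← hx, ← hy, h.metric.symm]
  have n1 : fderiv ℝ t u ((G u).inverse (hess G δ u w)) = hess G δ u w (grad G t u) := by
    rw [← hx, h.metric.symm, h.metric.invertible.self_apply_inverse]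
  have tr : ∀ (α : V →L[ℝ] ℝ) (x : V), LinearMap.trace ℝ V
      ((α.smulRight x : V →L[ℝ] V) : V →ₗ[ℝ] V) = α x := fun α x => by
    simp
  have e1 : ∀ s : V → ℝ, LinearMap.trace ℝ V (((G u).inverse ∘L hess G s u : V →L[ℝ] V) :
      V →ₗ[ℝ] V) = traceWith (G u) (hess G s u) := fun s => rfl
  simp only [ricci, LinearMap.mk₂_apply]
  rw [h.curvatureEnd_addSq]
  simp only [ContinuousLinearMap.toLinearMap_add, ContinuousLinearMap.toLinearMap_sub,
    ContinuousLinearMap.toLinearMap_smul,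
    map_add, map_sub, map_smul, tr, h.metric.nablaVector_grad ht2,
    h.metric.nablaVector_grad h.contDiffAt_coeff, add_apply, sub_apply, smul_apply,
    ContinuousLinearMap.flip_apply, ContinuousLinearMap.comp_apply, smul_eq_mul, hxy, n1, e1]
  ring

/-- The exact formula for the change of the scalar curvature under `G ↦ G + δ dt²`. -/
theorem scalarCoord_addSq (h : IsPerturbationAt G t δ u) (hu : fderiv ℝ t u (grad G t u) ≠ 0) :
    scalarCoord (addSq G t δ) u - scalarCoord G u =
      (lapseScalars (G u) (fderiv ℝ t u) (hess G t u)
        (nablaBilin (christoffel G) (hess G t) u)).variation (δ u) (fderiv ℝ δ u (grad G t u))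
        (fderiv ℝ δ u (grad G δ u)) (hess G t u (grad G t u) (grad G δ u))
        (traceWith (G u) (hess G δ u)) (hess G δ u (grad G t u) (grad G t u)) := by
  have ht2 : ContDiffAt ℝ 2 t u := h.contDiffAt_fun.of_le (by norm_num)
  let toBil : (V →ₗ[ℝ] V →ₗ[ℝ] ℝ) → V →L[ℝ] V →L[ℝ] ℝ := fun R =>
    LinearMap.toContinuousLinearMap
      ((LinearMap.toContinuousLinearMap : (V →ₗ[ℝ] ℝ) ≃ₗ[ℝ] (V →L[ℝ] ℝ)).toLinearMap.comp R)
  have hb : ∀ R w z, toBil R w z = R w z := fun R w z => rfl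
  have hS : ∀ K : V → V →L[ℝ] V →L[ℝ] ℝ, scalarCoord K u = traceWith (K u) (toBil (ricci K u)) :=
    fun K => rfl
  have main := traceWith_ricci_change h.metric.invertible h.metric.symm
    (hess_symm h.metric ht2) (hess_symm h.metric h.contDiffAt_coeff)
    (nablaBilin (christoffel G) (hess G t) u) (θ := fderiv ℝ t u) (d := fderiv ℝ δ u)
    (δ := δ u) (ξ := grad G t u) (η := grad G δ u) rfl rfl hu h.nondegenerate
    (A := fun w z => changeForm G t δ u w z) rfl rfl rfl rfl (fun _ _ => rfl)
    (fun w z => by simp [changeForm]; ring) (fun _ => rfl) (fun _ => rfl)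
    (fun _ _ _ => rfl) (A' := fun v w z => nablaBilin (christoffel G) (changeForm G t δ) u v w z)
    (fun v w z => by rw [h.nablaBilin_changeForm rfl])
    (toBil (ricci (addSq G t δ) u) - toBil (ricci G u)) (fun w z => by
      rw [sub_apply, sub_apply, hb, hb, h.ricci_addSq]
      ring)
  rw [hS, hS, ← main, traceWith_sub]
  -- The old Ricci tensor, traced with the new metric, differs from the old scalar curvature by a
  -- multiple of `Ric(ξ, ξ)`. By `ricci_grad` this is the difference of traces of `∇ Hess t` that
  -- was split off in `traceWith_ricci_change`, so no curvature of `G` survives.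
  have e : traceWith (addSq G t δ u) (toBil (ricci G u)) = _ :=
    traceWith_rankOne h.metric.invertible h.metric.symm _ h.nondegenerate _
  have e' := h.metric.ricci_grad h.contDiffAt_fun
  change _ = traceWith (addSq G t δ u) _ - traceWith (addSq G t δ u) _ - _
  rw [e, hb]
  have hg : (G u).inverse (fderiv ℝ t u) = grad G t u := rfl
  rw [hg, e']
  ring

end IsPerturbationAt

end Perturbation

set_option linter.unusedSectionVars false

/-! ### Hessians of one function with respect to two metrics. -/

section Comparison

variable {V : Type*} [NormedAddCommGroup V] [NormedSpace ℝ V] [FiniteDimensional ℝ V]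
  {G G₀ : V → V →L[ℝ] V →L[ℝ] ℝ} {t : V → ℝ} {u : V}

/-- The combination of derivatives in the Koszul formula. -/
def koszul (L : V → V → V → ℝ) (v w z : V) : ℝ := 2⁻¹ * (L v w z + L w v z - L z v w)

/-- The covariant derivative of a trilinear form; the differentiation slot comes first. -/
def nablaTri (Γ : V → V →L[ℝ] V →L[ℝ] V) (L : V → V →L[ℝ] V →L[ℝ] V →L[ℝ] ℝ) (u v w z y : V) : ℝ :=
  fderiv ℝ L u v w z y - L u (Γ u v w) z y - L u w (Γ u v z) y - L u w z (Γ u v y)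

lemma contDiffAt_nablaBilin {Γ : V → V →L[ℝ] V →L[ℝ] V} {B : V → V →L[ℝ] V →L[ℝ] ℝ}
    (hΓ : ContDiffAt ℝ 1 Γ u) (hB : ContDiffAt ℝ 2 B u) : ContDiffAt ℝ 1 (nablaBilin Γ B) u := by
  have hB1 : ContDiffAt ℝ 1 B u := hB.of_le (by norm_num)
  have hf : ContDiffAt ℝ 1 (fun y => (B y).flip) u :=
    (ContinuousLinearMap.flipₗᵢ ℝ V V ℝ).toContinuousLinearEquiv.contDiff.contDiffAt.comp u hB1
  refine ((hB.fderiv_right (by norm_num)).sub (ContDiffAt.clm_comp ?_ hΓ)).sub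
    (contDiffAt_const.clm_comp (ContDiffAt.clm_comp ?_ hΓ))
  · exact (ContinuousLinearMap.contDiff _).contDiffAt.comp u hB1
  · exact (ContinuousLinearMap.contDiff _).contDiffAt.comp u hf

/-- The difference of the Christoffel symbols of two metrics. -/
def diffChristoffel (G G₀ : V → V →L[ℝ] V →L[ℝ] ℝ) (u v w : V) : V :=
  christoffel G u v w - christoffel G₀ u v w

/-- Because `∇⁰ G₀ = 0`, replacing the coordinate derivatives in the Koszul formula of `G` by
covariant ones leaves only `∇⁰ (G - G₀)`. -/
lemma apply_diffChristoffel (h : IsMetricAt G u) (h₀ : IsMetricAt G₀ u) (v w z : V) :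
    G u (diffChristoffel G G₀ u v w) z =
      koszul (fun v w z => nablaBilin (christoffel G₀) (G - G₀) u v w z) v w z := by
  have e : ∀ a b c, fderiv ℝ (G - G₀) u a b c = fderiv ℝ G u a b c - fderiv ℝ G₀ u a b c := by
    intro a b c
    rw [fderiv_sub h.differentiableAt h₀.differentiableAt]; rfl
  rw [diffChristoffel, map_sub, sub_apply, christoffel_koszul h.invertible]
  simp only [koszul, nablaBilin_apply, e, h₀.fderiv_eq, Pi.sub_apply, sub_apply]
  rw [h₀.christoffel_symm w v, h₀.christoffel_symm z v, h₀.christoffel_symm z w,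
    h.symm w (christoffel G₀ u v z), h₀.symm w (christoffel G₀ u v z),
    h.symm v (christoffel G₀ u w z), h₀.symm v (christoffel G₀ u w z)]
  ring

/-- The Hessians differ by `dt` of the difference of the connections, and `dt` is the pairing with
`grad t` in the metric `G`. -/
lemma hess_eq_sub (h : IsMetricAt G u) (h₀ : IsMetricAt G₀ u) (v w : V) :
    hess G t u v w = hess G₀ t u v w -
      koszul (fun v w z => nablaBilin (christoffel G₀) (G - G₀) u v w z) v w (grad G t u) := by
  have hx : ∀ z, G u (grad G t u) z = fderiv ℝ t u z := h.apply_sharp _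
  rw [← apply_diffChristoffel h h₀, h.symm, hx, hess_apply, hess_apply, diffChristoffel, map_sub]
  ring

/-- Obtained by differentiating `hess_eq_sub`, with the change of connection accounted for. It shows
that two covariant derivatives of `G - G₀`, as provided by the weighted estimate, control `∇ Hess
t`. -/
lemma nablaBilin_hess_eq (h : IsMetricAt G u) (h₀ : IsMetricAt G₀ u) (ht : ContDiffAt ℝ 3 t u)
    (v w z : V) :
    nablaBilin (christoffel G) (hess G t) u v w z =
      nablaBilin (christoffel G₀) (hess G₀ t) u v w z -
      koszul (nablaTri (christoffel G₀) (nablaBilin (christoffel G₀) (G - G₀)) u v) w z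
        (grad G t u) -
      koszul (fun v w z => nablaBilin (christoffel G₀) (G - G₀) u v w z) w z
        ((G u).inverse (hess G t u v) - diffChristoffel G G₀ u v (grad G t u)) -
      hess G t u (diffChristoffel G G₀ u v w) z - hess G t u w (diffChristoffel G G₀ u v z) := by
  have := FiniteDimensional.complete ℝ V
  have hL : HasFDerivAt (nablaBilin (christoffel G₀) (G - G₀))
      (fderiv ℝ (nablaBilin (christoffel G₀) (G - G₀)) u) u :=
    ((contDiffAt_nablaBilin (contDiffAt_christoffel h₀.contDiffAt (by norm_num) h₀.invertible)
      (h.contDiffAt.sub h₀.contDiffAt)).differentiableAt (by norm_num)).hasFDerivAt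
  have hH : HasFDerivAt (hess G t) (fderiv ℝ (hess G t) u) u :=
    ((h.contDiffAt_hess (m := 1) ht le_rfl (by norm_num)).differentiableAt
      (by norm_num)).hasFDerivAt
  have hH₀ : HasFDerivAt (hess G₀ t) (fderiv ℝ (hess G₀ t) u) u :=
    ((h₀.contDiffAt_hess (m := 1) ht le_rfl (by norm_num)).differentiableAt
      (by norm_num)).hasFDerivAt
  have hg : HasFDerivAt (grad G t) (fderiv ℝ (grad G t) u) u :=
    ((h.contDiffAt_grad ht).differentiableAt (by norm_num)).hasFDerivAt
  have l := (hH.apply_const w).apply_const z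
  have r := ((hH₀.apply_const w).apply_const z).sub
    (((((hL.apply_const w).apply_const z).clm_apply hg).add
      (((hL.apply_const z).apply_const w).clm_apply hg) |>.sub
      (((hL.clm_apply hg).apply_const w).apply_const z)).const_mul (2⁻¹ : ℝ))
  have e := l.unique (r.congr_of_eventuallyEq (by
    filter_upwards [h.eventually, h₀.eventually] with y a b
    exact hess_eq_sub a b w z))
  have e' := congrArg (fun L => L v) e
  have hgv : fderiv ℝ (grad G t) u v = (G u).inverse (hess G t u v) -
      christoffel G u v (grad G t u) := by
    have := congrArg (fun L => L v) (h.nablaVector_grad (ht.of_le (by norm_num) :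
      ContDiffAt ℝ 2 t u))
    simp only [nablaVector_apply, ContinuousLinearMap.comp_apply] at this
    rw [← this]; abel
  simp only [ContinuousLinearMap.flip_apply, add_apply, sub_apply, smul_apply,
    ContinuousLinearMap.comp_apply, smul_eq_mul, hgv] at e'
  rw [nablaBilin_apply, nablaBilin_apply (hess G₀ t), e']
  simp only [koszul, nablaTri, diffChristoffel, hess_eq_sub (t := t) h h₀, map_sub, sub_apply]
  ring

end Comparison

/-! ### The function `log x` on the warped product `x⁻² dx² + B(x) q`. -/

section Warped

variable {n : ℕ}

/-- The warped product metric `x⁻² dx² + B(x) q`. -/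
def warped (B : ℝ → ℝ) (q : E (n - 1) → E (n - 1) →L[ℝ] E (n - 1) →L[ℝ] ℝ) (w : F n) :
    F n →L[ℝ] F n →L[ℝ] ℝ :=
  (w.1 ^ 2)⁻¹ • dxSq + B w.1 • liftN (q w.2)

/-- The function `log x`. -/
def logFst (w : F n) : ℝ := Real.log w.1

lemma dxSq_apply (v w : F n) : (dxSq : F n →L[ℝ] F n →L[ℝ] ℝ) v w = v.1 * w.1 := by
  simp [dxSq]

lemma liftN_apply (B : E (n - 1) →L[ℝ] E (n - 1) →L[ℝ] ℝ) (v w : F n) :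
    liftN B v w = B v.2 w.2 := by
  simp [liftN]

lemma warped_apply (B : ℝ → ℝ) (q : E (n - 1) → E (n - 1) →L[ℝ] E (n - 1) →L[ℝ] ℝ) (w v v' : F n) :
    warped B q w v v' = (w.1 ^ 2)⁻¹ * (v.1 * v'.1) + B w.1 * q w.2 v.2 v'.2 := by
  simp [warped, dxSq_apply, liftN_apply]

lemma hasFDerivAt_logFst {w : F n} (hw : w.1 ≠ 0) :
    HasFDerivAt (logFst (n := n)) (w.1⁻¹ • ContinuousLinearMap.fst ℝ ℝ (E (n - 1))) w :=
  (Real.hasDerivAt_log hw).comp_hasFDerivAt w hasFDerivAt_fst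

lemma contDiffAt_logFst {w : F n} (hw : w.1 ≠ 0) {m : ℕ∞ω} : ContDiffAt ℝ m (logFst (n := n)) w :=
  (Real.contDiffAt_log.2 hw).comp w contDiffAt_fst

lemma fderiv_logFst {w : F n} (hw : w.1 ≠ 0) (v : F n) : fderiv ℝ logFst w v = w.1⁻¹ * v.1 := by
  rw [(hasFDerivAt_logFst hw).fderiv]; simp

lemma fderiv_fderiv_logFst {w : F n} (hw : w.1 ≠ 0) (v v' : F n) :
    fderiv ℝ (fderiv ℝ logFst) w v v' = -(w.1 ^ 2)⁻¹ * (v.1 * v'.1) := by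
  have hd : DifferentiableAt ℝ (fderiv ℝ (logFst (n := n))) w :=
    ((contDiffAt_logFst hw (m := 2)).fderiv_right (m := 1) (by norm_num)).differentiableAt
      (by norm_num)
  have h1 := hd.hasFDerivAt.apply_const v'
  have h2 : HasFDerivAt (fun y : F n => y.1⁻¹ * v'.1)
      (v'.1 • (-(w.1 ^ 2)⁻¹ • ContinuousLinearMap.fst ℝ ℝ (E (n - 1)))) w :=
    ((hasDerivAt_inv hw).comp_hasFDerivAt w hasFDerivAt_fst).mul_const v'.1
  have hne : ∀ᶠ y : F n in 𝓝 w, y.1 ≠ 0 := continuousAt_fst.eventually_ne hw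
  have := congrArg (fun L => L v) (h1.unique (h2.congr_of_eventuallyEq (hne.mono fun y hy =>
    fderiv_logFst hy v')))
  simp at this
  rw [this]
  ring

variable {B : ℝ → ℝ} {q : E (n - 1) → E (n - 1) →L[ℝ] E (n - 1) →L[ℝ] ℝ} {w : F n}

/-- The assumptions on the data of a warped product metric near `w`. -/
structure IsWarpedAt (B : ℝ → ℝ) (q : E (n - 1) → E (n - 1) →L[ℝ] E (n - 1) →L[ℝ] ℝ) (w : F n) :
    Prop where
  fst_pos : 0 < w.1
  coeff_pos : 0 < B w.1
  coeff_contDiffAt : ContDiffAt ℝ 2 B w.1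
  fibre : IsMetricAt q w.2

namespace IsWarpedAt

protected lemma eventually (h : IsWarpedAt B q w) : ∀ᶠ y in 𝓝 w, IsWarpedAt B q y := by
  have hc : ContinuousAt (fun y : F n => B y.1) w :=
    h.coeff_contDiffAt.continuousAt.comp_of_eq continuousAt_fst rfl
  filter_upwards [continuousAt_fst.eventually (lt_mem_nhds h.fst_pos),
    hc.eventually (lt_mem_nhds h.coeff_pos),
    continuousAt_fst.eventually (h.coeff_contDiffAt.eventually (by simp)),
    continuousAt_snd.eventually h.fibre.eventually] with y a b c d
  exact ⟨a, b, c, d⟩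

lemma isMetricAt (h : IsWarpedAt B q w) : IsMetricAt (warped B q) w := by
  have hs : ∀ y : F n, IsMetricAt q y.2 → ∀ v v', warped B q y v v' = warped B q y v' v := by
    intro y hy v v'
    rw [warped_apply, warped_apply, hy.symm, mul_comm v.1]
  refine ⟨?_, ?_, h.eventually.mono fun y hy => hs y hy.fibre⟩
  · have h1 : ContDiffAt ℝ 2 (fun y : F n => (y.1 ^ 2)⁻¹) w :=
      (contDiffAt_fst.pow 2).inv (pow_ne_zero 2 h.fst_pos.ne')
    have h2 : ContDiffAt ℝ 2 (fun y : F n => B y.1) w :=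
      ContDiffAt.comp w (f := Prod.fst) h.coeff_contDiffAt contDiffAt_fst
    have h3 : ContDiffAt ℝ 2 (fun y : F n => liftN (n := n) (q y.2)) w :=
      contDiffAt_bilinearComp (ContDiffAt.comp w (f := Prod.snd) h.fibre.contDiffAt contDiffAt_snd)
        contDiffAt_const contDiffAt_const
    exact (h1.smul contDiffAt_const).add (h2.smul h3)
  · have hinj : Function.Injective (warped B q w) := by
      rw [injective_iff_map_eq_zero]
      intro v hv
      have hv' : ∀ v', warped B q w v v' = 0 := fun v' => by rw [hv]; rfl
      have h1 : v.1 = 0 := by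
        have := hv' (1, 0)
        simp [warped_apply, h.fst_pos.ne'] at this
        exact this
      have h2 : v.2 = 0 := by
        apply h.fibre.invertible.injective
        ext z
        have := hv' (0, z)
        simp [warped_apply, h.coeff_pos.ne'] at this
        simpa using this
      exact Prod.ext h1 h2
    have hd : Module.finrank ℝ (F n) = Module.finrank ℝ (F n →L[ℝ] ℝ) := by
      rw [← LinearMap.toContinuousLinearMap.finrank_eq, Module.finrank_linearMap_self]
    exact ⟨(LinearEquiv.ofInjectiveOfFinrankEq
      ((warped B q w : F n →L[ℝ] F n →L[ℝ] ℝ) : F n →ₗ[ℝ] F n →L[ℝ] ℝ) hinj hd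
        ).toContinuousLinearEquiv, by ext <;> rfl⟩

/-- The gradient is `x ∂_x`, of length one, since the radial part of the metric is `(d log x)²`. -/
lemma grad_logFst (h : IsWarpedAt B q w) : grad (warped B q) logFst w = (w.1, 0) := by
  unfold grad sharp
  rw [h.isMetricAt.invertible.inverse_apply_eq]
  ext v
  · simp [warped_apply, fderiv_logFst h.fst_pos.ne']
    have := h.fst_pos.ne'
    field_simp
  · simp [warped_apply, fderiv_logFst h.fst_pos.ne']

lemma fderiv_warped (h : IsWarpedAt B q w) (a b c : F n) :
    fderiv ℝ (warped B q) w a b c = -2 * (w.1 ^ 3)⁻¹ * (a.1 * b.1 * c.1) +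
      deriv B w.1 * a.1 * q w.2 b.2 c.2 + B w.1 * fderiv ℝ q w.2 a.2 b.2 c.2 := by
  have hB : HasFDerivAt (fun y : F n => B y.1)
      (deriv B w.1 • ContinuousLinearMap.fst ℝ ℝ (E (n - 1))) w :=
    (h.coeff_contDiffAt.differentiableAt (by norm_num)).hasDerivAt.comp_hasFDerivAt w hasFDerivAt_fst
  have hq : HasFDerivAt (fun y : F n => q y.2)
      (fderiv ℝ q w.2 ∘L ContinuousLinearMap.snd ℝ ℝ (E (n - 1))) w :=
    h.fibre.differentiableAt.hasFDerivAt.comp w hasFDerivAt_snd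
  have hfst : HasFDerivAt (fun y : F n => y.1) (ContinuousLinearMap.fst ℝ ℝ (E (n - 1))) w :=
    hasFDerivAt_fst
  have hx := (hasDerivAt_inv (pow_ne_zero 2 h.fst_pos.ne')).comp_hasFDerivAt w (hfst.pow 2)
  have h1 := (hx.mul_const (b.1 * c.1)).add (hB.mul ((hq.apply_const b.2).apply_const c.2))
  rw [fderiv_apply_apply h.isMetricAt.differentiableAt, h1.congr_of_eventuallyEq
    (f₁ := fun y => warped B q y b c) (Eventually.of_forall fun y => by
      simp [warped_apply]) |>.fderiv]
  have := h.fst_pos.ne'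
  simp
  field_simp
  ring

/-- The Hessian is half the Lie derivative of the metric along `x ∂_x`, and this field preserves
`x⁻² dx²`. -/
lemma hess_logFst (h : IsWarpedAt B q w) (v v' : F n) :
    hess (warped B q) logFst w v v' = 2⁻¹ * w.1 * deriv B w.1 * q w.2 v.2 v'.2 := by
  have hx : ∀ z, warped B q w (grad (warped B q) logFst w) z = fderiv ℝ logFst w z :=
    h.isMetricAt.apply_sharp _
  have hw := h.fst_pos.ne'
  rw [hess_apply, ← hx, h.isMetricAt.symm, christoffel_koszul h.isMetricAt.invertible,
    h.fderiv_warped, h.fderiv_warped, h.fderiv_warped, h.grad_logFst, fderiv_fderiv_logFst hw]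
  simp
  field_simp
  ring

/-- The logarithmic derivative of the warping function. -/
def _root_.MassAspect.logRate (B : ℝ → ℝ) (x : ℝ) : ℝ := 2⁻¹ * x * deriv B x / B x

lemma hess_logFst_eq (h : IsWarpedAt B q w) (v v' : F n) :
    hess (warped B q) logFst w v v' =
      logRate B w.1 * (warped B q w v v' - fderiv ℝ logFst w v * fderiv ℝ logFst w v') := by
  have hw := h.fst_pos.ne'
  have hB := h.coeff_pos.ne'
  rw [h.hess_logFst, warped_apply, fderiv_logFst hw, fderiv_logFst hw, logRate]
  field_simp
  ring

/-- Differentiate `hess_logFst_eq` using `∇G = 0`; the derivative of `d log x` is again the Hessian.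
-/
lemma nablaBilin_hess_logFst (h : IsWarpedAt B q w) (a b c : F n) :
    nablaBilin (christoffel (warped B q)) (hess (warped B q) logFst) w a b c =
      deriv (logRate B) w.1 * a.1 *
        (warped B q w b c - fderiv ℝ logFst w b * fderiv ℝ logFst w c) -
      logRate B w.1 * (hess (warped B q) logFst w a b * fderiv ℝ logFst w c +
        fderiv ℝ logFst w b * hess (warped B q) logFst w a c) := by
  have hw := h.fst_pos.ne'
  have hl : ContDiffAt ℝ 3 (logFst (n := n)) w := contDiffAt_logFst hw
  have h1 : HasFDerivAt (fderiv ℝ logFst) (fderiv ℝ (fderiv ℝ logFst) w) w :=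
    ((hl.fderiv_right (m := 2) (by norm_num)).differentiableAt (by norm_num)).hasFDerivAt
  have hH : DifferentiableAt ℝ (hess (warped B q) logFst) w :=
    (h.isMetricAt.contDiffAt_hess (m := 1) hl le_rfl (by norm_num)).differentiableAt
      (by norm_num)
  have hκ : DifferentiableAt ℝ (logRate B) w.1 := by
    have hB1 : ContDiffAt ℝ 1 (deriv B) w.1 :=
      (h.coeff_contDiffAt.fderiv_right (m := 1) (by norm_num)).clm_apply contDiffAt_const
    exact ((differentiableAt_id.const_mul 2⁻¹).mul (hB1.differentiableAt (by norm_num))).div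
      (h.coeff_contDiffAt.differentiableAt (by norm_num)) h.coeff_pos.ne'
  have hκ' : HasFDerivAt (fun y : F n => logRate B y.1)
      (deriv (logRate B) w.1 • ContinuousLinearMap.fst ℝ ℝ (E (n - 1))) w :=
    hκ.hasDerivAt.comp_hasFDerivAt w hasFDerivAt_fst
  have hG := h.isMetricAt.differentiableAt.hasFDerivAt
  have r := hκ'.mul (((hG.apply_const b).apply_const c).sub
    ((h1.apply_const b).mul (h1.apply_const c)))
  have e : (fun y => hess (warped B q) logFst y b c) =ᶠ[𝓝 w] _ :=
    h.eventually.mono fun y hy => hy.hess_logFst_eq b c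
  rw [nablaBilin_apply, fderiv_apply_apply hH, (r.congr_of_eventuallyEq e).fderiv]
  have m1 : ∀ a b, fderiv ℝ (fderiv ℝ logFst) w a b = hess (warped B q) logFst w a b +
    fderiv ℝ logFst w (christoffel (warped B q) w a b) := fun a b => by rw [hess_apply]; ring
  simp only [add_apply, sub_apply, smul_apply, ContinuousLinearMap.flip_apply, smul_eq_mul, m1,
    h.isMetricAt.fderiv_eq, Pi.sub_apply, Pi.mul_apply, ContinuousLinearMap.coe_fst']
  rw [h.hess_logFst_eq (christoffel (warped B q) w a b), h.hess_logFst_eq b]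
  ring

/-- The Christoffel symbols in the directions of the fibre. -/
lemma christoffel_fibre (h : IsWarpedAt B q w) (v v' : E (n - 1)) :
    (christoffel (warped B q) w (0, v) (0, v')).2 = christoffel q w.2 v v' := by
  apply h.fibre.invertible.injective
  ext z
  have := christoffel_koszul h.isMetricAt.invertible (0, v) (0, v') (0, z)
  rw [warped_apply, h.fderiv_warped, h.fderiv_warped, h.fderiv_warped] at this
  rw [christoffel_koszul h.fibre.invertible]
  have hB := h.coeff_pos.ne'
  apply mul_left_cancel₀ hB
  simp at this
  rw [this]
  ring

end IsWarpedAt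

end Warped

set_option linter.unusedSectionVars false

/-! ### Expansion of the curvature variation around hyperbolic space, at a point. -/

section NearModel

variable {V : Type*} [NormedAddCommGroup V] [NormedSpace ℝ V] [FiniteDimensional ℝ V]

/-- The trace along the kernel of `θ`. -/
def tangentTrace (G : V →L[ℝ] V →L[ℝ] ℝ) (θ : V →L[ℝ] ℝ) (T : V →L[ℝ] V →L[ℝ] ℝ) : ℝ :=
  traceWith G T - T (G.inverse θ) (G.inverse θ) / θ (G.inverse θ)

lemma tangentTrace_add (G : V →L[ℝ] V →L[ℝ] ℝ) (θ : V →L[ℝ] ℝ) (S T : V →L[ℝ] V →L[ℝ] ℝ) :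
    tangentTrace G θ (S + T) = tangentTrace G θ S + tangentTrace G θ T := by
  simp only [tangentTrace, traceWith_add, add_apply]; ring

lemma tangentTrace_sub (G : V →L[ℝ] V →L[ℝ] ℝ) (θ : V →L[ℝ] ℝ) (S T : V →L[ℝ] V →L[ℝ] ℝ) :
    tangentTrace G θ (S - T) = tangentTrace G θ S - tangentTrace G θ T := by
  simp only [tangentTrace, traceWith_sub, sub_apply]; ring

lemma tangentTrace_smul (G : V →L[ℝ] V →L[ℝ] ℝ) (θ : V →L[ℝ] ℝ) (T : V →L[ℝ] V →L[ℝ] ℝ) (c : ℝ) :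
    tangentTrace G θ (c • T) = c * tangentTrace G θ T := by
  simp only [tangentTrace, traceWith_smul, smul_apply, smul_eq_mul]; ring

/-- Splitting both arguments along `ξ = G⁻¹ θ` and the kernel of `θ` shows that `T` is a sum of
products with `θ` as a factor; its whole trace is then `T(ξ, ξ) / θ(ξ)`. -/
lemma tangentTrace_eq_zero {G : V →L[ℝ] V →L[ℝ] ℝ} (hG : G.IsInvertible)
    (hs : ∀ v w, G v w = G w v) {θ : V →L[ℝ] ℝ} (hu : θ (G.inverse θ) ≠ 0)
    {T : V →L[ℝ] V →L[ℝ] ℝ} (hT : ∀ v w, θ v = 0 → θ w = 0 → T v w = 0) :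
    tangentTrace G θ T = 0 := by
  have i1 : ∀ β : V →L[ℝ] ℝ, θ (G.inverse β) = β (G.inverse θ) := fun β => by
    have h1 := hs (G.inverse θ) (G.inverse β)
    rwa [hG.self_apply_inverse, hG.self_apply_inverse] at h1
  set ξ := G.inverse θ with hξ
  set u := θ ξ with hu'
  have key : T = u⁻¹ • θ.smulRight (T ξ) + u⁻¹ • (T.flip ξ).smulRight θ -
      (u⁻¹ ^ 2 * T ξ ξ) • θ.smulRight θ := by
    ext v w
    have := hT (v - (u⁻¹ * θ v) • ξ) (w - (u⁻¹ * θ w) • ξ)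
      (by rw [map_sub, map_smul, ← hu', smul_eq_mul]; field_simp; ring)
      (by rw [map_sub, map_smul, ← hu', smul_eq_mul]; field_simp; ring)
    simp only [map_sub, map_smul, sub_apply, smul_apply, smul_eq_mul] at this
    simp only [add_apply, sub_apply, smul_apply, ContinuousLinearMap.smulRight_apply, smul_eq_mul,
      ContinuousLinearMap.flip_apply]
    linear_combination this
  unfold tangentTrace
  conv_lhs => rw [key]
  simp only [traceWith_add, traceWith_sub, traceWith_smul, traceWith_smulRight, add_apply,
    sub_apply, smul_apply, ContinuousLinearMap.smulRight_apply, smul_eq_mul,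
    ContinuousLinearMap.flip_apply, ← hξ, i1, ← hu']
  field_simp
  ring

lemma tangentTrace_congr {G : V →L[ℝ] V →L[ℝ] ℝ} (hG : G.IsInvertible)
    (hs : ∀ v w, G v w = G w v) {θ : V →L[ℝ] ℝ} (hu : θ (G.inverse θ) ≠ 0)
    {S T : V →L[ℝ] V →L[ℝ] ℝ} (hT : ∀ v w, θ v = 0 → θ w = 0 → S v w = T v w) :
    tangentTrace G θ S = tangentTrace G θ T := by
  rw [← sub_eq_zero, ← tangentTrace_sub]
  exact tangentTrace_eq_zero hG hs hu fun v w hv hw => by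
    rw [sub_apply, sub_apply, hT v w hv hw, sub_self]

namespace LapseScalars

/-- The coefficient of the transversal derivative of `δ` in the variation. -/
def slope (s : LapseScalars) (δ : ℝ) : ℝ := -(s.u * s.tau) / (1 + δ * s.u) ^ 2

/-- The coefficient of `δ` in the variation. -/
def potential (s : LapseScalars) (n δ : ℝ) : ℝ :=
  s.u / (1 + δ * s.u) * s.zeroth + 2 * s.tau * s.a1 / s.u / (1 + δ * s.u) ^ 2 -
    s.lapU / (1 + δ * s.u) + δ * s.gradU / (2 * (1 + δ * s.u) ^ 2) +
    s.gradU / s.u / (1 + δ * s.u) - n * s.slope δ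

/-- The first order operator `δt - n δ` is isolated. The remainder contains `δ` undifferentiated
only through `potential`, and its other terms are combinations to which the component of `dδ` along
`θ` does not contribute: `β`, the slice Laplacian, and the two brackets that vanish when `dδ` is a
multiple of `θ`. -/
lemma variation_eq (s : LapseScalars) (hu : s.u ≠ 0) {δ e p r a7 a8 δt β n : ℝ}
    (he : e = s.u * δt + β) (hδ : 1 + δ * s.u ≠ 0) :
    s.variation δ e p r a7 a8 + s.slope δ * (δt - n * δ) =
      δ * s.potential n δ + s.tau / (1 + δ * s.u) ^ 2 * β -
      s.u / (1 + δ * s.u) * (a7 - a8 / s.u - e / s.u * s.tau) +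
      (δ * s.u / (1 + δ * s.u) ^ 2 - (1 + δ * s.u)⁻¹) * (2 * r - 2 * s.a1 * e / s.u) +
      s.u ^ 2 / (2 * (1 + δ * s.u) ^ 2) * (p - e ^ 2 / s.u) := by
  have e1 : s.tau / s.u * (2 * δ * s.a1 + s.u * e) =
    2 * δ * (s.tau * s.a1 / s.u) + s.tau * s.u * δt + s.tau * β := by
    rw [he]; field_simp; ring
  unfold variation
  rw [e1]
  generalize a7 - a8 / s.u - e / s.u * s.tau = Z
  generalize 2 * r - 2 * s.a1 * e / s.u = X
  generalize p - e ^ 2 / s.u = Y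
  unfold potential slope
  generalize s.zeroth = z
  generalize s.lapU = l
  generalize s.gradU = g
  generalize s.tau = τ
  field_simp
  ring

end LapseScalars

/-- The space of the tensors `G`, `H`, `∇H` and the number `δ`. -/
abbrev LapseJet (V : Type*) [NormedAddCommGroup V] [NormedSpace ℝ V] : Type _ :=
  (V →L[ℝ] V →L[ℝ] ℝ) × (V →L[ℝ] V →L[ℝ] ℝ) × (V →L[ℝ] V →L[ℝ] V →L[ℝ] ℝ) × ℝ

/-- The invariants of a jet. -/
def LapseJet.scalars (θ : V →L[ℝ] ℝ) (J : LapseJet V) : LapseScalars :=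
  lapseScalars J.1 θ J.2.1 J.2.2.1

/-- The trace of an endomorphism as a continuous linear map. -/
def traceCLM (V : Type*) [NormedAddCommGroup V] [NormedSpace ℝ V] [FiniteDimensional ℝ V] :
    (V →L[ℝ] V) →L[ℝ] ℝ :=
  LinearMap.toContinuousLinearMap
    (LinearMap.trace ℝ V ∘ₗ (LinearMap.toContinuousLinearMap : (V →ₗ[ℝ] V) ≃ₗ[ℝ] _).symm.toLinearMap)

lemma traceWith_eq_traceCLM (B T : V →L[ℝ] V →L[ℝ] ℝ) :
    traceWith B T = traceCLM V (B.inverse.comp T) := rfl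

section Differentiability

variable {J₀ : LapseJet V} {θ : V →L[ℝ] ℝ}

lemma differentiableAt_inverse (h : J₀.1.IsInvertible) :
    DifferentiableAt ℝ (fun J : LapseJet V => J.1.inverse) J₀ := by
  have := FiniteDimensional.complete ℝ V
  exact (h.contDiffAt_map_inverse (n := 1)).differentiableAt (by norm_num) |>.comp (𝕜 := ℝ) J₀
    (f := Prod.fst) differentiableAt_fst

lemma differentiableAt_scalars (h : J₀.1.IsInvertible) :
    DifferentiableAt ℝ (fun J => (J.scalars θ).u) J₀ ∧
    DifferentiableAt ℝ (fun J => (J.scalars θ).h) J₀ ∧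
    DifferentiableAt ℝ (fun J => (J.scalars θ).a1) J₀ ∧
    DifferentiableAt ℝ (fun J => (J.scalars θ).a2) J₀ ∧
    DifferentiableAt ℝ (fun J => (J.scalars θ).a3) J₀ ∧
    DifferentiableAt ℝ (fun J => (J.scalars θ).a4) J₀ ∧
    DifferentiableAt ℝ (fun J => (J.scalars θ).a5) J₀ ∧
    DifferentiableAt ℝ (fun J => (J.scalars θ).a6) J₀ := by
  have hi := differentiableAt_inverse h
  have hξ : DifferentiableAt ℝ (fun J : LapseJet V => J.1.inverse θ) J₀ :=
    hi.clm_apply (differentiableAt_const θ)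
  have hH : DifferentiableAt ℝ (fun J : LapseJet V => J.2.1) J₀ := by fun_prop
  have hD : DifferentiableAt ℝ (fun J : LapseJet V => J.2.2.1) J₀ := by fun_prop
  have hf : DifferentiableAt ℝ (fun J : LapseJet V => J.2.2.1.flip) J₀ :=
    (ContinuousLinearMap.flipₗᵢ ℝ V V (V →L[ℝ] ℝ)).toContinuousLinearEquiv.differentiableAt.comp
      J₀ hD
  have ht : ∀ {T : LapseJet V → V →L[ℝ] V →L[ℝ] ℝ}, DifferentiableAt ℝ T J₀ →
      DifferentiableAt ℝ (fun J => traceWith J.1 (T J)) J₀ := fun {T} hT =>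
    (traceCLM V).differentiableAt.comp J₀ (hi.clm_comp hT)
  refine ⟨?_, ht hH, ?_, ?_, ht (hH.clm_comp (hi.clm_comp hH)), ht (hD.clm_apply hξ), ?_,
    ht (hf.clm_apply hξ)⟩
  · exact (differentiableAt_const θ).clm_apply hξ
  · exact (hH.clm_apply hξ).clm_apply hξ
  · exact (hH.clm_apply hξ).clm_apply (hi.clm_apply (hH.clm_apply hξ))
  · exact ((hD.clm_apply hξ).clm_apply hξ).clm_apply hξ

/-- The jet of the model: the level sets of `θ` are umbilic with principal curvatures `-1`. -/
structure IsModelJet (θ : V →L[ℝ] ℝ) (m : ℝ) (J₀ : LapseJet V) : Prop where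
  invertible : J₀.1.IsInvertible
  scalars_eq : J₀.scalars θ = ⟨1, -m, 0, 0, m, 0, 0, -m⟩
  hess_grad : J₀.2.1 (J₀.1.inverse θ) = 0
  coeff : J₀.2.2.2 = 0

/-- All these quantities are differentiable in the jet at the model, so those vanishing there are
bounded by the distance to it and the others stay near their model values. The potential vanishes
because at the model `zeroth = m + m²`, `lapU = 0` and `slope = m`: the exponent `m + 1`, which is
the dimension, is the indicial root. -/
lemma IsModelJet.exists_bounds {m : ℝ} (h : IsModelJet θ m J₀) (hm : 2 ≤ m) :
    ∃ K : ℝ, 0 < K ∧ ∀ᶠ J in 𝓝 J₀, J.1.IsInvertible ∧ 2⁻¹ ≤ (J.scalars θ).u ∧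
      2⁻¹ ≤ 1 + J.2.2.2 * (J.scalars θ).u ∧ 1 ≤ (J.scalars θ).slope J.2.2.2 ∧
      (J.scalars θ).slope J.2.2.2 ≤ m + 1 ∧
      |(J.scalars θ).potential (m + 1) J.2.2.2| ≤ K * ‖J - J₀‖ ∧
      ‖J.1.inverse θ - J₀.1.inverse θ‖ ≤ K * ‖J - J₀‖ ∧
      ‖J.2.1 (J.1.inverse θ)‖ ≤ K * ‖J - J₀‖ ∧
      ‖J.1.inverse‖ ≤ K ∧ ‖J.1.inverse θ‖ ≤ K ∧
      |(J.scalars θ).u| ≤ K ∧ |(J.scalars θ).tau| ≤ K := by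
  have := FiniteDimensional.complete ℝ V
  obtain ⟨du, dh, d1, d2, d3, d4, d5, d6⟩ := differentiableAt_scalars (θ := θ) h.invertible
  have hi := differentiableAt_inverse h.invertible
  have hξ : DifferentiableAt ℝ (fun J : LapseJet V => J.1.inverse θ) J₀ :=
    hi.clm_apply (differentiableAt_const θ)
  have hδ : DifferentiableAt ℝ (fun J : LapseJet V => J.2.2.2) J₀ := by fun_prop
  have hH : DifferentiableAt ℝ (fun J : LapseJet V => J.2.1) J₀ := by fun_prop
  have hu0 : (J₀.scalars θ).u ≠ 0 := by rw [h.scalars_eq]; norm_num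
  have hy0 : 1 + J₀.2.2.2 * (J₀.scalars θ).u ≠ 0 := by rw [h.coeff]; norm_num
  have dy : DifferentiableAt ℝ (fun J : LapseJet V => 1 + J.2.2.2 * (J.scalars θ).u) J₀ :=
    (differentiableAt_const _).add (hδ.mul du)
  have dτ : DifferentiableAt ℝ (fun J : LapseJet V => (J.scalars θ).tau) J₀ :=
    show DifferentiableAt ℝ
      (fun J : LapseJet V => (J.scalars θ).h - (J.scalars θ).a1 / (J.scalars θ).u) J₀ by
    fun_prop (disch := assumption)
  have hy2 := pow_ne_zero 2 hy0
  have hy3 := mul_ne_zero (two_ne_zero (α := ℝ)) hy2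
  have dz : DifferentiableAt ℝ (fun J : LapseJet V => (J.scalars θ).zeroth) J₀ := by
    unfold LapseScalars.zeroth
    fun_prop (disch := first | assumption | exact pow_ne_zero 2 hu0)
  have dl : DifferentiableAt ℝ (fun J : LapseJet V => (J.scalars θ).lapU) J₀ := by
    unfold LapseScalars.lapU
    fun_prop (disch := assumption)
  have dg : DifferentiableAt ℝ (fun J : LapseJet V => (J.scalars θ).gradU) J₀ := by
    unfold LapseScalars.gradU
    fun_prop (disch := assumption)
  have ds : DifferentiableAt ℝ (fun J : LapseJet V => (J.scalars θ).slope J.2.2.2) J₀ := by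
    unfold LapseScalars.slope
    fun_prop (disch := assumption)
  have dp : DifferentiableAt ℝ (fun J : LapseJet V =>
      (J.scalars θ).potential (m + 1) J.2.2.2) J₀ := by
    unfold LapseScalars.potential
    fun_prop (disch := assumption)
  obtain ⟨K₁, b₁⟩ := ((dp.prodMk (hξ.prodMk (hH.clm_apply hξ))).isBigO_sub).bound
  have c : ContinuousAt (fun J : LapseJet V =>
      (J.1.inverse, J.1.inverse θ, (J.scalars θ).u, (J.scalars θ).tau)) J₀ :=
    (hi.prodMk (hξ.prodMk (du.prodMk dτ))).continuousAt
  set K₂ := ‖((J₀.1.inverse, J₀.1.inverse θ, (J₀.scalars θ).u, (J₀.scalars θ).tau) :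
    ((V →L[ℝ] ℝ) →L[ℝ] V) × V × ℝ × ℝ)‖ + 1
  have b₂ := c.norm.eventually (gt_mem_nhds (lt_add_one _))
  have es : (J₀.scalars θ).slope J₀.2.2.2 = m := by
    rw [h.scalars_eq, h.coeff]; simp [LapseScalars.slope, LapseScalars.tau]
  have ep : (J₀.scalars θ).potential (m + 1) J₀.2.2.2 = 0 := by
    rw [h.scalars_eq, h.coeff]
    simp [LapseScalars.slope, LapseScalars.tau, LapseScalars.potential, LapseScalars.zeroth,
      LapseScalars.lapU, LapseScalars.gradU]
    ring
  have m1 : ∀ J : LapseJet V, K₁ * ‖J - J₀‖ ≤ max K₁ K₂ * ‖J - J₀‖ := fun J => by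
    gcongr; exact le_max_left _ _
  have n1 : 2⁻¹ < (J₀.scalars θ).u := by rw [h.scalars_eq]; norm_num
  have n2 : 2⁻¹ < 1 + J₀.2.2.2 * (J₀.scalars θ).u := by rw [h.coeff]; norm_num
  have n3 : 1 < (J₀.scalars θ).slope J₀.2.2.2 := by rw [es]; linarith
  have n4 : (J₀.scalars θ).slope J₀.2.2.2 < m + 1 := by rw [es]; linarith
  refine ⟨max K₁ K₂, lt_max_of_lt_right (by positivity), ?_⟩
  filter_upwards [ContinuousLinearMap.IsInvertible.eventually continuousAt_fst h.invertible, b₁, b₂,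
    du.continuousAt.eventually (lt_mem_nhds n1), dy.continuousAt.eventually (lt_mem_nhds n2),
    ds.continuousAt.eventually (lt_mem_nhds n3), ds.continuousAt.eventually (gt_mem_nhds n4)]
    with J c0 c1 c2 c3 c4 c5 c6
  simp only [ep, h.hess_grad, Prod.mk_sub_mk, sub_zero] at c1
  have c1' := c1.trans (m1 J)
  have c2' := c2.le.trans (le_max_right K₁ K₂)
  simp only [Prod.norm_mk, max_le_iff] at c1' c2'
  exact ⟨c0, c3.le, c4.le, c5.le, c6.le, c1'.1, c1'.2.1, c1'.2.2, c2'.1, c2'.2.1, c2'.2.2.1,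
    c2'.2.2.2⟩

lemma traceWith_le : ∃ K : ℝ, 0 < K ∧ ∀ B T : V →L[ℝ] V →L[ℝ] ℝ,
    |traceWith B T| ≤ K * ‖B.inverse‖ * ‖T‖ := by
  refine ⟨‖traceCLM V‖ + 1, by positivity, fun B T => ?_⟩
  rw [traceWith_eq_traceCLM, mul_assoc]
  calc |traceCLM V (B.inverse.comp T)| ≤ ‖traceCLM V‖ * ‖B.inverse.comp T‖ :=
        (traceCLM V).le_opNorm _
    _ ≤ _ := by
        gcongr
        · linarith
        · exact ContinuousLinearMap.opNorm_comp_le _ _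

/-- The variation of the scalar curvature near the model. -/
theorem IsModelJet.exists_variation_bound {m : ℝ} (h : IsModelJet θ m J₀) (hm : 2 ≤ m) (C : ℝ) :
    ∃ K r : ℝ, 0 < r ∧ ∀ (J : LapseJet V) (σ P δt : ℝ) (α : V →L[ℝ] ℝ) (D T : V →L[ℝ] V →L[ℝ] ℝ),
      0 ≤ σ → σ ≤ r → ‖J - J₀‖ ≤ C * σ ^ 2 → (∀ v w, J.1 v w = J.1 w v) → 0 ≤ P → P ≤ C →
      0 ≤ J.2.2.2 → J.2.2.2 ≤ C * P → α (J₀.1.inverse θ) = 0 → ‖α‖ ≤ C * P * σ →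
      ‖T‖ ≤ C * P * σ ^ 2 → (∀ v w, θ v = 0 → θ w = 0 → D v w = T v w + δt * J.2.1 v w) →
      let d := δt • θ + α
      let ξ := J.1.inverse θ
      0 < θ ξ ∧ ∃ ϑ ∈ Icc 1 (m + 1),
        |(J.scalars θ).variation J.2.2.2 (d ξ) (d (J.1.inverse d)) (J.2.1 ξ (J.1.inverse d))
          (traceWith J.1 D) (D ξ ξ) + ϑ * (δt - (m + 1) * J.2.2.2)| ≤ K * P * σ ^ 2 := by
  -- In the application `σ` is the value of `x`, `P` that of the radial profile, `α` the slice part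
  -- of `dδ`, and `T` the slice Hessian of `δ` up to `δt H`. Each slice derivative is worth a factor
  -- `σ`, and so is half the distance of the jet to the model.
  obtain ⟨K, hK, hev⟩ := h.exists_bounds hm
  obtain ⟨Kt, hKt, htr⟩ := traceWith_le (V := V)
  obtain ⟨R, hR, hball⟩ := Metric.eventually_nhds_iff_ball.1 hev
  have hlim : Tendsto (fun σ : ℝ => C * σ ^ 2) (𝓝 0) (𝓝 0) := by
    have : Continuous fun σ : ℝ => C * σ ^ 2 := by fun_prop
    simpa using this.tendsto 0
  obtain ⟨r, hr, hr'⟩ := Metric.eventually_nhds_iff_ball.1 (hlim.eventually (gt_mem_nhds hR))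
  -- The constant is the sum of the bounds `T1`, …, `T5` below, one for each term of `variation_eq`.
  -- The radius keeps the jet in the ball where `exists_bounds` applies.
  refine ⟨C * (K * C) + K * (K * C * C) * 4 +
      K * 2 * ((Kt * K + K ^ 2 * 2) * C + K * C * C * 2 * K) +
      4 * (2 * (K * C * (K * C)) + 2 * (K * K * C) * (K * C * C) * 2) +
      K ^ 2 * 2 * (C * (K * C) * C + K * C * C * (K * C * C * C) * 2), min (r / 2) 1,
      by positivity, ?_⟩
  intro J σ P δt α D T hσ hσr hJ hs hP hPC hδ hδP hα hαn hT hD d ξ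
  have hσ1 : σ ≤ 1 := hσr.trans (min_le_right _ _)
  have hσ2 : σ ^ 2 ≤ 1 := pow_le_one₀ hσ hσ1
  have hC : 0 ≤ C := hP.trans hPC
  have hJR : J ∈ Metric.ball J₀ R := by
    rw [mem_ball_iff_norm]
    refine hJ.trans_lt (hr' σ ?_)
    rw [Metric.mem_ball, Real.dist_eq, sub_zero, abs_of_nonneg hσ]
    linarith [hσr.trans (min_le_left (r / 2) 1)]
  obtain ⟨hi, b1, b2, b3, b4, b5, b6, b7, b8, b9, b10, b11⟩ := hball J hJR
  set s := J.scalars θ with hsdef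
  have hu : s.u = θ ξ := rfl
  have hupos : 0 < s.u := by linarith
  refine ⟨by linarith, s.slope J.2.2.2, ⟨b3, b4⟩, ?_⟩
  have i1 : ∀ β : V →L[ℝ] ℝ, θ (J.1.inverse β) = β ξ := fun β => by
    have h1 := hs (J.1.inverse θ) (J.1.inverse β)
    rwa [hi.self_apply_inverse, hi.self_apply_inverse] at h1
  have hKJ : K * ‖J - J₀‖ ≤ K * C * σ ^ 2 := by rw [mul_assoc]; gcongr
  -- The slice covector `α` annihilates the model gradient, so `α(ξ)` gains the distance of `ξ` to
  -- the model gradient.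
  have hβ : |α ξ| ≤ K * C * C * P * σ ^ 2 := by
    have e : α ξ = α (J.1.inverse θ - J₀.1.inverse θ) := by rw [map_sub, hα, sub_zero]
    calc |α ξ| ≤ ‖α‖ * ‖J.1.inverse θ - J₀.1.inverse θ‖ := by rw [e]; exact α.le_opNorm _
      _ ≤ (C * P * σ) * (K * C * σ ^ 2) := by
          gcongr
          exact b6.trans hKJ
      _ = (K * C * C * P * σ ^ 2) * σ := by ring
      _ ≤ (K * C * C * P * σ ^ 2) * 1 := by gcongr
      _ = _ := by ring
  have hd : d ξ = s.u * δt + α ξ := by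
    simp only [d, add_apply, smul_apply, smul_eq_mul, hu]; ring
  have hgd : J.1.inverse d = δt • ξ + J.1.inverse α := by
    simp only [d, map_add, map_smul]; rfl
  rw [s.variation_eq hupos.ne' hd (by linarith)]
  -- In `hZ`, `hX` and `hY` the transversal part `δt θ` of `dδ` cancels; only `T` and `α` remain,
  -- and both are small.
  have hZ : traceWith J.1 D - D ξ ξ / s.u - d ξ / s.u * s.tau =
      tangentTrace J.1 θ T - α ξ / s.u * s.tau := by
    have e1 : tangentTrace J.1 θ D = tangentTrace J.1 θ (T + δt • J.2.1) :=
      tangentTrace_congr hi hs hupos.ne' fun v w hv hw => by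
        rw [hD v w hv hw, add_apply, add_apply, smul_apply, smul_apply, smul_eq_mul]
    have e2 : tangentTrace J.1 θ J.2.1 = s.tau := rfl
    have e3 : tangentTrace J.1 θ D = traceWith J.1 D - D ξ ξ / s.u := rfl
    rw [← e3, e1, tangentTrace_add, tangentTrace_smul, e2, hd]
    field_simp
    ring
  have hX : 2 * J.2.1 ξ (J.1.inverse d) - 2 * s.a1 * d ξ / s.u =
      2 * J.2.1 ξ (J.1.inverse α) - 2 * s.a1 * α ξ / s.u := by
    have e1 : s.a1 = J.2.1 ξ ξ := rfl
    rw [hd, hgd, map_add, map_smul, smul_eq_mul, ← e1]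
    field_simp
    ring
  have hY : d (J.1.inverse d) - d ξ ^ 2 / s.u = α (J.1.inverse α) - α ξ ^ 2 / s.u := by
    rw [hd, hgd]
    simp only [d, add_apply, smul_apply, smul_eq_mul, map_add, map_smul, i1]
    rw [← hu]
    field_simp
    ring
  rw [hZ, hX, hY]
  have iu : s.u⁻¹ ≤ 2 := by
    rw [inv_le_comm₀ hupos (by norm_num)]; exact b1
  have iy : (1 + J.2.2.2 * s.u)⁻¹ ≤ 2 := by
    rw [inv_le_comm₀ (by linarith) (by norm_num)]; exact b2
  have hypos : 0 < 1 + J.2.2.2 * s.u := by linarith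
  have hPσ : 0 ≤ P * σ ^ 2 := by positivity
  have hα' : ‖α‖ ≤ C * P := hαn.trans (mul_le_of_le_one_right (by positivity) hσ1)
  have ha1 : |s.a1| ≤ K * K * C := by
    have : |s.a1| ≤ ‖J.2.1 (J.1.inverse θ)‖ * ‖J.1.inverse θ‖ :=
      (J.2.1 (J.1.inverse θ)).le_opNorm _
    refine this.trans ?_
    calc _ ≤ (K * C * σ ^ 2) * K := by gcongr; exact b7.trans hKJ
      _ ≤ (K * C * 1) * K := by gcongr
      _ = _ := by ring
  have hiα : ‖J.1.inverse α‖ ≤ K * (C * P * σ) :=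
    (J.1.inverse.le_opNorm _).trans (by gcongr)
  have T1 : |J.2.2.2 * s.potential (m + 1) J.2.2.2| ≤ C * (K * C) * (P * σ ^ 2) := by
    rw [abs_mul, abs_of_nonneg hδ]
    calc _ ≤ (C * P) * (K * C * σ ^ 2) := by gcongr; exact b5.trans hKJ
      _ = _ := by ring
  have T2 : |s.tau / (1 + J.2.2.2 * s.u) ^ 2 * α ξ| ≤ K * (K * C * C) * 4 * (P * σ ^ 2) := by
    rw [div_eq_mul_inv, abs_mul, abs_mul, abs_inv, abs_pow, abs_of_pos hypos, ← inv_pow]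
    calc _ ≤ K * 2 ^ 2 * (K * C * C * P * σ ^ 2) := by gcongr
      _ = _ := by ring
  have T3 : |s.u / (1 + J.2.2.2 * s.u) * (tangentTrace J.1 θ T - α ξ / s.u * s.tau)| ≤
      K * 2 * ((Kt * K + K ^ 2 * 2) * C + K * C * C * 2 * K) * (P * σ ^ 2) := by
    have t1 : |tangentTrace J.1 θ T| ≤ (Kt * K + K ^ 2 * 2) * (C * P * σ ^ 2) := by
      have a1 : |traceWith J.1 T| ≤ Kt * K * (C * P * σ ^ 2) :=
        (htr _ _).trans (by gcongr)
      have a2 : |T ξ ξ / θ ξ| ≤ K ^ 2 * 2 * (C * P * σ ^ 2) := by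
        rw [div_eq_mul_inv, abs_mul, abs_inv, ← hu, abs_of_pos hupos]
        calc _ ≤ (‖T‖ * ‖ξ‖ * ‖ξ‖) * 2 := by gcongr; exact T.le_opNorm₂ _ _
          _ ≤ ((C * P * σ ^ 2) * K * K) * 2 := by gcongr
          _ = _ := by ring
      calc _ ≤ |traceWith J.1 T| + |T ξ ξ / θ ξ| := abs_sub _ _
        _ ≤ _ := by linarith
    have t2 : |α ξ / s.u * s.tau| ≤ (K * C * C * P * σ ^ 2) * 2 * K := by
      rw [div_eq_mul_inv, abs_mul, abs_mul, abs_inv, abs_of_pos hupos]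
      gcongr
    rw [div_eq_mul_inv, abs_mul, abs_mul, abs_inv, abs_of_pos hypos]
    calc _ ≤ K * 2 * ((Kt * K + K ^ 2 * 2) * (C * P * σ ^ 2) + (K * C * C * P * σ ^ 2) * 2 * K) := by
          gcongr
          exact (abs_sub _ _).trans (add_le_add t1 t2)
      _ = _ := by ring
  have T4 : |(J.2.2.2 * s.u / (1 + J.2.2.2 * s.u) ^ 2 - (1 + J.2.2.2 * s.u)⁻¹) *
      (2 * J.2.1 ξ (J.1.inverse α) - 2 * s.a1 * α ξ / s.u)| ≤
      4 * (2 * (K * C * (K * C)) + 2 * (K * K * C) * (K * C * C) * 2) * (P * σ ^ 2) := by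
    have e : J.2.2.2 * s.u / (1 + J.2.2.2 * s.u) ^ 2 - (1 + J.2.2.2 * s.u)⁻¹ =
        -((1 + J.2.2.2 * s.u)⁻¹) ^ 2 := by
      have := hypos.ne'
      field_simp
      ring
    have t1 : |2 * J.2.1 ξ (J.1.inverse α)| ≤ 2 * (K * C * (K * C)) * (P * σ ^ 2) := by
      rw [abs_mul, abs_of_pos (two_pos (α := ℝ))]
      calc _ ≤ 2 * (‖J.2.1 ξ‖ * ‖J.1.inverse α‖) := by
            gcongr; exact (J.2.1 ξ).le_opNorm _
        _ ≤ 2 * ((K * C * σ ^ 2) * (K * (C * P * σ))) := by gcongr; exact b7.trans hKJ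
        _ = 2 * (K * C * (K * C)) * (P * σ ^ 2) * σ := by ring
        _ ≤ _ := mul_le_of_le_one_right (by positivity) hσ1
    have t2 : |2 * s.a1 * α ξ / s.u| ≤ 2 * (K * K * C) * (K * C * C * P * σ ^ 2) * 2 := by
      rw [div_eq_mul_inv, abs_mul, abs_mul, abs_mul, abs_inv, abs_of_pos hupos,
        abs_of_pos (two_pos (α := ℝ))]
      gcongr
    rw [e, abs_mul, abs_neg, abs_pow, abs_inv, abs_of_pos hypos]
    calc _ ≤ 2 ^ 2 * (2 * (K * C * (K * C)) * (P * σ ^ 2) +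
          2 * (K * K * C) * (K * C * C * P * σ ^ 2) * 2) := by
          gcongr
          exact (abs_sub _ _).trans (add_le_add t1 t2)
      _ = _ := by ring
  have T5 : |s.u ^ 2 / (2 * (1 + J.2.2.2 * s.u) ^ 2) * (α (J.1.inverse α) - α ξ ^ 2 / s.u)| ≤
      K ^ 2 * 2 * (C * (K * C) * C + K * C * C * (K * C * C * C) * 2) * (P * σ ^ 2) := by
    have t1 : |α (J.1.inverse α)| ≤ C * (K * C) * C * (P * σ ^ 2) := by
      calc _ ≤ ‖α‖ * ‖J.1.inverse α‖ := α.le_opNorm _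
        _ ≤ (C * P * σ) * (K * (C * P * σ)) := by gcongr
        _ = C * (K * C) * P * (P * σ ^ 2) := by ring
        _ ≤ _ := by gcongr
    have t2 : |α ξ ^ 2 / s.u| ≤ K * C * C * (K * C * C * C) * 2 * (P * σ ^ 2) := by
      rw [div_eq_mul_inv, abs_mul, abs_inv, abs_of_pos hupos, abs_pow, sq]
      have : K * C * C * P * σ ^ 2 ≤ K * C * C * C * 1 := by gcongr
      calc _ ≤ (K * C * C * P * σ ^ 2) * (K * C * C * C * 1) * 2 := by
            gcongr
            exact hβ.trans this
        _ = _ := by ring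
    have e : s.u ^ 2 / (2 * (1 + J.2.2.2 * s.u) ^ 2) =
        s.u ^ 2 * (((1 + J.2.2.2 * s.u)⁻¹) ^ 2 * 2⁻¹) := by
      rw [div_eq_mul_inv, mul_inv, inv_pow]; ring
    rw [e, abs_mul, abs_mul, abs_mul, abs_pow, abs_pow, abs_inv, abs_of_pos hypos,
      abs_of_pos (by norm_num : (0 : ℝ) < 2⁻¹)]
    calc _ ≤ K ^ 2 * (2 ^ 2 * 2⁻¹) * (C * (K * C) * C * (P * σ ^ 2) +
          K * C * C * (K * C * C * C) * 2 * (P * σ ^ 2)) := by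
          gcongr
          exact (abs_sub _ _).trans (add_le_add t1 t2)
      _ = _ := by ring
  refine (abs_add_le _ _).trans ?_
  refine (add_le_add ((abs_add_le _ _).trans (add_le_add ((abs_sub _ _).trans
    (add_le_add ((abs_add_le _ _).trans (add_le_add T1 T2)) T3)) T4)) T5).trans (le_of_eq ?_)
  ring

end Differentiability

end NearModel

set_option linter.unusedSectionVars false

/-! ### Quantitative comparison of the Hessians for two close metrics. -/

section Comparison

variable {V : Type*} [NormedAddCommGroup V] [NormedSpace ℝ V] [FiniteDimensional ℝ V]
  {G G₀ : V → V →L[ℝ] V →L[ℝ] ℝ} {t : V → ℝ} {u : V}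

lemma abs_koszul_le {L : V → V → V → ℝ} {ρ : ℝ} (hL : ∀ v w z, |L v w z| ≤ ρ * (‖v‖ * ‖w‖ * ‖z‖))
    (v w z : V) : |koszul L v w z| ≤ 2 * ρ * (‖v‖ * ‖w‖ * ‖z‖) := by
  have h1 := hL v w z
  have h2 := hL w v z
  have h3 := hL z v w
  have h0 : 0 ≤ ρ * (‖v‖ * ‖w‖ * ‖z‖) := (abs_nonneg _).trans h1
  rw [show ρ * (‖w‖ * ‖v‖ * ‖z‖) = ρ * (‖v‖ * ‖w‖ * ‖z‖) by ring] at h2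
  rw [show ρ * (‖z‖ * ‖v‖ * ‖w‖) = ρ * (‖v‖ * ‖w‖ * ‖z‖) by ring] at h3
  have h4 := abs_le.1 h1
  have h5 := abs_le.1 h2
  have h6 := abs_le.1 h3
  rw [koszul, abs_le]
  constructor <;> linarith [h4.1, h4.2, h5.1, h5.2, h6.1, h6.2]

lemma norm_apply₃_le {ρ : ℝ} {L : V →L[ℝ] V →L[ℝ] V →L[ℝ] ℝ} (hL : ‖L‖ ≤ ρ) (v w z : V) :
    |L v w z| ≤ ρ * (‖v‖ * ‖w‖ * ‖z‖) := by
  calc |L v w z| ≤ ‖L v w‖ * ‖z‖ := (L v w).le_opNorm z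
    _ ≤ ‖L v‖ * ‖w‖ * ‖z‖ := by gcongr; exact (L v).le_opNorm w
    _ ≤ ‖L‖ * ‖v‖ * ‖w‖ * ‖z‖ := by gcongr; exact L.le_opNorm v
    _ ≤ ρ * ‖v‖ * ‖w‖ * ‖z‖ := by gcongr
    _ = _ := by ring

lemma opNorm₃_le {ρ : ℝ} (hρ : 0 ≤ ρ) {L : V →L[ℝ] V →L[ℝ] V →L[ℝ] ℝ}
    (hL : ∀ v w z, |L v w z| ≤ ρ * (‖v‖ * ‖w‖ * ‖z‖)) : ‖L‖ ≤ ρ := by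
  refine L.opNorm_le_bound hρ fun v => (L v).opNorm_le_bound (by positivity) fun w =>
    (L v w).opNorm_le_bound (by positivity) fun z => (hL v w z).trans (le_of_eq (by ring))

lemma opNorm₂_le {ρ : ℝ} (hρ : 0 ≤ ρ) {L : V →L[ℝ] V →L[ℝ] ℝ}
    (hL : ∀ v w, |L v w| ≤ ρ * (‖v‖ * ‖w‖)) : ‖L‖ ≤ ρ := by
  refine L.opNorm_le_bound hρ fun v => (L v).opNorm_le_bound (by positivity) fun w =>
    (hL v w).trans (le_of_eq (by ring))

/-- The metric `G` is close to `G₀`, together with two covariant derivatives. -/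
structure IsCloseAt (G G₀ : V → V →L[ℝ] V →L[ℝ] ℝ) (u : V) (ρ : ℝ) : Prop where
  metric : IsMetricAt G u
  base : IsMetricAt G₀ u
  norm_le : ‖G u - G₀ u‖ ≤ ρ
  nabla_le : ‖nablaBilin (christoffel G₀) (G - G₀) u‖ ≤ ρ
  nabla₂_le : ∀ v w z y, |nablaTri (christoffel G₀) (nablaBilin (christoffel G₀) (G - G₀)) u v w z y|
    ≤ ρ * (‖v‖ * ‖w‖ * ‖z‖ * ‖y‖)

namespace IsCloseAt

variable {ρ A : ℝ}

lemma norm_diffChristoffel_le (h : IsCloseAt G G₀ u ρ) (hA : ‖(G u).inverse‖ ≤ A) (v w : V) :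
    ‖diffChristoffel G G₀ u v w‖ ≤ 2 * A * ρ * (‖v‖ * ‖w‖) := by
  have hρ : 0 ≤ ρ := (norm_nonneg _).trans h.norm_le
  have e : diffChristoffel G G₀ u v w = (G u).inverse (G u (diffChristoffel G G₀ u v w)) :=
    (h.metric.invertible.inverse_apply_self _).symm
  have hb : ‖G u (diffChristoffel G G₀ u v w)‖ ≤ 2 * ρ * (‖v‖ * ‖w‖) := by
    refine ContinuousLinearMap.opNorm_le_bound _ (by positivity) fun z => ?_
    rw [apply_diffChristoffel h.metric h.base]
    exact (abs_koszul_le (norm_apply₃_le h.nabla_le) v w z).trans (le_of_eq (by ring))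
  rw [e]
  calc _ ≤ ‖(G u).inverse‖ * ‖G u (diffChristoffel G G₀ u v w)‖ := ContinuousLinearMap.le_opNorm _ _
    _ ≤ A * (2 * ρ * (‖v‖ * ‖w‖)) := by
        have := (norm_nonneg _).trans hA
        gcongr
    _ = _ := by ring

lemma norm_grad_le (hA : ‖(G u).inverse‖ ≤ A) (ht : ‖fderiv ℝ t u‖ ≤ A) : ‖grad G t u‖ ≤ A ^ 2 := by
  have := (norm_nonneg _).trans hA
  calc _ ≤ ‖(G u).inverse‖ * ‖fderiv ℝ t u‖ := ContinuousLinearMap.le_opNorm _ _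
    _ ≤ A * A := by gcongr
    _ = _ := by ring

lemma norm_hess_sub_le (h : IsCloseAt G G₀ u ρ) (hA : ‖(G u).inverse‖ ≤ A)
    (ht : ‖fderiv ℝ t u‖ ≤ A) : ‖hess G t u - hess G₀ t u‖ ≤ 2 * A ^ 2 * ρ := by
  have hρ : 0 ≤ ρ := (norm_nonneg _).trans h.norm_le
  refine opNorm₂_le (by positivity) fun v w => ?_
  rw [sub_apply, sub_apply, hess_eq_sub h.metric h.base, sub_sub_cancel_left, abs_neg]
  refine (abs_koszul_le (norm_apply₃_le h.nabla_le) v w _).trans ?_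
  calc _ ≤ 2 * ρ * (‖v‖ * ‖w‖ * A ^ 2) := by gcongr; exact norm_grad_le hA ht
    _ = _ := by ring

lemma norm_nabla_hess_sub_le (h : IsCloseAt G G₀ u ρ) (hA : ‖(G u).inverse‖ ≤ A)
    (ht : ‖fderiv ℝ t u‖ ≤ A) (hH : ‖hess G t u‖ ≤ A) (hρ1 : ρ ≤ 1) (ht3 : ContDiffAt ℝ 3 t u) :
    ‖nablaBilin (christoffel G) (hess G t) u - nablaBilin (christoffel G₀) (hess G₀ t) u‖ ≤
      (8 * A ^ 2 + 4 * A ^ 3) * ρ := by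
  have hρ : 0 ≤ ρ := (norm_nonneg _).trans h.norm_le
  have hA0 := (norm_nonneg _).trans hA
  have hg := norm_grad_le hA ht
  refine opNorm₃_le (by positivity) fun v w z => ?_
  rw [sub_apply, sub_apply, sub_apply, nablaBilin_hess_eq h.metric h.base ht3]
  have b1 := abs_koszul_le (fun a b c => (h.nabla₂_le v a b c).trans_eq
    (show _ = ρ * ‖v‖ * (‖a‖ * ‖b‖ * ‖c‖) by ring)) w z (grad G t u)
  have hS := h.norm_diffChristoffel_le hA
  have b2 := abs_koszul_le (norm_apply₃_le h.nabla_le) w z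
    ((G u).inverse (hess G t u v) - diffChristoffel G G₀ u v (grad G t u))
  have hHv : ∀ v w, |hess G t u v w| ≤ A * (‖v‖ * ‖w‖) := fun v w =>
    ((hess G t u).le_opNorm₂ v w).trans (by rw [mul_assoc]; gcongr)
  have hHv' : ‖hess G t u v‖ ≤ A * ‖v‖ := ((hess G t u).le_opNorm v).trans (by gcongr)
  have b3 : ‖(G u).inverse (hess G t u v) - diffChristoffel G G₀ u v (grad G t u)‖ ≤
      (A ^ 2 + 2 * A ^ 3) * ‖v‖ := by
    refine (norm_sub_le _ _).trans ?_
    calc _ ≤ A * (A * ‖v‖) + 2 * A * 1 * (‖v‖ * A ^ 2) := by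
          gcongr
          · exact (ContinuousLinearMap.le_opNorm _ _).trans (by gcongr)
          · exact (hS v _).trans (by gcongr)
      _ = _ := by ring
  have c1 : |koszul (nablaTri (christoffel G₀) (nablaBilin (christoffel G₀) (G - G₀)) u v) w z
      (grad G t u)| ≤ 2 * A ^ 2 * ρ * (‖v‖ * ‖w‖ * ‖z‖) := by
    refine b1.trans ?_
    calc _ ≤ 2 * (ρ * ‖v‖) * (‖w‖ * ‖z‖ * A ^ 2) := by gcongr
      _ = _ := by ring
  have c2 : |koszul (fun v w z => nablaBilin (christoffel G₀) (G - G₀) u v w z) w z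
      ((G u).inverse (hess G t u v) - diffChristoffel G G₀ u v (grad G t u))| ≤
      (2 * A ^ 2 + 4 * A ^ 3) * ρ * (‖v‖ * ‖w‖ * ‖z‖) := by
    refine b2.trans ?_
    calc _ ≤ 2 * ρ * (‖w‖ * ‖z‖ * ((A ^ 2 + 2 * A ^ 3) * ‖v‖)) := by gcongr
      _ = _ := by ring
  have c3 : |hess G t u (diffChristoffel G G₀ u v w) z| ≤ 2 * A ^ 2 * ρ * (‖v‖ * ‖w‖ * ‖z‖) := by
    refine (hHv _ _).trans ?_
    calc _ ≤ A * ((2 * A * ρ * (‖v‖ * ‖w‖)) * ‖z‖) := by gcongr; exact hS v w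
      _ = _ := by ring
  have c4 : |hess G t u w (diffChristoffel G G₀ u v z)| ≤ 2 * A ^ 2 * ρ * (‖v‖ * ‖w‖ * ‖z‖) := by
    refine (hHv _ _).trans ?_
    calc _ ≤ A * (‖w‖ * (2 * A * ρ * (‖v‖ * ‖z‖))) := by gcongr; exact hS v z
      _ = _ := by ring
  have d1 := abs_le.1 c1
  have d2 := abs_le.1 c2
  have d3 := abs_le.1 c3
  have d4 := abs_le.1 c4
  rw [abs_le]
  constructor <;> linarith [d1.1, d1.2, d2.1, d2.2, d3.1, d3.2, d4.1, d4.2]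

end IsCloseAt

end Comparison

/-! ### The jet of `log x` for the hyperbolic metric in the upper half-space. -/

section Model

variable {n : ℕ}

/-- The Euclidean scalar product. -/
def euclid (d : ℕ) : E d →L[ℝ] E d →L[ℝ] ℝ := innerSL ℝ

lemma euclid_apply {d : ℕ} (v w : E d) : euclid d v w = inner ℝ v w := innerSL_apply_apply ℝ v w

/-- The covector `dx`. -/
abbrev dx (n : ℕ) : F n →L[ℝ] ℝ := ContinuousLinearMap.fst ℝ ℝ (E (n - 1))

/-- The jet of `log x` for the metric `x⁻² (dx² + |dy|²)` at `x = 1`. -/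
def modelJet (n : ℕ) : LapseJet (F n) :=
  let P : F n →L[ℝ] F n →L[ℝ] ℝ := liftN (euclid (n - 1))
  (dxSq + P, -P, -(((ContinuousLinearMap.smulRightL ℝ (F n) (F n →L[ℝ] ℝ)).flip (dx n)).comp P +
    (ContinuousLinearMap.smulRightL ℝ (F n) (F n →L[ℝ] ℝ) (dx n)).comp P), 0)

lemma modelJet_fst_apply (v w : F n) :
    (modelJet n).1 v w = v.1 * w.1 + inner ℝ v.2 w.2 := by
  simp [modelJet, dxSq_apply, liftN_apply, euclid_apply]

lemma modelJet_hess_apply (v w : F n) : (modelJet n).2.1 v w = -inner ℝ v.2 w.2 := by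
  simp [modelJet, liftN_apply, euclid_apply]

lemma modelJet_nabla_apply (v w z : F n) : (modelJet n).2.2.1 v w z =
    -(inner ℝ v.2 w.2 * z.1 + w.1 * inner ℝ v.2 z.2) := by
  simp [modelJet, liftN_apply, euclid_apply]

lemma isInvertible_euclid (d : ℕ) : (euclid d).IsInvertible :=
  ⟨(InnerProductSpace.toDual ℝ (E d)).toContinuousLinearEquiv, by ext; rfl⟩

lemma isMetricAt_euclid {d : ℕ} (y : E d) : IsMetricAt (fun _ : E d => euclid d) y :=
  ⟨contDiffAt_const, isInvertible_euclid d,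
    Eventually.of_forall fun _ v w => by rw [euclid_apply, euclid_apply, real_inner_comm]⟩

lemma isInvertible_modelJet (n : ℕ) : (modelJet n).1.IsInvertible := by
  have h : IsWarpedAt (fun _ => 1) (fun _ => euclid (n - 1)) ((1, 0) : F n) :=
    ⟨one_pos, one_pos, contDiffAt_const, isMetricAt_euclid _⟩
  convert h.isMetricAt.invertible using 1
  simp [warped, modelJet]

lemma modelJet_inverse_dx (n : ℕ) : (modelJet n).1.inverse (dx n) = (1, 0) := by
  rw [(isInvertible_modelJet n).inverse_apply_eq]
  ext v <;> simp [modelJet_fst_apply]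

/-- The shape endomorphism is minus the projection onto the slice, which makes all traces of the
model explicit. -/
lemma modelJet_inverse_comp (n : ℕ) : (modelJet n).1.inverse.comp (modelJet n).2.1 =
    -((ContinuousLinearMap.inr ℝ ℝ (E (n - 1))).comp (ContinuousLinearMap.snd ℝ ℝ (E (n - 1)))) := by
  refine ContinuousLinearMap.ext fun v => ?_
  rw [ContinuousLinearMap.comp_apply, (isInvertible_modelJet n).inverse_apply_eq]
  refine ContinuousLinearMap.ext fun w => ?_
  simp [modelJet_hess_apply, modelJet_fst_apply]

lemma trace_inr_comp_snd (n : ℕ) :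
    LinearMap.trace ℝ (F n) (((ContinuousLinearMap.inr ℝ ℝ (E (n - 1))).comp
      (ContinuousLinearMap.snd ℝ ℝ (E (n - 1))) : F n →L[ℝ] F n) : F n →ₗ[ℝ] F n) =
        ((n - 1 : ℕ) : ℝ) := by
  have := LinearMap.trace_comp_comm' (LinearMap.snd ℝ ℝ (E (n - 1))) (LinearMap.inr ℝ ℝ (E (n - 1)))
  refine this.trans ?_
  rw [show LinearMap.snd ℝ ℝ (E (n - 1)) ∘ₗ LinearMap.inr ℝ ℝ (E (n - 1)) = LinearMap.id by ext; simp]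
  simp

/-- With `ξ = ∂_x`, the model satisfies `H(ξ) = 0`, `H G⁻¹ H = -H`, `∇H(ξ) = 0` and `∇H(·, ξ, ·) =
H`, so every invariant is zero or a trace of `±H`. -/
lemma isModelJet_modelJet (n : ℕ) : IsModelJet (dx n) ((n - 1 : ℕ) : ℝ) (modelJet n) := by
  have hH : (modelJet n).2.1 (1, 0) = 0 := by refine ContinuousLinearMap.ext fun v => ?_; simp [modelJet_hess_apply]
  have htr : traceWith (modelJet n).1 (modelJet n).2.1 = -((n - 1 : ℕ) : ℝ) := by
    rw [traceWith, modelJet_inverse_comp, ContinuousLinearMap.toLinearMap_neg, map_neg,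
      trace_inr_comp_snd]
  have h3 : (modelJet n).2.1.comp ((modelJet n).1.inverse.comp (modelJet n).2.1) =
      (-1 : ℝ) • (modelJet n).2.1 := by
    rw [modelJet_inverse_comp]
    refine ContinuousLinearMap.ext fun v => ?_
    refine ContinuousLinearMap.ext fun w => ?_
    simp [modelJet_hess_apply]
  have h4 : (modelJet n).2.2.1 (1, 0) = 0 := by refine ContinuousLinearMap.ext fun v => ?_; refine ContinuousLinearMap.ext fun w => ?_; simp [modelJet_nabla_apply]
  have h6 : (modelJet n).2.2.1.flip (1, 0) = (modelJet n).2.1 := by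
    refine ContinuousLinearMap.ext fun v => ?_; refine ContinuousLinearMap.ext fun w => ?_; simp [modelJet_nabla_apply, modelJet_hess_apply]
  refine ⟨isInvertible_modelJet n, ?_, ?_, rfl⟩
  · simp only [LapseJet.scalars, lapseScalars, modelJet_inverse_dx, htr, hH, h3, h4, h6,
      traceWith_smul]
    simp [traceWith]
  · rw [modelJet_inverse_dx, hH]

end Model

/-! ### Warped products that agree with the model at the base point. -/

section Normalized

variable {n : ℕ} {B : ℝ → ℝ} {q : E (n - 1) → E (n - 1) →L[ℝ] E (n - 1) →L[ℝ] ℝ}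

lemma warped_base (hB : B 1 = 1) (hq : q 0 = euclid (n - 1)) :
    warped B q (1, 0) = (modelJet n).1 := by
  simp [warped, modelJet, hB, hq]

lemma fderiv_logFst_base : fderiv ℝ (logFst (n := n)) (1, 0) = dx n := by
  refine ContinuousLinearMap.ext fun v => ?_
  rw [fderiv_logFst one_ne_zero]; simp

/-- A warped product metric which is close to the model at the base point. -/
structure IsNearModel (B : ℝ → ℝ) (q : E (n - 1) → E (n - 1) →L[ℝ] E (n - 1) →L[ℝ] ℝ) (ρ : ℝ) :
    Prop where
  warped : IsWarpedAt B q ((1, 0) : F n)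
  coeff_eq : B 1 = 1
  fibre_eq : q 0 = euclid (n - 1)
  rate_le : |logRate B 1 + 1| ≤ ρ
  deriv_rate_le : |deriv (logRate B) 1| ≤ ρ

lemma abs_inner_snd_le (v w : F n) : |inner ℝ v.2 w.2| ≤ ‖v‖ * ‖w‖ :=
  (abs_real_inner_le_norm _ _).trans (mul_le_mul (norm_snd_le v) (norm_snd_le w) (norm_nonneg _)
    (norm_nonneg _))

namespace IsNearModel

variable {ρ : ℝ}

lemma hess_base (h : IsNearModel B q ρ) (v w : F n) :
    hess (MassAspect.warped B q) logFst (1, 0) v w = logRate B 1 * inner ℝ v.2 w.2 := by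
  rw [h.warped.hess_logFst_eq, warped_base h.coeff_eq h.fibre_eq, modelJet_fst_apply,
    fderiv_logFst_base]
  simp

lemma norm_hess_sub_le (h : IsNearModel B q ρ) :
    ‖hess (MassAspect.warped B q) logFst (1, 0) - (modelJet n).2.1‖ ≤ ρ := by
  have hρ := (abs_nonneg _).trans h.rate_le
  refine opNorm₂_le hρ fun v w => ?_
  rw [sub_apply, sub_apply, h.hess_base, modelJet_hess_apply,
    show logRate B 1 * inner ℝ v.2 w.2 - -inner ℝ v.2 w.2 =
      (logRate B 1 + 1) * inner ℝ v.2 w.2 by ring, abs_mul]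
  exact mul_le_mul h.rate_le (abs_inner_snd_le v w) (abs_nonneg _) hρ

lemma norm_nabla_hess_sub_le (h : IsNearModel B q ρ) (hρ1 : ρ ≤ 1) :
    ‖nablaBilin (christoffel (MassAspect.warped B q)) (hess (MassAspect.warped B q) logFst) (1, 0) -
      (modelJet n).2.2.1‖ ≤ 7 * ρ := by
  have hρ := (abs_nonneg _).trans h.rate_le
  refine opNorm₃_le (by positivity) fun a b c => ?_
  -- The deviation consists of the derivative of the logarithmic rate and of `1 - (logRate)²`, which
  -- contains the small factor `logRate + 1`. The constant `7` below is `1 + 3 * 2`.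
  have e : nablaBilin (christoffel (MassAspect.warped B q))
      (hess (MassAspect.warped B q) logFst) (1, 0) a b c - (modelJet n).2.2.1 a b c =
      deriv (logRate B) 1 * (a.1 * inner ℝ b.2 c.2) + (1 - logRate B 1) * (1 + logRate B 1) *
        (inner ℝ a.2 b.2 * c.1 + b.1 * inner ℝ a.2 c.2) := by
    rw [h.warped.nablaBilin_hess_logFst, warped_base h.coeff_eq h.fibre_eq, h.hess_base,
      h.hess_base, modelJet_fst_apply, fderiv_logFst_base, modelJet_nabla_apply]
    simp
    ring
  have n1 : ∀ a b c : F n, |a.1 * inner ℝ b.2 c.2| ≤ ‖a‖ * ‖b‖ * ‖c‖ := fun a b c => by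
    rw [abs_mul, mul_assoc]
    exact mul_le_mul (norm_fst_le a) (abs_inner_snd_le b c) (abs_nonneg _) (norm_nonneg _)
  have h1 : |1 - logRate B 1| ≤ 3 := by
    have := abs_le.1 h.rate_le
    rw [abs_le]; constructor <;> linarith
  have h2 : |1 + logRate B 1| ≤ ρ := by rw [add_comm]; exact h.rate_le
  rw [sub_apply, sub_apply, sub_apply, e]
  refine (abs_add_le _ _).trans ?_
  rw [abs_mul, abs_mul ((1 - _) * _), abs_mul (1 - _)]
  have h3 : |inner ℝ a.2 b.2 * c.1 + b.1 * inner ℝ a.2 c.2| ≤ 2 * (‖a‖ * ‖b‖ * ‖c‖) := by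
    refine (abs_add_le _ _).trans ?_
    have m1 := n1 c a b
    have m2 := n1 b a c
    rw [mul_comm (inner ℝ a.2 b.2)]
    calc _ ≤ ‖c‖ * ‖a‖ * ‖b‖ + ‖b‖ * ‖a‖ * ‖c‖ := add_le_add m1 m2
      _ = _ := by ring
  calc _ ≤ ρ * (‖a‖ * ‖b‖ * ‖c‖) + 3 * ρ * (2 * (‖a‖ * ‖b‖ * ‖c‖)) := by
        exact add_le_add (mul_le_mul h.deriv_rate_le (n1 a b c) (abs_nonneg _) hρ)
          (mul_le_mul (mul_le_mul h1 h2 (abs_nonneg _) (by norm_num)) h3 (abs_nonneg _)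
            (by positivity))
    _ = _ := by ring

end IsNearModel

end Normalized

set_option linter.unusedSectionVars false

/-! ### Derivatives of functions of the form `p(x) η(y) + Q(x)`. -/

section Separated

variable {n : ℕ} {p Q : ℝ → ℝ} {η : E (n - 1) → ℝ} {w : F n}

/-- The function `p(x) η(y) + Q(x)`. -/
def separated (p : ℝ → ℝ) (η : E (n - 1) → ℝ) (Q : ℝ → ℝ) (w : F n) : ℝ := p w.1 * η w.2 + Q w.1

lemma contDiffAt_separated {m : ℕ∞ω} (hp : ContDiffAt ℝ m p w.1) (hQ : ContDiffAt ℝ m Q w.1)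
    (hη : ContDiffAt ℝ m η w.2) : ContDiffAt ℝ m (separated p η Q) w :=
  ((ContDiffAt.comp w (f := Prod.fst) hp contDiffAt_fst).mul
    (ContDiffAt.comp w (f := Prod.snd) hη contDiffAt_snd)).add
    (ContDiffAt.comp w (f := Prod.fst) hQ contDiffAt_fst)

lemma fderiv_separated (hp : DifferentiableAt ℝ p w.1) (hQ : DifferentiableAt ℝ Q w.1)
    (hη : DifferentiableAt ℝ η w.2) : fderiv ℝ (separated p η Q) w =
      (deriv p w.1 * η w.2 + deriv Q w.1) • dx n +
        p w.1 • (fderiv ℝ η w.2).comp (ContinuousLinearMap.snd ℝ ℝ (E (n - 1))) := by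
  have h1 : HasFDerivAt (fun y : F n => p y.1) (deriv p w.1 • dx n) w :=
    hp.hasDerivAt.comp_hasFDerivAt w hasFDerivAt_fst
  have h2 : HasFDerivAt (fun y : F n => Q y.1) (deriv Q w.1 • dx n) w :=
    hQ.hasDerivAt.comp_hasFDerivAt w hasFDerivAt_fst
  have h3 : HasFDerivAt (fun y : F n => η y.2)
      ((fderiv ℝ η w.2).comp (ContinuousLinearMap.snd ℝ ℝ (E (n - 1)))) w :=
    hη.hasFDerivAt.comp w hasFDerivAt_snd
  rw [((h1.mul h3).add h2).congr_of_eventuallyEq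
    (f₁ := separated p η Q) (Eventually.of_forall fun y => by simp [separated]) |>.fderiv]
  refine ContinuousLinearMap.ext fun v => ?_
  simp
  ring

/-- In slice directions neither `Q` nor the derivatives of `p` contribute. The transversal second
derivatives are not needed, since `exists_variation_bound` only asks for the slice part of the
Hessian. -/
lemma fderiv_fderiv_separated (hp : ContDiffAt ℝ 2 p w.1) (hQ : ContDiffAt ℝ 2 Q w.1)
    (hη : ContDiffAt ℝ 2 η w.2) {v v' : F n} (hv : v.1 = 0) (hv' : v'.1 = 0) :
    fderiv ℝ (fderiv ℝ (separated p η Q)) w v v' =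
      p w.1 * fderiv ℝ (fderiv ℝ η) w.2 v.2 v'.2 := by
  have hd : DifferentiableAt ℝ (fderiv ℝ (separated p η Q)) w :=
    ((contDiffAt_separated hp hQ hη).fderiv_right (m := 1) (by norm_num)).differentiableAt
      (by norm_num)
  have h1 : HasFDerivAt (fun y : F n => p y.1) (deriv p w.1 • dx n) w :=
    (hp.differentiableAt (by norm_num)).hasDerivAt.comp_hasFDerivAt w hasFDerivAt_fst
  have h2 : HasFDerivAt (fun y : F n => fderiv ℝ η y.2)
      ((fderiv ℝ (fderiv ℝ η) w.2).comp (ContinuousLinearMap.snd ℝ ℝ (E (n - 1)))) w :=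
    ((hη.fderiv_right (m := 1) (by norm_num)).differentiableAt
      (by norm_num)).hasFDerivAt.comp w hasFDerivAt_snd
  have e : (fun y => fderiv ℝ (separated p η Q) y v') =ᶠ[𝓝 w]
      fun y => p y.1 * fderiv ℝ η y.2 v'.2 := by
    filter_upwards [continuousAt_fst.eventually (hp.eventually (by simp)),
      continuousAt_fst.eventually (hQ.eventually (by simp)),
      continuousAt_snd.eventually (hη.eventually (by simp))] with y a b c
    rw [fderiv_separated (a.differentiableAt (by norm_num)) (b.differentiableAt (by norm_num))
      (c.differentiableAt (by norm_num))]
    simp [hv']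
  have h3 := (hd.hasFDerivAt.apply_const v').unique
    ((h1.mul (h2.apply_const v'.2)).congr_of_eventuallyEq e)
  have h4 := congrArg (fun L => L v) h3
  simpa [hv] using h4

end Separated

/-! ### The change of the scalar curvature at the base point of a normalised chart. -/

section MainEstimate

lemma LapseJet.norm_sub_le {V : Type*} [NormedAddCommGroup V] [NormedSpace ℝ V] {J J₀ : LapseJet V}
    {c : ℝ} (h1 : ‖J.1 - J₀.1‖ ≤ c) (h2 : ‖J.2.1 - J₀.2.1‖ ≤ c) (h3 : ‖J.2.2.1 - J₀.2.2.1‖ ≤ c)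
    (h4 : ‖J.2.2.2 - J₀.2.2.2‖ ≤ c) : ‖J - J₀‖ ≤ c :=
  max_le h1 (max_le h2 (max_le h3 h4))

variable {n : ℕ}

set_option maxHeartbeats 1000000 in
/-- The change of the scalar curvature at the base point of a normalised chart. -/
theorem exists_normalized_bound (hn : 3 ≤ n) (C : ℝ) :
    ∃ K r : ℝ, 0 < r ∧ ∀ (σ : ℝ) (B : ℝ → ℝ) (q : E (n - 1) → E (n - 1) →L[ℝ] E (n - 1) →L[ℝ] ℝ)
      (G : F n → F n →L[ℝ] F n →L[ℝ] ℝ) (p Q : ℝ → ℝ) (η : E (n - 1) → ℝ),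
      0 ≤ σ → σ ≤ r → IsNearModel B q (C * σ ^ 2) → IsCloseAt G (warped B q) (1, 0) (C * σ ^ 2) →
      ContDiffAt ℝ 2 p 1 → ContDiffAt ℝ 2 Q 1 → ContDiffAt ℝ 2 η 0 → 0 ≤ p 1 → p 1 ≤ C * σ ^ 2 →
      0 ≤ separated p η Q (1, 0) → separated p η Q (1, 0) ≤ C * p 1 →
      ‖fderiv ℝ η 0‖ ≤ C * σ → ‖hess q η 0‖ ≤ C * σ ^ 2 →
      ∃ ϑ ∈ Icc (1 : ℝ) n, |scalarCoord (addSq G logFst (separated p η Q)) (1, 0) -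
        scalarCoord G (1, 0) + ϑ * (deriv p 1 * η 0 + deriv Q 1 - n * separated p η Q (1, 0))| ≤
          K * p 1 * σ ^ 2 := by
  have hm : ((n - 1 : ℕ) : ℝ) + 1 = n := by
    have : 1 ≤ n := by omega
    push_cast [this]; ring
  have hm2 : (2 : ℝ) ≤ ((n - 1 : ℕ) : ℝ) := by
    have : 2 ≤ n - 1 := by omega
    exact_mod_cast this
  -- Inversion is continuous at the model, which yields one bound for the inverses of all nearby
  -- metrics.
  obtain ⟨r₁, hr₁, hinv⟩ : ∃ r₁ > 0, ∀ G : F n →L[ℝ] F n →L[ℝ] ℝ, ‖G - (modelJet n).1‖ < r₁ →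
      ‖G.inverse‖ < ‖(modelJet n).1.inverse‖ + 1 := by
    have hc : ContinuousAt (ContinuousLinearMap.inverse : (F n →L[ℝ] F n →L[ℝ] ℝ) → _)
        (modelJet n).1 :=
      ((isInvertible_modelJet n).contDiffAt_map_inverse (n := 1)).continuousAt
    obtain ⟨r₁, hr₁, h⟩ := Metric.eventually_nhds_iff_ball.1
      (hc.norm.eventually (gt_mem_nhds (lt_add_one _)))
    exact ⟨r₁, hr₁, fun G hG => h G (mem_ball_iff_norm.2 hG)⟩
  -- Two stages: `A₀` bounds the inverse metric and `d log x`. These bounds control the Hessian of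
  -- `log x`, and `A` bounds that as well, as the estimate of its covariant derivative requires.
  set A₀ := ‖(modelJet n).1.inverse‖ + 1 + ‖dx n‖ with hA₀
  have hA₀0 : 0 ≤ A₀ := by positivity
  set A := A₀ + ‖(modelJet n).2.1‖ + 1 + 2 * A₀ ^ 2 with hA
  have hA0 : 0 ≤ A := by positivity
  set C' := |C| * (1 + 2 * A ^ 2 + (8 * A ^ 2 + 4 * A ^ 3) + 7 + |C| * (1 + 2 * A)) with hC'
  have hCC : |C| ≤ C' := by
    have : 0 ≤ |C| * (2 * A ^ 2 + (8 * A ^ 2 + 4 * A ^ 3) + 7 + |C| * (1 + 2 * A)) := by positivity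
    rw [hC']; linarith
  obtain ⟨K, r, hr, hmain⟩ := (isModelJet_modelJet n).exists_variation_bound hm2 C'
  have hlim : Tendsto (fun σ : ℝ => |C| * σ ^ 2) (𝓝 0) (𝓝 0) := by
    have : Continuous fun σ : ℝ => |C| * σ ^ 2 := by fun_prop
    simpa using this.tendsto 0
  obtain ⟨r₂, hr₂, hr₂'⟩ := Metric.eventually_nhds_iff_ball.1
    (hlim.eventually (gt_mem_nhds (lt_min hr₁ one_pos)))
  refine ⟨K, min (min r (r₂ / 2)) 1, by positivity, ?_⟩
  intro σ B q G p Q η hσ hσr hB hG hp hQ hη hp0 hpC hδ0 hδC hη1 hη2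
  have hσ1 : σ ≤ 1 := hσr.trans (min_le_right _ _)
  have hCσ : |C| * σ ^ 2 < min r₁ 1 := hr₂' σ (by
    rw [Metric.mem_ball, Real.dist_eq, sub_zero, abs_of_nonneg hσ]
    linarith [hσr.trans ((min_le_left _ _).trans (min_le_right _ _))])
  have hle : C * σ ^ 2 ≤ |C| * σ ^ 2 := by gcongr; exact le_abs_self C
  have hρ1 : C * σ ^ 2 ≤ 1 := hle.trans (hCσ.trans_le (min_le_right _ _)).le
  have hρ0 : 0 ≤ C * σ ^ 2 := (abs_nonneg _).trans hB.rate_le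
  have hbase : warped B q (1, 0) = (modelJet n).1 := warped_base hB.coeff_eq hB.fibre_eq
  have hGs : ‖G (1, 0) - (modelJet n).1‖ ≤ C * σ ^ 2 := hbase ▸ hG.norm_le
  have hGi₀ : ‖(G (1, 0)).inverse‖ ≤ A₀ := by
    have := hinv _ (hGs.trans_lt (hle.trans_lt (hCσ.trans_le (min_le_left _ _))))
    linarith [norm_nonneg (dx n)]
  have ht₀ : ‖fderiv ℝ (logFst (n := n)) (1, 0)‖ ≤ A₀ := by
    rw [fderiv_logFst_base]; linarith [norm_nonneg (modelJet n).1.inverse]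
  have hA₀A : A₀ ≤ A := by rw [hA]; linarith [norm_nonneg (modelJet n).2.1, sq_nonneg A₀]
  have hH₁ : ‖hess G logFst (1, 0) - (modelJet n).2.1‖ ≤ (1 + 2 * A₀ ^ 2) * (C * σ ^ 2) := by
    have := (norm_sub_le_norm_sub_add_norm_sub (hess G logFst (1, 0))
      (hess (warped B q) logFst (1, 0)) (modelJet n).2.1).trans
      (add_le_add (hG.norm_hess_sub_le hGi₀ ht₀) hB.norm_hess_sub_le)
    linarith
  have hH₂ : ‖hess G logFst (1, 0)‖ ≤ A := by
    have h1 := norm_le_norm_sub_add (hess G logFst (1, 0)) (modelJet n).2.1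
    have h2 : (1 + 2 * A₀ ^ 2) * (C * σ ^ 2) ≤ (1 + 2 * A₀ ^ 2) * 1 := by gcongr
    rw [hA]; linarith
  have hGi := hGi₀.trans hA₀A
  have ht := ht₀.trans hA₀A
  have hl3 : ContDiffAt ℝ 3 (logFst (n := n)) (1, 0) := contDiffAt_logFst one_ne_zero
  have hDH : ‖nablaBilin (christoffel G) (hess G logFst) (1, 0) - (modelJet n).2.2.1‖ ≤
      (8 * A ^ 2 + 4 * A ^ 3 + 7) * (C * σ ^ 2) := by
    have := (norm_sub_le_norm_sub_add_norm_sub (nablaBilin (christoffel G) (hess G logFst) (1, 0))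
      (nablaBilin (christoffel (warped B q)) (hess (warped B q) logFst) (1, 0))
      (modelJet n).2.2.1).trans (add_le_add (hG.norm_nabla_hess_sub_le hGi ht hH₂ hρ1 hl3)
        (hB.norm_nabla_hess_sub_le hρ1))
    linarith
  set δ := separated p η Q with hδ
  have hδd : fderiv ℝ δ (1, 0) = (deriv p 1 * η 0 + deriv Q 1) • dx n +
      p 1 • (fderiv ℝ η 0).comp (ContinuousLinearMap.snd ℝ ℝ (E (n - 1))) :=
    fderiv_separated (w := ((1, 0) : F n)) (hp.differentiableAt (by norm_num)) (hQ.differentiableAt (by norm_num))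
      (hη.differentiableAt (by norm_num))
  set δt := deriv p 1 * η 0 + deriv Q 1
  set α := p 1 • (fderiv ℝ η 0).comp (ContinuousLinearMap.snd ℝ ℝ (E (n - 1))) with hα
  let S : F n →L[ℝ] F n →L[ℝ] F n :=
    christoffel G (1, 0) - christoffel (warped B q) (1, 0)
  -- The slice Hessian of `δ`: the intrinsic Hessian of `η`, scaled by `p`, corrected by the
  -- difference of the connections of `G` and of the warped product.
  let T : F n →L[ℝ] F n →L[ℝ] ℝ := p 1 • liftN (hess q η 0) -
    (ContinuousLinearMap.compL ℝ (F n) (F n) ℝ α).comp S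
  have hδ2 : ContDiffAt ℝ 2 δ (1, 0) := contDiffAt_separated (w := ((1, 0) : F n)) hp hQ hη
  have hαn : ‖α‖ ≤ |C| * p 1 * σ := by
    have h1 : ‖(fderiv ℝ η 0).comp (ContinuousLinearMap.snd ℝ ℝ (E (n - 1)))‖ ≤ C * σ := by
      refine ((ContinuousLinearMap.opNorm_comp_le _ _).trans ?_).trans hη1
      exact mul_le_of_le_one_right (norm_nonneg _) (ContinuousLinearMap.norm_snd_le ..)
    rw [hα, norm_smul, Real.norm_of_nonneg hp0]
    calc _ ≤ p 1 * (C * σ) := by gcongr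
      _ ≤ p 1 * (|C| * σ) := by gcongr; exact le_abs_self C
      _ = _ := by ring
  have hJ : ‖((G (1, 0), hess G logFst (1, 0), nablaBilin (christoffel G) (hess G logFst) (1, 0),
      δ (1, 0)) : LapseJet (F n)) - modelJet n‖ ≤ C' * σ ^ 2 := by
    have e0 : (1 + 2 * A₀ ^ 2) ≤ (1 + 2 * A ^ 2) := by gcongr
    have hab := abs_nonneg C
    have cc : ∀ {a b : ℝ}, a ≤ b * (C * σ ^ 2) → 0 ≤ b → |C| * b ≤ C' → a ≤ C' * σ ^ 2 :=
      fun {a b} h hb h' => h.trans (by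
        calc b * (C * σ ^ 2) ≤ b * (|C| * σ ^ 2) := by gcongr
          _ = (|C| * b) * σ ^ 2 := by ring
          _ ≤ _ := by gcongr)
    have hA2 : 0 ≤ A ^ 2 := by positivity
    have hA3 : 0 ≤ A ^ 3 := by positivity
    have hCA : 0 ≤ |C| * (1 + 2 * A) := by positivity
    have hCA' : 0 ≤ |C| * A := by positivity
    have b1 : |C| * (1 + 2 * A ^ 2) ≤ C' := mul_le_mul_of_nonneg_left (by linarith) hab
    have b2 : |C| * (8 * A ^ 2 + 4 * A ^ 3 + 7) ≤ C' :=
      mul_le_mul_of_nonneg_left (by linarith) hab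
    have b3 : |C| * |C| ≤ C' := mul_le_mul_of_nonneg_left (by linarith) hab
    have b4 : δ (1, 0) ≤ |C| * (C * σ ^ 2) :=
      calc _ ≤ C * p 1 := hδC
        _ ≤ |C| * p 1 := mul_le_mul_of_nonneg_right (le_abs_self C) hp0
        _ ≤ _ := mul_le_mul_of_nonneg_left hpC hab
    have b5 : ‖δ (1, 0) - 0‖ ≤ |C| * (C * σ ^ 2) := by
      rwa [sub_zero, Real.norm_of_nonneg hδ0]
    exact LapseJet.norm_sub_le (cc (b := 1) (by rw [one_mul]; exact hGs) zero_le_one (by rwa [mul_one]))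
      (cc (hH₁.trans (mul_le_mul_of_nonneg_right e0 hρ0)) (by positivity) b1)
      (cc hDH (by positivity) b2) (cc b5 hab b3)
  have hTn : ‖T‖ ≤ C' * p 1 * σ ^ 2 := by
    have h1 : ‖p 1 • liftN (n := n) (hess q η 0)‖ ≤ p 1 * (|C| * σ ^ 2) := by
      rw [norm_smul, Real.norm_of_nonneg hp0]
      gcongr
      refine opNorm₂_le (by positivity) fun v w => ?_
      rw [liftN_apply]
      refine ((hess q η 0).le_opNorm₂ _ _).trans ?_
      rw [mul_assoc]
      have := norm_snd_le v
      have := norm_snd_le w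
      gcongr
      exact hη2.trans hle
    have h2 : ‖(ContinuousLinearMap.compL ℝ (F n) (F n) ℝ α).comp S‖ ≤
        (|C| * p 1 * σ) * (2 * A * (C * σ ^ 2)) := by
      refine opNorm₂_le (by positivity) fun v w => ?_
      calc _ ≤ ‖α‖ * ‖diffChristoffel G (warped B q) (1, 0) v w‖ := α.le_opNorm _
        _ ≤ (|C| * p 1 * σ) * (2 * A * (C * σ ^ 2) * (‖v‖ * ‖w‖)) := by
            gcongr
            exact hG.norm_diffChristoffel_le hGi v w
        _ = _ := by ring
    calc _ ≤ p 1 * (|C| * σ ^ 2) + (|C| * p 1 * σ) * (2 * A * (C * σ ^ 2)) :=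
          (norm_sub_le _ _).trans (add_le_add h1 h2)
      _ ≤ p 1 * (|C| * σ ^ 2) + (|C| * p 1 * 1) * (2 * A * (|C| * σ ^ 2)) := by gcongr
      _ = (|C| * (1 + |C| * (2 * A))) * p 1 * σ ^ 2 := by ring
      _ ≤ _ := by
          gcongr
          refine mul_le_mul_of_nonneg_left ?_ (abs_nonneg C)
          have : 0 ≤ 2 * A ^ 2 + (8 * A ^ 2 + 4 * A ^ 3) + 7 + |C| := by positivity
          linarith
  have hC'1 : C * p 1 ≤ C' * p 1 := by gcongr; exact (le_abs_self C).trans hCC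
  have hP : p 1 ≤ C' :=
    calc p 1 ≤ C * σ ^ 2 := hpC
      _ ≤ |C| * σ ^ 2 := hle
      _ ≤ |C| * 1 := by gcongr; exact pow_le_one₀ hσ hσ1
      _ ≤ C' := by rwa [mul_one]
  -- In slice directions the fibre part of the warped connection is that of `q`, which produces
  -- `hess q η`. The radial part of the connection of `G` enters with coefficient `δt` and is the
  -- Hessian of `log x`, because `log x` has no second derivatives along the slices.
  have hD : ∀ v w, dx n v = 0 → dx n w = 0 →
      hess G δ (1, 0) v w = T v w + δt * hess G logFst (1, 0) v w := by
    intro v w hv hw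
    have hv' : v = (0, v.2) := Prod.ext hv rfl
    have hw' : w = (0, w.2) := Prod.ext hw rfl
    have e1 : fderiv ℝ (fderiv ℝ logFst) ((1, 0) : F n) v w = 0 := by
      rw [fderiv_fderiv_logFst one_ne_zero, show v.1 = 0 from hv]; ring
    have e2 := hB.warped.christoffel_fibre v.2 w.2
    rw [← hv', ← hw'] at e2
    have e3 := fderiv_fderiv_separated (w := ((1, 0) : F n)) hp hQ hη hv hw
    simp only [hess_apply, e1, hδd, fderiv_logFst_base, T, S, sub_apply, smul_apply, liftN_apply]
    rw [← hδ] at e3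
    rw [e3, ← e2]
    simp [α]
    ring
  obtain ⟨hu, ϑ, hϑ, hfin⟩ := hmain (G (1, 0), hess G logFst (1, 0),
    nablaBilin (christoffel G) (hess G logFst) (1, 0), δ (1, 0)) σ (p 1) δt α
    (hess G δ (1, 0)) T hσ (hσr.trans ((min_le_left _ _).trans (min_le_left _ _))) hJ
    hG.metric.symm hp0 hP hδ0 (hδC.trans hC'1) (by rw [modelJet_inverse_dx]; simp [hα])
    (hαn.trans (by gcongr)) hTn hD
  rw [hm] at hϑ hfin
  refine ⟨ϑ, hϑ, ?_⟩
  have hu' : 0 < fderiv ℝ logFst (1, 0) (grad G logFst (1, 0)) := by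
    unfold grad sharp; rw [fderiv_logFst_base]; exact hu
  have hpert : IsPerturbationAt G logFst δ (1, 0) := ⟨hG.metric, hl3, hδ2, by positivity⟩
  rw [hpert.scalarCoord_addSq hu'.ne']
  unfold grad sharp
  rw [hδd, fderiv_logFst_base]
  exact hfin

end MainEstimate

set_option linter.unusedSectionVars false

/-! ### Iterated covariant derivatives as multilinear maps. -/

section IteratedDerivatives

variable {V : Type*} [NormedAddCommGroup V] [NormedSpace ℝ V]
  {Γ : V → V →L[ℝ] V →L[ℝ] V} {L : V → V →L[ℝ] V →L[ℝ] ℝ} {u : V}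

lemma nablaBilin_apply' (hL : DifferentiableAt ℝ L u) (v w z : V) :
    nablaBilin Γ L u v w z = fderiv ℝ (fun y => L y w z) u v - L u (Γ u v w) z - L u w (Γ u v z) := by
  rw [nablaBilin_apply, fderiv_apply_apply hL]

lemma covDeriv_toTwoTensor (hL : DifferentiableAt ℝ L u) (v : Fin 3 → V) :
    covDeriv Γ (toTwoTensor L) u v = nablaBilin Γ L u (v 0) (v 1) (v 2) := by
  rw [nablaBilin_apply' hL]
  simp only [covDeriv, Fin.sum_univ_two, toTwoTensor]
  have e0 : Fin.tail v 0 = v 1 := rfl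
  have e1 : Fin.tail v 1 = v 2 := rfl
  simp [Function.update, e0, e1]
  ring

lemma iterCovDeriv_one (hL : DifferentiableAt ℝ L u) (v : Fin 3 → V) :
    iterCovDeriv Γ (toTwoTensor L) 1 u v = nablaBilin Γ L u (v 0) (v 1) (v 2) :=
  covDeriv_toTwoTensor hL v

lemma iterCovDeriv_two (hL : ∀ᶠ y in 𝓝 u, DifferentiableAt ℝ L y)
    (hN : DifferentiableAt ℝ (nablaBilin Γ L) u) (v : Fin 4 → V) :
    iterCovDeriv Γ (toTwoTensor L) 2 u v =
      nablaTri Γ (nablaBilin Γ L) u (v 0) (v 1) (v 2) (v 3) := by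
  have e : (fun y => iterCovDeriv Γ (toTwoTensor L) 1 y (Fin.tail v)) =ᶠ[𝓝 u]
      fun y => nablaBilin Γ L y (v 1) (v 2) (v 3) := by
    filter_upwards [hL] with y hy
    rw [iterCovDeriv_one hy]; rfl
  change covDeriv Γ (iterCovDeriv Γ (toTwoTensor L) 1) u v = _
  have h0 := iterCovDeriv_one (Γ := Γ) hL.self_of_nhds
  unfold covDeriv
  rw [e.fderiv_eq, (((hN.hasFDerivAt.apply_const (v 1)).apply_const (v 2)).apply_const
    (v 3)).fderiv]
  change _ - ∑ i : Fin 3, _ = _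
  rw [Fin.sum_univ_three, h0, h0, h0]
  simp [nablaTri, Function.update, Fin.tail]
  ring

end IteratedDerivatives

/-! ### Covariance of Hessians and covariant derivatives, in particular under affine maps. -/

section Covariance

variable {V W : Type*} [NormedAddCommGroup V] [NormedSpace ℝ V] [FiniteDimensional ℝ V]
  [NormedAddCommGroup W] [NormedSpace ℝ W] [FiniteDimensional ℝ W]

/-- Both sides of the Koszul formula scale alike. The fibre metric of a normalised chart is a
pull-back divided by a constant, so its Hessians are those of the pull-back. -/
lemma christoffel_const_smul {G : V → V →L[ℝ] V →L[ℝ] ℝ} {u : V} (hG : DifferentiableAt ℝ G u)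
    (hi : (G u).IsInvertible) {c : ℝ} (hc : c ≠ 0) :
    christoffel (fun y => c • G y) u = christoffel G u := by
  have hi' : (c • G u).IsInvertible := by
    obtain ⟨e, he⟩ := hi
    exact ⟨e.trans (ContinuousLinearEquiv.smulLeft (Units.mk0 c hc)), by rw [← he]; ext; rfl⟩
  have hd : fderiv ℝ (fun y => c • G y) u = c • fderiv ℝ G u := fderiv_const_smul hG c
  refine ContinuousLinearMap.ext fun v => ContinuousLinearMap.ext fun w => hi.injective ?_
  ext z
  have := christoffel_koszul (G := fun y => c • G y) hi' v w z
  rw [hd] at this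
  rw [christoffel_koszul hi]
  apply mul_left_cancel₀ hc
  simp at this
  rw [this]
  ring

/-- Covariance of the Hessian. -/
lemma IsLocalPullback.hess_comp {φ : V → W} {G : W → W →L[ℝ] W →L[ℝ] ℝ}
    {G' : V → V →L[ℝ] V →L[ℝ] ℝ} {u : V} (h : IsLocalPullback φ G G' u) {f : W → ℝ}
    (hs : ∀ᶠ y in 𝓝 (φ u), ∀ v w, G y v w = G y w v)
    (hf : ContDiffAt ℝ 2 f (φ u)) (v w : V) :
    hess G' (fun y => f (φ y)) u v w = hess G f (φ u) (fderiv ℝ φ u v) (fderiv ℝ φ u w) := by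
  have hφ : DifferentiableAt ℝ φ u := h.contDiffAt.differentiableAt (by norm_num)
  have hφ' : DifferentiableAt ℝ (fderiv ℝ φ) u :=
    (h.contDiffAt.fderiv_right (m := 2) (by norm_num)).differentiableAt (by norm_num)
  have hf' : DifferentiableAt ℝ (fderiv ℝ f) (φ u) :=
    (hf.fderiv_right (m := 1) (by norm_num)).differentiableAt (by norm_num)
  have hc : ContDiffAt ℝ 2 (fun y => f (φ y)) u := hf.comp u (h.contDiffAt.of_le (by norm_num))
  have hc' : DifferentiableAt ℝ (fderiv ℝ fun y => f (φ y)) u :=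
    (hc.fderiv_right (m := 1) (by norm_num)).differentiableAt (by norm_num)
  have e : (fun y => fderiv ℝ (fun y => f (φ y)) y w) =ᶠ[𝓝 u]
      fun y => fderiv ℝ f (φ y) (fderiv ℝ φ y w) := by
    filter_upwards [h.contDiffAt.continuousAt.eventually (hf.eventually (by simp)),
      h.contDiffAt.eventually (by simp)] with y a b
    have := (a.differentiableAt (by norm_num)).hasFDerivAt.comp y
      (b.differentiableAt (by norm_num)).hasFDerivAt
    rw [show (fun y => f (φ y)) = f ∘ φ from rfl, this.fderiv]; rfl
  have h1 : HasFDerivAt (fun y => fderiv ℝ f (φ y)) _ u := hf'.hasFDerivAt.comp u hφ.hasFDerivAt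
  have h2 := (hc'.hasFDerivAt.apply_const w).unique
    ((h1.clm_apply (hφ'.hasFDerivAt.apply_const w)).congr_of_eventuallyEq e)
  have h3 := congrArg (fun L => L v) h2
  have h4 := h.christoffel_eq hs v w
  have h5 := e.self_of_nhds
  have h6 : fderiv ℝ (fun y => f (φ y)) u (christoffel G' u v w) =
      fderiv ℝ f (φ u) (fderiv ℝ φ u (christoffel G' u v w)) := by
    have := (hf.differentiableAt (by norm_num)).hasFDerivAt.comp u hφ.hasFDerivAt
    rw [show (fun y => f (φ y)) = f ∘ φ from rfl, this.fderiv]; rfl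
  rw [hess_apply, hess_apply, h6, h4, map_add]
  simp at h3
  rw [h3]
  ring

section Affine

variable (c : W) (A : V ≃L[ℝ] W) {G : W → W →L[ℝ] W →L[ℝ] ℝ} {L : W → W →L[ℝ] W →L[ℝ] ℝ} {u : V}

/-- The pull-back of a bilinear form under the affine map `y ↦ c + A y`. -/
def affinePullback (G : W → W →L[ℝ] W →L[ℝ] ℝ) (y : V) : V →L[ℝ] V →L[ℝ] ℝ :=
  (G (c + A y)).bilinearComp (A : V →L[ℝ] W) (A : V →L[ℝ] W)

lemma hasFDerivAt_affine : HasFDerivAt (fun y => c + A y) (A : V →L[ℝ] W) u :=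
  (A.hasFDerivAt).const_add c

lemma fderiv_affine : fderiv ℝ (fun y => c + A y) u = (A : V →L[ℝ] W) :=
  (hasFDerivAt_affine c A).fderiv

lemma contDiff_affine {m : ℕ∞ω} : ContDiff ℝ m (fun y => c + A y) := contDiff_const.add A.contDiff

lemma affinePullback_apply (v w : V) : affinePullback c A G u v w = G (c + A u) (A v) (A w) := by
  simp [affinePullback]

lemma isLocalPullback_affine (h : IsMetricAt G (c + A u)) :
    IsLocalPullback (fun y => c + A y) G (affinePullback c A G) u :=
  ⟨(contDiff_affine c A).contDiffAt, by rw [fderiv_affine]; exact ⟨A, rfl⟩, h.contDiffAt,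
    h.invertible, Eventually.of_forall fun y => by rw [fderiv_affine]; rfl⟩

lemma isMetricAt_affine (h : IsMetricAt G (c + A u)) : IsMetricAt (affinePullback c A G) u :=
  ⟨(isLocalPullback_affine c A h).contDiffAt_pullback,
    (isLocalPullback_affine c A h).invertible_pullback,
    ((contDiff_affine c A (m := 0)).continuous.tendsto u).eventually h.eventually_symm |>.mono
      fun y hy v w => by rw [affinePullback_apply, affinePullback_apply, hy]⟩

lemma apply_christoffel_affine (h : IsMetricAt G (c + A u)) (v w : V) :
    A (christoffel (affinePullback c A G) u v w) = christoffel G (c + A u) (A v) (A w) := by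
  have := (isLocalPullback_affine c A h).christoffel_eq h.eventually_symm v w
  have e : fderiv ℝ (fun y => c + A y) = fun _ => (A : V →L[ℝ] W) := by
    ext1 y; exact fderiv_affine c A
  rw [e] at this
  simpa using this

lemma scalarCoord_affine (h : IsMetricAt G (c + A u)) :
    scalarCoord (affinePullback c A G) u = scalarCoord G (c + A u) :=
  (isLocalPullback_affine c A h).scalarCoord_eq h.eventually_symm

lemma nablaBilin_affine (h : IsMetricAt G (c + A u)) (hL : DifferentiableAt ℝ L (c + A u))
    (v w z : V) : nablaBilin (christoffel (affinePullback c A G)) (affinePullback c A L) u v w z =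
      nablaBilin (christoffel G) L (c + A u) (A v) (A w) (A z) := by
  have h1 : HasFDerivAt (fun y => L (c + A y)) _ u :=
    hL.hasFDerivAt.comp u (hasFDerivAt_affine c A)
  have hd : DifferentiableAt ℝ (affinePullback c A L) u := by
    have : ContDiff ℝ 1 (fun B : W →L[ℝ] W →L[ℝ] ℝ =>
        B.bilinearComp (A : V →L[ℝ] W) (A : V →L[ℝ] W)) := by
      rw [contDiff_iff_contDiffAt]
      exact fun B => contDiffAt_bilinearComp contDiffAt_id contDiffAt_const contDiffAt_const
    exact (this.differentiable (by norm_num)).differentiableAt.comp u h1.differentiableAt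
  rw [nablaBilin_apply' hd, nablaBilin_apply, affinePullback_apply, affinePullback_apply,
    apply_christoffel_affine c A h, apply_christoffel_affine c A h]
  simp only [affinePullback_apply]
  rw [((h1.apply_const (A w)).apply_const (A z)).fderiv]
  simp

/-- `T'` is only assumed to agree with the pull-back of `T` near `u`: it will be the covariant
derivative of a pulled-back tensor, for which that agreement is `nablaBilin_affine`. -/
lemma nablaTri_affine (h : IsMetricAt G (c + A u)) {T : W → W →L[ℝ] W →L[ℝ] W →L[ℝ] ℝ}
    {T' : V → V →L[ℝ] V →L[ℝ] V →L[ℝ] ℝ} (hT : DifferentiableAt ℝ T (c + A u))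
    (hT' : DifferentiableAt ℝ T' u)
    (e : ∀ᶠ y in 𝓝 u, ∀ v w z, T' y v w z = T (c + A y) (A v) (A w) (A z)) (v w z y : V) :
    nablaTri (christoffel (affinePullback c A G)) T' u v w z y =
      nablaTri (christoffel G) T (c + A u) (A v) (A w) (A z) (A y) := by
  have h1 : HasFDerivAt (fun y => T (c + A y)) _ u :=
    hT.hasFDerivAt.comp u (hasFDerivAt_affine c A)
  have h2 := (((hT'.hasFDerivAt.apply_const w).apply_const z).apply_const y).unique
    ((((h1.apply_const (A w)).apply_const (A z)).apply_const (A y)).congr_of_eventuallyEq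
      (e.mono fun a ha => ha w z y))
  have h3 := congrArg (fun L => L v) h2
  simp at h3
  rw [nablaTri, nablaTri, h3]
  simp only [e.self_of_nhds, apply_christoffel_affine c A h]

end Affine

end Covariance

set_option linter.unusedSectionVars false

/-! ### Linear isometries from Euclidean space. -/

section Isometry

/-- An orthogonal basis for `B`, divided by the lengths of its vectors, is the image of the standard
basis. -/
lemma exists_isometry {d : ℕ} {B : E d →L[ℝ] E d →L[ℝ] ℝ} (hs : ∀ v w, B v w = B w v)
    (hp : ∀ v, v ≠ 0 → 0 < B v v) :
    ∃ f : E d ≃L[ℝ] E d, ∀ v w, B (f v) (f w) = inner ℝ v w := by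
  let B' : LinearMap.BilinForm ℝ (E d) :=
    (ContinuousLinearMap.coeLM ℝ).comp (B : E d →ₗ[ℝ] E d →L[ℝ] ℝ)
  have hB' : ∀ v w, B' v w = B v w := fun _ _ => rfl
  obtain ⟨b₀, hb₀⟩ := LinearMap.BilinForm.exists_orthogonal_basis (B := B') ⟨hs⟩
  let b := b₀.reindex (finCongr (finrank_euclideanSpace_fin (𝕜 := ℝ) (n := d)))
  have hb : ∀ i j, i ≠ j → B (b i) (b j) = 0 := fun i j hij => by
    have := hb₀ (i := (finCongr (finrank_euclideanSpace_fin (𝕜 := ℝ) (n := d))).symm i)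
      (j := (finCongr (finrank_euclideanSpace_fin (𝕜 := ℝ) (n := d))).symm j)
      (fun h => hij ((finCongr _).symm.injective h))
    simpa [b, hB'] using this
  have hbp : ∀ i, 0 < B (b i) (b i) := fun i => hp _ (b.ne_zero i)
  let c := b.unitsSMul fun i => Units.mk0 (Real.sqrt (B (b i) (b i)))⁻¹
    (inv_ne_zero (Real.sqrt_pos.2 (hbp i)).ne')
  have hc : ∀ i, c i = (Real.sqrt (B (b i) (b i)))⁻¹ • b i := fun i => by
    simp [c, Module.Basis.unitsSMul_apply, Units.smul_def]
  have hcc : ∀ i j, B (c i) (c j) = if i = j then 1 else 0 := fun i j => by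
    split_ifs with h
    · subst h
      have := (Real.sqrt_pos.2 (hbp i)).ne'
      simp only [hc, map_smul, smul_apply, smul_eq_mul]
      field_simp
      rw [Real.sq_sqrt (hbp i).le]
    · simp [hc, hb i j h]
  let f : E d ≃ₗ[ℝ] E d := (WithLp.linearEquiv 2 ℝ (Fin d → ℝ)).trans c.equivFun.symm
  have hf : ∀ v, f v = ∑ i, v i • c i := fun v => c.equivFun_symm_apply _
  refine ⟨f.toContinuousLinearEquiv, fun v w => ?_⟩
  change B (f v) (f w) = _
  rw [hf, hf, PiLp.inner_apply]
  simp only [map_sum, map_smul, sum_apply, smul_apply, hcc, smul_eq_mul]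
  simp [mul_comm]

end Isometry

/-! ### Locality of the metric notions. -/

section Congruence

variable {V : Type*} [NormedAddCommGroup V] [NormedSpace ℝ V] [FiniteDimensional ℝ V]
  {G G₀ G₁ : V → V →L[ℝ] V →L[ℝ] ℝ} {u : V} {ρ : ℝ}

lemma IsMetricAt.congr (h : IsMetricAt G₀ u) (e : G₁ =ᶠ[𝓝 u] G₀) : IsMetricAt G₁ u :=
  ⟨h.contDiffAt.congr_of_eventuallyEq e, e.self_of_nhds ▸ h.invertible, by
    filter_upwards [e, h.eventually_symm] with y a b v w
    rw [a, b]⟩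

lemma christoffel_congr (e : G₀ =ᶠ[𝓝 u] G₁) : christoffel G₀ =ᶠ[𝓝 u] christoffel G₁ := by
  filter_upwards [e.eventuallyEq_nhds] with y hy
  unfold christoffel
  rw [hy.fderiv_eq, hy.eq_of_nhds]

lemma nablaBilin_congr {Γ Γ' : V → V →L[ℝ] V →L[ℝ] V} {L L' : V → V →L[ℝ] V →L[ℝ] ℝ}
    (e : Γ =ᶠ[𝓝 u] Γ') (e' : L =ᶠ[𝓝 u] L') : nablaBilin Γ L =ᶠ[𝓝 u] nablaBilin Γ' L' := by
  filter_upwards [e.eventuallyEq_nhds, e'.eventuallyEq_nhds] with y h h'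
  unfold nablaBilin
  rw [h'.fderiv_eq, h.eq_of_nhds, h'.eq_of_nhds]

lemma IsCloseAt.congr (h : IsCloseAt G G₀ u ρ) (e : G₁ =ᶠ[𝓝 u] G₀) : IsCloseAt G G₁ u ρ := by
  have e1 := christoffel_congr e
  have e2 : G - G₁ =ᶠ[𝓝 u] G - G₀ := e.mono fun y hy => by simp [hy]
  have e3 := nablaBilin_congr e1 e2
  refine ⟨h.metric, h.base.congr e, e.self_of_nhds ▸ h.norm_le, e3.self_of_nhds ▸ h.nabla_le, ?_⟩
  intro v w z y
  have := h.nabla₂_le v w z y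
  unfold nablaTri at this ⊢
  rwa [e3.fderiv_eq, e3.self_of_nhds, e1.self_of_nhds]

end Congruence

/-! ### The warping function of the reference metric and its logarithmic rate. -/

section WarpingFunction

/-- The warping function of the reference metric. -/
def refWarp (k x : ℝ) : ℝ := (1 - k / 4 * x ^ 2) ^ 2 / x ^ 2

/-- The warping function of the reference metric in a normalised chart. -/
def normalWarp (κ w : ℝ) : ℝ := (1 - κ * w ^ 2) ^ 2 / ((1 - κ) ^ 2 * w ^ 2)

/-- Rescaling `x` to `x w` and the slices by `x / (1 - κ)`, where `κ = k x² / 4`, leaves `κ` as the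
only trace of `k` and of the point; the model is `κ = 0`, so the deviation is of order `x²`. -/
lemma refWarp_mul {k x : ℝ} (hx : x ≠ 0) (w : ℝ) :
    refWarp k (x * w) * (x / (1 - k / 4 * x ^ 2)) ^ 2 = normalWarp (k / 4 * x ^ 2) w := by
  unfold refWarp normalWarp
  rcases eq_or_ne w 0 with rfl | hw
  · simp
  field_simp

variable {κ : ℝ}

lemma logRate_normalWarp (hκ : 1 - κ ≠ 0) {w : ℝ} (hw : w ≠ 0) (h : 1 - κ * w ^ 2 ≠ 0) :
    logRate (normalWarp κ) w = -2 * κ * w ^ 2 / (1 - κ * w ^ 2) - 1 := by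
  have h1 : HasDerivAt (fun w : ℝ => 1 - κ * w ^ 2) (-(κ * (2 * w))) w := by
    simpa using ((hasDerivAt_pow 2 w).const_mul κ).const_sub 1
  have h2 : HasDerivAt (fun w : ℝ => (1 - κ) ^ 2 * w ^ 2) ((1 - κ) ^ 2 * (2 * w)) w := by
    simpa using (hasDerivAt_pow 2 w).const_mul ((1 - κ) ^ 2)
  have h3 : HasDerivAt (normalWarp κ) _ w :=
    (h1.fun_pow 2).fun_div h2 (mul_ne_zero (pow_ne_zero 2 hκ) (pow_ne_zero 2 hw))
  rw [logRate, h3.deriv, normalWarp]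
  have e : κ * w ^ 2 = 1 - (1 - κ * w ^ 2) := by ring
  rw [show -2 * κ * w ^ 2 = -2 * (1 - (1 - κ * w ^ 2)) by ring,
    show -(κ * (2 * w)) = -(2 * (1 - (1 - κ * w ^ 2)) / w) by field_simp; ring]
  generalize 1 - κ * w ^ 2 = D at h ⊢
  simp
  field_simp

lemma deriv_logRate_normalWarp (hκ : 1 - κ ≠ 0) :
    deriv (logRate (normalWarp κ)) 1 = -4 * κ / (1 - κ) ^ 2 := by
  have hc : ContinuousAt (fun w : ℝ => 1 - κ * w ^ 2) 1 := by fun_prop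
  have e : logRate (normalWarp κ) =ᶠ[𝓝 1] fun w => -2 * κ * w ^ 2 / (1 - κ * w ^ 2) - 1 := by
    filter_upwards [isOpen_ne.mem_nhds (one_ne_zero (α := ℝ)),
      hc.eventually_ne (by simpa using hκ)] with w a b
    exact logRate_normalWarp hκ a b
  have h1 : HasDerivAt (fun w : ℝ => 1 - κ * w ^ 2) (-(κ * (2 * 1))) 1 := by
    simpa using ((hasDerivAt_pow 2 (1 : ℝ)).const_mul κ).const_sub 1
  have h2 : HasDerivAt (fun w : ℝ => -2 * κ * w ^ 2) (-2 * κ * (2 * 1)) 1 := by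
    simpa using (hasDerivAt_pow 2 (1 : ℝ)).const_mul (-2 * κ)
  rw [e.deriv_eq, ((h2.fun_div h1 (by simpa using hκ)).sub_const 1).deriv]
  simp
  field_simp
  ring

end WarpingFunction

/-! ### From decay relative to the reference metric to closeness in a normalised chart. -/

section CoordinateEstimate

variable {n : ℕ}

lemma contDiffAt_normalWarp {κ : ℝ} (hκ : 1 - κ ≠ 0) : ContDiffAt ℝ 2 (normalWarp κ) 1 := by
  unfold normalWarp
  refine ContDiffAt.div (by fun_prop) (by fun_prop) ?_
  simpa using hκ

lemma isNearModel_normalWarp {κ ρ : ℝ} (hκ : |κ| ≤ 1 / 4) (hρ : 8 * |κ| ≤ ρ)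
    {q : E (n - 1) → E (n - 1) →L[ℝ] E (n - 1) →L[ℝ] ℝ} (hq : IsMetricAt q 0)
    (hq0 : q 0 = euclid (n - 1)) : IsNearModel (normalWarp κ) q ρ := by
  have hκ1 := abs_le.1 hκ
  have hpos : 3 / 4 ≤ 1 - κ := by linarith
  have hne : 1 - κ ≠ 0 := by linarith
  have h1 : normalWarp κ 1 = 1 := by
    unfold normalWarp; field_simp
  refine ⟨⟨one_pos, by rw [h1]; exact one_pos, contDiffAt_normalWarp hne, hq⟩, h1, hq0, ?_, ?_⟩
  · rw [logRate_normalWarp hne one_ne_zero (by simpa using hne)]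
    simp only [one_pow, mul_one, sub_add_cancel]
    rw [abs_div, abs_mul, abs_of_pos (by linarith : 0 < 1 - κ), div_le_iff₀ (by linarith)]
    norm_num
    nlinarith [abs_nonneg κ]
  · rw [deriv_logRate_normalWarp hne, abs_div, abs_mul, abs_of_pos (by positivity : 0 < (1 - κ) ^ 2),
      div_le_iff₀ (by positivity)]
    have : 1 / 2 ≤ (1 - κ) ^ 2 := by nlinarith
    norm_num
    nlinarith [abs_nonneg κ]

/-- The factor accounts for the maximum norm on the product `F n`; `√2` would suffice. -/
lemma sqrt_modelJet_le (v : F n) : Real.sqrt ((modelJet n).1 v v) ≤ 2 * ‖v‖ := by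
  rw [modelJet_fst_apply, real_inner_self_eq_norm_sq]
  refine Real.sqrt_le_iff.2 ⟨by positivity, ?_⟩
  have h1 : v.1 * v.1 ≤ ‖v‖ * ‖v‖ := by
    rw [← abs_mul_abs_self v.1]
    exact mul_self_le_mul_self (abs_nonneg _) (norm_fst_le v)
  have h2 : ‖v.2‖ ^ 2 ≤ ‖v‖ ^ 2 := by gcongr; exact norm_snd_le v
  nlinarith [norm_nonneg v]

lemma IsMetricAt.const_smul {V : Type*} [NormedAddCommGroup V] [NormedSpace ℝ V]
    {G : V → V →L[ℝ] V →L[ℝ] ℝ} {u : V} (h : IsMetricAt G u) {c : ℝ} (hc : c ≠ 0) :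
    IsMetricAt (fun y => c • G y) u := by
  refine ⟨h.contDiffAt.const_smul c, ?_, h.eventually_symm.mono fun y hy v w => by
    simp [hy v w]⟩
  obtain ⟨e, he⟩ := h.invertible
  exact ⟨e.trans (ContinuousLinearEquiv.smulLeft (Units.mk0 c hc)), by rw [← he]; ext; rfl⟩

/-- The tensor `λ` and its first two covariant derivatives with respect to `G₀` are at most `c`
at `u`. -/
def DecaysAt (G₀ lam : F n → F n →L[ℝ] F n →L[ℝ] ℝ) (u : F n) (c : ℝ) : Prop :=
  ∀ l ≤ 2, TensorNormLE (G₀ u) (iterCovDeriv (christoffel G₀) (toTwoTensor lam) l u) c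

/-- Decay with respect to the reference metric gives closeness in a normalised chart. -/
lemma isCloseAt_affine {G G₀ : F n → F n →L[ℝ] F n →L[ℝ] ℝ} {c : F n} {A : F n ≃L[ℝ] F n}
    (hG : IsMetricAt G (c + A (1, 0))) (hG₀ : IsMetricAt G₀ (c + A (1, 0)))
    (hA : affinePullback c A G₀ (1, 0) = (modelJet n).1) {ρ : ℝ} (hρ : 0 ≤ ρ)
    (hd : DecaysAt G₀ (G - G₀) (c + A (1, 0)) ρ) :
    IsCloseAt (affinePullback c A G) (affinePullback c A G₀) (1, 0) (16 * ρ) := by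
  set u := c + A (1, 0)
  -- Each argument costs a factor `2`, and the second covariant derivative has four arguments: hence
  -- the constant `16`.
  have hs : ∀ v, Real.sqrt (G₀ u (A v) (A v)) ≤ 2 * ‖v‖ := fun v => by
    rw [← affinePullback_apply, hA]; exact sqrt_modelJet_le v
  have hsub : affinePullback c A G - affinePullback c A G₀ = affinePullback c A (G - G₀) := by
    ext1 y
    refine ContinuousLinearMap.ext fun v => ContinuousLinearMap.ext fun w => ?_
    simp only [Pi.sub_apply, sub_apply, affinePullback_apply]
  have hL : ∀ᶠ y in 𝓝 u, DifferentiableAt ℝ (G - G₀) y := by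
    filter_upwards [hG.eventually, hG₀.eventually] with y a b
    exact a.differentiableAt.sub b.differentiableAt
  have hL2 : ContDiffAt ℝ 2 (G - G₀) u := hG.contDiffAt.sub hG₀.contDiffAt
  have hN : DifferentiableAt ℝ (nablaBilin (christoffel G₀) (G - G₀)) u :=
    (contDiffAt_nablaBilin (contDiffAt_christoffel hG₀.contDiffAt (by norm_num) hG₀.invertible)
      hL2).differentiableAt (by norm_num)
  have hG' := isMetricAt_affine c A hG
  have hG₀' := isMetricAt_affine c A hG₀
  have hN' : DifferentiableAt ℝ (nablaBilin (christoffel (affinePullback c A G₀))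
      (affinePullback c A (G - G₀))) (1, 0) := by
    rw [← hsub]
    exact (contDiffAt_nablaBilin (contDiffAt_christoffel hG₀'.contDiffAt (by norm_num)
      hG₀'.invertible) (hG'.contDiffAt.sub hG₀'.contDiffAt)).differentiableAt (by norm_num)
  have ht : Tendsto (fun y => c + A y) (𝓝 (1, 0)) (𝓝 u) :=
    (contDiff_affine c A (m := 0)).continuous.tendsto _
  refine ⟨hG', hG₀', ?_, ?_, ?_⟩
  · have e : affinePullback c A G (1, 0) - affinePullback c A G₀ (1, 0) =
        affinePullback c A (G - G₀) (1, 0) := by rw [← hsub]; rfl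
    refine opNorm₂_le (by positivity) fun v w => ?_
    rw [e, affinePullback_apply]
    have := hd 0 (by norm_num) ![A v, A w]
    simp [iterCovDeriv, toTwoTensor, Fin.prod_univ_two] at this
    refine this.trans ?_
    calc _ ≤ ρ * ((2 * ‖v‖) * (2 * ‖w‖)) := by gcongr <;> exact hs _
      _ ≤ _ := by nlinarith [mul_nonneg hρ (mul_nonneg (norm_nonneg v) (norm_nonneg w))]
  · refine opNorm₃_le (by positivity) fun v w z => ?_
    rw [hsub, nablaBilin_affine c A hG₀ hL.self_of_nhds]
    have := hd 1 (by norm_num) ![A v, A w, A z]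
    rw [iterCovDeriv_one hL.self_of_nhds] at this
    have e : ∏ i : Fin (2 + 1), Real.sqrt (G₀ u (![A v, A w, A z] i) (![A v, A w, A z] i)) =
      Real.sqrt (G₀ u (A v) (A v)) * Real.sqrt (G₀ u (A w) (A w)) *
        Real.sqrt (G₀ u (A z) (A z)) := Fin.prod_univ_three _
    rw [e] at this
    refine this.trans ?_
    calc _ ≤ ρ * ((2 * ‖v‖) * (2 * ‖w‖) * (2 * ‖z‖)) := by gcongr <;> exact hs _
      _ ≤ _ := by
        have : 0 ≤ ρ * (‖v‖ * ‖w‖ * ‖z‖) := by positivity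
        linarith
  · intro v w z y
    rw [hsub, nablaTri_affine c A hG₀ hN hN' (by
      filter_upwards [ht.eventually hL, ht.eventually hG₀.eventually] with y a b v w z
      exact nablaBilin_affine c A b a v w z)]
    have := hd 2 le_rfl ![A v, A w, A z, A y]
    rw [iterCovDeriv_two hL hN] at this
    have e : ∏ i : Fin (2 + 2), Real.sqrt (G₀ u (![A v, A w, A z, A y] i) (![A v, A w, A z, A y] i)) =
      Real.sqrt (G₀ u (A v) (A v)) * Real.sqrt (G₀ u (A w) (A w)) *
        Real.sqrt (G₀ u (A z) (A z)) * Real.sqrt (G₀ u (A y) (A y)) := Fin.prod_univ_four _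
    rw [e] at this
    refine this.trans ?_
    calc _ ≤ ρ * ((2 * ‖v‖) * (2 * ‖w‖) * (2 * ‖z‖) * (2 * ‖y‖)) := by gcongr <;> exact hs _
      _ = _ := by ring

end CoordinateEstimate

set_option linter.unusedSectionVars false

/-! ### The change of the scalar curvature at an arbitrary point of a product chart. -/

section CoordinateEstimate

variable {n : ℕ}

/-- The linear part `(w, v) ↦ (x w, c f v)` of a normalised chart. -/
def normalChart (x c : ℝ) (hx : x ≠ 0) (hc : c ≠ 0) (f : E (n - 1) ≃L[ℝ] E (n - 1)) :
    F n ≃L[ℝ] F n :=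
  ContinuousLinearEquiv.prodCongr (ContinuousLinearEquiv.smulLeft (Units.mk0 x hx))
    (f.trans (ContinuousLinearEquiv.smulLeft (Units.mk0 c hc)))

lemma normalChart_apply {x c : ℝ} (hx : x ≠ 0) (hc : c ≠ 0) (f : E (n - 1) ≃L[ℝ] E (n - 1))
    (w : F n) : normalChart x c hx hc f w = (x * w.1, c • f w.2) := rfl

set_option maxHeartbeats 1000000 in
/-- The change of the scalar curvature at the point `(x, y₀)` of a chart. -/
theorem exists_coordinate_bound (hn : 3 ≤ n) (C : ℝ) :
    ∃ K r : ℝ, 0 < r ∧ ∀ (k x : ℝ) (y₀ : E (n - 1)) (h : E (n - 1) → E (n - 1) →L[ℝ] E (n - 1) →L[ℝ] ℝ)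
      (G G₀ : F n → F n →L[ℝ] F n →L[ℝ] ℝ) (p Q : ℝ → ℝ) (η : E (n - 1) → ℝ),
      |k| ≤ 1 → 0 < x → x ≤ r → IsMetricAt h y₀ → (∀ v, v ≠ 0 → 0 < h y₀ v v) →
      IsMetricAt G (x, y₀) → G₀ =ᶠ[𝓝 (x, y₀)] warped (refWarp k) h →
      DecaysAt G₀ (G - G₀) (x, y₀) (C * x ^ 2) →
      IsMetricAt (addSq G logFst (separated p η Q)) (x, y₀) →
      ContDiffAt ℝ 2 p x → ContDiffAt ℝ 2 Q x → ContDiffAt ℝ 2 η y₀ → 0 ≤ p x → p x ≤ C * x ^ 2 →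
      0 ≤ separated p η Q (x, y₀) → separated p η Q (x, y₀) ≤ C * p x →
      (∀ v, |fderiv ℝ η y₀ v| ≤ C * Real.sqrt (h y₀ v v)) →
      (∀ v w, |hess h η y₀ v w| ≤ C * (Real.sqrt (h y₀ v v) * Real.sqrt (h y₀ w w))) →
      ∃ ϑ ∈ Icc (1 : ℝ) n, |scalarCoord (addSq G logFst (separated p η Q)) (x, y₀) -
        scalarCoord G (x, y₀) +
        ϑ * (x * (deriv p x * η y₀ + deriv Q x) - n * separated p η Q (x, y₀))| ≤
          K * p x * x ^ 2 := by
  set C' := 16 * |C| + 2 with hC'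
  have hC0 := abs_nonneg C
  have hCC : C ≤ C' := by rw [hC']; linarith [le_abs_self C]
  obtain ⟨K, r, hr, hmain⟩ := exists_normalized_bound hn C'
  refine ⟨K, min r 1, by positivity, ?_⟩
  intro k x y₀ h G G₀ p Q η hk hx hxr hh hpos hG hG₀ hd hG' hp hQ hη hp0 hpC hδ0 hδC hη1 hη2
  have hx1 : x ≤ 1 := hxr.trans (min_le_right _ _)
  have hx2 : x ^ 2 ≤ 1 := pow_le_one₀ hx.le hx1
  -- In the chart `(w, v) ↦ (x w, y₀ + c f v)`, with `f` an isometry onto `(E (n - 1), h y₀)` and `c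
  -- = x / (1 - κ)`, the reference metric agrees at `(1, 0)` with the hyperbolic model.
  set κ := k / 4 * x ^ 2 with hκdef
  have hκ : |κ| ≤ x ^ 2 / 4 := by
    rw [hκdef, abs_mul, abs_div, abs_of_nonneg (sq_nonneg x), abs_of_pos (four_pos (α := ℝ))]
    nlinarith [sq_nonneg x]
  have hκ4 : |κ| ≤ 1 / 4 := hκ.trans (by linarith)
  have ha : 3 / 4 ≤ 1 - κ := by linarith [le_abs_self κ]
  have hane : 1 - κ ≠ 0 := by linarith
  set c := x / (1 - κ) with hc
  have hcpos : 0 < c := div_pos hx (by linarith)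
  have hc2 : c ≤ 2 * x := by rw [hc, div_le_iff₀ (by linarith)]; nlinarith
  obtain ⟨f, hf⟩ := exists_isometry hh.symm hpos
  set A := normalChart x c hx.ne' hcpos.ne' f with hA
  have hA1 : ((0, y₀) : F n) + A (1, 0) = (x, y₀) := by
    rw [hA, normalChart_apply]; simp
  have hφ : ∀ w : F n, ((0, y₀) : F n) + A w = (x * w.1, y₀ + c • f w.2) := fun w => by
    rw [hA, normalChart_apply]; simp
  have ht : Tendsto (fun w : F n => ((0, y₀) : F n) + A w) (𝓝 (1, 0)) (𝓝 (x, y₀)) := by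
    have := (contDiff_affine ((0, y₀) : F n) A (m := 0)).continuous.tendsto (1, 0)
    rwa [hA1] at this
  have hpos1 : ∀ᶠ w : F n in 𝓝 (1, 0), 0 < w.1 :=
    continuousAt_fst.eventually (lt_mem_nhds (by exact one_pos))
  let e : E (n - 1) ≃L[ℝ] E (n - 1) :=
    f.trans (ContinuousLinearEquiv.smulLeft (Units.mk0 c hcpos.ne'))
  have he : ∀ v, e v = c • f v := fun v => rfl
  -- Division by `c²` makes the fibre metric Euclidean at the origin; the factor is moved into the
  -- warping function, which becomes `normalWarp κ`.
  set q : E (n - 1) → E (n - 1) →L[ℝ] E (n - 1) →L[ℝ] ℝ :=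
    fun y => (c⁻¹ ^ 2) • affinePullback y₀ e h y with hq
  have hhy : IsMetricAt h (y₀ + e 0) := by rwa [map_zero, add_zero]
  have hq' := isMetricAt_affine y₀ e hhy
  have hcinv : c⁻¹ ^ 2 ≠ 0 := by positivity
  have hqm : IsMetricAt q 0 := hq'.const_smul hcinv
  have hqa : ∀ y v w, q y v w = h (y₀ + c • f y) (f v) (f w) := fun y v w => by
    simp only [hq, smul_apply, affinePullback_apply, he, map_smul, smul_eq_mul]
    field_simp
  have hq0 : q 0 = euclid (n - 1) := by
    ext v w
    rw [hqa, map_zero, smul_zero, add_zero, hf, euclid_apply]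
  have hB : IsNearModel (normalWarp κ) q (C' * x ^ 2) :=
    isNearModel_normalWarp hκ4 (by nlinarith [sq_nonneg x]) hqm hq0
  have hGA : affinePullback (0, y₀) A G₀ =ᶠ[𝓝 (1, 0)] warped (normalWarp κ) q := by
    filter_upwards [ht.eventually hG₀, hpos1] with w h1 h2
    refine ContinuousLinearMap.ext fun v => ContinuousLinearMap.ext fun v' => ?_
    rw [affinePullback_apply, h1, hφ, warped_apply, warped_apply, hA, normalChart_apply,
      normalChart_apply, ← refWarp_mul hx.ne', hqa, ← hκdef, ← hc]
    simp only [map_smul, smul_apply, smul_eq_mul]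
    have := hx.ne'
    have := h2.ne'
    field_simp
  have hG₀m : IsMetricAt G₀ (x, y₀) := by
    refine IsMetricAt.congr ?_ hG₀
    have hw : IsWarpedAt (refWarp k) h (x, y₀) := by
      refine ⟨hx, div_pos (pow_pos ?_ 2) (pow_pos hx 2), ?_, hh⟩
      · change 0 < 1 - κ; linarith
      · unfold refWarp
        exact ContDiffAt.div (by fun_prop) (by fun_prop) (pow_ne_zero 2 hx.ne')
    exact hw.isMetricAt
  have hclose : IsCloseAt (affinePullback (0, y₀) A G) (warped (normalWarp κ) q) (1, 0)
      (C' * x ^ 2) := by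
    have h1 := isCloseAt_affine (G := G) (G₀ := G₀) (c := ((0, y₀) : F n)) (A := A) (by rwa [hA1]) (by rwa [hA1])
      (by rw [hGA.self_of_nhds, warped_base hB.coeff_eq hB.fibre_eq]) (ρ := |C| * x ^ 2)
      (by positivity) (by
        rw [hA1]
        intro l hl v
        refine (hd l hl v).trans ?_
        have : 0 ≤ ∏ i, Real.sqrt (G₀ (x, y₀) (v i) (v i)) :=
          Finset.prod_nonneg fun _ _ => Real.sqrt_nonneg _
        gcongr
        exact le_abs_self C)
    have h2 := h1.congr hGA.symm
    have hle : 16 * (|C| * x ^ 2) ≤ C' * x ^ 2 := by rw [hC']; nlinarith [sq_nonneg x]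
    exact ⟨h2.metric, h2.base, h2.norm_le.trans hle, h2.nabla_le.trans hle, fun v w z y =>
      (h2.nabla₂_le v w z y).trans (by gcongr)⟩
  set η' : E (n - 1) → ℝ := fun y => η (y₀ + e y) with hη'
  set p' : ℝ → ℝ := fun w => p (x * w)
  set Q' : ℝ → ℝ := fun w => Q (x * w)
  have hp'1 : p' 1 = p x := by simp [p']
  have hsep : ∀ w, separated p' η' Q' w = separated p η Q ((0, y₀) + A w) := fun w => by
    rw [hφ]; rfl
  have hmul : ContDiffAt ℝ 2 (fun w : ℝ => x * w) 1 := by fun_prop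
  have hηy : ContDiffAt ℝ 2 η (y₀ + e 0) := by rwa [map_zero, add_zero]
  -- A unit vector of the normalised chart has `h`-length `c ≤ 2 x`. This is where each derivative
  -- along `N` gains a factor `x`.
  have hsq : ∀ v, Real.sqrt (h y₀ (e v) (e v)) = c * ‖v‖ := fun v => by
    simp only [he, map_smul, smul_apply, smul_eq_mul, hf, real_inner_self_eq_norm_sq]
    rw [show c * (c * ‖v‖ ^ 2) = (c * ‖v‖) ^ 2 by ring, Real.sqrt_sq (by positivity)]
  have hη'1 : ‖fderiv ℝ η' 0‖ ≤ C' * x := by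
    have h1 : HasFDerivAt η' ((fderiv ℝ η (y₀ + e 0)).comp (e : E (n - 1) →L[ℝ] E (n - 1))) 0 :=
      (hηy.differentiableAt (by norm_num)).hasFDerivAt.comp 0 (hasFDerivAt_affine y₀ e)
    rw [h1.fderiv, map_zero, add_zero]
    refine ContinuousLinearMap.opNorm_le_bound _ (by positivity) fun v => ?_
    refine (hη1 (e v)).trans ?_
    rw [hsq]
    calc C * (c * ‖v‖) ≤ |C| * ((2 * x) * ‖v‖) := by gcongr; exact le_abs_self C
      _ ≤ _ := by
        have : 0 ≤ x * ‖v‖ := by positivity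
        rw [hC']; nlinarith
  have hη'2 : ‖hess q η' 0‖ ≤ C' * x ^ 2 := by
    refine opNorm₂_le (by positivity) fun v w => ?_
    have h1 : hess q η' 0 v w = hess h η y₀ (e v) (e w) := by
      have h2 : hess q η' 0 = hess (affinePullback y₀ e h) η' 0 := by
        unfold hess nablaCovector
        rw [christoffel_const_smul hq'.differentiableAt hq'.invertible hcinv]
      have h3 := (isLocalPullback_affine y₀ e hhy).hess_comp hhy.eventually_symm hηy v w
      rw [h2, h3, fderiv_affine, map_zero, add_zero]
      rfl
    rw [h1]
    refine (hη2 _ _).trans ?_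
    rw [hsq, hsq]
    calc C * (c * ‖v‖ * (c * ‖w‖)) ≤ |C| * ((2 * x) * ‖v‖ * ((2 * x) * ‖w‖)) := by
          gcongr; exact le_abs_self C
      _ ≤ _ := by
        have : 0 ≤ x ^ 2 * (‖v‖ * ‖w‖) := by positivity
        rw [hC']; nlinarith
  obtain ⟨ϑ, hϑ, hfin⟩ := hmain x (normalWarp κ) q (affinePullback (0, y₀) A G) p' Q' η' hx.le
    (hxr.trans (min_le_left _ _)) hB hclose
    (ContDiffAt.comp 1 (by simpa using hp) hmul) (ContDiffAt.comp 1 (by simpa using hQ) hmul)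
    (ContDiffAt.comp 0 hηy (contDiff_affine y₀ e).contDiffAt)
    (by rwa [hp'1]) (by rw [hp'1]; exact hpC.trans (by gcongr)) (by rwa [hsep, hA1])
    (by rw [hsep, hA1, hp'1]; exact hδC.trans (by gcongr)) hη'1 hη'2
  refine ⟨ϑ, hϑ, ?_⟩
  have hdp : deriv p' 1 = x * deriv p x := by
    have := deriv_comp_mul_left x p 1
    rwa [mul_one, smul_eq_mul] at this
  have hdQ : deriv Q' 1 = x * deriv Q x := by
    have := deriv_comp_mul_left x Q 1
    rwa [mul_one, smul_eq_mul] at this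
  have hη0 : η' 0 = η y₀ := by simp [hη']
  -- Since `log (x w) = log x + log w` with `x` now a constant, `d log` is preserved by the chart,
  -- and so is the form of the perturbation.
  have hadd : addSq (affinePullback (0, y₀) A G) logFst (separated p' η' Q') =ᶠ[𝓝 (1, 0)]
      affinePullback (0, y₀) A (addSq G logFst (separated p η Q)) := by
    filter_upwards [hpos1] with w hw
    refine ContinuousLinearMap.ext fun v => ContinuousLinearMap.ext fun v' => ?_
    have hxw : (((0, y₀) : F n) + A w).1 ≠ 0 := by rw [hφ]; exact (mul_pos hx hw).ne'
    rw [affinePullback_apply]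
    simp only [addSq, add_apply, smul_apply, ContinuousLinearMap.smulRight_apply, smul_eq_mul,
      affinePullback_apply, hsep, fderiv_logFst hw.ne', fderiv_logFst hxw]
    have e1 : ∀ v : F n, (((0, y₀) : F n) + A w).1⁻¹ * (A v).1 = w.1⁻¹ * v.1 := fun v => by
      rw [hφ, hA, normalChart_apply]
      have := hx.ne'
      have := hw.ne'
      field_simp
    rw [e1, e1]
  rw [scalarCoord_congr hadd, scalarCoord_affine _ _ (by rwa [hA1]),
    scalarCoord_affine _ _ (by rwa [hA1]), hsep, hA1, hdp, hdQ, hp'1, hη0] at hfin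
  rwa [show x * (deriv p x * η y₀ + deriv Q x) = x * deriv p x * η y₀ + x * deriv Q x by ring]

end CoordinateEstimate

/-! ### Smoothness of tensor fields in terms of components. -/

section Sections

variable {V : Type*} [NormedAddCommGroup V] [NormedSpace ℝ V]
  {H : Type*} [TopologicalSpace H] {I : ModelWithCorners ℝ V H} [I.Boundaryless]
  {M : Type*} [TopologicalSpace M] [ChartedSpace H M]

/-- Regularity of a covariant 2-tensor field, as a section, in terms of its components. -/
lemma contMDiffAt_section_iff_chartRep [IsManifold I ∞ M] {m : ℕ∞ω} (hm : m + 1 ≤ ∞)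
    (T : ∀ q : M, TangentSpace I q →L[ℝ] TangentSpace I q →L[ℝ] ℝ) {p q : M}
    (hq : q ∈ (extChartAt I p).source) :
    ContMDiffAt I (I.prod 𝓘(ℝ, V →L[ℝ] V →L[ℝ] ℝ)) m
      (fun q : M => Bundle.TotalSpace.mk' (V →L[ℝ] V →L[ℝ] ℝ)
        (E := fun q : M => TangentSpace I q →L[ℝ] TangentSpace I q →L[ℝ] ℝ) q (T q)) q ↔
      ContDiffAt ℝ m (chartRep I T p) (extChartAt I p q) := by
  have hm' : m ≤ ∞ := le_self_add.trans hm
  have : IsManifold I (m + 1) M := IsManifold.of_le hm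
  have : IsManifold I m M := IsManifold.of_le hm'
  have : IsManifold I 1 M := IsManifold.of_le (n := ∞) (by simp)
  have : ContMDiffVectorBundle m V (TangentSpace I : M → Type _) I :=
    TangentBundle.contMDiffVectorBundle
  have hq' : q ∈ (chartAt H p).source := by rwa [extChartAt_source] at hq
  rw [(trivializationAt (V →L[ℝ] V →L[ℝ] ℝ)
    (fun q : M => TangentSpace I q →L[ℝ] TangentSpace I q →L[ℝ] ℝ) p).contMDiffAt_section_iff
      (by simpa [hom_trivializationAt_baseSet] using hq'),
    contMDiffAt_iff_source_of_mem_source hq', I.range_eq_univ, contMDiffWithinAt_univ,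
    contMDiffAt_iff_contDiffAt]
  suffices e : _ =ᶠ[𝓝 (extChartAt I p q)] _ from
    ⟨fun h => h.congr_of_eventuallyEq e.symm, fun h => h.congr_of_eventuallyEq e⟩
  filter_upwards [(isOpen_extChartAt_target p).mem_nhds ((extChartAt I p).map_source hq)] with u hu
  have hs : (extChartAt I p).symm u ∈ (chartAt H p).source := by
    rw [← extChartAt_source I]; exact (extChartAt I p).map_target hu
  have hb : (extChartAt I p).symm u ∈ (trivializationAt V (TangentSpace I) p).baseSet := by simpa
  -- The inverse of the tangent trivialisation is the derivative of the inverse chart, which is what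
  -- `chartRep` uses.
  have key : ∀ v : V, (trivializationAt V (TangentSpace I) p).symm ((extChartAt I p).symm u) v =
      mfderiv 𝓘(ℝ, V) I (extChartAt I p).symm u v := fun v => by
    have := TangentBundle.symmL_trivializationAt (I := I) hs
    rw [I.range_eq_univ, mfderivWithin_univ, (extChartAt I p).right_inv hu] at this
    exact ((trivializationAt V (TangentSpace I) p).symmL_apply (R := ℝ) hb v).symm.trans
      (congrArg (fun L : V →L[ℝ] V => L v) this)
  refine ContinuousLinearMap.ext fun v => ContinuousLinearMap.ext fun w => ?_
  simp only [Function.comp_apply]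
  rw [hom_trivializationAt_apply, inCoordinates_apply_eq₂ hb hb (mem_univ _), key, key]
  rw [Bundle.Trivialization.linearMapAt_apply]
  exact if_pos (mem_univ _)

end Sections

/-! ### Pull-backs of 2-tensors on manifolds. -/

section Pullback

set_option linter.unusedSectionVars false

variable {V : Type*} [NormedAddCommGroup V] [NormedSpace ℝ V]
  {H : Type*} [TopologicalSpace H] {I : ModelWithCorners ℝ V H}
  {M : Type*} [TopologicalSpace M] [ChartedSpace H M]
  {V₂ : Type*} [NormedAddCommGroup V₂] [NormedSpace ℝ V₂]
  {H₂ : Type*} [TopologicalSpace H₂] {I₂ : ModelWithCorners ℝ V₂ H₂}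
  {M₂ : Type*} [TopologicalSpace M₂] [ChartedSpace H₂ M₂]
  {V₃ : Type*} [NormedAddCommGroup V₃] [NormedSpace ℝ V₃]
  {H₃ : Type*} [TopologicalSpace H₃] {I₃ : ModelWithCorners ℝ V₃ H₃}
  {M₃ : Type*} [TopologicalSpace M₃] [ChartedSpace H₃ M₃]

lemma pullback_apply (f : M → M₂) (T : M₂ → V₂ →L[ℝ] V₂ →L[ℝ] ℝ) (z : M) (v w : V) :
    pullback I I₂ f T z v w = T (f z) (mfderiv I I₂ f z v) (mfderiv I I₂ f z w) := rfl

lemma pullback_comp {f : M₂ → M₃} {g : M → M₂} {z : M} (T : M₃ → V₃ →L[ℝ] V₃ →L[ℝ] ℝ)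
    (hf : MDifferentiableAt I₂ I₃ f (g z)) (hg : MDifferentiableAt I I₂ g z) :
    pullback I I₃ (f ∘ g) T z = pullback I I₂ g (pullback I₂ I₃ f T) z := by
  have e := mfderiv_comp z hf hg
  unfold pullback
  rw [e]
  rfl

lemma pullback_congr {f g : M → M₂} {z : M} (T : M₂ → V₂ →L[ℝ] V₂ →L[ℝ] ℝ)
    (h : f =ᶠ[𝓝 z] g) : pullback I I₂ f T z = pullback I I₂ g T z := by
  have h1 := h.mfderiv_eq (I := I) (I' := I₂)
  have h2 := h.eq_of_nhds
  show (T (f z)).bilinearComp _ _ = _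
  rw [h2]
  exact congrArg (fun A : V →L[ℝ] V₂ => (T (g z)).bilinearComp A A) h1

lemma pullback_id (T : M → V →L[ℝ] V →L[ℝ] ℝ) : pullback I I (fun z => z) T = T := by
  ext1 z
  refine ContinuousLinearMap.ext fun v => ContinuousLinearMap.ext fun w => ?_
  rw [pullback_apply]
  erw [mfderiv_id]
  rfl

section Boundaryless

variable [I.Boundaryless] [I₂.Boundaryless] [IsManifold I ∞ M] [IsManifold I₂ ∞ M₂]

lemma contMDiffAt_extChartAt_symm {p : M} {u : V} (hu : u ∈ (extChartAt I p).target) {m : ℕ∞ω}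
    (hm : m ≤ ∞) : ContMDiffAt 𝓘(ℝ, V) I m (extChartAt I p).symm u :=
  ((contMDiffOn_extChartAt_symm p).contMDiffAt ((isOpen_extChartAt_target p).mem_nhds hu)).of_le hm

lemma contMDiffAt_extChartAt_of_mem {p q : M} (hq : q ∈ (extChartAt I p).source) {m : ℕ∞ω}
    (hm : m ≤ ∞) : ContMDiffAt I 𝓘(ℝ, V) m (extChartAt I p) q :=
  (contMDiffAt_extChartAt' (by rwa [extChartAt_source] at hq)).of_le hm

lemma isInvertible_mfderiv_extChartAt_symm {p : M} {u : V} (hu : u ∈ (extChartAt I p).target) :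
    (mfderiv 𝓘(ℝ, V) I (extChartAt I p).symm u : V →L[ℝ] V).IsInvertible := by
  have : IsManifold I 1 M := IsManifold.of_le (n := ∞) (by simp)
  have := isInvertible_mfderivWithin_extChartAt_symm (I := I) hu
  rwa [I.range_eq_univ, mfderivWithin_univ] at this

/-- The transformation law of the components of a 2-tensor field. -/
lemma isLocalPullback_chart {f : M → M₂} {T : M₂ → V₂ →L[ℝ] V₂ →L[ℝ] ℝ} {a z : M} {b : M₂}
    (hz : z ∈ (extChartAt I a).source) (hfz : f z ∈ (extChartAt I₂ b).source)
    (hf : ContMDiffAt I I₂ 3 f z) (hi : (mfderiv I I₂ f z : V →L[ℝ] V₂).IsInvertible)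
    (hT : ContDiffAt ℝ 2 (chartRep I₂ T b) (extChartAt I₂ b (f z)))
    (hTi : (chartRep I₂ T b (extChartAt I₂ b (f z))).IsInvertible) :
    IsLocalPullback (fun u => extChartAt I₂ b (f ((extChartAt I a).symm u))) (chartRep I₂ T b)
      (chartRep I (pullback I I₂ f T) a) (extChartAt I a z) := by
  have : IsManifold I 1 M := IsManifold.of_le (n := ∞) (by simp)
  have : IsManifold I₂ 1 M₂ := IsManifold.of_le (n := ∞) (by simp)
  have h3 : (3 : ℕ∞ω) ≤ ∞ := WithTop.coe_le_coe.2 le_top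
  have : IsManifold I 3 M := IsManifold.of_le (n := ∞) h3
  have : IsManifold I₂ 3 M₂ := IsManifold.of_le (n := ∞) h3
  have hu := (extChartAt I a).map_source hz
  have hzz : (extChartAt I a).symm (extChartAt I a z) = z := (extChartAt I a).left_inv hz
  have hc : ContinuousAt (extChartAt I a).symm (extChartAt I a z) :=
    (contMDiffAt_extChartAt_symm hu h3).continuousAt
  have ht : Tendsto (extChartAt I a).symm (𝓝 (extChartAt I a z)) (𝓝 z) := by
    have := hc.tendsto; rwa [hzz] at this
  have hs : ∀ᶠ u in 𝓝 (extChartAt I a z), u ∈ (extChartAt I a).target ∧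
      ContMDiffAt I I₂ 3 f ((extChartAt I a).symm u) ∧
      f ((extChartAt I a).symm u) ∈ (extChartAt I₂ b).source := by
    filter_upwards [(isOpen_extChartAt_target a).mem_nhds hu,
      ht.eventually ((contMDiffAt_iff_contMDiffAt_nhds (by decide)).1 hf),
      ht.eventually (hf.continuousAt.eventually ((isOpen_extChartAt_source b).mem_nhds hfz))]
      with u h1 h2 h3 using ⟨h1, h2, h3⟩
  have hψ : ∀ u, u ∈ (extChartAt I a).target → ContMDiffAt I I₂ 3 f ((extChartAt I a).symm u) →
      f ((extChartAt I a).symm u) ∈ (extChartAt I₂ b).source →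
      ContMDiffAt 𝓘(ℝ, V) 𝓘(ℝ, V₂) 3 (fun u => extChartAt I₂ b (f ((extChartAt I a).symm u))) u :=
    fun u h1 h2 h4 => (contMDiffAt_extChartAt_of_mem h4 h3).comp u
      (h2.comp u (contMDiffAt_extChartAt_symm h1 h3))
  have h13 : (3 : ℕ∞ω) ≠ 0 := by norm_num
  refine ⟨?_, ?_, by rw [hzz]; exact hT, by rw [hzz]; exact hTi, ?_⟩
  · exact contMDiffAt_iff_contDiffAt.1 (hψ _ hu (by rwa [hzz]) (by rwa [hzz]))
  · have e1 := mfderiv_comp (I := 𝓘(ℝ, V)) (I' := I) (I'' := I₂) (extChartAt I a z) (g := f)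
      (f := (extChartAt I a).symm) (by rw [hzz]; exact hf.mdifferentiableAt h13)
      ((contMDiffAt_extChartAt_symm hu h3).mdifferentiableAt h13)
    have e2 := mfderiv_comp (I := 𝓘(ℝ, V)) (I' := I₂) (I'' := 𝓘(ℝ, V₂)) (extChartAt I a z)
      (g := extChartAt I₂ b) (f := f ∘ (extChartAt I a).symm)
      ((contMDiffAt_extChartAt_of_mem (by rw [Function.comp_apply, hzz]; exact hfz) h3).mdifferentiableAt h13)
      (MDifferentiableAt.comp _ (by rw [hzz]; exact hf.mdifferentiableAt h13)
        ((contMDiffAt_extChartAt_symm hu h3).mdifferentiableAt h13))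
    rw [← mfderiv_eq_fderiv]
    have e3 : mfderiv 𝓘(ℝ, V) 𝓘(ℝ, V₂) (fun u => extChartAt I₂ b (f ((extChartAt I a).symm u)))
      (extChartAt I a z) = _ := e2
    rw [e3, e1]
    have i2 : (mfderiv 𝓘(ℝ, V) I (extChartAt I a).symm (extChartAt I a z) :
      V →L[ℝ] V).IsInvertible := isInvertible_mfderiv_extChartAt_symm hu
    have i3 : (mfderiv I I₂ f ((extChartAt I a).symm (extChartAt I a z)) :
      V →L[ℝ] V₂).IsInvertible := by rw [hzz]; exact hi
    have i4 : (mfderiv I₂ 𝓘(ℝ, V₂) (extChartAt I₂ b) ((f ∘ (extChartAt I a).symm)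
      (extChartAt I a z)) : V₂ →L[ℝ] V₂).IsInvertible :=
      isInvertible_mfderiv_extChartAt (by rw [Function.comp_apply, hzz]; exact hfz)
    exact i4.comp (i3.comp i2)
  · filter_upwards [hs.eventually_nhds] with u hu'
    obtain ⟨h1, h2, h4⟩ := hu'.self_of_nhds
    have hrep : (chartRep I₂ T b (extChartAt I₂ b (f ((extChartAt I a).symm u)))).bilinearComp
        (fderiv ℝ (fun u => extChartAt I₂ b (f ((extChartAt I a).symm u))) u)
        (fderiv ℝ (fun u => extChartAt I₂ b (f ((extChartAt I a).symm u))) u) =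
        pullback 𝓘(ℝ, V) 𝓘(ℝ, V₂) (fun u => extChartAt I₂ b (f ((extChartAt I a).symm u)))
          (pullback 𝓘(ℝ, V₂) I₂ (extChartAt I₂ b).symm T) u := by
      unfold pullback
      rw [mfderiv_eq_fderiv]
      rfl
    have c1 := pullback_comp T
      (g := fun u => extChartAt I₂ b (f ((extChartAt I a).symm u))) (z := u)
      ((contMDiffAt_extChartAt_symm ((extChartAt I₂ b).map_source h4) h3).mdifferentiableAt h13)
      ((hψ u h1 h2 h4).mdifferentiableAt h13)
    have c2 := pullback_comp T (g := (extChartAt I a).symm) (z := u) (h2.mdifferentiableAt h13)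
      ((contMDiffAt_extChartAt_symm h1 h3).mdifferentiableAt h13)
    -- The chart of the target cancels against its inverse, but only near `u`; so the chain rule is
    -- applied to germs.
    have e : ((extChartAt I₂ b).symm ∘ fun u => extChartAt I₂ b (f ((extChartAt I a).symm u)))
        =ᶠ[𝓝 u] f ∘ (extChartAt I a).symm := by
      filter_upwards [hu'] with y hy
      exact (extChartAt I₂ b).left_inv hy.2.2
    exact c2.symm.trans ((pullback_congr T e).symm.trans (c1.trans hrep.symm))

end Boundaryless

end Pullback

/-! ### Components of sums and multiples of tensor fields. -/

section ChartRep

variable {V : Type*} [NormedAddCommGroup V] [NormedSpace ℝ V]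
  {H : Type*} [TopologicalSpace H] {I : ModelWithCorners ℝ V H}
  {M : Type*} [TopologicalSpace M] [ChartedSpace H M]

lemma chartRep_add (T T' : M → V →L[ℝ] V →L[ℝ] ℝ) (p : M) (u : V) :
    chartRep I (fun q => T q + T' q) p u = chartRep I T p u + chartRep I T' p u := rfl

lemma chartRep_smul (c : M → ℝ) (T : M → V →L[ℝ] V →L[ℝ] ℝ) (p : M) (u : V) :
    chartRep I (fun q => c q • T q) p u =
      c ((extChartAt I p).symm u) • chartRep I T p u := rfl

lemma chartRep_congr {T T' : M → V →L[ℝ] V →L[ℝ] ℝ} {p : M} {u : V}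
    (h : T ((extChartAt I p).symm u) = T' ((extChartAt I p).symm u)) :
    chartRep I T p u = chartRep I T' p u := by
  unfold chartRep pullback
  rw [h]

lemma chartRep_eventuallyEq [I.Boundaryless] {T T' : M → V →L[ℝ] V →L[ℝ] ℝ} {p q : M}
    (hq : q ∈ (extChartAt I p).source)
    (h : T =ᶠ[𝓝 q] T') : chartRep I T p =ᶠ[𝓝 (extChartAt I p q)] chartRep I T' p := by
  have ht := continuousAt_extChartAt_symm' (I := I) hq
  unfold ContinuousAt at ht
  rw [(extChartAt I p).left_inv hq] at ht
  exact (ht.eventually h).mono fun u hu => chartRep_congr hu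

end ChartRep

/-! ### Product charts on `ℝ × N`; there the reference metric is a warped product. -/

section ProductChart

variable {n : ℕ} {N : Type*} [TopologicalSpace N] [ChartedSpace (E (n - 1)) N]

lemma extChartAt_prod_symm_apply (z : ℝ × N) (u : F n) :
    (extChartAt (IC n) z).symm u = (u.1, (extChartAt (𝓡 (n - 1)) z.2).symm u.2) := by
  rw [extChartAt_prod]; rfl

lemma extChartAt_prod_apply (z w : ℝ × N) :
    extChartAt (IC n) z w = (w.1, extChartAt (𝓡 (n - 1)) z.2 w.2) := by
  rw [extChartAt_prod]; rfl

lemma mem_extChartAt_prod_target {z : ℝ × N} {u : F n} :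
    u ∈ (extChartAt (IC n) z).target ↔ u.2 ∈ (extChartAt (𝓡 (n - 1)) z.2).target := by
  rw [extChartAt_prod, PartialEquiv.prod_target, mem_prod, extChartAt_model_space_eq_id]; simp

instance boundaryless_IC : (IC n).Boundaryless := by
  constructor
  rw [modelWithCorners_prod_coe, range_prodMap, ModelWithCorners.range_eq_univ,
    ModelWithCorners.range_eq_univ, univ_prod_univ]

variable [IsManifold (𝓡 (n - 1)) ∞ N]

lemma mfderiv_extChartAt_prod_symm {z : ℝ × N} {u : F n}
    (hu : u ∈ (extChartAt (IC n) z).target) (v : F n) :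
    (mfderiv 𝓘(ℝ, F n) (IC n) (extChartAt (IC n) z).symm u : F n →L[ℝ] F n) v =
      (v.1, (mfderiv 𝓘(ℝ, E (n - 1)) (𝓡 (n - 1)) (extChartAt (𝓡 (n - 1)) z.2).symm u.2 :
        E (n - 1) →L[ℝ] E (n - 1)) v.2) := by
  have hu2 := mem_extChartAt_prod_target.1 hu
  have e : ((extChartAt (IC n) z).symm : F n → ℝ × N) =
      fun u => (u.1, ((extChartAt (𝓡 (n - 1)) z.2).symm ∘ Prod.snd) u) :=
    funext fun u => extChartAt_prod_symm_apply z u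
  have d1 : MDifferentiableAt 𝓘(ℝ, F n) 𝓘(ℝ, ℝ) (Prod.fst : F n → ℝ) u :=
    mdifferentiableAt_iff_differentiableAt.2 differentiableAt_fst
  have d2 : MDifferentiableAt 𝓘(ℝ, F n) 𝓘(ℝ, E (n - 1)) (Prod.snd : F n → E (n - 1)) u :=
    mdifferentiableAt_iff_differentiableAt.2 differentiableAt_snd
  have d3 : MDifferentiableAt 𝓘(ℝ, E (n - 1)) (𝓡 (n - 1)) (extChartAt (𝓡 (n - 1)) z.2).symm
      ((Prod.snd : F n → E (n - 1)) u) :=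
    (contMDiffAt_extChartAt_symm hu2 (m := ∞) le_rfl).mdifferentiableAt (by simp)
  have h1 := (d1.mfderiv_prod (d3.comp u d2))
  have h2 := mfderiv_comp u d3 d2
  rw [h2, mfderiv_eq_fderiv, mfderiv_eq_fderiv, fderiv_fst, fderiv_snd] at h1
  rw [e]
  exact (congrArg (fun L : F n →L[ℝ] F n => L v) h1)

lemma chartRep_liftN (S : N → E (n - 1) →L[ℝ] E (n - 1) →L[ℝ] ℝ) {z : ℝ × N} {u : F n}
    (hu : u ∈ (extChartAt (IC n) z).target) :
    chartRep (IC n) (fun z => liftN (S z.2)) z u = liftN (chartRep (𝓡 (n - 1)) S z.2 u.2) := by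
  refine ContinuousLinearMap.ext fun v => ContinuousLinearMap.ext fun w => ?_
  have e : ∀ v : F n, (mfderiv 𝓘(ℝ, F n) (IC n) (extChartAt (IC n) z).symm u : F n →L[ℝ] F n) v =
    _ := mfderiv_extChartAt_prod_symm hu
  have e1 : ((extChartAt (IC n) z).symm u).2 = (extChartAt (𝓡 (n - 1)) z.2).symm u.2 := by
    rw [extChartAt_prod_symm_apply]
  refine (congrArg₂ (fun a b => liftN (S ((extChartAt (IC n) z).symm u).2) a b) (e v) (e w)).trans
    ((liftN_apply _ _ _).trans ?_)
  rw [e1, liftN_apply]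
  rfl

lemma chartRep_dxSq {z : ℝ × N} {u : F n} (hu : u ∈ (extChartAt (IC n) z).target) :
    chartRep (IC n) (fun _ => dxSq) z u = dxSq := by
  refine ContinuousLinearMap.ext fun v => ContinuousLinearMap.ext fun w => ?_
  have e : ∀ v : F n, (mfderiv 𝓘(ℝ, F n) (IC n) (extChartAt (IC n) z).symm u : F n →L[ℝ] F n) v =
    _ := mfderiv_extChartAt_prod_symm hu
  exact (congrArg₂ (fun a b => (dxSq : F n →L[ℝ] F n →L[ℝ] ℝ) a b) (e v) (e w)).trans
    ((dxSq_apply _ _).trans (dxSq_apply _ _).symm)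

lemma chartRep_referenceMetric (h : N → E (n - 1) →L[ℝ] E (n - 1) →L[ℝ] ℝ) (k : ℝ) {z : ℝ × N}
    {u : F n} (hu : u ∈ (extChartAt (IC n) z).target) :
    chartRep (IC n) (referenceMetric h k) z u =
      warped (refWarp k) (chartRep (𝓡 (n - 1)) h z.2) u := by
  have e : chartRep (IC n) (referenceMetric h k) z u =
      (u.1 ^ 2)⁻¹ • (chartRep (IC n) (fun _ => dxSq) z u +
        (1 - k / 4 * u.1 ^ 2) ^ 2 • chartRep (IC n) (fun z => liftN (h z.2)) z u) := by
    have e1 : ((extChartAt (IC n) z).symm u).1 = u.1 := by rw [extChartAt_prod_symm_apply]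
    have := chartRep_smul (I := IC n) (fun z : ℝ × N => (z.1 ^ 2)⁻¹)
      (fun z => dxSq + (1 - k / 4 * z.1 ^ 2) ^ 2 • liftN (h z.2)) z u
    rw [e1] at this
    refine this.trans ?_
    rw [chartRep_add, chartRep_smul (I := IC n) (fun z : ℝ × N => (1 - k / 4 * z.1 ^ 2) ^ 2)
      (fun z => liftN (h z.2)) z u, e1]
  rw [e, chartRep_liftN h hu, chartRep_dxSq hu, warped, refWarp, smul_add, smul_smul]
  congr 2
  exact (div_eq_inv_mul _ _).symm

end ProductChart

/-! ### Riemannian metrics in charts. -/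

section Metrics

variable {m : ℕ} {r : ℕ∞ω} {M : Type*} [TopologicalSpace M] [ChartedSpace (E m) M]
  [IsManifold (𝓡 m) ∞ M]

lemma isInvertible_of_pos {V : Type*} [NormedAddCommGroup V] [NormedSpace ℝ V]
    [FiniteDimensional ℝ V] {B : V →L[ℝ] V →L[ℝ] ℝ} (hB : ∀ v, v ≠ 0 → 0 < B v v) :
    B.IsInvertible := by
  have hi : Function.Injective (B : V →ₗ[ℝ] V →L[ℝ] ℝ) := by
    refine (injective_iff_map_eq_zero _).2 fun v hv => ?_
    by_contra hne
    have := hB v hne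
    have e : B v = 0 := hv
    simp [e] at this
  let e := LinearEquiv.ofInjectiveOfFinrankEq (B : V →ₗ[ℝ] V →L[ℝ] ℝ) hi (by
    rw [← (LinearMap.toContinuousLinearMap : (V →ₗ[ℝ] ℝ) ≃ₗ[ℝ] (V →L[ℝ] ℝ)).finrank_eq]
    exact (Subspace.dual_finrank_eq).symm)
  exact ⟨e.toContinuousLinearEquiv, by ext1 v; rfl⟩

namespace RiemMetric

variable (g : RiemMetric m r M)

lemma toTensor_symm (q : M) (v w : E m) : g.toTensor q v w = g.toTensor q w v := g.symm q v w

lemma toTensor_pos (q : M) {v : E m} (hv : v ≠ 0) : 0 < g.toTensor q v v := g.pos q v hv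

lemma chartRep_pos {p : M} {u : E m} (hu : u ∈ (extChartAt (𝓡 m) p).target) {v : E m}
    (hv : v ≠ 0) : 0 < chartRep (𝓡 m) g.toTensor p u v v := by
  obtain ⟨A, hA⟩ := isInvertible_mfderiv_extChartAt_symm hu
  have : A v ≠ 0 := A.map_ne_zero_iff.2 hv
  have h2 := g.toTensor_pos ((extChartAt (𝓡 m) p).symm u) this
  have e : A v = (mfderiv 𝓘(ℝ, E m) (𝓡 m) (extChartAt (𝓡 m) p).symm u : E m →L[ℝ] E m) v := by
    rw [← hA]; rfl
  rw [e] at h2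
  exact h2

lemma isMetricAt_chartRep (hr : 2 ≤ r) {p q : M} (hq : q ∈ (extChartAt (𝓡 m) p).source) :
    IsMetricAt (chartRep (𝓡 m) g.toTensor p) (extChartAt (𝓡 m) p q) := by
  refine ⟨?_, isInvertible_of_pos fun v hv => g.chartRep_pos ((extChartAt _ p).map_source hq) hv,
    Eventually.of_forall fun y v w => g.toTensor_symm _ _ _⟩
  exact (contMDiffAt_section_iff_chartRep (m := 2) (by norm_cast) _ hq).1
    ((g.contMDiff q).of_le hr)

end RiemMetric

end Metrics

/-! ### Comparison of a metric with the norm of the coordinate space. -/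

section Coercivity

variable {d : ℕ}

lemma exists_norm_sq_le {B : E d →L[ℝ] E d →L[ℝ] ℝ} (hs : ∀ v w, B v w = B w v)
    (hp : ∀ v, v ≠ 0 → 0 < B v v) : ∃ a > 0, ∀ v, ‖v‖ ^ 2 ≤ a * B v v := by
  obtain ⟨f, hf⟩ := exists_isometry hs hp
  refine ⟨‖(f : E d →L[ℝ] E d)‖ ^ 2 + 1, by positivity, fun v => ?_⟩
  have h1 : ‖v‖ ≤ ‖(f : E d →L[ℝ] E d)‖ * ‖f.symm v‖ := by
    simpa using (f : E d →L[ℝ] E d).le_opNorm (f.symm v)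
  have h2 : B v v = ‖f.symm v‖ ^ 2 := by
    rw [← real_inner_self_eq_norm_sq, ← hf, f.apply_symm_apply]
  rw [h2]
  nlinarith [norm_nonneg v, sq_nonneg ‖f.symm v‖]

/-- A perturbation of `B y` of norm below `1 / (2 a)` loses at most half of the coercivity of `B y`,
whence the constant `√(2 a)`. -/
lemma exists_eventually_norm_sq_le {B : E d → E d →L[ℝ] E d →L[ℝ] ℝ} {y : E d}
    (hc : ContinuousAt B y) (hs : ∀ v w, B y v w = B y w v) (hp : ∀ v, v ≠ 0 → 0 < B y v v) :
    ∃ a > 0, ∀ᶠ y' in 𝓝 y, ∀ v, ‖v‖ ≤ a * Real.sqrt (B y' v v) := by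
  obtain ⟨a, ha, hB⟩ := exists_norm_sq_le hs hp
  refine ⟨Real.sqrt (2 * a), by positivity, ?_⟩
  have he : ∀ᶠ y' in 𝓝 y, ‖B y - B y'‖ < (2 * a)⁻¹ := by
    have := ((continuousAt_const (y := B y)).sub hc).norm
    exact this.eventually (gt_mem_nhds (by simp; positivity))
  filter_upwards [he] with y' hy v
  have h1 : B y v v - B y' v v ≤ (2 * a)⁻¹ * ‖v‖ * ‖v‖ := by
    have := (le_abs_self _).trans ((B y - B y').le_opNorm₂ v v)
    simp only [sub_apply] at this
    exact this.trans (by gcongr)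
  have h2 : ‖v‖ ^ 2 ≤ 2 * a * B y' v v := by
    have h3 := mul_le_mul_of_nonneg_left h1 ha.le
    have h4 : a * ((2 * a)⁻¹ * ‖v‖ * ‖v‖) = ‖v‖ ^ 2 / 2 := by field_simp
    nlinarith [hB v]
  rw [← Real.sqrt_mul (by positivity)]
  exact Real.le_sqrt_of_sq_le h2

end Coercivity

/-! ### Uniform bounds on a compact manifold. -/

section UniformBounds

variable {d : ℕ} {N : Type*} [TopologicalSpace N] [ChartedSpace (E d) N]
  [IsManifold (𝓡 d) ∞ N]

/-- A local-to-global principle for bounds that are monotone in the constant. It serves for bounds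
stated in the preferred chart around `q`, since that chart need not depend continuously on `q`. -/
lemma exists_uniform_bound {X : Type*} [TopologicalSpace X] [CompactSpace X] {P : ℝ → X → Prop}
    (hP : ∀ C C' q, C ≤ C' → P C q → P C' q) (hloc : ∀ a, ∃ C, ∀ᶠ q in 𝓝 a, P C q) :
    ∃ C, ∀ q, P C q := by
  suffices ∃ C, ∀ q ∈ (univ : Set X), P C q by simpa using this
  refine isCompact_univ.induction_on (p := fun s : Set X => ∃ C, ∀ q ∈ s, P C q) ⟨0, by simp⟩
    (fun s t hst ⟨C, hC⟩ => ⟨C, fun q hq => hC q (hst hq)⟩) ?_ ?_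
  · rintro s t ⟨C, hC⟩ ⟨C', hC'⟩
    refine ⟨max C C', fun q hq => hq.elim (fun h => ?_) fun h => ?_⟩
    · exact hP _ _ _ (le_max_left _ _) (hC q h)
    · exact hP _ _ _ (le_max_right _ _) (hC' q h)
  · intro a _
    obtain ⟨C, hC⟩ := hloc a
    exact ⟨_, mem_nhdsWithin_of_mem_nhds hC, C, fun q hq => hq⟩

/-- The bounds on a function and its first two covariant derivatives at `q`. -/
structure HasHessianBound (h : N → E d →L[ℝ] E d →L[ℝ] ℝ) (η : N → ℝ) (C : ℝ) (q : N) : Prop where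
  le : η q ≤ C
  fderiv_le : ∀ v, |fderiv ℝ (fun y => η ((extChartAt (𝓡 d) q).symm y)) (extChartAt (𝓡 d) q q) v| ≤
    C * Real.sqrt (chartRep (𝓡 d) h q (extChartAt (𝓡 d) q q) v v)
  hess_le : ∀ v w, |hess (chartRep (𝓡 d) h q) (fun y => η ((extChartAt (𝓡 d) q).symm y))
    (extChartAt (𝓡 d) q q) v w| ≤ C *
      (Real.sqrt (chartRep (𝓡 d) h q (extChartAt (𝓡 d) q q) v v) *
        Real.sqrt (chartRep (𝓡 d) h q (extChartAt (𝓡 d) q q) w w))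

variable (h : RiemMetric d ∞ N)

lemma two_le_infty : (2 : ℕ∞ω) ≤ ∞ := WithTop.coe_le_coe.2 le_top

lemma three_le_infty : (3 : ℕ∞ω) ≤ ∞ := WithTop.coe_le_coe.2 le_top

lemma isLocalPullback_transition {a q : N} (hq : q ∈ (extChartAt (𝓡 d) a).source) :
    IsLocalPullback (fun u => extChartAt (𝓡 d) a ((extChartAt (𝓡 d) q).symm u))
      (chartRep (𝓡 d) h.toTensor a) (chartRep (𝓡 d) h.toTensor q) (extChartAt (𝓡 d) q q) := by
  have hm := h.isMetricAt_chartRep two_le_infty hq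
  have := isLocalPullback_chart (f := fun z : N => z) (T := h.toTensor)
    (mem_extChartAt_source (I := 𝓡 d) q) hq contMDiffAt_id
    (by
      have : mfderiv (𝓡 d) (𝓡 d) (fun z : N => z) q = ContinuousLinearMap.id ℝ _ := mfderiv_id
      rw [this]; exact ⟨ContinuousLinearEquiv.refl ℝ _, rfl⟩) hm.contDiffAt hm.invertible
  rwa [pullback_id] at this

/-- The bounds are invariant: differentials, Hessians and metric lengths all transform by the
derivative of the transition map. Hence they may be verified in one fixed chart for all nearby `q`.
-/
lemma HasHessianBound.of_chart {η : N → ℝ} (hη : ContMDiff (𝓡 d) 𝓘(ℝ, ℝ) ∞ η) {C : ℝ} {a q : N}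
    (hq : q ∈ (extChartAt (𝓡 d) a).source) (h0 : η q ≤ C)
    (h1 : ∀ v, |fderiv ℝ (fun y => η ((extChartAt (𝓡 d) a).symm y)) (extChartAt (𝓡 d) a q) v| ≤
      C * Real.sqrt (chartRep (𝓡 d) h.toTensor a (extChartAt (𝓡 d) a q) v v))
    (h2 : ∀ v w, |hess (chartRep (𝓡 d) h.toTensor a) (fun y => η ((extChartAt (𝓡 d) a).symm y))
      (extChartAt (𝓡 d) a q) v w| ≤ C *
        (Real.sqrt (chartRep (𝓡 d) h.toTensor a (extChartAt (𝓡 d) a q) v v) *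
          Real.sqrt (chartRep (𝓡 d) h.toTensor a (extChartAt (𝓡 d) a q) w w))) :
    HasHessianBound h.toTensor η C q := by
  have hp := isLocalPullback_transition h hq
  have hm := h.isMetricAt_chartRep two_le_infty hq
  set φ := fun u => extChartAt (𝓡 d) a ((extChartAt (𝓡 d) q).symm u) with hφ
  set u := extChartAt (𝓡 d) q q with hu
  have hqq : (extChartAt (𝓡 d) q).symm u = q := (extChartAt (𝓡 d) q).left_inv (mem_extChartAt_source q)
  have hφu : φ u = extChartAt (𝓡 d) a q := by rw [hφ]; simp only [hqq]
  have ht : Tendsto (extChartAt (𝓡 d) q).symm (𝓝 u) (𝓝 q) := by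
    have := (continuousAt_extChartAt_symm (I := 𝓡 d) q).tendsto
    rwa [extChartAt_to_inv] at this
  have e : (fun y => η ((extChartAt (𝓡 d) q).symm y)) =ᶠ[𝓝 u]
      fun y => η ((extChartAt (𝓡 d) a).symm (φ y)) := by
    filter_upwards [ht.eventually ((isOpen_extChartAt_source a).mem_nhds hq)] with y hy
    rw [hφ]
    exact congrArg η ((extChartAt (𝓡 d) a).left_inv hy).symm
  have hη' : ContDiffAt ℝ 2 (fun y => η ((extChartAt (𝓡 d) a).symm y)) (φ u) := by
    rw [hφu]
    exact contMDiffAt_iff_contDiffAt.1 ((hη.contMDiffAt.of_le two_le_infty).comp _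
      (contMDiffAt_extChartAt_symm ((extChartAt _ a).map_source hq) two_le_infty))
  have hB : ∀ v w, chartRep (𝓡 d) h.toTensor q u v w = chartRep (𝓡 d) h.toTensor a
      (extChartAt (𝓡 d) a q) (fderiv ℝ φ u v) (fderiv ℝ φ u w) := fun v w => by
    rw [hp.eventually_eq.self_of_nhds, hφu]; rfl
  refine ⟨h0, fun v => ?_, fun v w => ?_⟩
  · have e1 := e.fderiv_eq.trans (fderiv_fun_comp u (g := fun y => η ((extChartAt (𝓡 d) a).symm y))
      (hη'.differentiableAt (by norm_num)) (hp.contDiffAt.differentiableAt (by norm_num)))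
    rw [← hu, e1, hφu, hB]
    exact h1 _
  · have e1 : hess (chartRep (𝓡 d) h.toTensor q) (fun y => η ((extChartAt (𝓡 d) q).symm y)) u v w =
        hess (chartRep (𝓡 d) h.toTensor q)
          (fun y => (fun y => η ((extChartAt (𝓡 d) a).symm y)) (φ y)) u v w := by
      rw [hess_apply, hess_apply, e.fderiv_eq, (e.fderiv).fderiv_eq]
    rw [← hu, e1, hp.hess_comp (by rw [hφu]; exact hm.eventually_symm) hη', hB, hB, hφu]
    exact h2 _ _

omit [IsManifold (𝓡 d) ∞ N] in
lemma HasHessianBound.mono {h : N → E d →L[ℝ] E d →L[ℝ] ℝ} {η : N → ℝ} {C C' : ℝ} {q : N}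
    (hb : HasHessianBound h η C q) (hC : C ≤ C') : HasHessianBound h η C' q :=
  ⟨hb.le.trans hC, fun v => (hb.fderiv_le v).trans (by gcongr),
    fun v w => (hb.hess_le v w).trans (by gcongr)⟩

/-- In a fixed chart the first derivative and the Hessian are continuous, and the metric is coercive
near the centre; compactness does the rest. -/
lemma exists_hasHessianBound [CompactSpace N] {η : N → ℝ} (hη : ContMDiff (𝓡 d) 𝓘(ℝ, ℝ) ∞ η) :
    ∃ C, ∀ q, HasHessianBound h.toTensor η C q := by
  refine exists_uniform_bound (fun C C' q hC hb => hb.mono hC) fun a => ?_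
  set y := extChartAt (𝓡 d) a a with hy
  have ha := mem_extChartAt_source (I := 𝓡 d) a
  have hm := h.isMetricAt_chartRep two_le_infty ha
  have hη' : ContDiffAt ℝ 3 (fun y => η ((extChartAt (𝓡 d) a).symm y)) y :=
    contMDiffAt_iff_contDiffAt.1 ((hη.contMDiffAt.of_le three_le_infty).comp _
      (contMDiffAt_extChartAt_symm ((extChartAt _ a).map_source ha) three_le_infty))
  obtain ⟨c, hc, hcoer⟩ := exists_eventually_norm_sq_le hm.contDiffAt.continuousAt hm.symm
    (fun v hv => h.chartRep_pos ((extChartAt _ a).map_source ha) hv)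
  have c1 : ContinuousAt (fderiv ℝ fun y => η ((extChartAt (𝓡 d) a).symm y)) y :=
    (hη'.fderiv_right (m := 2) (by norm_num)).continuousAt
  have c2 : ContinuousAt (hess (chartRep (𝓡 d) h.toTensor a)
      fun y => η ((extChartAt (𝓡 d) a).symm y)) y :=
    (hm.contDiffAt_hess (m := 1) hη' le_rfl (by norm_num)).continuousAt
  set L := fderiv ℝ fun y => η ((extChartAt (𝓡 d) a).symm y) with hL
  set S := hess (chartRep (𝓡 d) h.toTensor a) fun y => η ((extChartAt (𝓡 d) a).symm y) with hS
  have b1 : ∀ᶠ y' in 𝓝 y, ‖L y'‖ < ‖L y‖ + 1 := c1.norm.eventually (gt_mem_nhds (by simp))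
  have b2 : ∀ᶠ y' in 𝓝 y, ‖S y'‖ < ‖S y‖ + 1 := c2.norm.eventually (gt_mem_nhds (by simp))
  have ht : Tendsto (extChartAt (𝓡 d) a) (𝓝 a) (𝓝 y) := continuousAt_extChartAt a
  refine ⟨max (η a + 1) (max ((‖L y‖ + 1) * c) ((‖S y‖ + 1) * (c * c))), ?_⟩
  filter_upwards [(isOpen_extChartAt_source a).mem_nhds ha, ht.eventually hcoer, ht.eventually b1,
    ht.eventually b2, hη.continuous.continuousAt.eventually (gt_mem_nhds (lt_add_one (η a)))]
    with q q1 q2 q3 q4 q5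
  refine HasHessianBound.of_chart h hη q1 (q5.le.trans (le_max_left _ _)) (fun v => ?_)
    fun v w => ?_
  · calc _ ≤ ‖L (extChartAt (𝓡 d) a q)‖ * ‖v‖ := ContinuousLinearMap.le_opNorm _ _
      _ ≤ (‖L y‖ + 1) * (c * _) := mul_le_mul q3.le (q2 v) (norm_nonneg _) (by positivity)
      _ = ((‖L y‖ + 1) * c) * _ := by ring
      _ ≤ _ := mul_le_mul_of_nonneg_right ((le_max_left _ _).trans (le_max_right _ _))
        (Real.sqrt_nonneg _)
  · calc _ ≤ ‖S (extChartAt (𝓡 d) a q)‖ * ‖v‖ * ‖w‖ := ContinuousLinearMap.le_opNorm₂ _ _ _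
      _ ≤ (‖S y‖ + 1) * (c * _) * (c * _) := mul_le_mul (mul_le_mul q4.le (q2 v) (norm_nonneg _)
        (by positivity)) (q2 w) (norm_nonneg _) (by positivity)
      _ = ((‖S y‖ + 1) * (c * c)) * (_ * _) := by ring
      _ ≤ _ := mul_le_mul_of_nonneg_right ((le_max_right _ _).trans (le_max_right _ _))
        (by positivity)

lemma exists_chartRep_eq_bilinearComp {a q : N} (hq : q ∈ (extChartAt (𝓡 d) a).source) :
    ∃ A : E d ≃L[ℝ] E d, HasMFDerivAt 𝓘(ℝ, E d) (𝓡 d) (extChartAt (𝓡 d) a).symm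
      (extChartAt (𝓡 d) a q) (A : E d →L[ℝ] E d) ∧ ∀ B : N → E d →L[ℝ] E d →L[ℝ] ℝ,
        chartRep (𝓡 d) B a (extChartAt (𝓡 d) a q) =
          (B q).bilinearComp (A : E d →L[ℝ] E d) (A : E d →L[ℝ] E d) := by
  have hu := (extChartAt (𝓡 d) a).map_source hq
  obtain ⟨A, hA⟩ : ∃ A : E d ≃L[ℝ] E d, (A : E d →L[ℝ] E d) =
    mfderiv 𝓘(ℝ, E d) (𝓡 d) (extChartAt (𝓡 d) a).symm (extChartAt (𝓡 d) a q) :=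
    isInvertible_mfderiv_extChartAt_symm hu
  refine ⟨A, ?_, fun B => ?_⟩
  · rw [hA]
    exact ((contMDiffAt_extChartAt_symm hu (m := ∞) le_rfl).mdifferentiableAt
      (by simp)).hasMFDerivAt
  · rw [hA]
    unfold chartRep pullback
    rw [(extChartAt (𝓡 d) a).left_inv hq]

/-- A continuous 2-tensor field on a compact manifold is bounded. -/
lemma exists_tensor_bound [CompactSpace N] {T : N → E d →L[ℝ] E d →L[ℝ] ℝ}
    (hT : IsSymmC2 (𝓡 d) T) :
    ∃ C, ∀ q v w, |T q v w| ≤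
      C * (Real.sqrt (h.toTensor q v v) * Real.sqrt (h.toTensor q w w)) := by
  refine exists_uniform_bound (fun C C' q hC hb v w => (hb v w).trans (by gcongr)) fun a => ?_
  set y := extChartAt (𝓡 d) a a with hy
  have ha := mem_extChartAt_source (I := 𝓡 d) a
  have hm := h.isMetricAt_chartRep two_le_infty ha
  obtain ⟨c, hc, hcoer⟩ := exists_eventually_norm_sq_le hm.contDiffAt.continuousAt hm.symm
    (fun v hv => h.chartRep_pos ((extChartAt _ a).map_source ha) hv)
  have c2 : ContinuousAt (chartRep (𝓡 d) T a) y :=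
    ((hT.contDiffOn a).continuousOn).continuousAt
      ((isOpen_extChartAt_target a).mem_nhds ((extChartAt _ a).map_source ha))
  set S := chartRep (𝓡 d) T a
  have b2 : ∀ᶠ y' in 𝓝 y, ‖S y'‖ < ‖S y‖ + 1 := c2.norm.eventually (gt_mem_nhds (by simp))
  have ht : Tendsto (extChartAt (𝓡 d) a) (𝓝 a) (𝓝 y) := continuousAt_extChartAt a
  refine ⟨(‖S y‖ + 1) * (c * c), ?_⟩
  filter_upwards [(isOpen_extChartAt_source a).mem_nhds ha, ht.eventually hcoer, ht.eventually b2]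
    with q q1 q2 q4 v w
  obtain ⟨A, -, hA⟩ := exists_chartRep_eq_bilinearComp q1
  have key : ∀ (B : N → E d →L[ℝ] E d →L[ℝ] ℝ) (v w : E d), B q v w =
      chartRep (𝓡 d) B a (extChartAt (𝓡 d) a q) (A.symm v) (A.symm w) := fun B v w => by
    rw [hA B]; simp
  rw [key T, key h.toTensor, key h.toTensor]
  calc _ ≤ ‖S (extChartAt (𝓡 d) a q)‖ * ‖A.symm v‖ * ‖A.symm w‖ :=
        ContinuousLinearMap.le_opNorm₂ _ _ _
    _ ≤ (‖S y‖ + 1) * (c * _) * (c * _) := mul_le_mul (mul_le_mul q4.le (q2 _) (norm_nonneg _)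
      (by positivity)) (q2 _) (norm_nonneg _) (by positivity)
    _ = ((‖S y‖ + 1) * (c * c)) * (_ * _) := by ring

/-- The bound on the differential of a function, without reference to charts. -/
lemma HasHessianBound.mfderiv_le {h : N → E d →L[ℝ] E d →L[ℝ] ℝ} {η : N → ℝ} {C : ℝ} {q : N}
    (hb : HasHessianBound h η C q) {L : E d →L[ℝ] ℝ} (hL : HasMFDerivAt (𝓡 d) 𝓘(ℝ, ℝ) η q L)
    (v : E d) : |L v| ≤ C * Real.sqrt (h q v v) := by
  have hq := mem_extChartAt_source (I := 𝓡 d) q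
  obtain ⟨A, hA, hAB⟩ := exists_chartRep_eq_bilinearComp hq
  rw [← (extChartAt (𝓡 d) q).left_inv hq] at hL
  have h2 : HasFDerivAt (fun y => η ((extChartAt (𝓡 d) q).symm y)) (L.comp (A : E d →L[ℝ] E d))
    (extChartAt (𝓡 d) q q) := (hL.comp _ hA).hasFDerivAt
  have h3 := hb.fderiv_le (A.symm v)
  have e : fderiv ℝ (fun y => η ((extChartAt (𝓡 d) q).symm y)) (extChartAt (𝓡 d) q q) =
    L.comp (A : E d →L[ℝ] E d) := h2.fderiv
  rw [e, hAB] at h3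
  simpa using h3

end UniformBounds

/-! ### The metric `g + F dx²`. -/

section AddSquare

set_option linter.unusedSectionVars false

variable {n : ℕ} {M : Type*} [TopologicalSpace M] [ChartedSpace (E n) M]

/-- The tensor field `T + F dx²`. -/
def addDiffSq (T : M → E n →L[ℝ] E n →L[ℝ] ℝ) (x F : M → ℝ) (q : M) : E n →L[ℝ] E n →L[ℝ] ℝ :=
  let A : E n →L[ℝ] ℝ := mfderiv (𝓡 n) 𝓘(ℝ, ℝ) x q
  T q + F q • A.smulRight A

lemma addDiffSq_of_eq_zero {T : M → E n →L[ℝ] E n →L[ℝ] ℝ} {x F : M → ℝ} {q : M} (h : F q = 0) :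
    addDiffSq T x F q = T q := by
  simp [addDiffSq, h]

lemma addDiffSq_apply {T : M → E n →L[ℝ] E n →L[ℝ] ℝ} {x F : M → ℝ} {q : M} {A : E n →L[ℝ] ℝ}
    (hA : HasMFDerivAt (𝓡 n) 𝓘(ℝ, ℝ) x q A) (v w : E n) :
    addDiffSq T x F q v w = T q v w + F q * (A v * A w) := by
  have : (mfderiv (𝓡 n) 𝓘(ℝ, ℝ) x q : E n →L[ℝ] ℝ) = A := hA.mfderiv
  simp [addDiffSq, this]

variable [IsManifold (𝓡 n) ∞ M]

lemma chartRep_addDiffSq {T : M → E n →L[ℝ] E n →L[ℝ] ℝ} {x F : M → ℝ}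
    (hx : ContMDiff (𝓡 n) 𝓘(ℝ, ℝ) ∞ x) {p : M} {u : E n}
    (hu : u ∈ (extChartAt (𝓡 n) p).target) :
    chartRep (𝓡 n) (addDiffSq T x F) p u = addSq (chartRep (𝓡 n) T p)
      (fun u => x ((extChartAt (𝓡 n) p).symm u)) (fun u => F ((extChartAt (𝓡 n) p).symm u)) u := by
  have h1 : HasMFDerivAt (𝓡 n) 𝓘(ℝ, ℝ) x ((extChartAt (𝓡 n) p).symm u) _ :=
    (hx.mdifferentiableAt (by simp)).hasMFDerivAt
  have h2 : HasMFDerivAt 𝓘(ℝ, E n) (𝓡 n) (extChartAt (𝓡 n) p).symm u _ :=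
    ((contMDiffAt_extChartAt_symm hu (m := ∞) le_rfl).mdifferentiableAt (by simp)).hasMFDerivAt
  have h3 := (mfderiv_eq_fderiv (f := fun u => x ((extChartAt (𝓡 n) p).symm u))).symm.trans
    (h1.comp u h2).mfderiv
  refine ContinuousLinearMap.ext fun v => ContinuousLinearMap.ext fun w => ?_
  simp only [addSq]
  rw [h3]
  exact addDiffSq_apply h1 _ _

/-- The metric `g + F dx²`. -/
def RiemMetric.addDiffSq (g : RiemMetric n 2 M) {x F : M → ℝ}
    (hx : ContMDiff (𝓡 n) 𝓘(ℝ, ℝ) ∞ x) (hF : ContMDiff (𝓡 n) 𝓘(ℝ, ℝ) 2 F)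
    (hF0 : ∀ q, 0 ≤ F q) : RiemMetric n 2 M where
  inner q := MassAspect.addDiffSq g.toTensor x F q
  symm q v w := by
    obtain ⟨A, hA⟩ : ∃ A : E n →L[ℝ] ℝ, HasMFDerivAt (𝓡 n) 𝓘(ℝ, ℝ) x q A :=
      ⟨_, (hx.mdifferentiableAt (by simp)).hasMFDerivAt⟩
    refine (addDiffSq_apply hA v w).trans (Eq.trans ?_ (addDiffSq_apply hA w v).symm)
    exact congrArg₂ (· + ·) (g.toTensor_symm q v w) (congrArg _ (mul_comm (A v) (A w)))
  pos q v hv := by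
    obtain ⟨A, hA⟩ : ∃ A : E n →L[ℝ] ℝ, HasMFDerivAt (𝓡 n) 𝓘(ℝ, ℝ) x q A :=
      ⟨_, (hx.mdifferentiableAt (by simp)).hasMFDerivAt⟩
    refine lt_of_lt_of_eq ?_ (addDiffSq_apply hA v v).symm
    exact add_pos_of_pos_of_nonneg (g.toTensor_pos q hv) (mul_nonneg (hF0 q) (mul_self_nonneg _))
  -- The metric only grows, so its unit ball lies in that of `g`.
  isVonNBounded q := by
    refine (g.isVonNBounded q).subset fun v hv => ?_
    obtain ⟨A, hA⟩ : ∃ A : E n →L[ℝ] ℝ, HasMFDerivAt (𝓡 n) 𝓘(ℝ, ℝ) x q A :=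
      ⟨_, (hx.mdifferentiableAt (by simp)).hasMFDerivAt⟩
    refine lt_of_le_of_lt ?_ (lt_of_eq_of_lt (addDiffSq_apply hA v v).symm hv)
    exact le_add_of_nonneg_right (mul_nonneg (hF0 q) (mul_self_nonneg _))
  contMDiff q := by
    have hq := mem_extChartAt_source (I := 𝓡 n) q
    have hu := (extChartAt (𝓡 n) q).map_source hq
    refine (contMDiffAt_section_iff_chartRep (m := 2) (by norm_cast) _ hq).2 ?_
    have e : chartRep (𝓡 n) (MassAspect.addDiffSq g.toTensor x F) q
        =ᶠ[𝓝 (extChartAt (𝓡 n) q q)] addSq (chartRep (𝓡 n) g.toTensor q)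
          (fun u => x ((extChartAt (𝓡 n) q).symm u))
          (fun u => F ((extChartAt (𝓡 n) q).symm u)) := by
      filter_upwards [(isOpen_extChartAt_target q).mem_nhds hu] with u hu'
      exact chartRep_addDiffSq hx hu'
    refine ContDiffAt.congr_of_eventuallyEq ?_ e
    have h1 : ContDiffAt ℝ 3 (fun u => x ((extChartAt (𝓡 n) q).symm u)) (extChartAt (𝓡 n) q q) :=
      contMDiffAt_iff_contDiffAt.1 ((hx.contMDiffAt.of_le three_le_infty).comp _
        (contMDiffAt_extChartAt_symm hu three_le_infty))
    have h2 : ContDiffAt ℝ 2 (fun u => F ((extChartAt (𝓡 n) q).symm u)) (extChartAt (𝓡 n) q q) :=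
      contMDiffAt_iff_contDiffAt.1 (hF.contMDiffAt.comp _
        (contMDiffAt_extChartAt_symm hu two_le_infty))
    have h3 := h1.fderiv_right (m := 2) (by norm_num)
    exact (g.isMetricAt_chartRep le_rfl hq).contDiffAt.add (h2.smul (h3.smulRight h3))

lemma RiemMetric.toTensor_addDiffSq (g : RiemMetric n 2 M) {x F : M → ℝ}
    (hx : ContMDiff (𝓡 n) 𝓘(ℝ, ℝ) ∞ x) (hF : ContMDiff (𝓡 n) 𝓘(ℝ, ℝ) 2 F)
    (hF0 : ∀ q, 0 ≤ F q) :
    (g.addDiffSq hx hF hF0).toTensor = MassAspect.addDiffSq g.toTensor x F := rfl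

lemma scalarCurvature_congr {T T' : M → E n →L[ℝ] E n →L[ℝ] ℝ} {q : M} (h : T =ᶠ[𝓝 q] T') :
    scalarCurvature (𝓡 n) T q = scalarCurvature (𝓡 n) T' q :=
  scalarCoord_congr (chartRep_eventuallyEq (mem_extChartAt_source q) h)

end AddSquare

/-! ### Geometry of the collar `(0, x₀) × N`. -/

section Collar

set_option linter.unusedSectionVars false

variable {n : ℕ} {N : Type*} [TopologicalSpace N] [ChartedSpace (E (n - 1)) N]
  [IsManifold (𝓡 (n - 1)) ∞ N] {M : Type*} [TopologicalSpace M] [ChartedSpace (E n) M]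
  [IsManifold (𝓡 n) ∞ M] {x : M → ℝ} {x₀ : ℝ} {Φ : OpenPartialHomeomorph (ℝ × N) M}

namespace IsCollar

variable (hΦ : IsCollar n x x₀ Φ)
include hΦ

lemma contMDiffAt {z : ℝ × N} (hz : z ∈ Φ.source) : ContMDiffAt (IC n) (𝓡 n) ∞ Φ z :=
  hΦ.contMDiffOn.contMDiffAt (Φ.open_source.mem_nhds hz)

lemma contMDiffAt_symm {q : M} (hq : q ∈ Φ.target) : ContMDiffAt (𝓡 n) (IC n) ∞ Φ.symm q :=
  hΦ.contMDiffOn_symm.contMDiffAt (Φ.open_target.mem_nhds hq)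

lemma isInvertible_mfderiv {z : ℝ × N} (hz : z ∈ Φ.source) :
    (mfderiv (IC n) (𝓡 n) Φ z : F n →L[ℝ] E n).IsInvertible := by
  have h1 : HasMFDerivAt (IC n) (𝓡 n) Φ z _ :=
    ((hΦ.contMDiffAt hz).mdifferentiableAt (by simp)).hasMFDerivAt
  have h2 : HasMFDerivAt (𝓡 n) (IC n) Φ.symm (Φ z) _ :=
    ((hΦ.contMDiffAt_symm (Φ.map_source hz)).mdifferentiableAt (by simp)).hasMFDerivAt
  have h1' : HasMFDerivAt (IC n) (𝓡 n) Φ (Φ.symm (Φ z)) (mfderiv (IC n) (𝓡 n) Φ z) := by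
    rw [Φ.left_inv hz]; exact h1
  have h3 := (h2.comp z h1).congr_of_eventuallyEq (f₁ := fun z => z)
    (Filter.mem_of_superset (Φ.open_source.mem_nhds hz) fun y hy => (Φ.left_inv hy).symm)
  have h4 := (h1'.comp (Φ z) h2).congr_of_eventuallyEq (f₁ := fun q => q)
    (Filter.mem_of_superset (Φ.open_target.mem_nhds (Φ.map_source hz))
      fun y hy => (Φ.right_inv hy).symm)
  exact ContinuousLinearMap.IsInvertible.of_inverse
    (hasMFDerivAt_unique h4 (hasMFDerivAt_id _)) (hasMFDerivAt_unique h3 (hasMFDerivAt_id _))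

variable (g : RiemMetric n 2 M)

lemma isLocalPullback {z : ℝ × N} (hz : z ∈ Φ.source) :
    IsLocalPullback (fun u => extChartAt (𝓡 n) (Φ z) (Φ ((extChartAt (IC n) z).symm u)))
      (chartRep (𝓡 n) g.toTensor (Φ z))
      (chartRep (IC n) (pullback (IC n) (𝓡 n) Φ g.toTensor) z) (extChartAt (IC n) z z) := by
  have hm := g.isMetricAt_chartRep le_rfl (mem_extChartAt_source (I := 𝓡 n) (Φ z))
  exact isLocalPullback_chart (mem_extChartAt_source z) (mem_extChartAt_source (Φ z))
    ((hΦ.contMDiffAt hz).of_le three_le_infty) (hΦ.isInvertible_mfderiv hz)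
    hm.contDiffAt hm.invertible

lemma isMetricAt {z : ℝ × N} (hz : z ∈ Φ.source) :
    IsMetricAt (chartRep (IC n) (pullback (IC n) (𝓡 n) Φ g.toTensor) z) (extChartAt (IC n) z z) :=
  ⟨(hΦ.isLocalPullback g hz).contDiffAt_pullback, (hΦ.isLocalPullback g hz).invertible_pullback,
    Eventually.of_forall fun _ _ _ => g.toTensor_symm _ _ _⟩

/-- Coordinate invariance of the scalar curvature moves the computation from the chart of `M` to
product coordinates on the collar, where `x` is a coordinate. -/
lemma scalarCurvature_eq {z : ℝ × N} (hz : z ∈ Φ.source) :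
    scalarCurvature (𝓡 n) g.toTensor (Φ z) =
      scalarCoord (chartRep (IC n) (pullback (IC n) (𝓡 n) Φ g.toTensor) z)
        (extChartAt (IC n) z z) := by
  have hm := g.isMetricAt_chartRep le_rfl (mem_extChartAt_source (I := 𝓡 n) (Φ z))
  have e : extChartAt (𝓡 n) (Φ z) (Φ ((extChartAt (IC n) z).symm (extChartAt (IC n) z z))) =
      extChartAt (𝓡 n) (Φ z) (Φ z) := by rw [extChartAt_to_inv]
  rw [(hΦ.isLocalPullback g hz).scalarCoord_eq (by rw [e]; exact hm.eventually_symm), e]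
  rfl

/-- On the collar `x ∘ Φ` is the first coordinate, so the differential of `x` pulls back to `dx`. -/
lemma pullback_addDiffSq (T : M → E n →L[ℝ] E n →L[ℝ] ℝ) (φ : M → ℝ) {z : ℝ × N}
    (hz : z ∈ Φ.source) : pullback (IC n) (𝓡 n) Φ (addDiffSq T x φ) z =
      pullback (IC n) (𝓡 n) Φ T z + φ (Φ z) • dxSq := by
  have h1 : HasMFDerivAt (IC n) (𝓡 n) Φ z _ :=
    ((hΦ.contMDiffAt hz).mdifferentiableAt (by simp)).hasMFDerivAt
  have h2 : HasMFDerivAt (𝓡 n) 𝓘(ℝ, ℝ) x (Φ z) _ :=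
    (hΦ.smooth.mdifferentiableAt (by simp)).hasMFDerivAt
  have h3 := (h2.comp z h1).congr_of_eventuallyEq (f₁ := Prod.fst)
    (Filter.mem_of_superset (Φ.open_source.mem_nhds hz) fun y hy => (hΦ.fst_eq y hy).symm)
  have h4 : ((mfderiv (𝓡 n) 𝓘(ℝ, ℝ) x (Φ z) : E n →L[ℝ] ℝ).comp
      (mfderiv (IC n) (𝓡 n) Φ z : F n →L[ℝ] E n)) = ContinuousLinearMap.fst ℝ ℝ (E (n - 1)) :=
    hasMFDerivAt_unique h3 (hasMFDerivAt_fst z)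
  have h5 : ∀ v : F n, (mfderiv (𝓡 n) 𝓘(ℝ, ℝ) x (Φ z) : E n →L[ℝ] ℝ)
      ((mfderiv (IC n) (𝓡 n) Φ z : F n →L[ℝ] E n) v) = v.1 := fun v =>
    congrArg (fun L : F n →L[ℝ] ℝ => L v) h4
  refine ContinuousLinearMap.ext fun v => ContinuousLinearMap.ext fun w => ?_
  refine (addDiffSq_apply h2 _ _).trans ?_
  simp only [add_apply, smul_apply, smul_eq_mul, dxSq_apply]
  exact congrArg₂ (fun a b => pullback (IC n) (𝓡 n) Φ T z v w + φ (Φ z) * (a * b)) (h5 v) (h5 w)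

end IsCollar

end Collar

/-! ### The radial profile, its correction, and the sign of the curvature change. -/

section Profile

/-- A smooth function which is `1` for `x ≤ 3ε` and `0` for `x ≥ 4ε`. -/
def cutoff (ε x : ℝ) : ℝ := Real.smoothTransition (4 - x / ε)

variable {ε x K : ℝ}

lemma contDiff_cutoff {m : ℕ∞} : ContDiff ℝ m (cutoff ε) :=
  Real.smoothTransition.contDiff.comp (contDiff_const.sub (contDiff_id.div_const ε))

lemma cutoff_nonneg : 0 ≤ cutoff ε x := Real.smoothTransition.nonneg _

lemma cutoff_le_one : cutoff ε x ≤ 1 := Real.smoothTransition.le_one _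

lemma cutoff_eq_one (hε : 0 < ε) (hx : x ≤ 3 * ε) : cutoff ε x = 1 := by
  refine Real.smoothTransition.one_of_one_le ?_
  have : x / ε ≤ 3 := by rwa [div_le_iff₀ hε]
  linarith

lemma cutoff_eq_zero (hε : 0 < ε) (hx : 4 * ε ≤ x) : cutoff ε x = 0 := by
  refine Real.smoothTransition.zero_of_nonpos ?_
  have : 4 ≤ x / ε := by rwa [le_div_iff₀ hε]
  linarith

lemma hasDerivAt_cutoff : HasDerivAt (cutoff ε) (deriv (cutoff ε) x) x :=
  (contDiff_cutoff.differentiable (n := 1) (by simp) x).hasDerivAt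

lemma deriv_cutoff_nonpos (hε : 0 < ε) : deriv (cutoff ε) x ≤ 0 := by
  refine Antitone.deriv_nonpos fun a b hab => Real.smoothTransition.monotone ?_
  have : a / ε ≤ b / ε := by gcongr
  linarith

/-- The derivative lives on `[3ε, 4ε]`, away from `0`, so it is bounded by a multiple of `x`, with a
constant depending on `ε`. The extra factor `x` raises the order of the cutoff term from `x^(n+1)`
to `x^(n+2)`. -/
lemma exists_neg_deriv_cutoff_le (hε : 0 < ε) :
    ∃ B, 0 ≤ B ∧ ∀ x, 0 < x → -deriv (cutoff ε) x ≤ B * x := by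
  have hc : Continuous (deriv (cutoff ε)) := contDiff_cutoff.continuous_deriv (n := 1) le_rfl
  obtain ⟨B, hB⟩ := isCompact_Icc.exists_bound_of_continuousOn (s := Icc (3 * ε) (4 * ε))
    hc.continuousOn
  refine ⟨|B| / (3 * ε), by positivity, fun x hx => ?_⟩
  have h0 : 0 ≤ |B| / (3 * ε) * x := by positivity
  rcases lt_or_ge x (3 * ε) with h | h
  · have e : cutoff ε =ᶠ[𝓝 x] fun _ => 1 := by
      filter_upwards [gt_mem_nhds h] with y hy using cutoff_eq_one hε (le_of_lt hy)
    rw [e.deriv_eq, deriv_const]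
    simpa using h0
  rcases lt_or_ge (4 * ε) x with h' | h'
  · have e : cutoff ε =ᶠ[𝓝 x] fun _ => 0 := by
      filter_upwards [lt_mem_nhds h'] with y hy using cutoff_eq_zero hε (le_of_lt hy)
    rw [e.deriv_eq, deriv_const]
    simpa using h0
  · have h1 := (neg_le_abs _).trans ((hB x ⟨h, h'⟩).trans (le_abs_self B))
    refine h1.trans ?_
    rw [div_mul_eq_mul_div, le_div_iff₀ (by positivity)]
    gcongr

/-- The function `n / (n - 1) x^n` cut off at `x = 4ε`. -/
def profile (n : ℕ) (ε x : ℝ) : ℝ := n / (n - 1) * x ^ n * cutoff ε x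

/-- The correction which makes the change of the scalar curvature nonnegative. -/
def correction (n : ℕ) (ε K x : ℝ) : ℝ := profile n ε x * (K * (16 * ε ^ 2 - x ^ 2))

variable {n : ℕ}

lemma contDiff_profile {m : ℕ∞} : ContDiff ℝ m (profile n ε) :=
  (contDiff_const.mul (contDiff_id.pow n)).mul contDiff_cutoff

lemma contDiff_correction {m : ℕ∞} : ContDiff ℝ m (correction n ε K) :=
  contDiff_profile.mul (contDiff_const.mul (contDiff_const.sub (contDiff_id.pow 2)))

lemma one_le_massFactor (hn : 3 ≤ n) : (1 : ℝ) ≤ n / (n - 1) := by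
  have : (3 : ℝ) ≤ n := by exact_mod_cast hn
  rw [le_div_iff₀ (by linarith)]
  linarith

lemma massFactor_le (hn : 3 ≤ n) : (n : ℝ) / (n - 1) ≤ 2 := by
  have : (3 : ℝ) ≤ n := by exact_mod_cast hn
  rw [div_le_iff₀ (by linarith)]
  linarith

lemma profile_nonneg (hn : 3 ≤ n) (hx : 0 ≤ x) : 0 ≤ profile n ε x := by
  have := one_le_massFactor hn
  have := cutoff_nonneg (ε := ε) (x := x)
  unfold profile
  positivity

lemma profile_le (hn : 3 ≤ n) (hx : 0 ≤ x) : profile n ε x ≤ 2 * x ^ n := by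
  have h1 := massFactor_le hn
  have h2 := one_le_massFactor hn
  have h3 := cutoff_le_one (ε := ε) (x := x)
  have h4 := cutoff_nonneg (ε := ε) (x := x)
  unfold profile
  calc _ ≤ 2 * x ^ n * 1 := by gcongr
    _ = _ := mul_one _

/-- The first order operator applied to the perturbation. -/
lemma deriv_profile_add_correction (hn : 3 ≤ n) (s : ℝ) :
    x * (deriv (profile n ε) x * s + deriv (correction n ε K) x) -
      n * (profile n ε x * s + correction n ε K x) =
    n / (n - 1) * x ^ (n + 1) * (deriv (cutoff ε) x * (s + K * (16 * ε ^ 2 - x ^ 2))) -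
      2 * K * x ^ 2 * profile n ε x := by
  -- The operator `x d/dx - n` annihilates `x^n`, so only the derivatives of the cutoff and of `-K
  -- x²` survive; the latter gives `-2 K x²` times the profile.
  have h1 : HasDerivAt (profile n ε) _ x :=
    ((hasDerivAt_pow n x).const_mul ((n : ℝ) / (n - 1))).mul (hasDerivAt_cutoff (ε := ε))
  have h2 : HasDerivAt (correction n ε K) _ x :=
    h1.mul (((hasDerivAt_const x (16 * ε ^ 2)).sub (hasDerivAt_pow 2 x)).const_mul K)
  rw [h2.deriv, h1.deriv]
  simp only [correction, profile]
  obtain ⟨m, rfl⟩ : ∃ m, n = m + 1 := ⟨n - 1, by omega⟩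
  simp only [Nat.add_sub_cancel]
  push_cast
  ring

/-- The change of the scalar curvature, given its leading term up to lower order. -/
lemma scalar_change_bounds (hn : 3 ≤ n) (hε : 0 < ε) {Kₑ η₁ : ℝ} (hK : |Kₑ| ≤ K) :
    ∃ C, ∀ x s D : ℝ, 0 < x → x ≤ 4 * ε → 0 ≤ s → s ≤ η₁ → (∃ ϑ ∈ Icc (1 : ℝ) n,
      |D + ϑ * (x * (deriv (profile n ε) x * s + deriv (correction n ε K) x) -
        n * (profile n ε x * s + correction n ε K x))| ≤ Kₑ * profile n ε x * x ^ 2) →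
      0 ≤ D ∧ D ≤ C * x ^ (n + 2) := by
  obtain ⟨B, hB0, hB⟩ := exists_neg_deriv_cutoff_le hε
  have hK0 : 0 ≤ K := (abs_nonneg _).trans hK
  refine ⟨n * (2 * B * (|η₁| + K * (16 * ε ^ 2)) + 4 * K) + 2 * K, ?_⟩
  rintro x s D hx hx4 hs hsη ⟨ϑ, ⟨hϑ1, hϑn⟩, hD⟩
  rw [deriv_profile_add_correction hn] at hD
  set a := n / (n - 1) * x ^ (n + 1) * (deriv (cutoff ε) x * (s + K * (16 * ε ^ 2 - x ^ 2))) with ha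
  set P := profile n ε x with hP
  have hP0 : 0 ≤ P := profile_nonneg hn hx.le
  have hP2 : P ≤ 2 * x ^ n := profile_le hn hx.le
  have hx16 : x ^ 2 ≤ 16 * ε ^ 2 := by nlinarith
  have hm0 : 0 ≤ s + K * (16 * ε ^ 2 - x ^ 2) :=
    add_nonneg hs (mul_nonneg hK0 (by linarith))
  have hm1 : s + K * (16 * ε ^ 2 - x ^ 2) ≤ |η₁| + K * (16 * ε ^ 2) := by
    have := hsη.trans (le_abs_self η₁)
    nlinarith [mul_nonneg hK0 (sq_nonneg x)]
  have hf1 := one_le_massFactor hn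
  have hf2 := massFactor_le hn
  have ha0 : a ≤ 0 := by
    rw [ha]
    refine mul_nonpos_of_nonneg_of_nonpos (by positivity) ?_
    exact mul_nonpos_of_nonpos_of_nonneg (deriv_cutoff_nonpos hε) hm0
  have ha1 : -a ≤ 2 * B * (|η₁| + K * (16 * ε ^ 2)) * x ^ (n + 2) := by
    have h1 : -deriv (cutoff ε) x * (s + K * (16 * ε ^ 2 - x ^ 2)) ≤
        B * x * (|η₁| + K * (16 * ε ^ 2)) :=
      mul_le_mul (hB x hx) hm1 hm0 (by positivity)
    calc -a = n / (n - 1) * x ^ (n + 1) *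
          (-deriv (cutoff ε) x * (s + K * (16 * ε ^ 2 - x ^ 2))) := by rw [ha]; ring
      _ ≤ 2 * x ^ (n + 1) * (B * x * (|η₁| + K * (16 * ε ^ 2))) := by
        refine mul_le_mul (by gcongr) h1 ?_ (by positivity)
        exact mul_nonneg (neg_nonneg.2 (deriv_cutoff_nonpos hε)) hm0
      _ = _ := by ring
  have hPx : 0 ≤ P * x ^ 2 := by positivity
  have hPx2 : P * x ^ 2 ≤ 2 * x ^ (n + 2) := by
    calc P * x ^ 2 ≤ 2 * x ^ n * x ^ 2 := by gcongr
      _ = _ := by ring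
  have hKe : Kₑ * P * x ^ 2 ≤ K * (P * x ^ 2) := by
    rw [mul_assoc]
    exact mul_le_mul_of_nonneg_right ((le_abs_self _).trans hK) hPx
  obtain ⟨hD1, hD2⟩ := abs_le.1 hD
  have hb0 : 0 ≤ -(a - 2 * K * x ^ 2 * P) := by nlinarith [mul_nonneg hK0 hPx]
  -- The correction yields twice the error bound `K P x²`. Since `ϑ ≥ 1`, the change of curvature is
  -- at least `Y - K P x² ≥ K P x² ≥ 0`; the upper bound uses `ϑ ≤ n`.
  have hb1 : 2 * (K * (P * x ^ 2)) ≤ -(a - 2 * K * x ^ 2 * P) := by nlinarith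
  have hb2 : -(a - 2 * K * x ^ 2 * P) ≤
      (2 * B * (|η₁| + K * (16 * ε ^ 2)) + 4 * K) * x ^ (n + 2) := by
    nlinarith [mul_le_mul_of_nonneg_left hPx2 hK0]
  have hKP := mul_nonneg hK0 hPx
  set Y := -(a - 2 * K * x ^ 2 * P)
  have hY : ϑ * (a - 2 * K * x ^ 2 * P) = -(ϑ * Y) := by ring
  rw [hY] at hD1 hD2
  have h1 := mul_le_mul_of_nonneg_right hϑ1 hb0
  have h2 := (mul_le_mul_of_nonneg_right hϑn hb0).trans
    (mul_le_mul_of_nonneg_left hb2 (Nat.cast_nonneg (α := ℝ) n))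
  have h3 := mul_le_mul_of_nonneg_left hPx2 hK0
  constructor
  · linarith
  · linarith

end Profile

/-! ### The function `f` for which the perturbed metric is `g + f dx²`. -/

section Perturbation

open Classical in
/-- The function `f` of the perturbed metric `g + f dx²`. -/
def perturbation (n : ℕ) {N M : Type*} [TopologicalSpace N] [TopologicalSpace M] (x : M → ℝ) (x₀ : ℝ) (Φ : OpenPartialHomeomorph (ℝ × N) M) (η : N → ℝ) (ε K : ℝ)
    (q : M) : ℝ :=
  if x q < x₀ then
    (x q ^ 2)⁻¹ * (profile n ε (x q) * η (Φ.symm q).2 + correction n ε K (x q))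
  else 0

variable {n : ℕ} {N : Type*} [TopologicalSpace N] [ChartedSpace (E (n - 1)) N]
  {M : Type*} [TopologicalSpace M] [ChartedSpace (E n) M]
  {x : M → ℝ} {x₀ : ℝ} {Φ : OpenPartialHomeomorph (ℝ × N) M} {η : N → ℝ} {ε K : ℝ}

set_option linter.unusedSectionVars false

lemma perturbation_eq_zero (hε : 0 < ε) {q : M} (hq : 4 * ε ≤ x q) :
    perturbation n x x₀ Φ η ε K q = 0 := by
  simp [perturbation, correction, profile, cutoff_eq_zero hε hq]

namespace IsCollar

variable (hΦ : IsCollar n x x₀ Φ)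
include hΦ

lemma fst_mem {z : ℝ × N} (hz : z ∈ Φ.source) : 0 < z.1 ∧ z.1 < x₀ := by
  rw [hΦ.source_eq] at hz
  exact hz.1

lemma mem_source {z : ℝ × N} (h0 : 0 < z.1) (h1 : z.1 < x₀) : z ∈ Φ.source := by
  rw [hΦ.source_eq]
  exact ⟨⟨h0, h1⟩, mem_univ _⟩

lemma perturbation_apply {z : ℝ × N} (hz : z ∈ Φ.source) : perturbation n x x₀ Φ η ε K (Φ z) =
    (z.1 ^ 2)⁻¹ * (profile n ε z.1 * η z.2 + correction n ε K z.1) := by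
  simp [perturbation, hΦ.fst_eq z hz, Φ.left_inv hz, hΦ.fst_mem hz]

lemma perturbation_nonneg (hn : 3 ≤ n) (hη : ∀ p, 0 ≤ η p) (hε : 0 < ε) (hK : 0 ≤ K) (q : M) :
    0 ≤ perturbation n x x₀ Φ η ε K q := by
  rcases le_or_gt (4 * ε) (x q) with h | h
  · rw [perturbation_eq_zero hε h]
  unfold perturbation
  split_ifs
  · have hx := hΦ.pos q
    have hp := profile_nonneg (ε := ε) hn hx.le
    have h1 : 0 ≤ 16 * ε ^ 2 - x q ^ 2 := by nlinarith
    have := hη (Φ.symm q).2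
    unfold correction
    positivity
  · exact le_rfl

variable [IsManifold (𝓡 (n - 1)) ∞ N] [IsManifold (𝓡 n) ∞ M]

/-- The formula on the collar and the constant zero on `{x > 4ε}` overlap because `4 ε < x₀`. -/
lemma contMDiff_perturbation (hη : ContMDiff (𝓡 (n - 1)) 𝓘(ℝ, ℝ) ∞ η) (hε : 0 < ε)
    (hx₀ : 4 * ε < x₀) : ContMDiff (𝓡 n) 𝓘(ℝ, ℝ) 2 (perturbation n x x₀ Φ η ε K) := by
  intro q
  rcases lt_or_ge (x q) x₀ with h | h
  · have hq : q ∈ Φ.target := by rw [hΦ.target_eq]; exact h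
    have h1 : ContMDiffAt (𝓡 n) 𝓘(ℝ, ℝ) 2 (fun q => η (Φ.symm q).2) q :=
      (hη.contMDiffAt.comp q (contMDiffAt_snd.comp q (hΦ.contMDiffAt_symm hq))).of_le two_le_infty
    have hx : ContMDiffAt (𝓡 n) 𝓘(ℝ, ℝ) 2 x q := hΦ.smooth.contMDiffAt.of_le two_le_infty
    have h2 : ContMDiffAt (𝓡 n) 𝓘(ℝ, ℝ) 2 (fun q => profile n ε (x q)) q :=
      (contDiff_profile (m := 2)).contMDiff.contMDiffAt.comp q hx
    have h3 : ContMDiffAt (𝓡 n) 𝓘(ℝ, ℝ) 2 (fun q => correction n ε K (x q)) q :=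
      (contDiff_correction (m := 2)).contMDiff.contMDiffAt.comp q hx
    have h4 : ContMDiffAt (𝓡 n) 𝓘(ℝ, ℝ) 2 (fun q => (x q ^ 2)⁻¹) q :=
      ContMDiffAt.comp q (g := fun t : ℝ => (t ^ 2)⁻¹)
        (((contDiffAt_id.pow 2).inv (pow_pos (hΦ.pos q) 2).ne').contMDiffAt) hx
    refine (h4.mul ((h2.mul h1).add h3)).congr_of_eventuallyEq ?_
    filter_upwards [Φ.open_target.mem_nhds hq] with y hy
    rw [hΦ.target_eq] at hy
    exact if_pos hy
  · refine contMDiffAt_const (c := (0 : ℝ)) |>.congr_of_eventuallyEq ?_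
    filter_upwards [hΦ.smooth.continuous.continuousAt.eventually
      (lt_mem_nhds (hx₀.trans_le h))] with y hy
    exact perturbation_eq_zero hε hy.le

/-- The factor `x⁻²` in the perturbation turns `dx²` into `(d log x)²`, the form to which the
curvature estimate applies. -/
lemma chartRep_pullback_perturbation (T : M → E n →L[ℝ] E n →L[ℝ] ℝ) {z : ℝ × N}
    (hz : z ∈ Φ.source) :
    chartRep (IC n) (pullback (IC n) (𝓡 n) Φ (addDiffSq T x (perturbation n x x₀ Φ η ε K))) z
      =ᶠ[𝓝 (extChartAt (IC n) z z)] addSq (chartRep (IC n) (pullback (IC n) (𝓡 n) Φ T) z) logFst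
        (separated (profile n ε) (fun y => η ((extChartAt (𝓡 (n - 1)) z.2).symm y))
          (correction n ε K)) := by
  have ht := continuousAt_extChartAt_symm (I := IC n) z
  unfold ContinuousAt at ht
  rw [extChartAt_to_inv] at ht
  filter_upwards [(isOpen_extChartAt_target z).mem_nhds (mem_extChartAt_target (I := IC n) z),
    ht.eventually (Φ.open_source.mem_nhds hz)] with u hu hs
  have h0 := (hΦ.fst_mem hs).1
  have e := extChartAt_prod_symm_apply z u
  have hu0 : 0 < u.1 := by rw [e] at h0; exact h0
  refine ContinuousLinearMap.ext fun v => ContinuousLinearMap.ext fun w => ?_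
  have h1 : chartRep (IC n)
      (pullback (IC n) (𝓡 n) Φ (addDiffSq T x (perturbation n x x₀ Φ η ε K))) z u =
      chartRep (IC n) (pullback (IC n) (𝓡 n) Φ T) z u + perturbation n x x₀ Φ η ε K
        (Φ ((extChartAt (IC n) z).symm u)) • chartRep (IC n) (fun _ => dxSq) z u := by
    refine (chartRep_congr (T' := fun z => pullback (IC n) (𝓡 n) Φ T z +
      perturbation n x x₀ Φ η ε K (Φ z) • dxSq) ?_).trans rfl
    exact hΦ.pullback_addDiffSq T _ hs
  rw [h1, chartRep_dxSq hu, hΦ.perturbation_apply hs, e]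
  simp only [addSq, add_apply, smul_apply, dxSq_apply, smul_eq_mul, fderiv_logFst hu0.ne',
    ContinuousLinearMap.smulRight_apply, separated]
  field_simp

end IsCollar

end Perturbation

/-! ### The change of the scalar curvature on `M`. -/

section ScalarCurvature

variable {n : ℕ} {N : Type*} [TopologicalSpace N] [CompactSpace N] [ChartedSpace (E (n - 1)) N]
  [IsManifold (𝓡 (n - 1)) ∞ N] {M : Type*} [TopologicalSpace M] [ChartedSpace (E n) M]
  [IsManifold (𝓡 n) ∞ M] {x : M → ℝ} {x₀ : ℝ} {Φ : OpenPartialHomeomorph (ℝ × N) M} {η : N → ℝ}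

lemma TensorNormLE.mono {V : Type*} [NormedAddCommGroup V] [NormedSpace ℝ V]
    {B : V →L[ℝ] V →L[ℝ] ℝ} {k : ℕ} {T : (Fin k → V) → ℝ} {c c' : ℝ} (h : TensorNormLE B T c)
    (hc : c ≤ c') : TensorNormLE B T c' := fun v =>
  (h v).trans (mul_le_mul_of_nonneg_right hc (Finset.prod_nonneg fun _ _ => Real.sqrt_nonneg _))

/-- The change of the scalar curvature under the perturbation. -/
theorem exists_scalarCurvature_bounds (hn : 3 ≤ n) (h : RiemMetric (n - 1) ∞ N) {k : ℝ}
    (hk : |k| ≤ 1) (hx₀ : x₀ < 1) (hΦ : IsCollar n x x₀ Φ) (g : RiemMetric n 2 M)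
    (hdecay : HasWeightedDecay h.toTensor k x₀
      (pullback (IC n) (𝓡 n) Φ g.toTensor - referenceMetric h.toTensor k))
    (hη : ContMDiff (𝓡 (n - 1)) 𝓘(ℝ, ℝ) ∞ η) (hη0 : ∀ p, 0 ≤ η p) :
    ∃ K r : ℝ, 0 ≤ K ∧ 0 < r ∧ ∀ ε, 0 < ε → 4 * ε ≤ r → 4 * ε < x₀ → 16 * K * ε ^ 2 ≤ 1 →
      ∃ C, ∀ q, 0 ≤ scalarCurvature (𝓡 n) (addDiffSq g.toTensor x (perturbation n x x₀ Φ η ε K)) q -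
          scalarCurvature (𝓡 n) g.toTensor q ∧
        scalarCurvature (𝓡 n) (addDiffSq g.toTensor x (perturbation n x x₀ Φ η ε K)) q -
          scalarCurvature (𝓡 n) g.toTensor q ≤ C * x q ^ (n + 2) := by
  obtain ⟨C₁, hC₁⟩ := hdecay
  obtain ⟨Cη, hCη⟩ := exists_hasHessianBound h hη
  set C := |C₁| + |Cη| + 3 with hC
  have hCη' : ∀ q, HasHessianBound h.toTensor η C q := fun q =>
    (hCη q).mono (by rw [hC]; linarith [le_abs_self Cη, abs_nonneg C₁])
  obtain ⟨Kₑ, r, hr, hbound⟩ := exists_coordinate_bound hn C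
  -- The strength `K` of the correction is the error constant itself, fixed before `ε`. This is not
  -- circular: `Kₑ` depends only on `C`, and for `16 K ε² ≤ 1` the perturbation is bounded by `C`
  -- times the profile whatever `K` is.
  refine ⟨|Kₑ|, r, abs_nonneg _, hr, fun ε hε hεr hεx hεK => ?_⟩
  set K := |Kₑ| with hKdef
  have hK : 0 ≤ K := abs_nonneg _
  obtain ⟨C₂, hC₂⟩ := scalar_change_bounds (η₁ := Cη) hn hε (le_refl |Kₑ|)
  refine ⟨max C₂ 0, fun q => ?_⟩
  have hxq := hΦ.pos q
  rcases lt_or_ge (4 * ε) (x q) with hq | hq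
  · rw [scalarCurvature_congr (T' := g.toTensor), sub_self]
    · exact ⟨le_rfl, by positivity⟩
    · filter_upwards [hΦ.smooth.continuous.continuousAt.eventually (lt_mem_nhds hq)] with y hy
      exact addDiffSq_of_eq_zero (perturbation_eq_zero hε hy.le)
  set g' := g.addDiffSq hΦ.smooth (hΦ.contMDiff_perturbation (K := K) hη hε hεx)
    (hΦ.perturbation_nonneg hn hη0 hε hK) with hg'
  have hqt : q ∈ Φ.target := by rw [hΦ.target_eq]; exact hq.trans_lt hεx
  obtain ⟨z, hz, rfl⟩ : ∃ z ∈ Φ.source, Φ z = q := ⟨Φ.symm q, Φ.map_target hqt, Φ.right_inv hqt⟩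
  rw [hΦ.fst_eq z hz] at hq hxq ⊢
  have hzx : z.1 < x₀ := (hΦ.fst_mem hz).2
  have hzu : extChartAt (IC n) z z = (z.1, extChartAt (𝓡 (n - 1)) z.2 z.2) :=
    extChartAt_prod_apply z z
  have heq := hΦ.chartRep_pullback_perturbation (η := η) (ε := ε) (K := K) g.toTensor hz
  have hmet' := hΦ.isMetricAt g' hz
  have hR := hΦ.scalarCurvature_eq g hz
  have hR' := hΦ.scalarCurvature_eq g' hz
  rw [hg', RiemMetric.toTensor_addDiffSq] at hmet' hR'
  rw [hR', hR, scalarCoord_congr heq]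
  have hq2 := mem_extChartAt_source (I := 𝓡 (n - 1)) z.2
  have hyt := (extChartAt (𝓡 (n - 1)) z.2).map_source hq2
  -- The decay `x^n` is stronger than the required `x²`, since `x < 1` and `n ≥ 3`.
  have hdec : DecaysAt (chartRep (IC n) (referenceMetric h.toTensor k) z)
      (chartRep (IC n) (pullback (IC n) (𝓡 n) Φ g.toTensor) z -
        chartRep (IC n) (referenceMetric h.toTensor k) z) (extChartAt (IC n) z z)
      (C * z.1 ^ 2) := fun l hl => by
    refine TensorNormLE.mono ((hC₁ z hxq hzx).2 l hl).1 ?_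
    have h1 : z.1 ^ n ≤ z.1 ^ 2 := pow_le_pow_of_le_one hxq.le (by linarith) (by omega)
    calc C₁ * z.1 ^ n ≤ |C₁| * z.1 ^ n := by gcongr; exact le_abs_self _
      _ ≤ C * z.1 ^ 2 := by
        gcongr
        rw [hC]; linarith [abs_nonneg Cη]
  have hηy : ContDiffAt ℝ 2 (fun y => η ((extChartAt (𝓡 (n - 1)) z.2).symm y))
      (extChartAt (𝓡 (n - 1)) z.2 z.2) :=
    contMDiffAt_iff_contDiffAt.1 ((hη.contMDiffAt.of_le two_le_infty).comp _
      (contMDiffAt_extChartAt_symm hyt two_le_infty))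
  have hx16 : z.1 ^ 2 ≤ 16 * ε ^ 2 := by nlinarith
  have hP0 := profile_nonneg (ε := ε) hn hxq.le
  have hcorr0 : 0 ≤ correction n ε K z.1 := by
    have : 0 ≤ 16 * ε ^ 2 - z.1 ^ 2 := by linarith
    unfold correction; positivity
  -- Here `16 K ε² ≤ 1` is used: the bracket in `correction` is at most `1`.
  have hcorr1 : correction n ε K z.1 ≤ profile n ε z.1 := by
    unfold correction
    refine mul_le_of_le_one_right hP0 ?_
    nlinarith [mul_nonneg hK (sq_nonneg z.1)]
  have hηz : η ((extChartAt (𝓡 (n - 1)) z.2).symm (extChartAt (𝓡 (n - 1)) z.2 z.2)) = η z.2 :=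
    congrArg η (extChartAt_to_inv z.2)
  have hb := hbound k z.1 (extChartAt (𝓡 (n - 1)) z.2 z.2) (chartRep (𝓡 (n - 1)) h.toTensor z.2)
    (chartRep (IC n) (pullback (IC n) (𝓡 n) Φ g.toTensor) z)
    (chartRep (IC n) (referenceMetric h.toTensor k) z) (profile n ε) (correction n ε K)
    (fun y => η ((extChartAt (𝓡 (n - 1)) z.2).symm y)) hk hxq (hq.trans hεr)
    (h.isMetricAt_chartRep two_le_infty hq2) (fun v hv => h.chartRep_pos hyt hv)
    (hzu ▸ hΦ.isMetricAt g hz)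
    (by
      rw [← hzu]
      filter_upwards [(isOpen_extChartAt_target z).mem_nhds (mem_extChartAt_target (I := IC n) z)]
        with u hu using chartRep_referenceMetric _ _ hu)
    (hzu ▸ hdec) (hzu ▸ hmet'.congr heq.symm)
    contDiff_profile.contDiffAt contDiff_correction.contDiffAt hηy hP0
    (by
      have h1 : z.1 ^ n ≤ z.1 ^ 2 := pow_le_pow_of_le_one hxq.le (by linarith) (by omega)
      refine (profile_le hn hxq.le).trans ?_
      gcongr
      rw [hC]; linarith [abs_nonneg C₁, abs_nonneg Cη])
    (by
      simp only [separated, hηz]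
      exact add_nonneg (mul_nonneg hP0 (hη0 _)) hcorr0)
    (by
      simp only [separated, hηz]
      have h1 := mul_le_mul_of_nonneg_left (hCη z.2).le hP0
      rw [hC]
      nlinarith [le_abs_self Cη, abs_nonneg C₁])
    (hCη' z.2).fderiv_le (hCη' z.2).hess_le
  simp only [hηz, separated] at hb
  obtain ⟨b1, b2⟩ := hC₂ z.1 (η z.2) _ hxq hq (hη0 _) (hCη z.2).le hb
  rw [hzu]
  exact ⟨b1, b2.trans (by gcongr; exact le_max_left _ _)⟩

end ScalarCurvature

/-! ### The radial change of coordinate `X = x (1 + m x^n / 2)^(-1/n)`. -/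

section RadialShift

/-- The factor `(1 + m x^n / 2)^(-1/n)`. -/
def shiftFactor (n : ℕ) (x m : ℝ) : ℝ := (1 + m / 2 * x ^ n) ^ (-(n : ℝ)⁻¹)

/-- The new radial coordinate `x (1 + m x^n / 2)^(-1/n)`. -/
def radialShift (n : ℕ) (x m : ℝ) : ℝ := x * shiftFactor n x m

variable {n : ℕ} {x m : ℝ}

lemma shiftFactor_pos (h : 0 < 1 + m / 2 * x ^ n) : 0 < shiftFactor n x m := Real.rpow_pos_of_pos h _

lemma shiftFactor_pow (hn : n ≠ 0) (h : 0 < 1 + m / 2 * x ^ n) :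
    shiftFactor n x m ^ n * (1 + m / 2 * x ^ n) = 1 := by
  rw [shiftFactor, ← Real.rpow_natCast, ← Real.rpow_mul h.le, neg_mul,
    inv_mul_cancel₀ (Nat.cast_ne_zero.2 hn), Real.rpow_neg_one, inv_mul_cancel₀ h.ne']

lemma one_add_radialShift (hn : n ≠ 0) (h : 0 < 1 + m / 2 * x ^ n) :
    1 + -m / 2 * radialShift n x m ^ n = (1 + m / 2 * x ^ n)⁻¹ := by
  refine eq_inv_of_mul_eq_one_left ?_
  have := shiftFactor_pow hn h
  rw [radialShift, mul_pow]
  linear_combination (-(m / 2) * x ^ n) * this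

/-- For `x > 0` the map is the translation `X^(-n) = x^(-n) + m / 2`, so its inverse is obtained by
changing the sign of `m`. The algebraic form also covers `x ≤ 0`. -/
lemma radialShift_radialShift (hn : n ≠ 0) (h : 0 < 1 + m / 2 * x ^ n) :
    radialShift n (radialShift n x m) (-m) = x := by
  have h1 : shiftFactor n (radialShift n x m) (-m) = (shiftFactor n x m)⁻¹ := by
    rw [shiftFactor, one_add_radialShift hn h, Real.inv_rpow h.le]
    rfl
  rw [radialShift, h1, radialShift, mul_assoc, mul_inv_cancel₀ (shiftFactor_pos h).ne', mul_one]

lemma radialShift_pos_iff (h : 0 < 1 + m / 2 * x ^ n) : 0 < radialShift n x m ↔ 0 < x :=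
  mul_pos_iff_of_pos_right (shiftFactor_pos h)

lemma contDiffAt_radialShift {p : ℝ × ℝ} (h : 0 < 1 + p.2 / 2 * p.1 ^ n) :
    ContDiffAt ℝ ∞ (fun y : ℝ × ℝ => radialShift n y.1 y.2) p := by
  refine contDiffAt_fst.mul (ContDiffAt.rpow_const_of_ne ?_ h.ne')
  exact contDiffAt_const.add ((contDiffAt_snd.div_const 2).mul (contDiffAt_fst.pow n))

/-- For `x > 0` this is the differential of `X^(-n) = x^(-n) + m / 2`, namely `dX = (X / x)^(n+1) dx
- X^(n+1) / (2 n) dm`. -/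
lemma hasFDerivAt_radialShift (hn : n ≠ 0) {p : ℝ × ℝ} (h : 0 < 1 + p.2 / 2 * p.1 ^ n) :
    HasFDerivAt (fun y : ℝ × ℝ => radialShift n y.1 y.2)
      (shiftFactor n p.1 p.2 ^ (n + 1) • ContinuousLinearMap.fst ℝ ℝ ℝ -
        (p.1 ^ (n + 1) * shiftFactor n p.1 p.2 ^ (n + 1) / (2 * n)) •
          ContinuousLinearMap.snd ℝ ℝ ℝ) p := by
  have h1 : HasFDerivAt (fun y : ℝ × ℝ => y.1) (ContinuousLinearMap.fst ℝ ℝ ℝ) p := hasFDerivAt_fst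
  have h2 : HasFDerivAt (fun y : ℝ × ℝ => y.2) (ContinuousLinearMap.snd ℝ ℝ ℝ) p := hasFDerivAt_snd
  have h2' : HasFDerivAt (fun y : ℝ × ℝ => y.2 / 2) ((2 : ℝ)⁻¹ • ContinuousLinearMap.snd ℝ ℝ ℝ) p := by
    simpa [div_eq_inv_mul] using h2.const_mul (2 : ℝ)⁻¹
  have h3 : HasFDerivAt (fun y : ℝ × ℝ => 1 + y.2 / 2 * y.1 ^ n) _ p :=
    (h2'.mul (h1.pow n)).const_add 1
  have h4 := h1.mul (h3.rpow_const (p := -(n : ℝ)⁻¹) (Or.inl h.ne'))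
  refine h4.congr_fderiv ?_
  have hn' : (n : ℝ) ≠ 0 := Nat.cast_ne_zero.2 hn
  have e := shiftFactor_pow hn h
  have e1 : (1 + p.2 / 2 * p.1 ^ n) ^ (-(n : ℝ)⁻¹ - 1) = shiftFactor n p.1 p.2 ^ (n + 1) := by
    rw [Real.rpow_sub_one h.ne', div_eq_iff h.ne', pow_succ, mul_right_comm, e, one_mul]
    rfl
  have e2 : (1 + p.2 / 2 * p.1 ^ n) ^ (-(n : ℝ)⁻¹) = shiftFactor n p.1 p.2 := rfl
  obtain ⟨j, rfl⟩ : ∃ j, n = j + 1 := ⟨n - 1, by omega⟩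
  rw [e1, e2]
  refine ContinuousLinearMap.ext fun v => ?_
  simp only [add_apply, sub_apply, smul_apply, smul_eq_mul, Nat.add_sub_cancel, nsmul_eq_mul,
    ContinuousLinearMap.coe_fst', ContinuousLinearMap.coe_snd']
  set f := shiftFactor (j + 1) p.1 p.2
  push_cast at hn' ⊢
  have e3 : f ^ (j + 2) * (1 + p.2 / 2 * p.1 ^ (j + 1)) = f := by
    rw [pow_succ, mul_right_comm, e, one_mul]
  field_simp
  linear_combination (-2 * ((j : ℝ) + 1) * v.1) * e3

end RadialShift

/-! ### Expansion of the metric coefficients under the radial change. -/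

section Estimates

variable {n : ℕ} {x m B : ℝ}

lemma shiftFactor_bounds (hn : n ≠ 0) (hx : 0 < x) (hm : 0 ≤ m) :
    0 < shiftFactor n x m ∧ shiftFactor n x m ≤ 1 ∧
      1 - shiftFactor n x m ^ n ≤ m / 2 * x ^ n := by
  have hs : 0 ≤ m / 2 * x ^ n := by positivity
  have h : 0 < 1 + m / 2 * x ^ n := by linarith
  have h0 := shiftFactor_pos h
  have e := shiftFactor_pow hn h
  have h1 : shiftFactor n x m ^ n ≤ 1 := by
    linarith [mul_nonneg (pow_pos h0 n).le hs]
  refine ⟨h0, (pow_le_one_iff_of_nonneg h0.le hn).1 h1, ?_⟩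
  linarith [mul_le_of_le_one_left hs h1]

/-- The quantity is `(1 + s)^(2/n)` with `s = m x^n / 2` and exponent at most `1`. Bernoulli's
inequality for `1 + s` bounds it from above, and the same inequality for `(1 + s)⁻¹` bounds it from
below. -/
lemma inv_shiftFactor_sq (hn : 3 ≤ n) (hx : 0 < x) (hm : 0 ≤ m) :
    |(shiftFactor n x m ^ 2)⁻¹ - 1 - m / n * x ^ n| ≤ (m * x ^ n) ^ 2 := by
  have hn' : (3 : ℝ) ≤ n := by exact_mod_cast hn
  set s := m / 2 * x ^ n with hs
  have hs0 : 0 ≤ s := by positivity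
  have h : 0 < 1 + s := by linarith
  set p : ℝ := 2 / n with hp
  have hp0 : 0 ≤ p := by positivity
  have hp1 : p ≤ 1 := by rw [hp, div_le_one (by linarith)]; linarith
  have e1 : (shiftFactor n x m ^ 2)⁻¹ = (1 + s) ^ p := by
    rw [shiftFactor, ← hs, ← Real.rpow_natCast, ← Real.rpow_mul h.le, ← Real.rpow_neg h.le]
    congr 1
    rw [hp]; push_cast; ring
  have e2 : m / n * x ^ n = p * s := by rw [hp, hs]; ring
  rw [e1, e2]
  have hup := rpow_one_add_le_one_add_mul_self (s := s) (by linarith) hp0 hp1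
  set t := (1 + s)⁻¹ with ht
  have hts : t * (1 + s) = 1 := inv_mul_cancel₀ h.ne'
  have ht0 : 0 < t := by positivity
  have ht1 : t ≤ 1 := by linarith [mul_nonneg ht0.le hs0]
  have hlow := rpow_one_add_le_one_add_mul_self (s := t - 1) (by linarith) hp0 hp1
  have e3 : (1 + (t - 1)) ^ p = ((1 + s) ^ p)⁻¹ := by
    rw [add_sub_cancel, ht, Real.inv_rpow h.le]
  rw [e3] at hlow
  have hA : 0 < (1 + s) ^ p := Real.rpow_pos_of_pos h p
  set A := (1 + s) ^ p
  have hlow' : 1 ≤ (1 + p * (t - 1)) * A := by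
    have := mul_le_mul_of_nonneg_right hlow hA.le
    rwa [inv_mul_cancel₀ hA.ne'] at this
  have e4 : t - 1 = -(s * t) := by linear_combination hts
  have hmx : (m * x ^ n) ^ 2 = 4 * s ^ 2 := by rw [hs]; ring
  rw [hmx, abs_le]
  have hst : 0 ≤ s * t := by positivity
  have hs1 : s * t = 1 - t := by linarith
  have hpst : p * (s * t) < 1 := (mul_le_of_le_one_left hst hp1).trans_lt (by linarith)
  have k1 : 1 + p * (s * t) ≤ A := by
    have : (1 + p * (s * t)) * (1 - p * (s * t)) ≤ A * (1 - p * (s * t)) := by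
      rw [e4] at hlow'
      linarith [sq_nonneg (p * (s * t))]
    exact le_of_mul_le_mul_right this (by linarith)
  have k2 : s - s * t ≤ s ^ 2 := by
    rw [show s - s * t = s * (s * t) by linear_combination (-s) * hs1, sq]
    exact mul_le_mul_of_nonneg_left (mul_le_of_le_one_right hs0 ht1) hs0
  constructor
  · linarith [mul_le_mul_of_nonneg_left k2 hp0, sq_nonneg s,
      mul_nonneg (sub_nonneg.2 hp1) (sq_nonneg s)]
  · linarith [sq_nonneg s]

lemma refWarp_eq {k : ℝ} (hx : x ≠ 0) :
    refWarp k x = (x ^ 2)⁻¹ - k / 2 + k ^ 2 / 16 * x ^ 2 := by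
  unfold refWarp
  field_simp
  ring

set_option maxHeartbeats 800000 in
/-- The estimates for the change of the radial coordinate. -/
lemma exists_radialShift_estimates (hn : 3 ≤ n) (B κ : ℝ) :
    ∃ C, 0 ≤ C ∧ ∀ k x m f X P b : ℝ, |k| ≤ 1 → 0 < x → x ≤ 1 → 0 ≤ m → m ≤ B →
      f = shiftFactor n x m → X = x * f → P = X ^ n * (m - κ * X ^ 2) →
      b = x ^ (n + 1) * f ^ (n + 1) / (2 * n) →
      |(X ^ 2)⁻¹ * (1 + P) * f ^ (n + 1) * f ^ (n + 1) - (x ^ 2)⁻¹| ≤ C * x ^ (n - 1) ∧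
      |(X ^ 2)⁻¹ * (1 + P) * f ^ (n + 1) * b| ≤ C * x ^ (n - 1) ∧
      |(X ^ 2)⁻¹ * (1 + P) * b * b| ≤ C * x ^ (n - 1) ∧
      |refWarp k X - refWarp k x - x ^ (n - 2) * (m / n)| ≤ C * x ^ (n - 1) ∧
      |X ^ (n - 2) - x ^ (n - 2)| ≤ C * x ^ (n - 1) := by
  refine ⟨B ^ 2 + |B| + |κ| + 1, by positivity, ?_⟩
  rintro k x m f X P b hk hx hx1 hm hmB hf rfl hP hb
  have hB : 0 ≤ B := hm.trans hmB
  rw [abs_of_nonneg hB]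
  obtain ⟨hf0, hf1, hfs⟩ := shiftFactor_bounds (n := n) (by omega) hx hm
  have hft := shiftFactor_pow (n := n) (x := x) (m := m) (by omega) (by positivity)
  have hsq := inv_shiftFactor_sq hn hx hm
  rw [← hf] at hf0 hf1 hfs hft hsq
  obtain ⟨j, rfl⟩ : ∃ j, n = j + 3 := ⟨n - 3, by omega⟩
  rw [show j + 3 - 1 = j + 2 by omega, show j + 3 - 2 = j + 1 by omega]
  set t := f ^ (j + 3) with ht
  have ht0 : 0 < t := pow_pos hf0 _
  have ht1 : t ≤ 1 := pow_le_one₀ hf0.le hf1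
  have eft : f ^ (j + 3 + 1) = t * f := by rw [ht, pow_succ]
  have hxj : 0 < x ^ j := pow_pos hx j
  have hxj1 : x ^ j ≤ 1 := pow_le_one₀ hx.le hx1
  have hy1 : x ^ (j + 3) ≤ 1 := pow_le_one₀ hx.le hx1
  have hy0 : 0 < x ^ (j + 3) := pow_pos hx _
  have hsB : m / 2 * x ^ (j + 3) ≤ B / 2 * x ^ (j + 3) := by gcongr
  have hmt : m * x ^ (j + 3) * t = 2 * (1 - t) := by linear_combination 2 * hft
  have ePt : P = 2 * (1 - t) - κ * (x ^ (j + 3) * x ^ 2 * t * f ^ 2) := by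
    rw [hP, mul_pow, ← ht]
    linear_combination hmt
  have hq0 : 0 ≤ x ^ (j + 3) * x ^ 2 * t * f ^ 2 := by positivity
  have hx2 : x ^ 2 ≤ 1 := pow_le_one₀ hx.le hx1
  have hf2 : f ^ 2 ≤ 1 := pow_le_one₀ hf0.le hf1
  have hq1 : x ^ (j + 3) * x ^ 2 * t * f ^ 2 ≤ 1 := by
    calc _ ≤ (1 : ℝ) * 1 * 1 * 1 := by gcongr
      _ = 1 := by norm_num
  have hP1 : |1 + P| ≤ B + |κ| + 1 := by
    rw [ePt]
    have h1 : |κ * (x ^ (j + 3) * x ^ 2 * t * f ^ 2)| ≤ |κ| := by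
      rw [abs_mul, abs_of_nonneg hq0]
      exact mul_le_of_le_one_right (abs_nonneg _) hq1
    have h2 : 1 - t ≤ B / 2 := hfs.trans (hsB.trans (mul_le_of_le_one_right (by positivity) hy1))
    have h3 := abs_le.1 h1
    rw [abs_le]
    constructor <;> linarith
  have h1t : 0 ≤ 1 - t := by linarith
  have h1tB : 1 - t ≤ B * x ^ (j + 3) := hfs.trans (hsB.trans (by gcongr; linarith))
  have hxp : 0 ≤ x ^ (j + 2) := by positivity
  have hC1 : 1 ≤ (2 * ((j + 3 : ℕ) : ℝ)) := by push_cast; linarith [Nat.cast_nonneg (α := ℝ) j]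
  have hb' : b = x ^ (j + 4) * (t * f) / (2 * ((j + 3 : ℕ) : ℝ)) := by rw [hb, eft]
  set c : ℝ := 2 * ((j + 3 : ℕ) : ℝ) with hc
  have hc0 : 0 < c := by linarith
  have hB2 : 0 ≤ B ^ 2 * x ^ (j + 2) := by positivity
  have hBx : 0 ≤ B * x ^ (j + 2) := by positivity
  have hκx : 0 ≤ |κ| * x ^ (j + 2) := by positivity
  have hC : (B ^ 2 + B + |κ| + 1) * x ^ (j + 2) =
    B ^ 2 * x ^ (j + 2) + B * x ^ (j + 2) + |κ| * x ^ (j + 2) + x ^ (j + 2) := by ring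
  have hC' : (B + |κ| + 1) * x ^ (j + 2) =
    B * x ^ (j + 2) + |κ| * x ^ (j + 2) + x ^ (j + 2) := by ring
  rw [hC]
  refine ⟨?_, ?_, ?_, ?_, ?_⟩
  -- With `t = f^n` one has `m X^n = 2 (1 - t)`, and `(3 - 2 t) t² = 1 - (1 - t)² (1 + 2 t)`: the
  -- term linear in `1 - t` is absent. This is what the factor `1/2` and the exponent `-1/n` of the
  -- shift are chosen for.
  · have e : ((x * f) ^ 2)⁻¹ * (1 + P) * f ^ (j + 3 + 1) * f ^ (j + 3 + 1) - (x ^ 2)⁻¹ =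
        -(x ^ 2)⁻¹ * ((1 - t) ^ 2 * (1 + 2 * t)) -
          κ * (x ^ (j + 3) * t ^ 3 * f ^ 2) := by
      rw [eft, ePt]
      field_simp
      ring
    have h1 : (x ^ 2)⁻¹ * ((1 - t) ^ 2 * (1 + 2 * t)) ≤ 3 / 4 * B ^ 2 * x ^ (j + 2) := by
      rw [inv_mul_le_iff₀ (by positivity)]
      have h2 : (1 - t) ^ 2 ≤ (B / 2 * x ^ (j + 3)) ^ 2 := by
        gcongr
        exact hfs.trans hsB
      calc (1 - t) ^ 2 * (1 + 2 * t) ≤ (B / 2 * x ^ (j + 3)) ^ 2 * 3 := by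
            gcongr; linarith
        _ = 3 / 4 * B ^ 2 * (x ^ 2 * (x ^ (j + 2) * x ^ (j + 2))) := by ring
        _ ≤ 3 / 4 * B ^ 2 * (x ^ 2 * (x ^ (j + 2) * 1)) := by
          gcongr; exact pow_le_one₀ hx.le hx1
        _ = _ := by ring
    have h0 : 0 ≤ (x ^ 2)⁻¹ * ((1 - t) ^ 2 * (1 + 2 * t)) := by positivity
    have h3 : |κ * (x ^ (j + 3) * t ^ 3 * f ^ 2)| ≤ |κ| * x ^ (j + 2) := by
      rw [abs_mul, abs_of_nonneg (by positivity : 0 ≤ x ^ (j + 3) * t ^ 3 * f ^ 2)]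
      gcongr
      calc x ^ (j + 3) * t ^ 3 * f ^ 2 = x ^ (j + 2) * x * t ^ 3 * f ^ 2 := by ring
        _ ≤ x ^ (j + 2) * 1 * 1 * 1 := by gcongr; exact pow_le_one₀ ht0.le ht1
        _ = _ := by ring
    rw [e]
    have h4 := abs_le.1 h3
    rw [abs_le]
    constructor <;> linarith
  · have e : ((x * f) ^ 2)⁻¹ * (1 + P) * f ^ (j + 3 + 1) * b =
        (1 + P) * (x ^ (j + 2) * (t ^ 2 / c)) := by
      rw [eft, hb']
      field_simp
      ring
    rw [e, abs_mul, abs_of_nonneg (by positivity : 0 ≤ x ^ (j + 2) * (t ^ 2 / c))]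
    have h2 : t ^ 2 / c ≤ 1 := by
      rw [div_le_one hc0]
      exact (pow_le_one₀ ht0.le ht1).trans hC1
    calc _ ≤ (B + |κ| + 1) * (x ^ (j + 2) * 1) := by gcongr
      _ ≤ _ := by rw [mul_one, hC']; linarith
  · have e : ((x * f) ^ 2)⁻¹ * (1 + P) * b * b =
        (1 + P) * (x ^ (j + 2) * (x ^ (j + 4) * (t ^ 2 / (c * c)))) := by
      rw [hb']
      field_simp
      ring
    rw [e, abs_mul, abs_of_nonneg
      (by positivity : 0 ≤ x ^ (j + 2) * (x ^ (j + 4) * (t ^ 2 / (c * c))))]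
    have h2 : t ^ 2 / (c * c) ≤ 1 := by
      rw [div_le_one (by positivity)]
      exact (pow_le_one₀ ht0.le ht1).trans (one_le_mul_of_one_le_of_one_le hC1 hC1)
    calc _ ≤ (B + |κ| + 1) * (x ^ (j + 2) * (1 * 1)) := by
          gcongr
          exact pow_le_one₀ hx.le hx1
      _ ≤ _ := by rw [one_mul, mul_one, hC']; linarith
  -- The constant term of the warping function cancels and its `x²` term changes at higher order;
  -- the gain `(m / n) x^(n-2)` comes from `x⁻² (f⁻² - 1)`.
  · rw [refWarp_eq (mul_pos hx hf0).ne', refWarp_eq hx.ne']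
    have e : ((x * f) ^ 2)⁻¹ - k / 2 + k ^ 2 / 16 * (x * f) ^ 2 -
        ((x ^ 2)⁻¹ - k / 2 + k ^ 2 / 16 * x ^ 2) - x ^ (j + 1) * (m / ((j + 3 : ℕ) : ℝ)) =
        (x ^ 2)⁻¹ * ((f ^ 2)⁻¹ - 1 - m / ((j + 3 : ℕ) : ℝ) * x ^ (j + 3)) -
          k ^ 2 / 16 * x ^ 2 * (1 - f ^ 2) := by
      have h0 : (((j + 3 : ℕ) : ℝ)) ≠ 0 := by positivity
      field_simp
      ring
    rw [e]
    have h1 : |(x ^ 2)⁻¹ * ((f ^ 2)⁻¹ - 1 - m / ((j + 3 : ℕ) : ℝ) * x ^ (j + 3))| ≤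
        B ^ 2 * x ^ (j + 2) := by
      rw [abs_mul, abs_of_nonneg (by positivity : 0 ≤ (x ^ 2)⁻¹), inv_mul_le_iff₀ (by positivity)]
      refine hsq.trans ?_
      calc (m * x ^ (j + 3)) ^ 2 ≤ (B * x ^ (j + 3)) ^ 2 := by gcongr
        _ = x ^ 2 * (B ^ 2 * (x ^ (j + 2) * x ^ (j + 2))) := by ring
        _ ≤ x ^ 2 * (B ^ 2 * (x ^ (j + 2) * 1)) := by
          gcongr; exact pow_le_one₀ hx.le hx1
        _ = _ := by ring
    have h2 : t ≤ f ^ 2 := pow_le_pow_of_le_one hf0.le hf1 (by omega)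
    have h3 : 0 ≤ 1 - f ^ 2 := by linarith
    have h4 : 1 - f ^ 2 ≤ B * x ^ (j + 2) := by
      calc _ ≤ 1 - t := by linarith
        _ ≤ B * (x ^ (j + 2) * x) := by rw [← pow_succ]; exact h1tB
        _ ≤ B * (x ^ (j + 2) * 1) := by gcongr
        _ = _ := by ring
    have hk2 : k ^ 2 ≤ 1 := by
      rw [← sq_abs]; exact pow_le_one₀ (abs_nonneg k) hk
    have h5 : k ^ 2 / 16 * x ^ 2 * (1 - f ^ 2) ≤ 1 / 16 * 1 * (B * x ^ (j + 2)) := by gcongr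
    have h6 : 0 ≤ k ^ 2 / 16 * x ^ 2 * (1 - f ^ 2) := by positivity
    have h7 := abs_le.1 h1
    rw [abs_le]
    constructor <;> linarith
  · have e : (x * f) ^ (j + 1) - x ^ (j + 1) = -(x ^ (j + 1) * (1 - f ^ (j + 1))) := by ring
    have h2 : t ≤ f ^ (j + 1) := pow_le_pow_of_le_one hf0.le hf1 (by omega)
    have h3 : f ^ (j + 1) ≤ 1 := pow_le_one₀ hf0.le hf1
    have h4 : 0 ≤ x ^ (j + 1) * (1 - f ^ (j + 1)) := mul_nonneg (by positivity) (by linarith)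
    rw [e, abs_neg, abs_of_nonneg h4]
    calc x ^ (j + 1) * (1 - f ^ (j + 1)) ≤ 1 * (B * x ^ (j + 3)) := by
          refine mul_le_mul (pow_le_one₀ hx.le hx1) (by linarith) (by linarith) zero_le_one
      _ = B * (x ^ (j + 2) * x) := by ring
      _ ≤ B * (x ^ (j + 2) * 1) := by gcongr
      _ ≤ _ := by linarith

end Estimates

/-! ### The change of coordinates on `ℝ × N`. -/

section BoundaryShift

variable {n : ℕ} {N : Type*} [TopologicalSpace N] [ChartedSpace (E (n - 1)) N]

lemma contMDiffAt_boundaryShift {m : N → ℝ} (hm : ContMDiff (𝓡 (n - 1)) 𝓘(ℝ, ℝ) ∞ m) {z : ℝ × N}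
    (hz : 0 < 1 + m z.2 / 2 * z.1 ^ n) :
    ContMDiffAt (IC n) (IC n) ∞ (fun z : ℝ × N => (radialShift n z.1 (m z.2), z.2)) z := by
  have h1 : ContMDiffAt (IC n) 𝓘(ℝ, ℝ × ℝ) ∞ (fun z : ℝ × N => (z.1, m z.2)) z :=
    contMDiffAt_fst.prodMk_space (hm.contMDiffAt.comp z contMDiffAt_snd)
  exact ((contDiffAt_radialShift (p := (z.1, m z.2)) hz).contMDiffAt.comp z h1).prodMk
    contMDiffAt_snd

lemma hasMFDerivAt_boundaryShift (hn : n ≠ 0) {m : N → ℝ} {z : ℝ × N} {L : E (n - 1) →L[ℝ] ℝ}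
    (hL : HasMFDerivAt (𝓡 (n - 1)) 𝓘(ℝ, ℝ) m z.2 L) (hz : 0 < 1 + m z.2 / 2 * z.1 ^ n) :
    ∃ A : F n →L[ℝ] F n,
      HasMFDerivAt (IC n) (IC n) (fun z : ℝ × N => (radialShift n z.1 (m z.2), z.2)) z A ∧
      ∀ v : F n, A v = (shiftFactor n z.1 (m z.2) ^ (n + 1) * v.1 -
        z.1 ^ (n + 1) * shiftFactor n z.1 (m z.2) ^ (n + 1) / (2 * n) * L v.2, v.2) := by
  have h0 : HasMFDerivAt (IC n) 𝓘(ℝ, ℝ) (fun z : ℝ × N => z.1) z _ := hasMFDerivAt_fst z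
  have h0' : HasMFDerivAt (IC n) 𝓘(ℝ, ℝ) (fun z : ℝ × N => m z.2) z _ :=
    hL.comp z (hasMFDerivAt_snd z)
  have h1 : HasMFDerivAt (IC n) 𝓘(ℝ, ℝ × ℝ) (fun z : ℝ × N => (z.1, m z.2)) z _ :=
    ⟨h0.1.prodMk h0'.1, h0.2.prodMk h0'.2⟩
  have h2 := ((hasFDerivAt_radialShift hn (p := (z.1, m z.2)) hz).hasMFDerivAt.comp z h1).prodMk
    (hasMFDerivAt_snd z)
  exact ⟨_, h2, fun v => rfl⟩

/-- The change of coordinates `(x, y) ↦ (x (1 + m(y) x^n / 2)^(-1/n), y)`. -/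
def boundaryShift (hn : n ≠ 0) {m : N → ℝ} (hm : ContMDiff (𝓡 (n - 1)) 𝓘(ℝ, ℝ) ∞ m) :
    OpenPartialHomeomorph (ℝ × N) (ℝ × N) where
  toFun z := (radialShift n z.1 (m z.2), z.2)
  invFun z := (radialShift n z.1 (-m z.2), z.2)
  -- These open sets contain `{0} × N` and are those where the base of the real power is positive.
  -- By `one_add_radialShift` the two bases are reciprocal under the map, so source and target
  -- correspond.
  source := {z | 0 < 1 + m z.2 / 2 * z.1 ^ n}
  target := {z | 0 < 1 + -m z.2 / 2 * z.1 ^ n}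
  map_source' z hz := by
    change 0 < 1 + -m z.2 / 2 * radialShift n z.1 (m z.2) ^ n
    rw [one_add_radialShift hn hz]
    exact inv_pos.2 hz
  map_target' z hz := by
    change 0 < 1 + m z.2 / 2 * radialShift n z.1 (-m z.2) ^ n
    have := one_add_radialShift hn (m := -m z.2) hz
    rw [neg_neg] at this
    rw [this]
    exact inv_pos.2 hz
  left_inv' z hz := Prod.ext (radialShift_radialShift hn hz) rfl
  right_inv' z hz := by
    have := radialShift_radialShift hn (m := -m z.2) hz
    rw [neg_neg] at this
    exact Prod.ext this rfl
  open_source := by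
    have := hm.continuous
    exact isOpen_lt continuous_const (by fun_prop)
  open_target := by
    have := hm.continuous
    exact isOpen_lt continuous_const (by fun_prop)
  continuousOn_toFun z hz := (contMDiffAt_boundaryShift hm hz).continuousAt.continuousWithinAt
  continuousOn_invFun z hz :=
    (contMDiffAt_boundaryShift (m := fun p => -m p) hm.neg hz).continuousAt.continuousWithinAt

lemma isBoundaryCoordChange_boundaryShift (hn : n ≠ 0) {m : N → ℝ}
    (hm : ContMDiff (𝓡 (n - 1)) 𝓘(ℝ, ℝ) ∞ m) :
    IsBoundaryCoordChange n (boundaryShift hn hm) where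
  contMDiffOn z hz := (contMDiffAt_boundaryShift hm hz).contMDiffWithinAt
  contMDiffOn_symm z hz :=
    (contMDiffAt_boundaryShift (m := fun p => -m p) hm.neg hz).contMDiffWithinAt
  boundary_mem p := by
    change 0 < 1 + m p / 2 * 0 ^ n
    simp [hn]
  boundary_fixed p := Prod.ext (zero_mul _) rfl
  pos_iff z hz := radialShift_pos_iff hz

end BoundaryShift

/-! ### Collecting the errors of the asymptotic expansion. -/

section Expansion

/-- The deviation from the desired expansion splits into the coefficient errors `h1`, …, `h5`, each
multiplied by a bounded bilinear expression, and the old error term. Here `a v - b lv` is the radial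
component of the image of a vector, `lv` being the differential of `m` on its slice part. -/
lemma abs_expansion_le {C Cl Ch Cμ y y₀ q a b Y x₂ R RX XX v w lv lw H Mu err e α β : ℝ}
    (h1 : |Y * a * a - x₂| ≤ C * y) (h2 : |Y * a * b| ≤ C * y) (h3 : |Y * b * b| ≤ C * y)
    (h4 : |RX - R - y₀ * q| ≤ C * y) (h5 : |XX - y₀| ≤ C * y) (hv : |v| ≤ α) (hw : |w| ≤ β)
    (hlv : |lv| ≤ Cl * α) (hlw : |lw| ≤ Cl * β) (hH : |H| ≤ Ch * (α * β))
    (hMu : |Mu| ≤ Cμ * (α * β)) (he : |err| ≤ e) :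
    |Y * ((a * v - b * lv) * (a * w - b * lw)) + RX * H + XX * Mu + err -
      (x₂ * (v * w) + R * H) - y₀ * (Mu + q * H)| ≤
      C * y * (1 + 2 * Cl + Cl ^ 2 + Ch + Cμ) * (α * β) + e := by
  have hα := (abs_nonneg v).trans hv
  have hlα := (abs_nonneg lv).trans hlv
  have hCy := (abs_nonneg _).trans h1
  have k1 : |(Y * a * a - x₂) * (v * w)| ≤ C * y * (α * β) := by
    rw [abs_mul, abs_mul v]; gcongr
  have k2 : |Y * a * b * (v * lw)| ≤ C * y * (α * (Cl * β)) := by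
    rw [abs_mul, abs_mul v]; gcongr
  have k3 : |Y * a * b * (lv * w)| ≤ C * y * (Cl * α * β) := by
    rw [abs_mul, abs_mul lv]; gcongr
  have k4 : |Y * b * b * (lv * lw)| ≤ C * y * (Cl * α * (Cl * β)) := by
    rw [abs_mul, abs_mul lv]; gcongr
  have k5 : |(RX - R - y₀ * q) * H| ≤ C * y * (Ch * (α * β)) := by
    rw [abs_mul]; gcongr
  have k6 : |(XX - y₀) * Mu| ≤ C * y * (Cμ * (α * β)) := by
    rw [abs_mul]; gcongr
  have e1 : Y * ((a * v - b * lv) * (a * w - b * lw)) + RX * H + XX * Mu + err -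
      (x₂ * (v * w) + R * H) - y₀ * (Mu + q * H) = (Y * a * a - x₂) * (v * w) -
      Y * a * b * (v * lw) - Y * a * b * (lv * w) + Y * b * b * (lv * lw) +
      (RX - R - y₀ * q) * H + (XX - y₀) * Mu + err := by ring
  have e2 : C * y * (1 + 2 * Cl + Cl ^ 2 + Ch + Cμ) * (α * β) = C * y * (α * β) +
      C * y * (α * (Cl * β)) + C * y * (Cl * α * β) + C * y * (Cl * α * (Cl * β)) +
      C * y * (Ch * (α * β)) + C * y * (Cμ * (α * β)) := by ring
  rw [e1, e2, abs_le]
  constructor <;>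
    linarith [(abs_le.1 k1).1, (abs_le.1 k1).2, (abs_le.1 k2).1, (abs_le.1 k2).2, (abs_le.1 k3).1,
      (abs_le.1 k3).2, (abs_le.1 k4).1, (abs_le.1 k4).2, (abs_le.1 k5).1, (abs_le.1 k5).2,
      (abs_le.1 k6).1, (abs_le.1 k6).2, (abs_le.1 he).1, (abs_le.1 he).2]

end Expansion

/-! ### Regularity and trace of the new coefficient tensor. -/

section Tensors

variable {d : ℕ} {N : Type*} [TopologicalSpace N] [ChartedSpace (E d) N] [IsManifold (𝓡 d) ∞ N]

lemma RiemMetric.isSymmC2 (h : RiemMetric d ∞ N) : IsSymmC2 (𝓡 d) h.toTensor where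
  symm := h.toTensor_symm
  contDiffOn p u hu := by
    have := (h.isMetricAt_chartRep two_le_infty ((extChartAt (𝓡 d) p).map_target hu)).contDiffAt
    rw [(extChartAt (𝓡 d) p).right_inv hu] at this
    exact this.contDiffWithinAt

lemma IsSymmC2.add_smul {S T : N → E d →L[ℝ] E d →L[ℝ] ℝ} (hS : IsSymmC2 (𝓡 d) S)
    (hT : IsSymmC2 (𝓡 d) T) {c : N → ℝ} (hc : ContMDiff (𝓡 d) 𝓘(ℝ, ℝ) ∞ c) :
    IsSymmC2 (𝓡 d) (fun p => S p + c p • T p) where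
  symm p v w := by simp [hS.symm p v w, hT.symm p v w]
  contDiffOn p := by
    have h1 : ContDiffOn ℝ 2 (fun u => c ((extChartAt (𝓡 d) p).symm u)) (extChartAt (𝓡 d) p).target :=
      contMDiffOn_iff_contDiffOn.1 ((hc.of_le two_le_infty).comp_contMDiffOn
        ((contMDiffOn_extChartAt_symm p).of_le two_le_infty))
    exact (hS.contDiffOn p).add (h1.smul (hT.contDiffOn p))

lemma traceWith_self {V : Type*} [NormedAddCommGroup V] [NormedSpace ℝ V] [FiniteDimensional ℝ V]
    {B : V →L[ℝ] V →L[ℝ] ℝ} (hB : B.IsInvertible) : traceWith B B = Module.finrank ℝ V := by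
  obtain ⟨e, rfl⟩ := hB
  have : ((e : V →L[ℝ] V →L[ℝ] ℝ).inverse.comp (e : V →L[ℝ] V →L[ℝ] ℝ)) =
      ContinuousLinearMap.id ℝ V := by
    ext v; simp
  rw [traceWith, this]
  exact LinearMap.trace_id ℝ V

end Tensors

/-! ### The asymptotic form of the perturbed metric. -/

section AsymptoticForm

variable {n : ℕ} {N : Type*} [TopologicalSpace N] [CompactSpace N] [ChartedSpace (E (n - 1)) N]
  [IsManifold (𝓡 (n - 1)) ∞ N] {M : Type*} [TopologicalSpace M] [ChartedSpace (E n) M]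
  [IsManifold (𝓡 n) ∞ M] {x : M → ℝ} {x₀ : ℝ} {Φ : OpenPartialHomeomorph (ℝ × N) M} {η : N → ℝ}

omit [CompactSpace N] [ChartedSpace (E (n - 1)) N] [IsManifold (𝓡 (n - 1)) ∞ N]
  [TopologicalSpace N] in
lemma referenceMetric_apply (h : N → E (n - 1) →L[ℝ] E (n - 1) →L[ℝ] ℝ) (k : ℝ) (z : ℝ × N)
    (v w : F n) : referenceMetric h k z v w =
      (z.1 ^ 2)⁻¹ * (v.1 * w.1) + refWarp k z.1 * h z.2 v.2 w.2 := by
  simp only [referenceMetric, add_apply, smul_apply, dxSq_apply, liftN_apply, smul_eq_mul, refWarp]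
  ring

/-- The mass aspect function gained by the perturbation, multiplied by `n / (n - 1)`. -/
def massGain (n : ℕ) {N : Type*} (η : N → ℝ) (ε K : ℝ) (p : N) : ℝ :=
  n / (n - 1) * (η p + 16 * K * ε ^ 2)

omit [CompactSpace N] [IsManifold (𝓡 (n - 1)) ∞ N] in
lemma contMDiff_massGain (hη : ContMDiff (𝓡 (n - 1)) 𝓘(ℝ, ℝ) ∞ η) (ε K : ℝ) :
    ContMDiff (𝓡 (n - 1)) 𝓘(ℝ, ℝ) ∞ (massGain n η ε K) :=
  contMDiff_const.mul (hη.add contMDiff_const)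

set_option maxHeartbeats 1600000 in
/-- The asymptotic form of the perturbed metric in the new coordinates. -/
theorem hasAsymptoticForm_addDiffSq (hn : 3 ≤ n) (h : RiemMetric (n - 1) ∞ N) {k : ℝ}
    (hk : |k| ≤ 1) (hx₀ : 0 < x₀) (hΦ : IsCollar n x x₀ Φ) {T : M → E n →L[ℝ] E n →L[ℝ] ℝ}
    {μ : N → E (n - 1) →L[ℝ] E (n - 1) →L[ℝ] ℝ}
    (hT : HasAsymptoticForm h.toTensor k (pullback (IC n) (𝓡 n) Φ T) μ)
    (hη : ContMDiff (𝓡 (n - 1)) 𝓘(ℝ, ℝ) ∞ η) (hη0 : ∀ p, 0 ≤ η p) {ε K : ℝ} (hε : 0 < ε)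
    (hK : 0 ≤ K) (hn0 : n ≠ 0) :
    HasAsymptoticForm h.toTensor k
      (pullback (IC n) (𝓡 n)
        (fun z => Φ (boundaryShift hn0 (contMDiff_massGain hη ε K) z))
        (addDiffSq T x (perturbation n x x₀ Φ η ε K)))
      (fun p => μ p + (massGain n η ε K p / n) • h.toTensor p) := by
  set m := massGain n η ε K with hm_def
  have hm := contMDiff_massGain hη ε K
  have hm0 : ∀ p, 0 ≤ m p := fun p => by
    have := one_le_massFactor hn
    have := hη0 p
    simp only [hm_def, massGain]
    positivity
  refine ⟨hT.regular.add_smul h.isSymmC2 (hm.div_const _), fun δ hδ => ?_⟩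
  obtain ⟨Cl, hCl⟩ := exists_hasHessianBound h hm
  obtain ⟨Cμ, hCμ⟩ := exists_tensor_bound h hT.regular
  obtain ⟨Ch, hCh⟩ := exists_tensor_bound h h.isSymmC2
  obtain ⟨C, hC0, hC⟩ := exists_radialShift_estimates hn |Cl| (n / (n - 1) * K)
  set D := C * (1 + 2 * |Cl| + |Cl| ^ 2 + |Ch| + |Cμ|) with hD
  have hD0 : 0 ≤ D := by positivity
  -- The change of coordinates stretches vectors by at most `2 + |Cl|` (`hnorm`), so this share of
  -- `δ` keeps the transformed old error below half of the allowance.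
  obtain ⟨r, hr, hexp⟩ := hT.expansion (δ / (2 * (2 + |Cl|) ^ 2)) (by positivity)
  -- Below `3 ε` the cutoff equals `1`; the last bound makes `z.1 * D ≤ δ / 2`, so the expansion
  -- errors, one power of `x` better than required, use the other half.
  refine ⟨min (min r (min x₀ 1)) (min (3 * ε) (δ / (2 * (D + 1)))), by positivity, ?_⟩
  intro z hz hzr v w
  simp only [lt_min_iff] at hzr
  obtain ⟨⟨hzr, hzx, hz1⟩, hzε, hzδ⟩ := hzr
  have hpos : 0 < 1 + m z.2 / 2 * z.1 ^ n := by have := hm0 z.2; positivity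
  obtain ⟨hf0, hf1, -⟩ := shiftFactor_bounds hn0 hz (hm0 z.2)
  obtain ⟨L, hL⟩ : ∃ L : E (n - 1) →L[ℝ] ℝ, HasMFDerivAt (𝓡 (n - 1)) 𝓘(ℝ, ℝ) m z.2 L :=
    ⟨_, (hm.mdifferentiableAt (by simp)).hasMFDerivAt⟩
  obtain ⟨A, hA, hAv⟩ := hasMFDerivAt_boundaryShift hn0 hL hpos
  set f := shiftFactor n z.1 (m z.2) with hf
  set X := z.1 * f with hX
  have hX0 : 0 < X := mul_pos hz hf0
  have hXz : X ≤ z.1 := mul_le_of_le_one_right hz.le hf1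
  set P := X ^ n * (m z.2 - n / (n - 1) * K * X ^ 2) with hP
  set a := f ^ (n + 1) with ha
  set b := z.1 ^ (n + 1) * f ^ (n + 1) / (2 * n) with hb
  have hs : ((X, z.2) : ℝ × N) ∈ Φ.source := hΦ.mem_source hX0 (hXz.trans_lt hzx)
  have hΨ : boundaryShift hn0 hm z = (X, z.2) := rfl
  have hpull : pullback (IC n) (𝓡 n) (fun z => Φ (boundaryShift hn0 hm z))
      (addDiffSq T x (perturbation n x x₀ Φ η ε K)) z v w =
      pullback (IC n) (𝓡 n) Φ T (X, z.2) (A v) (A w) +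
        (X ^ 2)⁻¹ * P * ((A v).1 * (A w).1) := by
    have e1 := pullback_comp (I := IC n) (I₂ := IC n) (I₃ := 𝓡 n) (f := Φ)
      (g := boundaryShift hn0 hm) (z := z) (addDiffSq T x (perturbation n x x₀ Φ η ε K))
      ((hΦ.contMDiffAt (z := boundaryShift hn0 hm z) hs).mdifferentiableAt (by simp))
      hA.mdifferentiableAt
    have e2 : pullback (IC n) (IC n) (boundaryShift hn0 hm)
        (pullback (IC n) (𝓡 n) Φ (addDiffSq T x (perturbation n x x₀ Φ η ε K))) z =
        (pullback (IC n) (𝓡 n) Φ (addDiffSq T x (perturbation n x x₀ Φ η ε K))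
          (X, z.2)).bilinearComp A A := by
      have : mfderiv (IC n) (IC n) (boundaryShift hn0 hm) z = A := hA.mfderiv
      unfold pullback
      rw [this]
      rfl
    -- Where the cutoff is `1`, the part `16 K ε²` of the correction joins `η` in `m`, while `-K x²`
    -- stays as a term of higher order.
    have e3 : perturbation n x x₀ Φ η ε K (Φ (X, z.2)) = (X ^ 2)⁻¹ * P := by
      rw [hΦ.perturbation_apply hs]
      simp only [profile, correction, cutoff_eq_one hε (hXz.trans hzε.le), hP, hm_def, massGain]
      ring
    rw [hΦ.pullback_addDiffSq T _ hs, e3] at e2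
    refine (congrArg (fun S : F n →L[ℝ] F n →L[ℝ] ℝ => S v w) (e1.trans e2)).trans ?_
    simp [dxSq_apply]
  obtain ⟨c1, c2, c3, c4, c5⟩ := hC k z.1 (m z.2) f X P b hk hz hz1.le (hm0 z.2)
    ((hCl z.2).le.trans (le_abs_self _)) hf hX hP hb
  set α := Real.sqrt (productMetric h.toTensor z v v) with hα
  set β := Real.sqrt (productMetric h.toTensor z w w) with hβ
  have hprod : ∀ u : F n, productMetric h.toTensor z u u = u.1 ^ 2 + h.toTensor z.2 u.2 u.2 :=
    fun u => by simp [productMetric, dxSq_apply, liftN_apply, sq]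
  have hnn : ∀ u : E (n - 1), 0 ≤ h.toTensor z.2 u u := fun u => by
    by_cases hu : u = 0
    · simp [hu]
    · exact (h.toTensor_pos z.2 hu).le
  have hfst : ∀ u : F n, |u.1| ≤ Real.sqrt (productMetric h.toTensor z u u) := fun u => by
    refine Real.abs_le_sqrt ?_
    rw [hprod]; linarith [hnn u.2]
  have hsnd : ∀ u : F n, Real.sqrt (h.toTensor z.2 u.2 u.2) ≤
      Real.sqrt (productMetric h.toTensor z u u) := fun u => by
    refine Real.sqrt_le_sqrt ?_
    rw [hprod]; linarith [sq_nonneg u.1]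
  have hLu : ∀ u : F n, |L u.2| ≤ |Cl| * Real.sqrt (productMetric h.toTensor z u u) := fun u =>
    ((hCl z.2).mfderiv_le hL u.2).trans
      (mul_le_mul (le_abs_self _) (hsnd u) (Real.sqrt_nonneg _) (abs_nonneg _))
  have hbil : ∀ (S : E (n - 1) →L[ℝ] E (n - 1) →L[ℝ] ℝ) (c : ℝ), |S v.2 w.2| ≤
      c * (Real.sqrt (h.toTensor z.2 v.2 v.2) * Real.sqrt (h.toTensor z.2 w.2 w.2)) →
      |S v.2 w.2| ≤ |c| * (α * β) := fun S c hS => hS.trans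
    (mul_le_mul (le_abs_self _) (mul_le_mul (hsnd v) (hsnd w) (Real.sqrt_nonneg _)
      (Real.sqrt_nonneg _)) (by positivity) (abs_nonneg _))
  have ha0 : 0 ≤ a := by positivity
  have ha1 : a ≤ 1 := pow_le_one₀ hf0.le hf1
  have hb0 : 0 ≤ b := by positivity
  have hb1 : b ≤ 1 := by
    have h1 : z.1 ^ (n + 1) ≤ 1 := pow_le_one₀ hz.le hz1.le
    have h2 : (1 : ℝ) ≤ 2 * n := by
      have : (3 : ℝ) ≤ n := by exact_mod_cast hn
      linarith
    rw [hb, div_le_one (by linarith)]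
    calc z.1 ^ (n + 1) * f ^ (n + 1) ≤ 1 * 1 := mul_le_mul h1 ha1 ha0 zero_le_one
      _ ≤ _ := by linarith
  have hnorm : ∀ u : F n, Real.sqrt (productMetric h.toTensor (X, z.2) (A u) (A u)) ≤
      (2 + |Cl|) * Real.sqrt (productMetric h.toTensor z u u) := fun u => by
    set γ := Real.sqrt (productMetric h.toTensor z u u)
    have hγ : 0 ≤ γ := Real.sqrt_nonneg _
    have e : productMetric h.toTensor (X, z.2) (A u) (A u) =
        (a * u.1 - b * L u.2) ^ 2 + h.toTensor z.2 u.2 u.2 := by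
      rw [hAv]
      simp [productMetric, dxSq_apply, liftN_apply, sq]
    have h1 : |a * u.1 - b * L u.2| ≤ γ + |Cl| * γ := by
      refine (abs_sub _ _).trans ?_
      rw [abs_mul, abs_mul, abs_of_nonneg ha0, abs_of_nonneg hb0]
      exact add_le_add ((mul_le_of_le_one_left (abs_nonneg _) ha1).trans (hfst u))
        ((mul_le_of_le_one_left (abs_nonneg _) hb1).trans (hLu u))
    have h2 : h.toTensor z.2 u.2 u.2 ≤ γ ^ 2 := by
      rw [← Real.sq_sqrt (hnn u.2)]
      exact pow_le_pow_left₀ (Real.sqrt_nonneg _) (hsnd u) 2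
    rw [e]
    refine Real.sqrt_le_iff.2 ⟨by positivity, ?_⟩
    have h3 := pow_le_pow_left₀ (abs_nonneg _) h1 2
    rw [sq_abs] at h3
    have h4 : 0 ≤ (2 + 2 * |Cl|) * γ ^ 2 := by positivity
    linarith [show ((2 + |Cl|) * γ) ^ 2 =
      (γ + |Cl| * γ) ^ 2 + γ ^ 2 + (2 + 2 * |Cl|) * γ ^ 2 by ring]
  have herr := hexp (X, z.2) hX0 (hXz.trans_lt hzr) (A v) (A w)
  set err := pullback (IC n) (𝓡 n) Φ T (X, z.2) (A v) (A w) -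
    referenceMetric h.toTensor k (X, z.2) (A v) (A w) -
      X ^ (n - 2) * liftN (μ z.2) (A v) (A w) with herr_def
  have hzn : 0 < z.1 ^ (n - 2) := pow_pos hz _
  have herr' : |err| ≤ δ / 2 * z.1 ^ (n - 2) * (α * β) := by
    refine herr.trans ?_
    have h1 : X ^ (n - 2) ≤ z.1 ^ (n - 2) := pow_le_pow_left₀ hX0.le hXz _
    calc _ ≤ δ / (2 * (2 + |Cl|) ^ 2) * z.1 ^ (n - 2) *
          (((2 + |Cl|) * α) * ((2 + |Cl|) * β)) := by
          gcongr
          · exact hnorm v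
          · exact hnorm w
      _ = _ := by field_simp
  have hAv1 : ∀ u : F n, (A u).1 = a * u.1 - b * L u.2 := fun u => by rw [hAv]
  have hAv2 : ∀ u : F n, (A u).2 = u.2 := fun u => by rw [hAv]
  have hmain := abs_expansion_le c1 c2 c3 c4 c5 (hfst v) (hfst w) (hLu v) (hLu w)
    (hbil (h.toTensor z.2) Ch (hCh z.2 v.2 w.2)) (hbil (μ z.2) Cμ (hCμ z.2 v.2 w.2)) herr'
  have e : pullback (IC n) (𝓡 n) (fun z => Φ (boundaryShift hn0 hm z))
      (addDiffSq T x (perturbation n x x₀ Φ η ε K)) z v w - referenceMetric h.toTensor k z v w -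
      z.1 ^ (n - 2) * liftN (μ z.2 + (m z.2 / n) • h.toTensor z.2) v w =
      (X ^ 2)⁻¹ * (1 + P) * ((a * v.1 - b * L v.2) * (a * w.1 - b * L w.2)) +
        refWarp k X * h.toTensor z.2 v.2 w.2 + X ^ (n - 2) * μ z.2 v.2 w.2 + err -
        ((z.1 ^ 2)⁻¹ * (v.1 * w.1) + refWarp k z.1 * h.toTensor z.2 v.2 w.2) -
        z.1 ^ (n - 2) * (μ z.2 v.2 w.2 + m z.2 / n * h.toTensor z.2 v.2 w.2) := by
    rw [hpull, herr_def, referenceMetric_apply, referenceMetric_apply, liftN_apply, liftN_apply]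
    simp only [hAv1, hAv2, add_apply, smul_apply, smul_eq_mul]
    ring
  refine (le_of_eq (congrArg _ e)).trans (hmain.trans ?_)
  have hzD : z.1 * D ≤ δ / 2 := by
    rw [lt_div_iff₀ (by positivity)] at hzδ
    linarith
  have e2 : C * z.1 ^ (n - 1) * (1 + 2 * |Cl| + |Cl| ^ 2 + |Ch| + |Cμ|) =
      (z.1 * D) * z.1 ^ (n - 2) := by
    rw [hD, show n - 1 = (n - 2) + 1 by omega, pow_succ]
    ring
  rw [e2]
  calc _ ≤ δ / 2 * z.1 ^ (n - 2) * (α * β) + δ / 2 * z.1 ^ (n - 2) * (α * β) := by gcongr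
    _ = _ := by ring

end AsymptoticForm

end MassAspect

end

/-! ### The main theorem. -/

theorem theorem5p1
    (n : ℕ) (hn : 3 ≤ n)
    -- the conformal boundary `N` and its metric `h`
    {N : Type*} [TopologicalSpace N] [T2Space N] [CompactSpace N]
    [ChartedSpace (E (n - 1)) N] [IsManifold (𝓡 (n - 1)) ∞ N]
    (h : RiemMetric (n - 1) ∞ N)
    (k : ℝ) (hk : k = 0 ∨ k = 1 ∨ k = -1)
    (hEinstein : IsEinstein (𝓡 (n - 1)) h.toTensor ((n - 2) * k))
    -- the manifold `M`, the function `x`, and the asymptotic region `{x < x₀}`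
    {M : Type*} [TopologicalSpace M] [T2Space M]
    [ChartedSpace (E n) M] [IsManifold (𝓡 n) ∞ M]
    (x : M → ℝ) (x₀ : ℝ) (hx₀ : 0 < x₀) (hx₀' : x₀ < 1)
    (Φ : OpenPartialHomeomorph (ℝ × N) M) (hΦ : IsCollar n x x₀ Φ)
    -- the metric `g` and its asymptotics
    (g : RiemMetric n 2 M)
    (μ : N → E (n - 1) →L[ℝ] E (n - 1) →L[ℝ] ℝ)
    (hg : HasAsymptoticForm h.toTensor k (pullback (IC n) (𝓡 n) Φ g.toTensor) μ)
    (hR : IntegrableOnCollar (pullback (IC n) (𝓡 n) Φ g.toTensor) x₀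
      (fun z => z.1⁻¹ * (scalarCurvature (𝓡 n) g.toTensor (Φ z) -
        scalarCurvature (IC n) (referenceMetric h.toTensor k) z)))
    (hdecay : HasWeightedDecay h.toTensor k x₀
      (pullback (IC n) (𝓡 n) Φ g.toTensor - referenceMetric h.toTensor k))
    -- the mass aspect function `Θ` of `g`, and the function `η`
    (Θ : N → ℝ) (hΘ : ∀ p, Θ p = traceWith (h.toTensor p) (μ p))
    (η : N → ℝ) (hη : ContMDiff (𝓡 (n - 1)) 𝓘(ℝ, ℝ) ∞ η) (hη_nonneg : ∀ p, 0 ≤ η p) :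
    ∃ ε₀ : ℝ, 0 < ε₀ ∧ ε₀ < x₀ / 4 ∧
    ∃ (g' : ℝ → RiemMetric n 2 M) (c : ℝ → ℝ),
      Tendsto c (𝓝[>] 0) (𝓝 0) ∧
      ∀ ε : ℝ, 0 < ε → ε < ε₀ →
        (∀ q, 0 ≤ scalarCurvature (𝓡 n) (g' ε).toTensor q -
          scalarCurvature (𝓡 n) g.toTensor q) ∧
        (∃ C : ℝ, ∀ q, scalarCurvature (𝓡 n) (g' ε).toTensor q -
          scalarCurvature (𝓡 n) g.toTensor q ≤ C * x q ^ (n + 2)) ∧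
        (∀ q, 4 * ε < x q → (g' ε).toTensor q = g.toTensor q) ∧
        0 ≤ c ε ∧
        ∃ (Ψ : OpenPartialHomeomorph (ℝ × N) (ℝ × N))
          (μ' : N → E (n - 1) →L[ℝ] E (n - 1) →L[ℝ] ℝ),
          IsBoundaryCoordChange n Ψ ∧
          HasAsymptoticForm h.toTensor k
            (pullback (IC n) (𝓡 n) (fun z => Φ (Ψ z)) (g' ε).toTensor) μ' ∧
          ∀ p, traceWith (h.toTensor p) (μ' p) = Θ p + η p + c ε := by
  have hk1 : |k| ≤ 1 := by rcases hk with rfl | rfl | rfl <;> simp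
  have hn0 : n ≠ 0 := by omega
  obtain ⟨K, r, hK, hr, hbound⟩ :=
    exists_scalarCurvature_bounds hn h hk1 hx₀' hΦ g hdecay hη hη_nonneg
  have hF : ∀ ε, 0 < ε → 4 * ε < x₀ → ContMDiff (𝓡 n) 𝓘(ℝ, ℝ) 2 (perturbation n x x₀ Φ η ε K) :=
    fun ε h1 h2 => hΦ.contMDiff_perturbation hη h1 h2
  have hF0 : ∀ ε, 0 < ε → ∀ q, 0 ≤ perturbation n x x₀ Φ η ε K q :=
    fun ε h1 => hΦ.perturbation_nonneg hn hη_nonneg h1 hK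
  let g' : ℝ → RiemMetric n 2 M := fun ε => by
    classical
    exact if hε : 0 < ε ∧ 4 * ε < x₀ then
      g.addDiffSq hΦ.smooth (hF ε hε.1 hε.2) (hF0 ε hε.1) else g
  have hg' : ∀ ε, 0 < ε → 4 * ε < x₀ →
      (g' ε).toTensor = addDiffSq g.toTensor x (perturbation n x x₀ Φ η ε K) := fun ε h1 h2 => by
    have : g' ε = g.addDiffSq hΦ.smooth (hF ε h1 h2) (hF0 ε h1) := dif_pos ⟨h1, h2⟩
    rw [this, RiemMetric.toTensor_addDiffSq]
  -- The three bounds ensure `4 ε < x₀`, `4 ε ≤ r` and `16 K ε² ≤ 1`, respectively; `c_ε = 16 K ε²`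
  -- is the value at `x = 0` of the correction relative to the profile.
  refine ⟨min (x₀ / 8) (min (r / 4) (4 * (K + 1))⁻¹), by positivity,
    (min_le_left _ _).trans_lt (by linarith), g', fun ε => 16 * K * ε ^ 2, ?_, ?_⟩
  · have : Tendsto (fun ε : ℝ => 16 * K * ε ^ 2) (𝓝 0) (𝓝 (16 * K * 0 ^ 2)) :=
      Continuous.tendsto (by fun_prop) 0
    rw [zero_pow two_ne_zero, mul_zero] at this
    exact this.mono_left nhdsWithin_le_nhds
  intro ε hε hε₀
  simp only [lt_min_iff] at hε₀
  obtain ⟨hεx, hεr, hεK⟩ := hε₀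
  have hεx' : 4 * ε < x₀ := by linarith
  have hεK' : 16 * K * ε ^ 2 ≤ 1 := by
    have h1 : ε * (4 * (K + 1)) ≤ 1 := by
      rw [inv_eq_one_div, lt_div_iff₀ (by positivity)] at hεK
      exact hεK.le
    have h2 : (ε * (4 * (K + 1))) ^ 2 ≤ 1 := pow_le_one₀ (by positivity) h1
    have h3 : 16 * K * ε ^ 2 ≤ (ε * (4 * (K + 1))) ^ 2 := by
      have : 0 ≤ 16 * ε ^ 2 * (K ^ 2 + K + 1) := by positivity
      linarith [show (ε * (4 * (K + 1))) ^ 2 - 16 * K * ε ^ 2 = 16 * ε ^ 2 * (K ^ 2 + K + 1) by ring]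
    exact h3.trans h2
  obtain ⟨C, hC⟩ := hbound ε hε (by linarith) hεx' hεK'
  rw [hg' ε hε hεx']
  refine ⟨fun q => (hC q).1, ⟨C, fun q => (hC q).2⟩,
    fun q hq => addDiffSq_of_eq_zero (perturbation_eq_zero hε hq.le), by positivity,
    boundaryShift hn0 (contMDiff_massGain hη ε K), _, isBoundaryCoordChange_boundaryShift hn0 _,
    hasAsymptoticForm_addDiffSq hn h hk1 hx₀ hΦ hg hη hη_nonneg hε hK hn0, fun p => ?_⟩
  -- The trace of `h` is `n - 1`, so the gain is `(n - 1) m / n`; the factor `n / (n - 1)` in the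
  -- profile normalises it to `η + c_ε`.
  rw [traceWith_add, traceWith_smul, ← hΘ p,
    traceWith_self (isInvertible_of_pos fun v hv => h.toTensor_pos p hv),
    finrank_euclideanSpace_fin, massGain, Nat.cast_sub (by omega), Nat.cast_one]
  have h1 : (n : ℝ) ≠ 0 := Nat.cast_ne_zero.2 hn0
  have h2 : (n : ℝ) - 1 ≠ 0 := by
    have : (3 : ℝ) ≤ n := by exact_mod_cast hn
    linarith
  field_simp
  ring
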